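/- **Setting.** Let $a<b$, $I=[a,b]$, $N\in\mathbb N$, $1<q,r<\infty$, $U_a,U_b\in\mathbb R^N$. Let $\mathcal L:I\times\mathbb R^N\times\mathbb R^N\to\mathbb R$, $(x,z,p)\mapsto\mathcal L(x,z,p)$, satisfy $|\mathcal L(x,z,p)|\le C(1+|z|^r+|p|^q)$ for some constant $C$. Put $\mathcal F(u)=\int_a^b\mathcal L(x,u,u')\,dx$ and $\mathcal A=\{u\in W^{1,q}(I;\mathbb R^N):u(a)=U_a,\ u(b)=U_b\}$. Let $u_*\in\mathcal A\cap C^1(I;\mathbb R^N)$ minimize $\mathcal F$ in $\mathcal A$. Assume (A1) $\mathcal L\in C^2(I\times\mathbb R^N\times\mathbb R^N)$, and there is $\theta>0$ such that, in the order of symmetric $2N\times 2N$ matrices written in the variables $(z,p)$, $$\int_0^1(1-\tau)\nabla^2_{(z,p)}\mathcal L(x,u_*(x)+\tau v,u_*'(x)+\tau w)\,d\tau\ \ge\ \theta\begin{pmatrix}0&0\\0&\mathrm{Id}_{N\times N}\end{pmatrix}\qquad\forall x\in I,\ v,w\in\mathbb R^N .$$ *Monotone maps.* Every $y:I\to\mathbb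 R$ is extended to $\mathbb R$ by $a$ on $(-\infty,a)$ and by $b$ on $(b,\infty)$. $BV(I)$ is the set of $y\in L^1(I)$ such that the distributional derivative $y'=[Dy]$ of this extension is a finite signed measure concentrated on $I$. $\frac{dy'}{d\mathcal L^1}$ is the density of the absolutely continuous part of $y'$. We write $y_n\stackrel{*}{\rightharpoonup}y$ in $BV(I)$ if $y_n,y\in BV(I)$, $y_n\to y$ in $L^1(I)$ and $\int_I\varphi\,d[Dy_n]\to\int_I\varphi\,d[Dy]$ for all $\varphi\in C^0(I)$. $\mathrm{MBV}(I)$ is the set of nondecreasing functions $I\to[a,b]$, up to null sets. For $y\in\mathrm{MBV}(I)$ the inverse $y^{-1}$ is defined, for a suitable representative of $y$, by: $y^{-1}(x_2)<x_1\Leftrightarrow x_2<y(x_1)$ for all $x_1,x_2\in I$. *Meshes.* For $n\ge1$ and $0\le i<n$ let $\bar X^n_i=[a+\frac{i(b-a)}n,a+\frac{(i+1)(b-a)}n)$. $\mathrm{PA}^n(I)$ is the set of continuous functions $I\to\mathbb R^N$ that are affine on every $\bar X_i^n$. $\mathrm{PAM}^n(I)$ is the set of nondecreasing continuous functions $\bar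 y:I\to I$ that are affine on every $\bar X_i^n$, with $\bar y(a)=a$, $\bar y(b)=b$. Call $(u,y)\in L^1(I;\mathbb R^{N+1})$ *$n$-admissible* if $y\in \mathrm{MBV}(I)$, $y^{-1}\in\mathrm{PAM}^n(I)$ and $u\circ y^{-1}\in\mathrm{PA}^n(I)\cap\mathcal A$ (for suitable representatives of $u$, $y$). *Energies.* $\mathcal F_n(u,y)=n^2(\mathcal F(u)-\mathcal F(u_*))$ if $(u,y)$ is $n$-admissible, and $\mathcal F_n(u,y)=+\infty$ otherwise. Let $$\delta^2\mathcal F(u_*,g)=\int_I (g^T,g'^T)\,\nabla^2_{(z,p)}\mathcal L(x,u_*,u_*')\begin{pmatrix}g\\g'\end{pmatrix}dx ,$$ $$\mathcal F^*(g,y)=\tfrac12\delta^2\mathcal F(u_*,g)+\frac{(b-a)^2}{24}\int_I\nabla_p^2\mathcal L(x,u_*,u_*'):u_*''\otimes u_*''\,\Big|\frac{dy'}{d\mathcal L^1}\Big|^{-2}dx$$ if $y\in\mathrm{MBV}(I)$ and $g\in W^{1,2}_0(I;\mathbb R^N)$, and $\mathcal F^*(g,y)=+\infty$ otherwise. The last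 integrand is $0$ where $u_*''=0=\frac{dy'}{d\mathcal L^1}$ and $+\infty$ where $u_*''\ne0=\frac{dy'}{d\mathcal L^1}$; the integral of this nonnegative function is taken in $[0,\infty]$. (Under the above assumptions $u_*\in C^2(I)$.) **Theorem.** The functionals $\mathcal F_n$ $\Gamma$-converge to $\mathcal F^*$ in the following sense. (o) If $\sup_{n\ge1}\mathcal F_n(u_n,y_n)<\infty$, then there are a subsequence (not relabeled), $g\in W^{1,2}_0(I;\mathbb R^N)$ and $y\in\mathrm{MBV}(I)$ such that $n(u_n-u_*)\rightharpoonup g$ weakly in $W^{1,2}_0(I;\mathbb R^N)$ and $y_n\stackrel{*}{\rightharpoonup}y$ in $BV(I)$. (i) If $n(u_n-u_*)\rightharpoonup g$ weakly in $W^{1,2}_0(I;\mathbb R^N)$ and $y_n\stackrel{*}{\rightharpoonup}y$ in $BV(I)$, possibly only along a subsequence of indices $n$, then along these indices $\liminf_{n\to\infty}\mathcal F_n(u_n,y_n)\ge\mathcal F^*(g,y)$. (ii) For all $g\in W^{1,2}_0(I;\mathbb R^N)$ and $y\in\mathrm{MBV}(I)$ there is a sequence $(u_n,y_n)$ such that $n(u_n-u_*)\rightharpoonup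 g$ weakly in $W^{1,2}_0(I;\mathbb R^N)$, $y_n\stackrel{*}{\rightharpoonup}y$ in $BV(I)$ and $\limsup_{n\to\infty}\mathcal F_n(u_n,y_n)=\mathcal F^*(g,y)$. If $\mathcal F^*(g,y)<\infty$, then $(u_n,y_n)$ can moreover be chosen $n$-admissible for every $n\ge1$. -/

import Mathlib

open Set Filter Topology MeasureTheory
open scoped ContDiff ENNReal

namespace RAdapt

noncomputable section

section Sobolev

variable {E : Type*} [NormedAddCommGroup E] [InnerProductSpace ℝ E]

/-- `w` is the weak derivative of `u` on the interval `(a, b)`, both functions being integrable.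
Functions are total; only their restriction to `[a, b]`, up to null sets, matters. -/
def HasWeakDeriv (a b : ℝ) (u w : ℝ → E) : Prop :=
  IntegrableOn u (Icc a b) ∧ IntegrableOn w (Icc a b) ∧
    ∀ φ : ℝ → ℝ, ContDiff ℝ ∞ φ → HasCompactSupport φ → tsupport φ ⊆ Ioo a b →
      ∫ x in Icc a b, deriv φ x • u x = - ∫ x in Icc a b, φ x • w x

open Classical in
/-- The weak derivative `u'` (unique up to null sets; `0` if there is none). -/
def weakDeriv (a b : ℝ) (u : ℝ → E) : ℝ → E :=
  if h : ∃ w, HasWeakDeriv a b u w then h.choose else 0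

/-- `u ∈ W^{1,p}((a,b); E)`. -/
def MemW1 (a b : ℝ) (p : ℝ≥0∞) (u : ℝ → E) : Prop :=
  MemLp u p (volume.restrict (Icc a b)) ∧
    ∃ w, HasWeakDeriv a b u w ∧ MemLp w p (volume.restrict (Icc a b))

/-- The continuous representative of `u` on `[a, b]` exists and takes the boundary values
`ua` and `ub`. -/
def HasBoundaryValues (a b : ℝ) (ua ub : E) (u : ℝ → E) : Prop :=
  ∃ v : ℝ → E, ContinuousOn v (Icc a b) ∧ u =ᵐ[volume.restrict (Icc a b)] v ∧
    v a = ua ∧ v b = ub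

/-- `g ∈ W^{1,2}_0((a,b); E)`. -/
def MemW120 (a b : ℝ) (g : ℝ → E) : Prop :=
  MemW1 a b 2 g ∧ HasBoundaryValues a b 0 0 g

/-- Weak convergence `f ⇀ F` in `L²((a,b); E)`. -/
def WeakL2Tendsto (a b : ℝ) (f : ℕ → ℝ → E) (F : ℝ → E) : Prop :=
  ∀ h : ℝ → E, MemLp h 2 (volume.restrict (Icc a b)) →
    Tendsto (fun k => ∫ x in Icc a b, inner ℝ (f k x) (h x)) atTop
      (𝓝 (∫ x in Icc a b, inner ℝ (F x) (h x)))

/-- Weak convergence `f ⇀ g` in `W^{1,2}_0((a,b); E)`: functions and weak derivatives converge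
weakly in `L²`. -/
def WeakW120Tendsto (a b : ℝ) (f : ℕ → ℝ → E) (g : ℝ → E) : Prop :=
  (∀ k, MemW120 a b (f k)) ∧ MemW120 a b g ∧
    WeakL2Tendsto a b f g ∧
    WeakL2Tendsto a b (fun k => weakDeriv a b (f k)) (weakDeriv a b g)

end Sobolev

section BV

/-- The extension of `y : [a,b] → ℝ` to the line by `a` on the left and by `b` on the right. -/
def bvExt (a b : ℝ) (y : ℝ → ℝ) (x : ℝ) : ℝ :=
  if x < a then a else if b < x then b else y x

/-- The integral over `[a,b]` of `φ` against a finite signed measure. -/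
def signedIntegral (a b : ℝ) (μ : SignedMeasure ℝ) (φ : ℝ → ℝ) : ℝ :=
  (∫ x in Icc a b, φ x ∂μ.toJordanDecomposition.posPart) -
    ∫ x in Icc a b, φ x ∂μ.toJordanDecomposition.negPart

/-- The finite signed measure `μ` is concentrated on `[a,b]` and is the distributional derivative
on the whole line of the extension of `y` (so it includes the jumps of the extension at `a`
and at `b`). -/
def IsBVDeriv (a b : ℝ) (y : ℝ → ℝ) (μ : SignedMeasure ℝ) : Prop :=
  μ.totalVariation (Icc a b)ᶜ = 0 ∧
    ∀ φ : ℝ → ℝ, ContDiff ℝ 1 φ → HasCompactSupport φ →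
      signedIntegral a b μ φ = - ∫ x, bvExt a b y x * deriv φ x

/-- `y ∈ BV(I)` with the fixed boundary values `a` and `b`. -/
def MemBV (a b : ℝ) (y : ℝ → ℝ) : Prop :=
  IntegrableOn y (Icc a b) ∧ ∃ μ, IsBVDeriv a b y μ

open Classical in
/-- The measure `y' = [Dy]` of `y ∈ BV(I)` (`0` if there is none). -/
def bvDeriv (a b : ℝ) (y : ℝ → ℝ) : SignedMeasure ℝ :=
  if h : ∃ μ, IsBVDeriv a b y μ then h.choose else 0

/-- Weak-* convergence in `BV(I)`: convergence in `L¹(I)`, and convergence of the derivative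
measures tested with all continuous functions on the closed interval. -/
def BVTendsto (a b : ℝ) (f : ℕ → ℝ → ℝ) (y : ℝ → ℝ) : Prop :=
  (∀ k, MemBV a b (f k)) ∧ MemBV a b y ∧
    Tendsto (fun k => ∫ x in Icc a b, |f k x - y x|) atTop (𝓝 0) ∧
    ∀ φ : ℝ → ℝ, ContinuousOn φ (Icc a b) →
      Tendsto (fun k => signedIntegral a b (bvDeriv a b (f k)) φ) atTop
        (𝓝 (signedIntegral a b (bvDeriv a b y) φ))

/-- Nondecreasing functions `[a,b] → [a,b]`. -/
def IsMono (a b : ℝ) (y : ℝ → ℝ) : Prop :=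
  MonotoneOn y (Icc a b) ∧ a ≤ y a ∧ y b ≤ b

/-- `y ∈ MBV(I)`: `y` has a nondecreasing representative with values in `[a,b]`. -/
def MemMBV (a b : ℝ) (y : ℝ → ℝ) : Prop :=
  ∃ v, IsMono a b v ∧ y =ᵐ[volume.restrict (Icc a b)] v

/-- `v = y⁻¹`: the graph of `v`, with its jumps filled in, is the reflection of that of `y`
across the diagonal. -/
def IsGraphInverse (a b : ℝ) (y v : ℝ → ℝ) : Prop :=
  ∀ x₁ ∈ Icc a b, ∀ x₂ ∈ Icc a b, v x₂ < x₁ ↔ x₂ < y x₁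

end BV

section Mesh

variable {E : Type*} [NormedAddCommGroup E] [NormedSpace ℝ E]

/-- The `i`-th node of the uniform reference grid with `n` cells. -/
def node (a b : ℝ) (n i : ℕ) : ℝ := a + i * (b - a) / n

/-- `PA^n(I)`: continuous functions that are affine on each of the `n` reference cells. -/
def IsPA (a b : ℝ) (n : ℕ) (u : ℝ → E) : Prop :=
  ContinuousOn u (Icc a b) ∧
    ∀ i < n, ∃ c d : E, ∀ x ∈ Ico (node a b n i) (node a b n (i + 1)), u x = c + x • d

/-- `PAM^n(I)`: nondecreasing continuous piecewise affine maps of `[a,b]` that fix `a` and `b`. -/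
def IsPAM (a b : ℝ) (n : ℕ) (v : ℝ → ℝ) : Prop :=
  IsPA a b n v ∧ MonotoneOn v (Icc a b) ∧ v a = a ∧ v b = b

end Mesh

section Energy

variable {E : Type*} [NormedAddCommGroup E] [InnerProductSpace ℝ E]

/-- The class `𝒜` of functions in `W^{1,q}` with boundary values `ua` and `ub`. -/
def MemA (a b q : ℝ) (ua ub : E) (u : ℝ → E) : Prop :=
  MemW1 a b (ENNReal.ofReal q) u ∧ HasBoundaryValues a b ua ub u

/-- The action `ℱ(u) = ∫_a^b ℒ(x, u, u') dx`. -/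
def action (L : ℝ → E → E → ℝ) (a b : ℝ) (u : ℝ → E) : ℝ :=
  ∫ x in Icc a b, L x (u x) (weakDeriv a b u x)

/-- `us` minimizes the action in `𝒜`. -/
def IsMinimizer (L : ℝ → E → E → ℝ) (a b q : ℝ) (ua ub : E) (us : ℝ → E) : Prop :=
  MemA a b q ua ub us ∧ ∀ u, MemA a b q ua ub u → action L a b us ≤ action L a b u

/-- The quadratic form `ζ ↦ ζᵀ ∇²_{(z,p)} ℒ(x,z,p) ζ` of the Hessian in `(z,p)`. -/
def hessQ (L : ℝ → E → E → ℝ) (x : ℝ) (z p : E) (ζ : E × E) : ℝ :=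
  fderiv ℝ (fderiv ℝ (fun s : E × E => L x s.1 s.2)) (z, p) ζ ζ

/-- The quadratic form `η ↦ ∇²_p ℒ(x,z,p) : η ⊗ η` of the `p`-block of that Hessian. -/
def hessPQ (L : ℝ → E → E → ℝ) (x : ℝ) (z p η : E) : ℝ := hessQ L x z p (0, η)

/-- Growth of the Lagrangian, with exponents `r` in `z` and `q` in `p`. -/
def HasGrowth (L : ℝ → E → E → ℝ) (a b q r : ℝ) : Prop :=
  ∃ C : ℝ, ∀ x ∈ Icc a b, ∀ z p : E, |L x z p| ≤ C * (1 + ‖z‖ ^ r + ‖p‖ ^ q)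

/-- Stability at `us`: `ℒ` is `C²`, and the averaged Hessian in `(z,p)` dominates `θ` times
the identity in the `p`-block, in the order of symmetric matrices. -/
def Stable (L : ℝ → E → E → ℝ) (a b : ℝ) (us : ℝ → E) : Prop :=
  ContDiffOn ℝ 2 (fun t : ℝ × E × E => L t.1 t.2.1 t.2.2) (Icc a b ×ˢ univ) ∧
    ∃ θ : ℝ, 0 < θ ∧ ∀ x ∈ Icc a b, ∀ v w : E, ∀ ζ : E × E,
      θ * ‖ζ.2‖ ^ 2 ≤ ∫ τ in (0 : ℝ)..1,
        (1 - τ) * hessQ L x (us x + τ • v) (derivWithin us (Icc a b) x + τ • w) ζ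

/-- `y⁻¹ ∈ PAM^n(I)` and `u ∘ y⁻¹ ∈ PA^n(I) ∩ 𝒜`, for suitable representatives of the
`L¹`-classes of `u` and `y`. -/
def Admissible (a b q : ℝ) (ua ub : E) (n : ℕ) (u : ℝ → E) (y : ℝ → ℝ) : Prop :=
  ∃ (u₁ : ℝ → E) (y₁ v : ℝ → ℝ),
    u =ᵐ[volume.restrict (Icc a b)] u₁ ∧ y =ᵐ[volume.restrict (Icc a b)] y₁ ∧
    IsMono a b y₁ ∧ IsGraphInverse a b y₁ v ∧ IsPAM a b n v ∧
    IsPA a b n (u₁ ∘ v) ∧ MemA a b q ua ub (u₁ ∘ v)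

open Classical in
/-- The renormalized discrete energies `ℱ_n(u,y)`. -/
def energy (L : ℝ → E → E → ℝ) (a b q : ℝ) (ua ub : E) (us : ℝ → E) (n : ℕ)
    (u : ℝ → E) (y : ℝ → ℝ) : EReal :=
  if Admissible a b q ua ub n u y then
    (((n : ℝ) ^ 2 * (action L a b u - action L a b us) : ℝ) : EReal)
  else ⊤

/-- The second variation `δ²ℱ(us, g)`. -/
def secondVariation (L : ℝ → E → E → ℝ) (a b : ℝ) (us g : ℝ → E) : ℝ :=
  ∫ x in Icc a b, hessQ L x (us x) (derivWithin us (Icc a b) x) (g x, weakDeriv a b g x)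

/-- The second derivative of `us` on `[a,b]` (one-sided at the end points). -/
def secondDeriv (a b : ℝ) (us : ℝ → E) : ℝ → E :=
  derivWithin (derivWithin us (Icc a b)) (Icc a b)

/-- The integral `∫_I ∇²_p ℒ(x, us, us') : us'' ⊗ us'' |dy'/dℒ¹|⁻² dx`. In `ℝ≥0∞` one has
`0 / 0 = 0` and `c / 0 = ∞` for `c ≠ 0`, so the integrand is `0` where `us''` and the density
both vanish, and `∞` where only the density vanishes (the `p`-Hessian along `us` being positive
definite). -/
def meshIntegral (L : ℝ → E → E → ℝ) (a b : ℝ) (us : ℝ → E) (y : ℝ → ℝ) : ℝ≥0∞ :=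
  ∫⁻ x in Icc a b,
    ENNReal.ofReal (hessPQ L x (us x) (derivWithin us (Icc a b) x) (secondDeriv a b us x)) /
      ENNReal.ofReal |(bvDeriv a b y).rnDeriv volume x| ^ 2

open Classical in
/-- The limit energy `ℱ*(g,y)`. -/
def limitEnergy (L : ℝ → E → E → ℝ) (a b : ℝ) (us g : ℝ → E) (y : ℝ → ℝ) : EReal :=
  if MemMBV a b y ∧ MemW120 a b g then
    ((1 / 2 * secondVariation L a b us g : ℝ) : EReal) +
      ((ENNReal.ofReal ((b - a) ^ 2 / 24) * meshIntegral L a b us y : ℝ≥0∞) : EReal)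
  else ⊤

end Energy

end

end RAdapt

/-!
The second order `Γ`-limit for piecewise affine approximations on free meshes.

**Expansion at the minimizer.** Write `p = us'`, `σ = us''`. The Euler-Lagrange equation and the
coercivity of `∂²_p ℒ` make `us` twice continuously differentiable, and the first order term in the
expansion of the action drops out (`action_sub_eq`): for `ξ = n (u - us, u' - us')` the renormalized
energy is `n² ∫ R x (ξ / n)`, where the Taylor remainder `R` is at least `θ |·|²` in the gradient and
is close to half of the Hessian `Q` at small arguments. These are the properties collected in the
structure `Expansion`, and the analysis uses nothing else about the Lagrangian. An admissible pair is
the same as a mesh with nodes `x i`, a function that is affine on the cells of the mesh, and a monotone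
map that takes the values of the uniform mesh between the nodes (`Admissible.exists_data`,
`exists_admissible_of_nodes`). Compactness then follows from the bound for `ξ` in `L²` and from Helly's
selection theorem (`exists_subseq_of_energy_le`).

**Lower bound.** On a mesh cell of length `ℓ` and midpoint `m`, the slope of `u` is constant while `p`
is almost affine, so the scaled deviation of the gradients contains the term `- n (x - m) σ`. The
convex form `Q` is bounded from below by its tangent at the test function `ζ - (A / ℓ) (x - m) (0, σ)`,
where `ζ` is a mean of the limit `(g, g')` over a small macroscopic interval. With `b₀ = Q (0, σ) (0, σ)`
this gives, besides the term `½ Q ζ ζ`, the contribution `b₀ (A² ℓ / 8 - A³ / (12 n))` of the cell for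
every `A ≥ 0` (`Expansion.good_cell`); cells on which the gradients are far apart carry so much energy
that they can be ignored (`bad_cell`). The number of cells in an interval `J` is at most
`n ΔY / (b - a) + 2`, where `ΔY` is the increment of the monotone map (`AdmData.card_le`). For
`A = (b - a) |J| / ΔY`, up to a regularization, the contributions of the cells in `J` add up to
`b₀ A² |J| (1 / 8 - 1 / 12) = b₀ A² |J| / 24`, which is the integrand of the limit functional with the
derivative of `Y` replaced by a difference quotient. Lebesgue's differentiation theorem and Fatou's
lemma conclude (`Expansion.lower_bound`). Only the absolutely continuous part of the derivative of `Y`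
survives, since difference quotients of a monotone function converge to it almost everywhere.

**Recovery sequence.** The nodes are the preimages of the uniform nodes under `(1 - l) Y + l id`
(`NMono.exists_mesh`), so that all cells have length at most `(b - a) / (n l)`. The competitor
interpolates `us + γ / n`, where `γ'` is continuous and close to `g'` in `L²`. By Jensen's inequality the
part with `γ` contributes at most its second variation (`Expansion.upper_cell`), and the oscillation of
`p` contributes `n² b₀ ℓ³ / 24` on a cell. If `r` is the density of the mesh, then Hölder's inequality
and `∫ r ≤ (b - a) / n` on the cell give `n² ℓ³ ≤ (b - a)² ∫ r⁻²` (`cell_cube_le`). A diagonal sequence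
with `l → 0` and `γ' → g'` recovers a finite limit energy (`Expansion.exists_recovery`,
`exists_recovery_of_lt_top`). If the limit energy is infinite, the lower bound applies to any sequence
that converges to the given pair (`exists_recovery_of_eq_top`).
-/

namespace RAdapt

set_option linter.unusedSectionVars false
set_option maxSynthPendingDepth 3

/-! ### Sobolev functions of one variable -/

section Sobolev

variable {E : Type*} [NormedAddCommGroup E] [InnerProductSpace ℝ E] [CompleteSpace E]

lemma integral_Icc_eq_interval {F : Type*} [NormedAddCommGroup F] [NormedSpace ℝ F] {a b : ℝ}
    (hab : a ≤ b) (f : ℝ → F) : ∫ x in Icc a b, f x = ∫ x in a..b, f x := by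
  rw [intervalIntegral.integral_of_le hab, integral_Icc_eq_integral_Ioc]

lemma intervalIntegrable_of_Icc {F : Type*} [NormedAddCommGroup F] {a b s t : ℝ} {w : ℝ → F}
    (hw : IntegrableOn w (Icc a b)) (hs : s ∈ Icc a b) (ht : t ∈ Icc a b) :
    IntervalIntegrable w volume s t := by
  rw [intervalIntegrable_iff]
  refine hw.mono_set (uIoc_subset_uIcc.trans ?_)
  exact (uIcc_subset_Icc hs ht)

lemma continuousOn_primitive_Icc {F : Type*} [NormedAddCommGroup F] [NormedSpace ℝ F] {a b : ℝ}
    (hab : a ≤ b) {w : ℝ → F} (hw : IntegrableOn w (Icc a b)) :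
    ContinuousOn (fun x => ∫ t in a..x, w t) (Icc a b) := by
  have := intervalIntegral.continuousOn_primitive_interval (μ := volume) (a := a) (b := b) (f := w)
    (by rwa [uIcc_of_le hab])
  rwa [uIcc_of_le hab] at this

/-- Fubini's theorem on the triangle `a < t ≤ x < b`, in the form of an integration by parts. -/
lemma integral_deriv_smul_primitive {a b : ℝ} (hab : a ≤ b) {φ : ℝ → ℝ} (hφ : ContDiff ℝ 1 φ)
    {w : ℝ → E} (hw : IntegrableOn w (Icc a b)) :
    ∫ x in a..b, deriv φ x • ∫ t in a..x, w t = ∫ t in a..b, (φ b - φ t) • w t := by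
  have hcont : Continuous (deriv φ) := hφ.continuous_deriv le_rfl
  set μ := volume.restrict (Ioc a b) with hμ
  have hw' : Integrable w μ := hw.mono_set Ioc_subset_Icc_self
  have hd : Integrable (deriv φ) μ :=
    (hcont.continuousOn.integrableOn_Icc (a := a) (b := b)).mono_set Ioc_subset_Icc_self
  have hint : Integrable (fun p : ℝ × ℝ => deriv φ p.1 • w p.2) (μ.prod μ) := hd.smul_prod hw'
  have hS : MeasurableSet {p : ℝ × ℝ | p.2 ≤ p.1} := measurableSet_le measurable_snd measurable_fst
  have hint2 := hint.indicator hS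
  have key := integral_integral_swap (f := fun x t => {p : ℝ × ℝ | p.2 ≤ p.1}.indicator
    (fun p : ℝ × ℝ => deriv φ p.1 • w p.2) (x, t)) hint2
  rw [intervalIntegral.integral_of_le hab, intervalIntegral.integral_of_le hab]
  refine Eq.trans ?_ (key.trans ?_)
  · refine setIntegral_congr_fun measurableSet_Ioc (fun x hx => ?_)
    have h1 : ∀ t, {p : ℝ × ℝ | p.2 ≤ p.1}.indicator (fun p : ℝ × ℝ => deriv φ p.1 • w p.2) (x, t)
        = deriv φ x • (Iic x).indicator w t := by
      intro t
      by_cases h : t ≤ x <;> simp [indicator, h]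
    simp only [h1]
    rw [integral_smul, hμ, setIntegral_indicator measurableSet_Iic,
      intervalIntegral.integral_of_le hx.1.le, Ioc_inter_Iic, min_eq_right hx.2]
  · refine setIntegral_congr_fun measurableSet_Ioc (fun t ht => ?_)
    have h1 : ∀ x, {p : ℝ × ℝ | p.2 ≤ p.1}.indicator (fun p : ℝ × ℝ => deriv φ p.1 • w p.2) (x, t)
        = (Ici t).indicator (deriv φ) x • w t := by
      intro x
      by_cases h : t ≤ x <;> simp [indicator, h]
    simp only [h1]
    rw [integral_smul_const, hμ, setIntegral_indicator measurableSet_Ici]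
    have h2 : Ioc a b ∩ Ici t = Icc t b := by
      ext x; simp only [mem_inter_iff, mem_Ioc, mem_Ici, mem_Icc]
      constructor
      · rintro ⟨⟨_, h2⟩, h3⟩; exact ⟨h3, h2⟩
      · rintro ⟨h2, h3⟩; exact ⟨⟨ht.1.trans_le h2, h3⟩, h2⟩
    rw [h2, integral_Icc_eq_interval ht.2, intervalIntegral.integral_deriv_eq_sub]
    · intro x _; exact (hφ.differentiable (by simp)).differentiableAt
    · exact hcont.intervalIntegrable _ _

lemma HasWeakDeriv.congr_ae {a b : ℝ} {u u' w w' : ℝ → E} (h : HasWeakDeriv a b u w)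
    (hu : u =ᵐ[volume.restrict (Icc a b)] u') (hw : w =ᵐ[volume.restrict (Icc a b)] w') :
    HasWeakDeriv a b u' w' := by
  refine ⟨h.1.congr_fun_ae hu, h.2.1.congr_fun_ae hw, fun φ h1 h2 h3 => ?_⟩
  have e1 : ∫ x in Icc a b, deriv φ x • u' x = ∫ x in Icc a b, deriv φ x • u x :=
    integral_congr_ae (hu.mono fun x hx => by simp [hx])
  have e2 : ∫ x in Icc a b, φ x • w' x = ∫ x in Icc a b, φ x • w x :=
    integral_congr_ae (hw.mono fun x hx => by simp [hx])
  rw [e1, e2, h.2.2 φ h1 h2 h3]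

lemma eq_zero_of_tsupport {a b : ℝ} {φ : ℝ → ℝ} (h : tsupport φ ⊆ Ioo a b) {x : ℝ}
    (hx : x ∉ Ioo a b) : φ x = 0 :=
  image_eq_zero_of_notMem_tsupport fun hh => hx (h hh)

/-- Absolutely continuous functions have a weak derivative. -/
lemma hasWeakDeriv_primitive {a b : ℝ} (hab : a ≤ b) (p : E) {w : ℝ → E}
    (hw : IntegrableOn w (Icc a b)) : HasWeakDeriv a b (fun x => p + ∫ t in a..x, w t) w := by
  have hc : ContinuousOn (fun x => p + ∫ t in a..x, w t) (Icc a b) :=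
    continuousOn_const.add (continuousOn_primitive_Icc hab hw)
  refine ⟨hc.integrableOn_Icc, hw, fun φ h1 _ h3 => ?_⟩
  have hφ : ContDiff ℝ 1 φ := h1.of_le (by exact_mod_cast le_top)
  have hcont : Continuous (deriv φ) := hφ.continuous_deriv le_rfl
  have hb : φ b = 0 := eq_zero_of_tsupport h3 (by simp)
  have ha : φ a = 0 := eq_zero_of_tsupport h3 (by simp)
  rw [integral_Icc_eq_interval hab, integral_Icc_eq_interval hab]
  simp only [smul_add]
  have h0 : IntervalIntegrable (fun x => deriv φ x • ∫ t in a..x, w t) volume a b := by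
    apply ContinuousOn.intervalIntegrable
    rw [uIcc_of_le hab]
    exact hcont.continuousOn.smul (continuousOn_primitive_Icc hab hw)
  rw [intervalIntegral.integral_add (f := fun x => deriv φ x • p)
    ((hcont.smul continuous_const).intervalIntegrable _ _) h0,
    intervalIntegral.integral_smul_const, intervalIntegral.integral_deriv_eq_sub,
    integral_deriv_smul_primitive hab hφ hw, ha, hb]
  · simp
  · intro x _; exact (hφ.differentiable (by simp)).differentiableAt
  · exact hcont.intervalIntegrable _ _

lemma ae_eq_of_integral_test {a b : ℝ} {w w' : ℝ → E} (hw : IntegrableOn w (Icc a b))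
    (hw' : IntegrableOn w' (Icc a b))
    (h : ∀ φ : ℝ → ℝ, ContDiff ℝ ∞ φ → HasCompactSupport φ → tsupport φ ⊆ Ioo a b →
      ∫ x in Icc a b, φ x • w x = ∫ x in Icc a b, φ x • w' x) :
    w =ᵐ[volume.restrict (Icc a b)] w' := by
  have key := isOpen_Ioo.ae_eq_zero_of_integral_contDiff_smul_eq_zero (U := Ioo a b) (μ := volume)
    (f := fun x => w x - w' x)
    ((hw.sub hw').mono_set Ioo_subset_Icc_self).locallyIntegrableOn ?_
  · have h2 : ∀ᵐ x ∂volume.restrict (Ioo a b), w x = w' x := by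
      rw [ae_restrict_iff' measurableSet_Ioo]
      filter_upwards [key] with x hx hx2
      exact sub_eq_zero.1 (hx hx2)
    rwa [Measure.restrict_congr_set Ioo_ae_eq_Icc] at h2
  · intro φ h1 h2 h3
    have h4 : ∫ x, φ x • (w x - w' x) = ∫ x in Icc a b, φ x • (w x - w' x) := by
      rw [setIntegral_eq_integral_of_forall_compl_eq_zero]
      intro x hx
      rw [eq_zero_of_tsupport h3 fun hh => hx (Ioo_subset_Icc_self hh), zero_smul]
    obtain ⟨C, hC⟩ := h1.continuous.bounded_above_of_compact_support h2
    have hi : ∀ {f : ℝ → E}, IntegrableOn f (Icc a b) → IntegrableOn (fun x => φ x • f x) (Icc a b) :=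
      fun hf => Integrable.bdd_smul hf C h1.continuous.aestronglyMeasurable
        (ae_of_all _ hC)
    rw [h4]
    simp only [smul_sub]
    rw [integral_sub (hi hw) (hi hw'), h φ h1 h2 h3, sub_self]

lemma HasWeakDeriv.ae_unique {a b : ℝ} {u w w' : ℝ → E} (h : HasWeakDeriv a b u w)
    (h' : HasWeakDeriv a b u w') : w =ᵐ[volume.restrict (Icc a b)] w' :=
  ae_eq_of_integral_test h.2.1 h'.2.1 fun φ h1 h2 h3 => by
    rw [← neg_inj, ← h.2.2 φ h1 h2 h3, h'.2.2 φ h1 h2 h3]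

lemma HasWeakDeriv.weakDeriv {a b : ℝ} {u w : ℝ → E} (h : HasWeakDeriv a b u w) :
    HasWeakDeriv a b u (weakDeriv a b u) := by
  have h' : ∃ w, HasWeakDeriv a b u w := ⟨w, h⟩
  rw [RAdapt.weakDeriv, dif_pos h']
  exact h'.choose_spec

lemma HasWeakDeriv.weakDeriv_ae_eq {a b : ℝ} {u w : ℝ → E} (h : HasWeakDeriv a b u w) :
    RAdapt.weakDeriv a b u =ᵐ[volume.restrict (Icc a b)] w :=
  h.weakDeriv.ae_unique h

/-- The primitive of a test function of mean zero is a test function. -/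
lemma exists_test_primitive {a b : ℝ} (hab : a < b) {φ : ℝ → ℝ} (h1 : ContDiff ℝ ∞ φ)
    (h2 : HasCompactSupport φ) (h3 : tsupport φ ⊆ Ioo a b) (h4 : ∫ x in a..b, φ x = 0) :
    ∃ Φ : ℝ → ℝ, ContDiff ℝ ∞ Φ ∧ HasCompactSupport Φ ∧ tsupport Φ ⊆ Ioo a b ∧ deriv Φ = φ := by
  obtain ⟨a', b', ha', hb', hsub⟩ : ∃ a' b', a < a' ∧ b' < b ∧ tsupport φ ⊆ Icc a' b' := by
    rcases (tsupport φ).eq_empty_or_nonempty with he | hne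
    · exact ⟨b, a, hab, hab, by simp [he]⟩
    · obtain ⟨p, hp, hp'⟩ := h2.exists_isLeast hne
      obtain ⟨q, hq, hq'⟩ := h2.exists_isGreatest hne
      exact ⟨p, q, (h3 hp).1, (h3 hq).2, fun x hx => ⟨hp' hx, hq' hx⟩⟩
  have hz : ∀ x ∉ Icc a' b', φ x = 0 := fun x hx =>
    image_eq_zero_of_notMem_tsupport fun hh => hx (hsub hh)
  have hd : ∀ x, HasDerivAt (fun x => ∫ t in a..x, φ t) (φ x) x := fun x =>
    intervalIntegral.integral_hasDerivAt_right (h1.continuous.intervalIntegrable _ _)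
      (h1.continuous.stronglyMeasurableAtFilter _ _) h1.continuous.continuousAt
  have hsupp : Function.support (fun x => ∫ t in a..x, φ t) ⊆ Icc a' b' := by
    intro x hx
    by_contra hx'
    apply hx
    rw [mem_Icc, not_and_or, not_le, not_le] at hx'
    rcases hx' with hx' | hx'
    · refine (intervalIntegral.integral_congr (g := fun _ => 0) fun t ht => hz t fun hh => ?_).trans
        (by simp)
      rcases le_total a x with h | h
      · rw [uIcc_of_le h] at ht; linarith [ht.2, hh.1]
      · rw [uIcc_of_ge h] at ht; linarith [ht.2, hh.1]
    · have : ∫ t in x..b, φ t = 0 := by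
        refine (intervalIntegral.integral_congr (g := fun _ => 0)
          fun t ht => hz t fun hh => ?_).trans (by simp)
        rcases le_total x b with h | h
        · rw [uIcc_of_le h] at ht; linarith [ht.1, hh.2]
        · rw [uIcc_of_ge h] at ht; linarith [ht.1, hh.2]
      have h5 := intervalIntegral.integral_add_adjacent_intervals
        (h1.continuous.intervalIntegrable (μ := volume) a x) (h1.continuous.intervalIntegrable x b)
      show ∫ t in a..x, φ t = 0
      linarith
  have hts : tsupport (fun x => ∫ t in a..x, φ t) ⊆ Icc a' b' := closure_minimal hsupp isClosed_Icc
  refine ⟨fun x => ∫ t in a..x, φ t, ?_, ?_, ?_, funext fun x => (hd x).deriv⟩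
  · rw [contDiff_infty_iff_deriv]
    refine ⟨fun x => (hd x).differentiableAt, ?_⟩
    rwa [show deriv (fun x => ∫ t in a..x, φ t) = φ from funext fun x => (hd x).deriv]
  · exact isCompact_Icc.of_isClosed_subset (isClosed_tsupport _) hts
  · exact hts.trans fun x hx => ⟨ha'.trans_le hx.1, hx.2.trans_lt hb'⟩

lemma exists_test_integral_one {a b : ℝ} (hab : a < b) :
    ∃ ψ : ℝ → ℝ, ContDiff ℝ ∞ ψ ∧ HasCompactSupport ψ ∧ tsupport ψ ⊆ Ioo a b ∧
      ∫ x in a..b, ψ x = 1 := by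
  let B : ContDiffBump ((a + b) / 2) := ⟨(b - a) / 8, (b - a) / 4, by linarith, by linarith⟩
  have hs : tsupport (B.normed volume) ⊆ Ioo a b := by
    rw [B.tsupport_normed_eq, Real.closedBall_eq_Icc]
    intro x hx
    have h1 : (a + b) / 2 - (b - a) / 4 ≤ x := hx.1
    have h2 : x ≤ (a + b) / 2 + (b - a) / 4 := hx.2
    constructor <;> linarith
  refine ⟨B.normed volume, B.contDiff_normed, B.hasCompactSupport_normed, hs, ?_⟩
  rw [← integral_Icc_eq_interval hab.le, setIntegral_eq_integral_of_forall_compl_eq_zero,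
    B.integral_normed]
  exact fun x hx => eq_zero_of_tsupport hs fun hh => hx (Ioo_subset_Icc_self hh)

/-- A function with vanishing weak derivative is constant. The test function `φ` is made mean free
by subtracting a multiple of a fixed test function `ψ` of integral one. -/
lemma ae_const_of_hasWeakDeriv_zero {a b : ℝ} (hab : a < b) {u : ℝ → E}
    (h : HasWeakDeriv a b u 0) : ∃ c, u =ᵐ[volume.restrict (Icc a b)] fun _ => c := by
  obtain ⟨ψ, p1, p2, p3, p4⟩ := exists_test_integral_one hab
  have hi : ∀ {φ : ℝ → ℝ}, ContDiff ℝ ∞ φ → HasCompactSupport φ →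
      IntegrableOn (fun x => φ x • u x) (Icc a b) := fun {φ} h1 h2 => by
    obtain ⟨C, hC⟩ := h1.continuous.bounded_above_of_compact_support h2
    exact Integrable.bdd_smul h.1 C h1.continuous.aestronglyMeasurable
        (ae_of_all _ hC)
  refine ⟨∫ x in Icc a b, ψ x • u x, ae_eq_of_integral_test h.1 (by simp) fun φ h1 h2 h3 => ?_⟩
  set m := ∫ x in a..b, φ x with hm
  have hη : ContDiff ℝ ∞ (fun x => φ x - m * ψ x) := h1.sub (contDiff_const.mul p1)
  have hηs : HasCompactSupport (fun x => φ x - m * ψ x) := h2.sub (p2.mul_left (f := fun _ => m))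
  have hηt : tsupport (fun x => φ x - m * ψ x) ⊆ Ioo a b := by
    refine (closure_minimal ?_ ((isClosed_tsupport φ).union (isClosed_tsupport ψ))).trans
      (union_subset h3 p3)
    intro x hx
    by_contra hh
    rw [mem_union, not_or] at hh
    exact hx (by simp [image_eq_zero_of_notMem_tsupport hh.1, image_eq_zero_of_notMem_tsupport hh.2])
  obtain ⟨Φ, q1, q2, q3, q4⟩ := exists_test_primitive hab hη hηs hηt (by
    rw [intervalIntegral.integral_sub (f := φ) (g := fun x => m * ψ x)
      (h1.continuous.intervalIntegrable _ _)
      ((continuous_const.mul p1.continuous).intervalIntegrable _ _),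
      intervalIntegral.integral_const_mul, p4, ← hm]; ring)
  have key := h.2.2 Φ q1 q2 q3
  rw [q4] at key
  simp only [sub_smul, mul_smul, Pi.zero_apply, smul_zero, integral_zero, neg_zero] at key
  rw [integral_sub (g := fun x => m • ψ x • u x) (hi h1 h2) ((hi p1 p2).smul m), integral_smul, sub_eq_zero] at key
  rw [key, integral_smul_const, hm, integral_Icc_eq_interval hab.le φ]

/-- A function with a weak derivative is almost everywhere a primitive of it, up to a constant. -/
lemma HasWeakDeriv.exists_primitive {a b : ℝ} (hab : a < b) {u w : ℝ → E}
    (h : HasWeakDeriv a b u w) :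
    ∃ c, u =ᵐ[volume.restrict (Icc a b)] fun x => c + ∫ t in a..x, w t := by
  have h0 := hasWeakDeriv_primitive hab.le 0 h.2.1
  have h1 : HasWeakDeriv a b (fun x => u x - (0 + ∫ t in a..x, w t)) 0 := by
    refine ⟨h.1.sub h0.1, integrable_zero _ _ _, fun φ h1 h2 h3 => ?_⟩
    obtain ⟨C, hC⟩ := (h1.continuous_deriv (by exact_mod_cast le_top)).bounded_above_of_compact_support
      h2.deriv
    have hi : ∀ {f : ℝ → E}, IntegrableOn f (Icc a b) →
        IntegrableOn (fun x => deriv φ x • f x) (Icc a b) := fun hf =>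
      Integrable.bdd_smul hf C
        (h1.continuous_deriv (by exact_mod_cast le_top)).aestronglyMeasurable (ae_of_all _ hC)
    have e : ∀ x, deriv φ x • (u x - (0 + ∫ t in a..x, w t)) =
        deriv φ x • u x - deriv φ x • (0 + ∫ t in a..x, w t) := fun x => smul_sub _ _ _
    simp_rw [e]
    rw [integral_sub (hi h.1) (hi h0.1), h.2.2 φ h1 h2 h3, h0.2.2 φ h1 h2 h3]
    simp
  obtain ⟨c, hc⟩ := ae_const_of_hasWeakDeriv_zero hab h1
  refine ⟨c, hc.mono fun x hx => ?_⟩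
  have hx' : u x - (0 + ∫ t in a..x, w t) = c := hx
  show u x = c + _
  rw [← hx']; abel

/-- Continuous functions that agree almost everywhere on an interval agree everywhere on it. -/
lemma eqOn_of_ae_eq {a b : ℝ} (hab : a < b) {u v : ℝ → E} (hu : ContinuousOn u (Icc a b))
    (hv : ContinuousOn v (Icc a b)) (h : u =ᵐ[volume.restrict (Icc a b)] v) :
    EqOn u v (Icc a b) :=
  Measure.eqOn_Icc_of_ae_eq volume hab.ne h hu hv

lemma HasBoundaryValues.primitive {a b : ℝ} (hab : a < b) {ua ub c : E} {u w : ℝ → E}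
    (h : HasBoundaryValues a b ua ub u) (hw : IntegrableOn w (Icc a b))
    (hu : u =ᵐ[volume.restrict (Icc a b)] fun x => c + ∫ t in a..x, w t) :
    c = ua ∧ c + ∫ t in a..b, w t = ub := by
  obtain ⟨v, hv, huv, rfl, rfl⟩ := h
  have key := eqOn_of_ae_eq hab hv (continuousOn_const.add (continuousOn_primitive_Icc hab.le hw))
    (huv.symm.trans hu)
  exact ⟨by simpa using (key (left_mem_Icc.2 hab.le)).symm, (key (right_mem_Icc.2 hab.le)).symm⟩

lemma hasBoundaryValues_primitive {a b : ℝ} (hab : a ≤ b) {c : E} {u w : ℝ → E}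
    (hw : IntegrableOn w (Icc a b))
    (hu : u =ᵐ[volume.restrict (Icc a b)] fun x => c + ∫ t in a..x, w t) :
    HasBoundaryValues a b c (c + ∫ t in a..b, w t) u :=
  ⟨fun x => c + ∫ t in a..x, w t,
    continuousOn_const.add (continuousOn_primitive_Icc hab hw), hu, by simp, rfl⟩

lemma memLp_of_continuousOn {a b : ℝ} {u : ℝ → E} (p : ℝ≥0∞) (hu : ContinuousOn u (Icc a b)) :
    MemLp u p (volume.restrict (Icc a b)) := by
  obtain ⟨C, hC⟩ := isCompact_Icc.exists_bound_of_continuousOn hu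
  exact MemLp.of_bound (hu.aestronglyMeasurable measurableSet_Icc) C
    ((ae_restrict_iff' measurableSet_Icc).2 (ae_of_all _ hC))

lemma memW1_primitive {a b : ℝ} (hab : a ≤ b) {p : ℝ≥0∞} (hp : 1 ≤ p) {c : E} {u w : ℝ → E}
    (hw : MemLp w p (volume.restrict (Icc a b)))
    (hu : u =ᵐ[volume.restrict (Icc a b)] fun x => c + ∫ t in a..x, w t) :
    MemW1 a b p u := by
  have hwi : IntegrableOn w (Icc a b) := hw.integrable hp
  refine ⟨(memLp_congr_ae hu).2 (memLp_of_continuousOn p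
    (continuousOn_const.add (continuousOn_primitive_Icc hab hwi))), w, ?_, hw⟩
  exact (hasWeakDeriv_primitive hab c hwi).congr_ae hu.symm (ae_eq_refl _)

/-- The elements of `W^{1,2}_0` are the primitives of the `L²` functions of mean zero. -/
lemma MemW120.primitive {a b : ℝ} (hab : a < b) {g : ℝ → E} (hg : MemW120 a b g) :
    MemLp (weakDeriv a b g) 2 (volume.restrict (Icc a b)) ∧
    g =ᵐ[volume.restrict (Icc a b)] (fun x => ∫ t in a..x, weakDeriv a b g t) ∧
    ∫ t in a..b, weakDeriv a b g t = 0 := by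
  obtain ⟨⟨_, w, hw, hw2⟩, hbv⟩ := hg
  obtain ⟨c, hc⟩ := hw.weakDeriv.exists_primitive hab
  obtain ⟨rfl, h2⟩ := hbv.primitive hab hw.weakDeriv.2.1 hc
  exact ⟨(memLp_congr_ae hw.weakDeriv_ae_eq).2 hw2, by simpa using hc, by simpa using h2⟩

lemma memW120_of_primitive {a b : ℝ} (hab : a < b) {g w : ℝ → E}
    (hw : MemLp w 2 (volume.restrict (Icc a b)))
    (hg : g =ᵐ[volume.restrict (Icc a b)] fun x => ∫ t in a..x, w t)
    (h0 : ∫ t in a..b, w t = 0) :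
    MemW120 a b g ∧ weakDeriv a b g =ᵐ[volume.restrict (Icc a b)] w := by
  have hwi : IntegrableOn w (Icc a b) := hw.integrable (by norm_num)
  have hg' : g =ᵐ[volume.restrict (Icc a b)] fun x => 0 + ∫ t in a..x, w t := by simpa using hg
  refine ⟨⟨memW1_primitive hab.le (by norm_num) hw hg', ?_⟩,
    ((hasWeakDeriv_primitive hab.le 0 hwi).congr_ae hg'.symm (ae_eq_refl _)).weakDeriv_ae_eq⟩
  simpa [h0] using hasBoundaryValues_primitive hab.le hwi hg'

end Sobolev

/-! ### Monotone maps as functions of bounded variation -/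

section Monotone

/-- A nondecreasing function on the line, equal to `a` up to `a` and to `b` from `b` on: a
normalized everywhere defined representative of an element of `MBV([a,b])`. -/
structure NMono (a b : ℝ) (Y : ℝ → ℝ) : Prop where
  mono : Monotone Y
  left : ∀ x ≤ a, Y x = a
  right : ∀ x, b ≤ x → Y x = b

variable {a b : ℝ} {Y : ℝ → ℝ}

lemma NMono.range_mem (hY : NMono a b Y) (x : ℝ) : Y x ∈ Icc a b := by
  constructor
  · rw [← hY.left (min a x) (min_le_left _ _)]; exact hY.mono (min_le_right _ _)
  · rw [← hY.right (max b x) (le_max_left _ _)]; exact hY.mono (le_max_right _ _)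

lemma IsMono.exists_nmono (hab : a < b) {v : ℝ → ℝ} (hv : IsMono a b v) :
    ∃ Y, NMono a b Y ∧ ∀ x ∈ Ioo a b, Y x = v x := by
  have hm : ∀ x ∈ Icc a b, v x ∈ Icc a b := fun x hx =>
    ⟨hv.2.1.trans (hv.1 (left_mem_Icc.2 hab.le) hx hx.1),
      (hv.1 hx (right_mem_Icc.2 hab.le) hx.2).trans hv.2.2⟩
  refine ⟨fun x => if x ≤ a then a else if b ≤ x then b else v x, ⟨?_, ?_, ?_⟩, ?_⟩
  · intro x y hxy
    simp only
    split_ifs with h1 h2 h3 h4 h5 h6 h7 <;> try linarith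
    · exact (hm y ⟨by linarith, by linarith⟩).1
    · exact (hm x ⟨by linarith, by linarith⟩).2
    · exact hv.1 ⟨by linarith, by linarith⟩ ⟨by linarith, by linarith⟩ hxy
  · intro x hx; simp [hx]
  · intro x hx; have : ¬ x ≤ a := by linarith
    simp [hx, this]
  · intro x hx; simp only; rw [if_neg (not_le.2 hx.1), if_neg (not_le.2 hx.2)]

lemma ae_Icc_of_Ioo {p : ℝ → Prop} (h : ∀ x ∈ Ioo a b, p x) :
    ∀ᵐ x ∂volume.restrict (Icc a b), p x := by
  rw [← Measure.restrict_congr_set Ioo_ae_eq_Icc, ae_restrict_iff' measurableSet_Ioo]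
  exact ae_of_all _ h

lemma MemMBV.exists_nmono (hab : a < b) {y : ℝ → ℝ} (hy : MemMBV a b y) :
    ∃ Y, NMono a b Y ∧ y =ᵐ[volume.restrict (Icc a b)] Y := by
  obtain ⟨v, hv, hyv⟩ := hy
  obtain ⟨Y, hY, h⟩ := hv.exists_nmono hab
  exact ⟨Y, hY, hyv.trans (ae_Icc_of_Ioo fun x hx => (h x hx).symm)⟩

lemma NMono.isMono (hY : NMono a b Y) : IsMono a b Y :=
  ⟨hY.mono.monotoneOn _, (hY.left a le_rfl).ge, (hY.right b le_rfl).le⟩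

lemma NMono.memMBV (hY : NMono a b Y) {y : ℝ → ℝ} (h : y =ᵐ[volume.restrict (Icc a b)] Y) :
    MemMBV a b y := ⟨Y, hY.isMono, h⟩

/-- The distributional derivative of a normalized monotone function. -/
noncomputable def NMono.meas (hY : NMono a b Y) : Measure ℝ := hY.mono.stieltjesFunction.measure

lemma NMono.rightLim_left (hY : NMono a b Y) {x : ℝ} (hx : x < a) :
    hY.mono.stieltjesFunction x = a := by
  rw [hY.mono.stieltjesFunction_eq]
  refine (tendsto_nhds_unique (hY.mono.tendsto_rightLim x) ?_)
  refine tendsto_const_nhds.congr' ?_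
  filter_upwards [Ioo_mem_nhdsGT hx] with y hy using (hY.left y hy.2.le).symm

lemma NMono.rightLim_right (hY : NMono a b Y) {x : ℝ} (hx : b ≤ x) :
    hY.mono.stieltjesFunction x = b := by
  rw [hY.mono.stieltjesFunction_eq]
  refine (tendsto_nhds_unique (hY.mono.tendsto_rightLim x) ?_)
  refine tendsto_const_nhds.congr' ?_
  filter_upwards [self_mem_nhdsWithin] with y hy using (hY.right y (hx.trans (le_of_lt hy))).symm

lemma NMono.tendsto_atBot (hY : NMono a b Y) :
    Tendsto hY.mono.stieltjesFunction atBot (𝓝 a) :=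
  tendsto_const_nhds.congr' (by
    filter_upwards [eventually_lt_atBot a] with x hx using (hY.rightLim_left hx).symm)

lemma NMono.tendsto_atTop (hY : NMono a b Y) :
    Tendsto hY.mono.stieltjesFunction atTop (𝓝 b) :=
  tendsto_const_nhds.congr' (by
    filter_upwards [eventually_ge_atTop b] with x hx using (hY.rightLim_right hx).symm)

lemma NMono.meas_univ (hY : NMono a b Y) : hY.meas univ = ENNReal.ofReal (b - a) :=
  StieltjesFunction.measure_univ _ hY.tendsto_atBot hY.tendsto_atTop

instance NMono.isFinite_meas (hY : NMono a b Y) : IsFiniteMeasure hY.meas :=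
  ⟨by rw [hY.meas_univ]; exact ENNReal.ofReal_lt_top⟩

lemma NMono.meas_compl (hY : NMono a b Y) : hY.meas (Icc a b)ᶜ = 0 := by
  have : (Icc a b)ᶜ = Iio a ∪ Ioi b := by
    ext x; simp only [mem_compl_iff, mem_Icc, not_and_or, not_le, mem_union, mem_Iio, mem_Ioi]
  rw [this]
  refine measure_union_null ?_ ?_
  · rw [NMono.meas, StieltjesFunction.measure_Iio _ hY.tendsto_atBot]
    have : Function.leftLim hY.mono.stieltjesFunction a = a := by
      refine (tendsto_nhds_unique (hY.mono.stieltjesFunction.mono.tendsto_leftLim a) ?_)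
      refine tendsto_const_nhds.congr' ?_
      filter_upwards [self_mem_nhdsWithin] with y hy using (hY.rightLim_left hy).symm
    simp [this]
  · rw [NMono.meas, StieltjesFunction.measure_Ioi _ hY.tendsto_atTop, hY.rightLim_right le_rfl]
    simp

lemma NMono.ae_eq (hY : NMono a b Y) : ∀ᵐ x, hY.mono.stieltjesFunction x = Y x := by
  filter_upwards [hY.mono.countable_not_continuousAt.ae_notMem volume] with x hx
  rw [hY.mono.stieltjesFunction_eq]
  replace hx : ContinuousAt Y x := not_not.1 hx
  exact tendsto_nhds_unique (hY.mono.tendsto_rightLim x) (hx.mono_left nhdsWithin_le_nhds)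

lemma integral_deriv_eq_zero' {φ : ℝ → ℝ} (hφ : ContDiff ℝ 1 φ) (hs : HasCompactSupport φ) :
    ∫ x, deriv φ x = 0 := by
  have hc := hφ.continuous_deriv le_rfl
  exact integral_eq_zero_of_hasDerivAt_of_integrable
    (fun x => (hφ.differentiable (by simp)).differentiableAt.hasDerivAt)
    (hc.integrable_of_hasCompactSupport hs.deriv)
    (hφ.continuous.integrable_of_hasCompactSupport hs)

/-- Integration by parts against the Stieltjes measure, by Fubini's theorem. -/
lemma NMono.integral_meas (hY : NMono a b Y) {φ : ℝ → ℝ} (hφ : ContDiff ℝ 1 φ)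
    (hs : HasCompactSupport φ) : ∫ x, φ x ∂hY.meas = - ∫ x, Y x * deriv φ x := by
  have hc := hφ.continuous_deriv le_rfl
  have hd : Integrable (deriv φ) := hc.integrable_of_hasCompactSupport hs.deriv
  have hS : MeasurableSet {p : ℝ × ℝ | p.1 ≤ p.2} := measurableSet_le measurable_fst measurable_snd
  have hint : Integrable ({p : ℝ × ℝ | p.1 ≤ p.2}.indicator (fun p : ℝ × ℝ => deriv φ p.2))
      (hY.meas.prod volume) :=
    (hd.comp_snd hY.meas).indicator hS
  have key := integral_integral_swap (f := fun x t => {p : ℝ × ℝ | p.1 ≤ p.2}.indicator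
    (fun p : ℝ × ℝ => deriv φ p.2) (x, t)) hint
  have e1 : ∀ x, ∫ t, {p : ℝ × ℝ | p.1 ≤ p.2}.indicator (fun p : ℝ × ℝ => deriv φ p.2) (x, t)
      = - φ x := by
    intro x
    have h1 : ∀ t, {p : ℝ × ℝ | p.1 ≤ p.2}.indicator (fun p : ℝ × ℝ => deriv φ p.2) (x, t)
        = (Ici x).indicator (deriv φ) t := by
      intro t; by_cases h : x ≤ t <;> simp [indicator, h]
    simp_rw [h1]
    rw [integral_indicator measurableSet_Ici, integral_Ici_eq_integral_Ioi,
      hs.integral_Ioi_deriv_eq hφ]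
  have e2 : ∀ t, ∫ x, {p : ℝ × ℝ | p.1 ≤ p.2}.indicator (fun p : ℝ × ℝ => deriv φ p.2) (x, t)
      ∂hY.meas = (hY.mono.stieltjesFunction t - a) * deriv φ t := by
    intro t
    have h1 : ∀ x, {p : ℝ × ℝ | p.1 ≤ p.2}.indicator (fun p : ℝ × ℝ => deriv φ p.2) (x, t)
        = (Iic t).indicator (fun _ => deriv φ t) x := by
      intro x; by_cases h : x ≤ t <;> simp [indicator, h]
    simp_rw [h1]
    rw [integral_indicator measurableSet_Iic, setIntegral_const, measureReal_def, NMono.meas,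
      StieltjesFunction.measure_Iic _ hY.tendsto_atBot, ENNReal.toReal_ofReal, smul_eq_mul]
    have := hY.mono.le_rightLim (le_refl t)
    rw [hY.mono.stieltjesFunction_eq]
    linarith [(hY.range_mem t).1]
  simp_rw [e1, e2] at key
  rw [integral_neg] at key
  have e3 : ∫ t, (hY.mono.stieltjesFunction t - a) * deriv φ t = ∫ t, Y t * deriv φ t := by
    have hYd : Integrable (fun t => Y t * deriv φ t) := by
      refine hd.bdd_mul (c := max |a| |b|) hY.mono.measurable.aestronglyMeasurable
        (ae_of_all _ fun t => ?_)
      exact abs_le_max_abs_abs (hY.range_mem t).1 (hY.range_mem t).2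
    calc _ = ∫ t, (Y t * deriv φ t - a * deriv φ t) := integral_congr_ae (by
            filter_upwards [hY.ae_eq] with t ht
            rw [ht, sub_mul])
      _ = _ := by rw [integral_sub hYd (hd.const_mul a), integral_const_mul,
                  integral_deriv_eq_zero' hφ hs]; ring
  rw [e3] at key
  linarith

lemma signedIntegral_toSignedMeasure (μ : Measure ℝ) [IsFiniteMeasure μ] (φ : ℝ → ℝ) :
    signedIntegral a b μ.toSignedMeasure φ = ∫ x in Icc a b, φ x ∂μ ∧
    μ.toSignedMeasure.totalVariation = μ ∧
    ∀ᵐ x, μ.toSignedMeasure.rnDeriv volume x = (μ.rnDeriv volume x).toReal := by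
  let j : JordanDecomposition ℝ := ⟨μ, 0, Measure.MutuallySingular.zero_right⟩
  have hj : μ.toSignedMeasure.toJordanDecomposition = j := by
    apply SignedMeasure.toJordanDecomposition_eq
    simp [j, JordanDecomposition.toSignedMeasure]
  refine ⟨by simp [signedIntegral, hj, j], by simp [SignedMeasure.totalVariation, hj, j], ?_⟩
  rw [SignedMeasure.rnDeriv_def, hj]
  filter_upwards [Measure.rnDeriv_zero (volume : Measure ℝ)] with x hx
  simp [j, hx]

lemma integral_bvExt_mul {y : ℝ → ℝ} (hY : NMono a b Y)
    (h : y =ᵐ[volume.restrict (Icc a b)] Y) (ψ : ℝ → ℝ) :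
    ∫ x, bvExt a b y x * ψ x = ∫ x, Y x * ψ x := by
  refine integral_congr_ae ?_
  rw [EventuallyEq, ae_restrict_iff' measurableSet_Icc] at h
  filter_upwards [h] with x hx
  rw [bvExt]
  split_ifs with h1 h2
  · rw [hY.left x h1.le]
  · rw [hY.right x h2.le]
  · rw [hx ⟨not_lt.1 h1, not_lt.1 h2⟩]

lemma NMono.isBVDeriv (hY : NMono a b Y) {y : ℝ → ℝ}
    (h : y =ᵐ[volume.restrict (Icc a b)] Y) : IsBVDeriv a b y hY.meas.toSignedMeasure := by
  refine ⟨by rw [(signedIntegral_toSignedMeasure (a := a) (b := b) hY.meas 0).2.1, hY.meas_compl],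
    fun φ h1 h2 => ?_⟩
  rw [(signedIntegral_toSignedMeasure _ _).1, integral_bvExt_mul hY h, ← hY.integral_meas h1 h2]
  rw [Measure.restrict_eq_self_of_ae_mem]
  exact mem_ae_iff.2 hY.meas_compl

/-- Polynomials agree on `[a, b]` with admissible test functions for `IsBVDeriv`. -/
lemma exists_cutoff (a b : ℝ) (p : Polynomial ℝ) :
    ∃ φ : ℝ → ℝ, ContDiff ℝ 1 φ ∧ HasCompactSupport φ ∧ ∀ x ∈ Icc a b, φ x = p.eval x := by
  let B : ContDiffBump (0 : ℝ) := ⟨|a| + |b| + 1, |a| + |b| + 2, by positivity, by linarith⟩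
  refine ⟨fun x => B x * p.eval x, B.contDiff.mul (by simpa using p.contDiff_aeval (𝕜 := ℝ) 1),
    B.hasCompactSupport.mul_right, fun x hx => ?_⟩
  show B x * p.eval x = _
  rw [B.one_of_mem_closedBall, one_mul]
  rw [mem_closedBall_zero_iff, Real.norm_eq_abs]
  have := abs_le_max_abs_abs hx.1 hx.2
  have h2 : max |a| |b| ≤ |a| + |b| := max_le (by linarith [abs_nonneg b]) (by linarith [abs_nonneg a])
  show |x| ≤ |a| + |b| + 1
  linarith

lemma signedIntegral_congr (μ : SignedMeasure ℝ) {φ ψ : ℝ → ℝ} (h : ∀ x ∈ Icc a b, φ x = ψ x) :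
    signedIntegral a b μ φ = signedIntegral a b μ ψ := by
  rw [signedIntegral, signedIntegral, setIntegral_congr_fun measurableSet_Icc h,
    setIntegral_congr_fun measurableSet_Icc h]

/-- Two finite measures on `[a,b]` with the same moments are equal (Weierstrass). -/
lemma measure_eq_of_moments {μ ν : Measure ℝ} [IsFiniteMeasure μ] [IsFiniteMeasure ν]
    (hμ : μ (Icc a b)ᶜ = 0) (hν : ν (Icc a b)ᶜ = 0)
    (h : ∀ p : Polynomial ℝ, ∫ x in Icc a b, p.eval x ∂μ = ∫ x in Icc a b, p.eval x ∂ν) :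
    μ = ν := by
  have rμ : μ.restrict (Icc a b) = μ := Measure.restrict_eq_self_of_ae_mem (mem_ae_iff.2 hμ)
  have rν : ν.restrict (Icc a b) = ν := Measure.restrict_eq_self_of_ae_mem (mem_ae_iff.2 hν)
  refine ext_of_forall_integral_eq_of_IsFiniteMeasure fun f => ?_
  rw [← rμ, ← rν]
  refine eq_of_forall_dist_le fun ε hε => ?_
  set m := μ.real (Icc a b) + ν.real (Icc a b) + 1 with hm
  have hm0 : 0 < m := by positivity
  obtain ⟨p, hp⟩ := exists_polynomial_near_of_continuousOn a b f f.continuous.continuousOn (ε / m)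
    (by positivity)
  have est : ∀ κ : Measure ℝ, IsFiniteMeasure κ →
      |∫ x in Icc a b, f x ∂κ - ∫ x in Icc a b, p.eval x ∂κ| ≤ ε / m * κ.real (Icc a b) := by
    intro κ _
    rw [← integral_sub]
    · refine norm_setIntegral_le_of_norm_le_const (f := fun x => f x - p.eval x)
        (measure_lt_top _ _) fun x hx => ?_
      rw [Real.norm_eq_abs, abs_sub_comm]; exact (hp x hx).le
    · exact (f.continuous.continuousOn).integrableOn_Icc
    · exact (p.continuous.continuousOn).integrableOn_Icc
  have e1 := est μ inferInstance
  have e2 := est ν inferInstance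
  rw [h p] at e1
  rw [Real.dist_eq]
  have : ε / m * μ.real (Icc a b) + ε / m * ν.real (Icc a b) ≤ ε := by
    rw [← mul_add, div_mul_eq_mul_div, div_le_iff₀ hm0]
    exact mul_le_mul_of_nonneg_left (by linarith) hε.le
  rw [abs_le] at *
  constructor <;> linarith [e1.1, e1.2, e2.1, e2.2]

/-- The distributional derivative is unique. Both measures are compared through their moments; to stay
with positive measures, the negative parts are moved to the other side. -/
lemma IsBVDeriv.unique {y : ℝ → ℝ} {μ ν : SignedMeasure ℝ} (hμ : IsBVDeriv a b y μ)
    (hν : IsBVDeriv a b y ν) : μ = ν := by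
  set P := μ.toJordanDecomposition.posPart
  set N := μ.toJordanDecomposition.negPart
  set P' := ν.toJordanDecomposition.posPart
  set N' := ν.toJordanDecomposition.negPart
  have h1 : P (Icc a b)ᶜ = 0 ∧ N (Icc a b)ᶜ = 0 := by
    have := hμ.1
    rwa [SignedMeasure.totalVariation, Measure.add_apply, add_eq_zero] at this
  have h2 : P' (Icc a b)ᶜ = 0 ∧ N' (Icc a b)ᶜ = 0 := by
    have := hν.1
    rwa [SignedMeasure.totalVariation, Measure.add_apply, add_eq_zero] at this
  have key : P + N' = P' + N := by
    refine measure_eq_of_moments (a := a) (b := b) (by simp [h1, h2]) (by simp [h1, h2])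
      fun p => ?_
    obtain ⟨φ, q1, q2, q3⟩ := exists_cutoff a b p
    have e := (hμ.2 φ q1 q2).trans (hν.2 φ q1 q2).symm
    rw [signedIntegral_congr μ q3, signedIntegral_congr ν q3] at e
    have hi : ∀ κ : Measure ℝ, IsFiniteMeasure κ → IntegrableOn (fun x => p.eval x) (Icc a b) κ :=
      fun κ _ => (p.continuous.continuousOn).integrableOn_Icc
    rw [Measure.restrict_add, Measure.restrict_add,
      integral_add_measure (hi P inferInstance) (hi N' inferInstance),
      integral_add_measure (hi P' inferInstance) (hi N inferInstance)]
    simp only [signedIntegral] at e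
    linarith
  have k2 := Measure.toSignedMeasure_congr key
  rw [Measure.toSignedMeasure_add, Measure.toSignedMeasure_add] at k2
  rw [← SignedMeasure.toSignedMeasure_toJordanDecomposition μ,
    ← SignedMeasure.toSignedMeasure_toJordanDecomposition ν, JordanDecomposition.toSignedMeasure,
    JordanDecomposition.toSignedMeasure, sub_eq_sub_iff_add_eq_add]
  exact k2

lemma NMono.bvDeriv_eq (hY : NMono a b Y) {y : ℝ → ℝ}
    (h : y =ᵐ[volume.restrict (Icc a b)] Y) : bvDeriv a b y = hY.meas.toSignedMeasure := by
  have hex : ∃ μ, IsBVDeriv a b y μ := ⟨_, hY.isBVDeriv h⟩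
  rw [bvDeriv, dif_pos hex]
  exact hex.choose_spec.unique (hY.isBVDeriv h)

lemma NMono.integrableOn (hY : NMono a b Y) : IntegrableOn Y (Icc a b) :=
  (hY.mono.monotoneOn _).integrableOn_isCompact isCompact_Icc

lemma NMono.memBV (hY : NMono a b Y) {y : ℝ → ℝ}
    (h : y =ᵐ[volume.restrict (Icc a b)] Y) : MemBV a b y :=
  ⟨hY.integrableOn.congr_fun_ae h.symm, _, hY.isBVDeriv h⟩

/-- The density of the absolutely continuous part of `y'` is the pointwise derivative. -/
lemma NMono.ae_hasDerivAt (hY : NMono a b Y) {y : ℝ → ℝ}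
    (h : y =ᵐ[volume.restrict (Icc a b)] Y) :
    ∀ᵐ x, HasDerivAt Y ((bvDeriv a b y).rnDeriv volume x) x := by
  rw [hY.bvDeriv_eq h]
  filter_upwards [hY.mono.ae_hasDerivAt,
    (signedIntegral_toSignedMeasure (a := a) (b := b) hY.meas 0).2.2] with x h1 h2
  rw [h2]; exact h1

/-- Weak-* convergence of monotone functions follows from convergence in `L¹`. -/
lemma bvTendsto_of_L1 {f : ℕ → ℝ → ℝ} {y : ℝ → ℝ} {F : ℕ → ℝ → ℝ} (hab : a ≤ b)
    (hF : ∀ k, NMono a b (F k)) (hf : ∀ k, f k =ᵐ[volume.restrict (Icc a b)] F k)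
    (hY : NMono a b Y) (hy : y =ᵐ[volume.restrict (Icc a b)] Y)
    (h : Tendsto (fun k => ∫ x in Icc a b, |F k x - Y x|) atTop (𝓝 0)) :
    BVTendsto a b f y := by
  refine ⟨fun k => (hF k).memBV (hf k), hY.memBV hy, ?_, fun φ hφ => ?_⟩
  · refine h.congr fun k => integral_congr_ae ?_
    filter_upwards [hf k, hy] with x h1 h2
    rw [h1, h2]
  have hsi : ∀ {Z z : ℝ → ℝ} (hZ : NMono a b Z) (hz : z =ᵐ[volume.restrict (Icc a b)] Z)
      (ψ : ℝ → ℝ), signedIntegral a b (bvDeriv a b z) ψ = ∫ x in Icc a b, ψ x ∂hZ.meas :=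
    fun hZ hz ψ => by rw [hZ.bvDeriv_eq hz, (signedIntegral_toSignedMeasure _ _).1]
  rw [hsi hY hy φ]
  simp_rw [fun k => hsi (hF k) (hf k) φ]
  have hpoly : ∀ p : Polynomial ℝ, Tendsto (fun k => ∫ x in Icc a b, p.eval x ∂(hF k).meas) atTop
      (𝓝 (∫ x in Icc a b, p.eval x ∂hY.meas)) := by
    intro p
    obtain ⟨ψ, q1, q2, q3⟩ := exists_cutoff a b p
    have e : ∀ {Z : ℝ → ℝ} (hZ : NMono a b Z),
        ∫ x in Icc a b, p.eval x ∂hZ.meas = - ∫ x, Z x * deriv ψ x := by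
      intro Z hZ
      rw [← hZ.integral_meas q1 q2, ← setIntegral_congr_fun measurableSet_Icc q3]
      rw [Measure.restrict_eq_self_of_ae_mem]
      exact mem_ae_iff.2 hZ.meas_compl
    have hc := q1.continuous_deriv le_rfl
    have hd : Integrable (deriv ψ) := hc.integrable_of_hasCompactSupport q2.deriv
    obtain ⟨C, hC⟩ := hc.bounded_above_of_compact_support q2.deriv
    have hi : ∀ {Z : ℝ → ℝ} (hZ : NMono a b Z), Integrable (fun x => Z x * deriv ψ x) := by
      intro Z hZ
      refine hd.bdd_mul (c := max |a| |b|) hZ.mono.measurable.aestronglyMeasurable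
        (ae_of_all _ fun t => ?_)
      exact abs_le_max_abs_abs (hZ.range_mem t).1 (hZ.range_mem t).2
    rw [e hY]
    simp_rw [fun k => e (hF k)]
    refine Tendsto.neg ?_
    rw [tendsto_iff_dist_tendsto_zero]
    refine squeeze_zero (fun _ => dist_nonneg) (fun k => ?_)
      (by simpa using h.mul_const C)
    have hdiff : IntegrableOn (fun x => |F k x - Y x|) (Icc a b) :=
      ((hF k).integrableOn.sub hY.integrableOn).abs
    rw [Real.dist_eq, ← integral_sub (hi (hF k)) (hi hY)]
    have e2 : ∫ x, (F k x * deriv ψ x - Y x * deriv ψ x) =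
        ∫ x in Icc a b, (F k x - Y x) * deriv ψ x := by
      rw [setIntegral_eq_integral_of_forall_compl_eq_zero]
      · simp_rw [sub_mul]
      · intro x hx
        rw [mem_Icc, not_and_or, not_le, not_le] at hx
        rcases hx with hx | hx
        · rw [(hF k).left x hx.le, hY.left x hx.le]; simp
        · rw [(hF k).right x hx.le, hY.right x hx.le]; simp
    rw [e2, ← integral_mul_const]
    refine (norm_integral_le_of_norm_le (f := fun x => (F k x - Y x) * deriv ψ x)
      (hdiff.mul_const C) (ae_of_all _ fun x => ?_))
    rw [norm_mul, Real.norm_eq_abs]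
    exact mul_le_mul_of_nonneg_left (hC x) (abs_nonneg _)
  rw [Metric.tendsto_atTop]
  intro ε hε
  have hm0 : 0 < b - a + 1 := by linarith
  set η := ε / 3 / (b - a + 1) with hη
  have hη0 : 0 < η := by positivity
  have hη1 : η * (b - a) ≤ ε / 3 := by
    rw [hη, div_mul_eq_mul_div, div_le_iff₀ hm0]
    exact mul_le_mul_of_nonneg_left (by linarith) (by positivity)
  obtain ⟨p, hp⟩ := exists_polynomial_near_of_continuousOn a b φ hφ η hη0
  obtain ⟨K, hK⟩ := Metric.tendsto_atTop.1 (hpoly p) (ε / 3) (by positivity)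
  refine ⟨K, fun k hk => ?_⟩
  have est : ∀ {Z : ℝ → ℝ} (hZ : NMono a b Z),
      |∫ x in Icc a b, φ x ∂hZ.meas - ∫ x in Icc a b, p.eval x ∂hZ.meas| ≤ ε / 3 := by
    intro Z hZ
    rw [← integral_sub hφ.integrableOn_Icc (p.continuous.continuousOn).integrableOn_Icc]
    refine (norm_setIntegral_le_of_norm_le_const (C := η) (f := fun x => φ x - p.eval x)
        (measure_lt_top _ _) fun x hx => ?_).trans ?_
    · rw [Real.norm_eq_abs, abs_sub_comm]; exact (hp x hx).le
    · refine le_trans (mul_le_mul_of_nonneg_left ?_ hη0.le) hη1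
      calc hZ.meas.real (Icc a b) ≤ hZ.meas.real univ := measureReal_mono (subset_univ _)
        _ = b - a := by rw [measureReal_def, hZ.meas_univ, ENNReal.toReal_ofReal (by linarith)]
  have e1 := est (hF k)
  have e2 := est hY
  have e3 := hK k hk
  rw [Real.dist_eq, abs_lt] at *
  rw [abs_le] at e1 e2
  constructor <;> linarith [e1.1, e1.2, e2.1, e2.2, e3.1, e3.2]

/-- Helly's selection theorem. -/
lemma exists_subseq_tendsto_of_nmono (hab : a < b) {F : ℕ → ℝ → ℝ} (hF : ∀ k, NMono a b (F k)) :
    ∃ (φ : ℕ → ℕ) (Y : ℝ → ℝ), StrictMono φ ∧ NMono a b Y ∧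
      ∀ᵐ x, Tendsto (fun k => F (φ k) x) atTop (𝓝 (Y x)) := by
  obtain ⟨z, φ, hφ, hz⟩ := CompactSpace.tendsto_subseq
    (fun k => fun q : ℚ => (⟨F k q, (hF k).range_mem q⟩ : Icc a b))
  have hz' : ∀ q : ℚ, Tendsto (fun k => F (φ k) q) atTop (𝓝 (z q : ℝ)) := fun q =>
    (continuous_subtype_val.tendsto _).comp ((tendsto_pi_nhds.1 hz) q)
  have zm : ∀ {q r : ℚ}, q ≤ r → (z q : ℝ) ≤ z r := fun {q r} hqr =>
    le_of_tendsto_of_tendsto' (hz' q) (hz' r) fun k => (hF _).mono (by exact_mod_cast hqr)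
  have zl : ∀ q : ℚ, (q : ℝ) ≤ a → (z q : ℝ) = a := fun q hq =>
    tendsto_nhds_unique (hz' q) (tendsto_const_nhds.congr fun k => ((hF _).left q hq).symm)
  let S : ℝ → Set ℝ := fun x => (fun q : ℚ => (z q : ℝ)) '' {q : ℚ | (q : ℝ) < x}
  have hSne : ∀ x, (S x).Nonempty := fun x => by
    obtain ⟨q, hq⟩ := exists_rat_lt x
    exact ⟨_, q, hq, rfl⟩
  have hSb : ∀ x, BddAbove (S x) := fun x => ⟨b, by rintro _ ⟨q, _, rfl⟩; exact (z q).2.2⟩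
  have hSm : ∀ x, sSup (S x) ∈ Icc a b := fun x => by
    obtain ⟨s, q, hq, hs⟩ := hSne x
    exact ⟨(z q).2.1.trans (le_csSup (hSb x) ⟨q, hq, rfl⟩),
      csSup_le (hSne x) (by rintro _ ⟨q, _, rfl⟩; exact (z q).2.2)⟩
  let Y : ℝ → ℝ := fun x => if b ≤ x then b else sSup (S x)
  have hYm : NMono a b Y := by
    refine ⟨fun x y hxy => ?_, fun x hx => ?_, fun x hx => by simp [Y, hx]⟩
    · simp only [Y]
      split_ifs with h1 h2 h3
      · exact le_rfl
      · linarith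
      · exact (hSm x).2
      · refine csSup_le_csSup (hSb y) (hSne x) (image_mono fun q hq => ?_)
        exact lt_of_lt_of_le hq hxy
    · have : ¬ b ≤ x := by linarith
      simp only [Y, if_neg this]
      refine le_antisymm (csSup_le (hSne x) ?_) (hSm x).1
      rintro _ ⟨q, hq, rfl⟩
      exact (zl q (hx.trans' (le_of_lt hq))).le
  refine ⟨φ, Y, hφ, hYm, ?_⟩
  filter_upwards [hYm.mono.countable_not_continuousAt.ae_notMem volume] with x hx
  replace hx : ContinuousAt Y x := not_not.1 hx
  by_cases hxa : x ≤ a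
  · refine tendsto_const_nhds.congr fun k => ?_
    rw [hYm.left x hxa, (hF _).left x hxa]
  by_cases hxb : b ≤ x
  · refine tendsto_const_nhds.congr fun k => ?_
    rw [hYm.right x hxb, (hF _).right x hxb]
  push Not at hxa hxb
  have hYS : ∀ t < b, Y t = sSup (S t) := fun t ht => by simp [Y, not_le.2 ht]
  refine tendsto_order.2 ⟨fun l hl => ?_, fun r hr => ?_⟩
  · rw [hYS x hxb] at hl
    obtain ⟨_, ⟨q, hq, rfl⟩, hlq⟩ := exists_lt_of_lt_csSup (hSne x) hl
    filter_upwards [(tendsto_order.1 (hz' q)).1 l hlq] with k hk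
    exact hk.trans_le ((hF _).mono (le_of_lt hq))
  · have h1 : ∀ᶠ t in 𝓝[>] x, Y t < r ∧ t ∈ Ioo x b :=
      ((hx.mono_left nhdsWithin_le_nhds).eventually (gt_mem_nhds hr)).and (Ioo_mem_nhdsGT hxb)
    obtain ⟨t, ht, htx⟩ := h1.exists
    obtain ⟨q, hq1, hq2⟩ := exists_rat_btwn htx.1
    have : (z q : ℝ) < r := lt_of_le_of_lt
      (by rw [hYS t htx.2]; exact le_csSup (hSb t) ⟨q, hq2, rfl⟩) ht
    filter_upwards [(tendsto_order.1 (hz' q)).2 r this] with k hk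
    exact lt_of_le_of_lt ((hF _).mono hq1.le) hk

lemma NMono.tendsto_L1 {F : ℕ → ℝ → ℝ} (hF : ∀ k, NMono a b (F k))
    (hY : NMono a b Y) (h : ∀ᵐ x, Tendsto (fun k => F k x) atTop (𝓝 (Y x))) :
    Tendsto (fun k => ∫ x in Icc a b, |F k x - Y x|) atTop (𝓝 0) := by
  have := tendsto_integral_of_dominated_convergence (μ := volume.restrict (Icc a b))
    (F := fun k x => |F k x - Y x|) (f := fun _ => 0) (fun _ => b - a)
    (fun k => ((hF k).mono.measurable.sub hY.mono.measurable).abs.aestronglyMeasurable)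
    (integrable_const _) (fun k => ae_of_all _ fun x => ?_) (ae_restrict_of_ae (h.mono fun x hx => ?_))
  · simpa using this
  · rw [Real.norm_eq_abs, abs_abs, abs_le]
    have h1 := (hF k).range_mem x
    have h2 := hY.range_mem x
    constructor <;> linarith [h1.1, h1.2, h2.1, h2.2]
  · have := (hx.sub_const (Y x)).abs
    simpa using this

/-- An `L¹` limit of monotone functions is monotone, and a subsequence converges almost
everywhere. -/
lemma exists_nmono_of_L1_limit (hab : a < b) {F : ℕ → ℝ → ℝ} (hF : ∀ k, NMono a b (F k))
    {y : ℝ → ℝ} (hy : IntegrableOn y (Icc a b))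
    (h : Tendsto (fun k => ∫ x in Icc a b, |F k x - y x|) atTop (𝓝 0)) :
    ∃ (φ : ℕ → ℕ) (Y : ℝ → ℝ), StrictMono φ ∧ NMono a b Y ∧
      y =ᵐ[volume.restrict (Icc a b)] Y ∧
      ∀ᵐ x, Tendsto (fun k => F (φ k) x) atTop (𝓝 (Y x)) := by
  obtain ⟨φ, Y, hφ, hY, hlim⟩ := exists_subseq_tendsto_of_nmono hab hF
  refine ⟨φ, Y, hφ, hY, ?_, hlim⟩
  have h1 := NMono.tendsto_L1 (fun k => hF (φ k)) hY hlim
  have h2 := h.comp hφ.tendsto_atTop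
  have h3 := h2.add h1
  have hi : ∀ k, IntegrableOn (fun x => |F (φ k) x - y x|) (Icc a b) := fun k =>
    ((hF _).integrableOn.sub hy).abs
  have hi' : ∀ k, IntegrableOn (fun x => |F (φ k) x - Y x|) (Icc a b) := fun k =>
    ((hF _).integrableOn.sub hY.integrableOn).abs
  have h4 : ∫ x in Icc a b, |y x - Y x| ≤ 0 + 0 := by
    refine ge_of_tendsto' h3 fun k => ?_
    simp only [Function.comp]
    rw [← integral_add (hi k) (hi' k)]
    refine integral_mono (hy.sub hY.integrableOn).abs ((hi k).add (hi' k)) fun x => ?_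
    have := abs_sub_le (y x) (F (φ k) x) (Y x)
    rw [abs_sub_comm (y x) (F (φ k) x)] at this
    exact this
  have h5 : ∫ x in Icc a b, |y x - Y x| = 0 :=
    le_antisymm (by simpa using h4) (integral_nonneg fun x => abs_nonneg _)
  rw [integral_eq_zero_iff_of_nonneg (f := fun x => |y x - Y x|) (fun x => abs_nonneg _) (hy.sub hY.integrableOn).abs] at h5
  filter_upwards [h5] with x hx
  have : |y x - Y x| = 0 := hx
  linarith [abs_eq_zero.1 this]

end Monotone

/-! ### Piecewise affine functions on a mesh -/

section Mesh

variable {E : Type*} [NormedAddCommGroup E] [InnerProductSpace ℝ E] [CompleteSpace E]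

/-- `x 0 ≤ x 1 ≤ …` are the nodes of a mesh of `[a,b]` with `n` cells, some of which may be
degenerate. -/
structure IsNodes (a b : ℝ) (n : ℕ) (x : ℕ → ℝ) : Prop where
  mono : Monotone x
  zero : x 0 = a
  last : x n = b

/-- `U` is affine with slope `c i` on the `i`-th cell of the mesh. -/
def IsPL (n : ℕ) (x : ℕ → ℝ) (c : ℕ → E) (U : ℝ → E) : Prop :=
  ∀ i < n, ∀ t ∈ Icc (x i) (x (i + 1)), U t = U (x i) + (t - x i) • c i

/-- The function equal to `c i` on the `i`-th cell of the mesh. -/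
noncomputable def stepFun (n : ℕ) (x : ℕ → ℝ) (c : ℕ → E) (t : ℝ) : E :=
  ∑ i ∈ Finset.range n, (Ico (x i) (x (i + 1))).indicator (fun _ => c i) t

variable {a b : ℝ} {n : ℕ} {x : ℕ → ℝ} {c : ℕ → E} {U : ℝ → E}

lemma stepFun_apply (hx : Monotone x) {i : ℕ} (hi : i < n) {t : ℝ}
    (ht : t ∈ Ico (x i) (x (i + 1))) : stepFun n x c t = c i := by
  rw [stepFun, Finset.sum_eq_single i]
  · rw [indicator_of_mem ht]
  · intro j _ hj
    rw [indicator_of_notMem]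
    intro htj
    rcases lt_or_gt_of_ne hj with h | h
    · have := hx (Nat.succ_le_of_lt h)
      exact absurd (htj.2.trans_le this) (not_lt.2 ht.1)
    · have := hx (Nat.succ_le_of_lt h)
      exact absurd (ht.2.trans_le this) (not_lt.2 htj.1)
  · intro h; exact absurd (Finset.mem_range.2 hi) h

lemma stepFun_stronglyMeasurable : StronglyMeasurable (stepFun n x c) := by
  have : stepFun n x c =
      fun t => ∑ i ∈ Finset.range n, (Ico (x i) (x (i + 1))).indicator (fun _ => c i) t := rfl
  rw [this]
  exact Finset.stronglyMeasurable_fun_sum _ fun i _ =>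
    stronglyMeasurable_const.indicator measurableSet_Ico

lemma norm_stepFun_le (t : ℝ) : ‖stepFun n x c t‖ ≤ ∑ i ∈ Finset.range n, ‖c i‖ := by
  refine (norm_sum_le _ _).trans (Finset.sum_le_sum fun i _ => ?_)
  exact norm_indicator_le_norm_self _ _

lemma stepFun_memLp (p : ℝ≥0∞) : MemLp (stepFun n x c) p (volume.restrict (Icc a b)) :=
  MemLp.of_bound stepFun_stronglyMeasurable.aestronglyMeasurable _
    (ae_of_all _ fun t => norm_stepFun_le t)

lemma stepFun_intervalIntegrable (s t : ℝ) : IntervalIntegrable (stepFun n x c) volume s t := by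
  rw [intervalIntegrable_iff]
  exact IntegrableOn.mono_set ((stepFun_memLp (a := min s t) (b := max s t) 1).integrable le_rfl)
    uIoc_subset_uIcc

lemma integral_stepFun_cell (hx : Monotone x) {i : ℕ} (hi : i < n) {s t : ℝ}
    (hs : s ∈ Icc (x i) (x (i + 1))) (ht : t ∈ Icc (x i) (x (i + 1))) (hst : s ≤ t) :
    ∫ τ in s..t, stepFun n x c τ = (t - s) • c i := by
  rw [← intervalIntegral.integral_const]
  refine intervalIntegral.integral_congr_ae ?_
  rw [uIoc_of_le hst]
  have h : ∀ᵐ τ : ℝ, τ ≠ t := by simp [ae_iff, measure_singleton]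
  filter_upwards [h] with τ hτ hτ2
  exact stepFun_apply hx hi ⟨hs.1.trans hτ2.1.le, (lt_of_le_of_ne hτ2.2 hτ).trans_le ht.2⟩

lemma IsNodes.mem_Icc' (hx : IsNodes a b n x) {i : ℕ} (hi : i ≤ n) : x i ∈ Icc a b :=
  ⟨hx.zero ▸ hx.mono (Nat.zero_le i), hx.last ▸ hx.mono hi⟩

lemma IsNodes.exists_cell (hx : IsNodes a b n x) {t : ℝ} (ht : t ∈ Icc a b) (hn : 1 ≤ n) :
    ∃ i < n, t ∈ Icc (x i) (x (i + 1)) := by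
  by_contra hcon
  push Not at hcon
  have key : ∀ i ≤ n, x i ≤ t := by
    intro i
    induction i with
    | zero => intro _; rw [hx.zero]; exact ht.1
    | succ i ih =>
      intro hi
      have h1 := hcon i (by omega)
      by_contra h2
      exact h1 ⟨ih (by omega), (not_le.1 h2).le⟩
  refine hcon (n - 1) (by omega) ⟨key _ (by omega), ?_⟩
  rw [Nat.sub_add_cancel hn, hx.last]; exact ht.2

/-- A piecewise affine function is the primitive of its slope. -/
lemma IsPL.eq_primitive (hx : IsNodes a b n x) (hU : IsPL n x c U) (hn : 1 ≤ n) :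
    ∀ t ∈ Icc a b, U t = U a + ∫ τ in a..t, stepFun n x c τ := by
  have key : ∀ i ≤ n, U (x i) = U a + ∫ τ in a..x i, stepFun n x c τ := by
    intro i
    induction i with
    | zero => intro _; rw [hx.zero]; simp
    | succ i ih =>
      intro hi
      have hle : x i ≤ x (i + 1) := hx.mono (Nat.le_succ i)
      rw [← intervalIntegral.integral_add_adjacent_intervals (stepFun_intervalIntegrable a (x i))
        (stepFun_intervalIntegrable _ _), ← add_assoc, ← ih (by omega),
        integral_stepFun_cell hx.mono (by omega : i < n) (left_mem_Icc.2 hle) (right_mem_Icc.2 hle)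
          hle]
      exact hU i (by omega) _ (right_mem_Icc.2 hle)
  intro t ht
  obtain ⟨i, hi, hti⟩ := hx.exists_cell ht hn
  have hle : x i ≤ x (i + 1) := hx.mono (Nat.le_succ i)
  rw [← intervalIntegral.integral_add_adjacent_intervals (stepFun_intervalIntegrable a (x i))
        (stepFun_intervalIntegrable _ _), ← add_assoc, ← key i hi.le,
        integral_stepFun_cell hx.mono hi (left_mem_Icc.2 hle) hti hti.1]
  exact hU i hi t hti

lemma isPL_primitive (hx : IsNodes a b n x) (p : E) :
    IsPL n x c (fun t => p + ∫ τ in a..t, stepFun n x c τ) := by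
  intro i hi t ht
  have hle : x i ≤ x (i + 1) := hx.mono (Nat.le_succ i)
  simp only
  rw [← intervalIntegral.integral_add_adjacent_intervals (stepFun_intervalIntegrable a (x i))
        (stepFun_intervalIntegrable (x i) t), ← add_assoc,
        integral_stepFun_cell hx.mono hi (left_mem_Icc.2 hle) ht ht.1]

/-- The piecewise affine interpolation of `f` at the nodes. -/
noncomputable def interp (a : ℝ) (n : ℕ) (x : ℕ → ℝ) (f : ℝ → E) (t : ℝ) : E :=
  f a + ∫ τ in a..t, stepFun n x (fun i => (x (i + 1) - x i)⁻¹ • (f (x (i + 1)) - f (x i))) τ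

lemma interp_isPL (hx : IsNodes a b n x) (f : ℝ → E) :
    IsPL n x (fun i => (x (i + 1) - x i)⁻¹ • (f (x (i + 1)) - f (x i))) (interp a n x f) :=
  isPL_primitive hx _

lemma interp_node (hx : IsNodes a b n x) (f : ℝ → E) {i : ℕ} (hi : i ≤ n) :
    interp a n x f (x i) = f (x i) := by
  induction i with
  | zero => rw [hx.zero, interp]; simp
  | succ i ih =>
    have hle : x i ≤ x (i + 1) := hx.mono (Nat.le_succ i)
    rw [interp_isPL hx f i (by omega) _ (right_mem_Icc.2 hle), ih (by omega), smul_smul]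
    rcases hle.eq_or_lt with h | h
    · rw [← h]; simp
    · rw [mul_inv_cancel₀ (by linarith)]; simp

lemma IsPL.continuousOn (hx : IsNodes a b n x) (hU : IsPL n x c U) (hn : 1 ≤ n) (hab : a ≤ b) :
    ContinuousOn U (Icc a b) := by
  refine ContinuousOn.congr ?_ (hU.eq_primitive hx hn)
  refine continuousOn_const.add (continuousOn_primitive_Icc hab ?_)
  exact (stepFun_memLp (a := a) (b := b) 1).integrable le_rfl

lemma IsPL.memW1 (hx : IsNodes a b n x) (hU : IsPL n x c U) (hn : 1 ≤ n) (hab : a ≤ b)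
    {p : ℝ≥0∞} (hp : 1 ≤ p) : MemW1 a b p U := by
  refine memW1_primitive hab hp (c := U a) (stepFun_memLp (n := n) (x := x) (c := c) p) ?_
  rw [EventuallyEq, ae_restrict_iff' measurableSet_Icc]
  exact ae_of_all _ (hU.eq_primitive hx hn)

lemma IsPL.memA (hx : IsNodes a b n x) (hU : IsPL n x c U) (hn : 1 ≤ n) (hab : a ≤ b)
    {q : ℝ} (hq : 1 < q) : MemA a b q (U a) (U b) U :=
  ⟨hU.memW1 hx hn hab (by rw [ENNReal.one_le_ofReal]; exact hq.le),
    U, hU.continuousOn hx hn hab, ae_eq_refl _, rfl, rfl⟩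

lemma isNodes_node (hab : a < b) (hn : 1 ≤ n) : IsNodes a b n (node a b n) := by
  have : (0 : ℝ) < n := by exact_mod_cast hn
  refine ⟨fun i j hij => ?_, by simp [node], by simp only [node]; field_simp; ring⟩
  simp only [node]
  have h2 : (i : ℝ) ≤ j := by exact_mod_cast hij
  have h3 : 0 ≤ b - a := by linarith
  gcongr

/-- The data carried by an admissible pair: a mesh with `n` cells on which the first component is
piecewise affine, while the second component maps its nodes to those of the uniform mesh. -/
structure AdmData (a b : ℝ) (n : ℕ) (x : ℕ → ℝ) (c : ℕ → E) (U : ℝ → E) (Y : ℝ → ℝ) : Prop where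
  nodes : IsNodes a b n x
  pl : IsPL n x c U
  nmono : NMono a b Y
  lower : ∀ i ≤ n, ∀ t ≤ b, x i < t → node a b n i ≤ Y t
  upper : ∀ i ≤ n, ∀ t, a ≤ t → t < x i → Y t ≤ node a b n i

lemma affine_closure {F : Type*} [NormedAddCommGroup F] [NormedSpace ℝ F] {s t : ℝ} (hst : s < t)
    {f : ℝ → F} (hf : ContinuousOn f (Icc s t)) {p d : F} (h : ∀ x ∈ Ico s t, f x = p + x • d) :
    ∀ x ∈ Icc s t, f x = f s + (x - s) • d := by
  have key : ∀ x ∈ Icc s t, f x = p + x • d := by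
    have hg : ContinuousOn (fun x : ℝ => p + x • d) (Icc s t) := by fun_prop
    have := Set.EqOn.of_subset_closure (s := Ico s t) (t := Icc s t) h hf hg Ico_subset_Icc_self
      (by rw [closure_Ico hst.ne])
    exact this
  intro x hx
  rw [key x hx, key s (left_mem_Icc.2 hst.le), sub_smul]; abel

/-- An admissible `u` is piecewise affine on the image of the uniform mesh. -/
lemma Admissible.exists_data (hab : a < b) (hn : 1 ≤ n) {q : ℝ} {ua ub : E} {u : ℝ → E}
    {y : ℝ → ℝ} (h : Admissible a b q ua ub n u y) :
    ∃ x c U Y, AdmData a b n x c U Y ∧ U a = ua ∧ U b = ub ∧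
      u =ᵐ[volume.restrict (Icc a b)] U ∧ y =ᵐ[volume.restrict (Icc a b)] Y := by
  obtain ⟨U, y₁, v, hu, hy, hmono, hinv, ⟨⟨hvc, hva⟩, hvm, hv0, hv1⟩, ⟨hwc, hwa⟩, hA⟩ := h
  obtain ⟨Y, hY, hYy⟩ := hmono.exists_nmono hab
  have hX := isNodes_node hab hn
  have hn0 : (0 : ℝ) < n := by exact_mod_cast hn
  have hXm : ∀ i, node a b n (min i n) ∈ Icc a b := fun i => hX.mem_Icc' (min_le_right _ _)
  have hXlt : ∀ i, node a b n i < node a b n (i + 1) := fun i => by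
    simp only [node, Nat.cast_add, Nat.cast_one]
    have : 0 < b - a := by linarith
    gcongr
    linarith
  set x : ℕ → ℝ := fun i => v (node a b n (min i n)) with hxdef
  have hxn : ∀ i ≤ n, x i = v (node a b n i) := fun i hi => by simp only [hxdef, min_eq_left hi]
  have hx : IsNodes a b n x := by
    refine ⟨fun i j hij => hvm (hXm i) (hXm j) (hX.mono (min_le_min_right n hij)), ?_, ?_⟩
    · rw [hxn 0 (Nat.zero_le n), hX.zero, hv0]
    · rw [hxn n le_rfl, hX.last, hv1]
  choose! cv dv hv using hva
  choose! cw dw hw using hwa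
  have hsub : ∀ i < n, Icc (node a b n i) (node a b n (i + 1)) ⊆ Icc a b := fun i hi =>
    Icc_subset_Icc (hX.mem_Icc' hi.le).1 (hX.mem_Icc' (Nat.succ_le_of_lt hi)).2
  refine ⟨x, fun i => (dv i)⁻¹ • dw i, U, Y, ⟨hx, ?_, hY, ?_, ?_⟩, ?_, ?_, hu,
    hy.trans (ae_Icc_of_Ioo fun t ht => (hYy t ht).symm)⟩
  · intro i hi t ht
    have e1 := affine_closure (hXlt i) (hvc.mono (hsub i hi)) (hv i hi)
    have e2 := affine_closure (hXlt i) (hwc.mono (hsub i hi)) (hw i hi)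
    rw [hxn i hi.le, hxn (i + 1) hi] at ht
    rw [hxn i hi.le]
    have e3 := e1 _ (right_mem_Icc.2 (hXlt i).le)
    have hd : 0 ≤ dv i := by
      have h1 := ht.1.trans ht.2
      rw [e3, smul_eq_mul] at h1
      have h2 := hXlt i
      by_contra h3
      nlinarith [mul_pos (sub_pos.2 h2) (neg_pos.2 (not_le.1 h3))]
    rcases hd.eq_or_lt with hd | hd
    · rw [e3, ← hd] at ht
      have : t = v (node a b n i) := le_antisymm (by simpa using ht.2) ht.1
      rw [this]; simp
    · set s := node a b n i + (t - v (node a b n i)) / dv i with hs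
      have hsm : s ∈ Icc (node a b n i) (node a b n (i + 1)) := by
        constructor
        · have : 0 ≤ (t - v (node a b n i)) / dv i := div_nonneg (by linarith [ht.1]) hd.le
          linarith
        · have : (t - v (node a b n i)) / dv i ≤ node a b n (i + 1) - node a b n i := by
            rw [div_le_iff₀ hd]
            have := ht.2
            rw [e3, smul_eq_mul] at this
            linarith
          linarith
      have hvs : v s = t := by
        rw [e1 s hsm, hs]; simp only [smul_eq_mul]; field_simp; ring
      have := e2 s hsm
      simp only [Function.comp, hvs] at this
      rw [this, smul_smul, hs]
      congr 2
      field_simp; ring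
  · intro i hi t htb hit
    have hti : t ∈ Icc a b := ⟨(hx.mem_Icc' hi).1.trans hit.le, htb⟩
    rcases htb.eq_or_lt with h | h
    · rw [hY.right t h.ge]; exact (hX.mem_Icc' hi).2
    · rw [hYy t ⟨lt_of_le_of_lt (hx.mem_Icc' hi).1 hit, h⟩]
      rw [hxn i hi] at hit
      exact ((hinv t hti _ (hX.mem_Icc' hi)).1 hit).le
  · intro i hi t hta hit
    have hti : t ∈ Icc a b := ⟨hta, hit.le.trans (hx.mem_Icc' hi).2⟩
    rcases hta.eq_or_lt with h | h
    · rw [hY.left t h.ge]; exact (hX.mem_Icc' hi).1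
    · rw [hYy t ⟨h, hit.trans_le (hx.mem_Icc' hi).2⟩]
      rw [hxn i hi] at hit
      by_contra hcon
      exact absurd ((hinv t hti _ (hX.mem_Icc' hi)).2 (not_le.1 hcon)) (not_lt.2 hit.le)
  all_goals
    obtain ⟨z, hz, hzu, hz0, hz1⟩ := hA.2
    have := eqOn_of_ae_eq hab hwc hz hzu
  · have h2 := this (left_mem_Icc.2 hab.le)
    simp only [Function.comp, hv0] at h2
    rw [h2, hz0]
  · have h2 := this (right_mem_Icc.2 hab.le)
    simp only [Function.comp, hv1] at h2
    rw [h2, hz1]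

/-- Every mesh is the image of the uniform mesh under a piecewise affine map, whose graph inverse
exists; interpolation on the mesh yields admissible pairs. -/
lemma exists_admissible_of_nodes (hab : a < b) (hn : 1 ≤ n) (hx : IsNodes a b n x) :
    ∃ y : ℝ → ℝ, IsMono a b y ∧
      (∀ i ≤ n, ∀ t ∈ Icc a b, x i < t ↔ node a b n i < y t) ∧
      ∀ (q : ℝ) (f : ℝ → E), 1 < q → Admissible a b q (f a) (f b) n (interp a n x f) y := by
  have hX := isNodes_node hab hn
  have hn0 : (0 : ℝ) < n := by exact_mod_cast hn
  have hH : 0 < b - a := by linarith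
  have hXd : ∀ i, node a b n (i + 1) - node a b n i = (b - a) / n := fun i => by
    simp only [node, Nat.cast_add, Nat.cast_one]; ring
  set d : ℕ → ℝ := fun i => (x (i + 1) - x i) / ((b - a) / n) with hd
  have hd0 : ∀ i, 0 ≤ d i := fun i =>
    div_nonneg (sub_nonneg.2 (hx.mono (Nat.le_succ i))) (by positivity)
  set v : ℝ → ℝ := fun t => a + ∫ τ in a..t, stepFun n (node a b n) d τ with hv
  have hvPL : IsPL n (node a b n) d v := isPL_primitive hX a
  have hva : v a = a := by simp [hv]
  have hvX : ∀ i ≤ n, v (node a b n i) = x i := by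
    intro i
    induction i with
    | zero => intro _; rw [hX.zero, hx.zero, hva]
    | succ i ih =>
      intro hi
      rw [hvPL i (by omega) _ (right_mem_Icc.2 (hX.mono (Nat.le_succ i))), ih (by omega), hXd,
        smul_eq_mul, hd]
      field_simp
      ring
  have hvb : v b = b := by rw [← hX.last, hvX n le_rfl, hx.last, hX.last]
  have hvc : ContinuousOn v (Icc a b) := hvPL.continuousOn hX hn hab.le
  have hvm : Monotone v := by
    intro s t hst
    have h1 := intervalIntegral.integral_add_adjacent_intervals
      (stepFun_intervalIntegrable (n := n) (x := node a b n) (c := d) a s)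
      (stepFun_intervalIntegrable s t)
    have h2 : 0 ≤ ∫ τ in s..t, stepFun n (node a b n) d τ :=
      intervalIntegral.integral_nonneg hst fun τ _ => Finset.sum_nonneg fun i _ =>
        indicator_nonneg (fun _ _ => hd0 i) _
    simp only [hv]; linarith
  let S : ℝ → Set ℝ := fun t => insert a {s ∈ Icc a b | v s < t}
  have hSb : ∀ t, BddAbove (S t) := fun t => ⟨b, by
    rintro s (rfl | hs)
    · exact hab.le
    · exact hs.1.2⟩
  have hSn : ∀ t, (S t).Nonempty := fun t => ⟨a, mem_insert _ _⟩
  have hinv : IsGraphInverse a b (fun t => sSup (S t)) v := by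
    intro t ht s hs
    constructor
    · intro hst
      have hsb : s < b := lt_of_le_of_ne hs.2 (by
        rintro rfl; rw [hvb] at hst; exact absurd ht.2 (not_le.2 hst))
      have h1 : ∀ᶠ r in 𝓝[>] s, v r < t := by
        have := (hvc s hs).mono_left (nhdsWithin_mono s (Ioo_subset_Icc_self (a := a) (b := b)))
        have h2 : Tendsto v (𝓝[Icc s b] s) (𝓝 (v s)) :=
          (hvc s hs).mono_left (nhdsWithin_mono s (Icc_subset_Icc_left hs.1))
        rw [nhdsWithin_Icc_eq_nhdsGE hsb] at h2
        exact (h2.mono_left (nhdsWithin_mono s Ioi_subset_Ici_self)).eventually (gt_mem_nhds hst)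
      obtain ⟨r, hr, hrs⟩ := (h1.and (Ioo_mem_nhdsGT hsb)).exists
      exact lt_of_lt_of_le hrs.1 (le_csSup (hSb t)
        (mem_insert_of_mem _ ⟨⟨hs.1.trans hrs.1.le, hrs.2.le⟩, hr⟩))
    · intro hst
      obtain ⟨r, hr, hsr⟩ := exists_lt_of_lt_csSup (hSn t) hst
      rcases hr with rfl | hr
      · exact absurd hs.1 (not_le.2 hsr)
      · exact lt_of_le_of_lt (hvm hsr.le) hr.2
  have hmono : IsMono a b (fun t => sSup (S t)) := by
    refine ⟨fun s _ t _ hst => csSup_le_csSup (hSb t) (hSn s) (insert_subset_insert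
      fun r hr => ⟨hr.1, lt_of_lt_of_le hr.2 hst⟩), le_csSup (hSb a) (mem_insert _ _), ?_⟩
    refine csSup_le (hSn b) ?_
    rintro s (rfl | hs)
    · exact hab.le
    · exact hs.1.2
  refine ⟨fun t => sSup (S t), hmono, fun i hi t ht => ?_, fun q f hq => ?_⟩
  · rw [← hvX i hi]; exact hinv t ht _ (hX.mem_Icc' hi)
  set c : ℕ → E := fun i => (x (i + 1) - x i)⁻¹ • (f (x (i + 1)) - f (x i)) with hc
  have hwPL : IsPL n (node a b n) (fun i => d i • c i) (interp a n x f ∘ v) := by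
    intro i hi t ht
    have hle : node a b n i ≤ node a b n (i + 1) := hX.mono (Nat.le_succ i)
    have h1 : v t ∈ Icc (x i) (x (i + 1)) := by
      rw [← hvX i hi.le, ← hvX (i + 1) hi]
      exact ⟨hvm ht.1, hvm ht.2⟩
    simp only [Function.comp]
    have h2 : x i + (t - node a b n i) • d i - x i = (t - node a b n i) * d i := by
      rw [smul_eq_mul]; ring
    rw [interp_isPL hx f i hi _ h1, hvX i hi.le, hvPL i hi t ht, hvX i hi.le, h2, mul_smul]
  have hpa : ∀ {F : Type _} [NormedAddCommGroup F] [InnerProductSpace ℝ F] [CompleteSpace F]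
      {c : ℕ → F} {W : ℝ → F}, IsPL n (node a b n) c W → IsPA a b n W := by
    intro F _ _ _ c W hW
    refine ⟨hW.continuousOn hX hn hab.le, fun i hi => ⟨W (node a b n i) - node a b n i • c i, c i,
      fun t ht => ?_⟩⟩
    rw [hW i hi t (Ico_subset_Icc_self ht), sub_smul]; abel
  have hpav : IsPA a b n v := by
    refine ⟨hvc, fun i hi => ⟨v (node a b n i) - node a b n i • d i, d i, fun t ht => ?_⟩⟩
    rw [hvPL i hi t (Ico_subset_Icc_self ht), sub_smul]; ring
  refine ⟨interp a n x f, _, v, ae_eq_refl _, ae_eq_refl _, hmono, hinv,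
    ⟨hpav, hvm.monotoneOn _, hva, hvb⟩, hpa hwPL, ?_⟩
  have := hwPL.memA hX hn hab.le hq
  simp only [Function.comp, hva, hvb] at this
  have e1 := interp_node hx f (Nat.zero_le n)
  have e2 := interp_node hx f (le_refl n)
  rw [hx.zero] at e1
  rw [hx.last] at e2
  rw [e1, e2] at this
  exact this

/-- The number of cells that meet `(α, β)` is controlled by the increment of `Y`. -/
lemma AdmData.card_le {Y : ℝ → ℝ} (h : AdmData a b n x c U Y) (hab : a < b) (hn : 1 ≤ n)
    {α β : ℝ} (hα : a ≤ α) (hαβ : α ≤ β) (hβ : β ≤ b) {s : Finset ℕ}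
    (hs : ∀ i ∈ s, i < n ∧ x i < β ∧ α < x (i + 1)) :
    (s.card : ℝ) ≤ n * (Y β - Y α) / (b - a) + 2 := by
  have hn0 : (0 : ℝ) < n := by exact_mod_cast hn
  have hH : 0 < b - a := by linarith
  have hY : Y α ≤ Y β := h.nmono.mono hαβ
  rcases s.eq_empty_or_nonempty with rfl | hne
  · simp only [Finset.card_empty, Nat.cast_zero]
    have : 0 ≤ n * (Y β - Y α) / (b - a) := div_nonneg (mul_nonneg hn0.le (by linarith)) hH.le
    linarith
  have h1 := hs _ (s.min'_mem hne)
  have h2 := hs _ (s.max'_mem hne)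
  set m := s.min' hne
  set M := s.max' hne
  have hmM : m ≤ M := s.min'_le _ (s.max'_mem hne)
  have hcard : s.card ≤ M + 1 - m := by
    have : s ⊆ Finset.Icc m M := fun i hi => Finset.mem_Icc.2 ⟨s.min'_le _ hi, s.le_max' _ hi⟩
    calc s.card ≤ (Finset.Icc m M).card := Finset.card_le_card this
      _ = M + 1 - m := Nat.card_Icc _ _
  have hcard' : (s.card : ℝ) ≤ M + 1 - m := by
    have : (s.card : ℝ) ≤ ((M + 1 - m : ℕ) : ℝ) := by exact_mod_cast hcard
    rwa [Nat.cast_sub (by omega), Nat.cast_add, Nat.cast_one] at this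
  have e1 := h.lower M h2.1.le β hβ h2.2.1
  have e2 := h.upper (m + 1) h1.1 α hα h1.2.2
  simp only [node, Nat.cast_add, Nat.cast_one] at e1 e2
  have e3 : ((M : ℝ) - m - 1) * (b - a) / n ≤ Y β - Y α := by
    have : ((M : ℝ) - m - 1) * (b - a) / n = (a + M * (b - a) / n) - (a + (m + 1) * (b - a) / n) := by
      ring
    linarith
  rw [div_le_iff₀ hn0] at e3
  have e4 : (M : ℝ) - m - 1 ≤ n * (Y β - Y α) / (b - a) := by
    rw [le_div_iff₀ hH]; linarith
  linarith

lemma IsNodes.sum_integral {F : Type*} [NormedAddCommGroup F] [NormedSpace ℝ F] {f : ℝ → F}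
    {x : ℕ → ℝ} (hx : IsNodes a b n x) (hf : IntegrableOn f (Icc a b)) :
    ∑ i ∈ Finset.range n, ∫ t in x i..x (i + 1), f t = ∫ t in a..b, f t := by
  rw [intervalIntegral.sum_integral_adjacent_intervals, hx.zero, hx.last]
  exact fun k hk => intervalIntegrable_of_Icc hf (hx.mem_Icc' hk.le) (hx.mem_Icc' hk)

end Mesh

/-! ### Second order expansion of the action -/

section Lagrangian

variable {E : Type*} [NormedAddCommGroup E] [InnerProductSpace ℝ E] [CompleteSpace E]

/-- The derivative of `ℒ` in `(z,p)`. -/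
noncomputable def grad (L : ℝ → E → E → ℝ) (x : ℝ) (s : E × E) : E × E →L[ℝ] ℝ :=
  fderiv ℝ (fun s : E × E => L x s.1 s.2) s

/-- The Hessian of `ℒ` in `(z,p)`, as a bilinear form. -/
noncomputable def hess (L : ℝ → E → E → ℝ) (x : ℝ) (s : E × E) : E × E →L[ℝ] E × E →L[ℝ] ℝ :=
  fderiv ℝ (fderiv ℝ (fun s : E × E => L x s.1 s.2)) s

/-- The pair `(us, us')`. -/
noncomputable def jet (a b : ℝ) (us : ℝ → E) (x : ℝ) : E × E := (us x, derivWithin us (Icc a b) x)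

/-- The remainder of order two in the Taylor expansion of `ℒ(x, ·)` at `(us(x), us'(x))`. -/
noncomputable def rem (L : ℝ → E → E → ℝ) (a b : ℝ) (us : ℝ → E) (x : ℝ) (h : E × E) : ℝ :=
  ∫ τ in (0 : ℝ)..1, (1 - τ) * hess L x (jet a b us x + τ • h) h h

variable {a b : ℝ} {L : ℝ → E → E → ℝ} {us : ℝ → E}

lemma hessQ_eq (L : ℝ → E → E → ℝ) (x : ℝ) (z p : E) (ζ : E × E) :
    hessQ L x z p ζ = hess L x (z, p) ζ ζ := rfl

lemma bounded_integrable {F : Type*} [NormedAddCommGroup F] {f : ℝ → F}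
    (hf : AEStronglyMeasurable f (volume.restrict (Icc a b))) {M : ℝ}
    (hM : ∀ᵐ x ∂volume.restrict (Icc a b), ‖f x‖ ≤ M) : IntegrableOn f (Icc a b) :=
  (MemLp.of_bound (p := 1) hf M hM).integrable le_rfl

section Partial

variable {V W : Type*} [NormedAddCommGroup V] [NormedSpace ℝ V] [NormedAddCommGroup W]
  [NormedSpace ℝ W]

lemma hasFDerivAt_partial {G : ℝ × V → W}
    (hG : DifferentiableOn ℝ G (Icc a b ×ˢ univ)) {t : ℝ × V} (ht : t.1 ∈ Icc a b) :
    HasFDerivAt (fun s => G (t.1, s))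
      ((fderivWithin ℝ G (Icc a b ×ˢ univ) t).comp (ContinuousLinearMap.inr ℝ ℝ V)) t.2 := by
  have h1 : HasFDerivWithinAt G (fderivWithin ℝ G (Icc a b ×ˢ univ) t) (Icc a b ×ˢ univ)
      (t.1, t.2) := (hG t ⟨ht, mem_univ _⟩).hasFDerivWithinAt
  have h2 := (hasFDerivAt_prodMk_right (𝕜 := ℝ) t.1 t.2).hasFDerivWithinAt (s := univ)
  have h3 := h1.comp t.2 h2 (fun s _ => ⟨ht, mem_univ _⟩)
  rwa [hasFDerivWithinAt_univ] at h3

/-- The derivative in the second variable alone is that of the map on the product, restricted to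
`{0} × V`, hence loses one order of smoothness. -/
lemma contDiffOn_partial (hab : a < b) {m n : WithTop ℕ∞} (hmn : m + 1 ≤ n) {G : ℝ × V → W}
    (hG : ContDiffOn ℝ n G (Icc a b ×ˢ univ)) :
    ContDiffOn ℝ m (fun t : ℝ × V => fderiv ℝ (fun s => G (t.1, s)) t.2) (Icc a b ×ˢ univ) := by
  have hu : UniqueDiffOn ℝ (Icc a b ×ˢ (univ : Set V)) :=
    (uniqueDiffOn_Icc hab).prod uniqueDiffOn_univ
  have h1 := hG.fderivWithin hu hmn
  have hn : n ≠ 0 := by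
    rintro rfl
    simp at hmn
  have h2 : ContDiffOn ℝ m (fun t : ℝ × V =>
      (fderivWithin ℝ G (Icc a b ×ˢ univ) t).comp (ContinuousLinearMap.inr ℝ ℝ V))
      (Icc a b ×ˢ univ) := h1.clm_comp contDiffOn_const
  refine h2.congr fun t ht => ?_
  exact (hasFDerivAt_partial (hG.differentiableOn hn) ht.1).fderiv

/-- A function continuous on `[a,b] × V`, evaluated along a bounded measurable map, is
integrable. -/
lemma integrableOn_comp [FiniteDimensional ℝ V] (hab : a ≤ b) {G : ℝ × V → W}
    (hG : ContinuousOn G (Icc a b ×ˢ univ))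
    {ξ : ℝ → V} (hξ : AEStronglyMeasurable ξ (volume.restrict (Icc a b))) {M : ℝ}
    (hM : ∀ x ∈ Icc a b, ‖ξ x‖ ≤ M) : IntegrableOn (fun x => G (x, ξ x)) (Icc a b) := by
  have hc : Continuous (fun t : ℝ × V => G ((projIcc a b hab t.1 : ℝ), t.2)) :=
    hG.comp_continuous (by fun_prop) (fun t => ⟨(projIcc a b hab t.1).2, mem_univ _⟩)
  have hm : AEStronglyMeasurable (fun x => G (x, ξ x)) (volume.restrict (Icc a b)) := by
    have := hc.comp_aestronglyMeasurable
      ((aestronglyMeasurable_id (μ := volume.restrict (Icc a b))).prodMk hξ)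
    refine this.congr ?_
    rw [EventuallyEq, ae_restrict_iff' measurableSet_Icc]
    refine ae_of_all _ fun x hx => ?_
    simp [projIcc_of_mem hab hx]
  have hK : IsCompact (Icc a b ×ˢ Metric.closedBall (0 : V) M) :=
    isCompact_Icc.prod (isCompact_closedBall _ _)
  obtain ⟨C, hC⟩ := hK.exists_bound_of_continuousOn
    (hG.mono (prod_mono le_rfl (subset_univ _)))
  exact bounded_integrable hm
    ((ae_restrict_iff' measurableSet_Icc).2
    (ae_of_all _ fun x hx => hC (x, ξ x) ⟨hx, by simpa using hM x hx⟩))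

end Partial

section Calculus

variable (hab : a < b)
  (hL : ContDiffOn ℝ 2 (fun t : ℝ × E × E => L t.1 t.2.1 t.2.2) (Icc a b ×ˢ univ))

include hab hL

lemma grad_contDiffOn :
    ContDiffOn ℝ 1 (fun t : ℝ × E × E => grad L t.1 t.2) (Icc a b ×ˢ univ) :=
  contDiffOn_partial hab (m := 1) (n := 2) (by norm_num) hL

lemma hess_continuousOn :
    ContinuousOn (fun t : ℝ × E × E => hess L t.1 t.2) (Icc a b ×ˢ univ) :=
  (contDiffOn_partial hab (m := 0) (n := 1) (by norm_num) (grad_contDiffOn hab hL)).continuousOn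

lemma contDiff_slice {x : ℝ} (hx : x ∈ Icc a b) :
    ContDiff ℝ 2 (fun s : E × E => L x s.1 s.2) := by
  rw [← contDiffOn_univ]
  exact hL.comp (g := fun t : ℝ × E × E => L t.1 t.2.1 t.2.2) (f := fun s : E × E => (x, s))
    (by fun_prop) (fun s _ => ⟨hx, mem_univ _⟩)

lemma hasFDerivAt_slice {x : ℝ} (hx : x ∈ Icc a b) (s : E × E) :
    HasFDerivAt (fun s : E × E => L x s.1 s.2) (grad L x s) s :=
  ((contDiff_slice hab hL hx).differentiable (by simp) s).hasFDerivAt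

lemma hasFDerivAt_grad {x : ℝ} (hx : x ∈ Icc a b) (s : E × E) :
    HasFDerivAt (grad L x) (hess L x s) s := by
  have : ContDiff ℝ 1 (grad L x) := (contDiff_slice hab hL hx).fderiv_right (by norm_num)
  exact (this.differentiable (by simp) s).hasFDerivAt

lemma hess_symm {x : ℝ} (hx : x ∈ Icc a b) (s ζ η : E × E) :
    hess L x s ζ η = hess L x s η ζ := by
  have := (contDiff_slice hab hL hx).contDiffAt (x := s) |>.isSymmSndFDerivAt (by simp)
  exact this.eq ζ η

lemma hess_slice_continuous {x : ℝ} (hx : x ∈ Icc a b) : Continuous (hess L x) :=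
  (hess_continuousOn hab hL).comp_continuous (f := fun s : E × E => (x, s)) (by fun_prop)
    (fun s => ⟨hx, mem_univ _⟩)

/-- Taylor's formula with integral remainder. -/
lemma taylor {x : ℝ} (hx : x ∈ Icc a b) (s h : E × E) :
    ∫ τ in (0 : ℝ)..1, (1 - τ) * hess L x (s + τ • h) h h =
      L x (s + h).1 (s + h).2 - L x s.1 s.2 - grad L x s h := by
  have h0 : ∀ τ : ℝ, HasDerivAt (fun τ : ℝ => s + τ • h) h τ := fun τ => by
    simpa using ((hasDerivAt_id τ).smul_const h).const_add s
  have h1 : ∀ τ : ℝ, HasDerivAt (fun τ : ℝ => L x (s + τ • h).1 (s + τ • h).2)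
      (grad L x (s + τ • h) h) τ := fun τ => by
    have := (hasFDerivAt_slice hab hL hx (s + τ • h)).comp_hasDerivAt τ (h0 τ)
    exact this
  have h2 : ∀ τ : ℝ, HasDerivAt (fun τ : ℝ => grad L x (s + τ • h) h)
      (hess L x (s + τ • h) h h) τ := fun τ => by
    have := (hasFDerivAt_grad hab hL hx (s + τ • h)).comp_hasDerivAt τ (h0 τ)
    simpa using this.clm_apply (hasDerivAt_const τ h)
  have h3 : ∀ τ : ℝ, HasDerivAt (fun τ : ℝ => (1 - τ) * grad L x (s + τ • h) h +
      L x (s + τ • h).1 (s + τ • h).2) ((1 - τ) * hess L x (s + τ • h) h h) τ := fun τ => by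
    have h4 : HasDerivAt (fun τ : ℝ => 1 - τ) (-1) τ := by
      simpa using (hasDerivAt_id τ).const_sub 1
    have := (h4.mul (h2 τ)).add (h1 τ)
    refine this.congr_deriv ?_
    ring
  have hc : Continuous (fun τ : ℝ => (1 - τ) * hess L x (s + τ • h) h h) := by
    have := hess_slice_continuous hab hL hx
    have h5 : Continuous (fun τ : ℝ => hess L x (s + τ • h)) := this.comp (by fun_prop)
    fun_prop
  rw [intervalIntegral.integral_eq_sub_of_hasDerivAt (fun τ _ => h3 τ) (hc.intervalIntegrable _ _)]
  simp
  ring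

variable (hus : ContDiffOn ℝ 1 us (Icc a b))

include hus

lemma jet_continuousOn : ContinuousOn (jet a b us) (Icc a b) :=
  hus.continuousOn.prodMk (hus.continuousOn_derivWithin (uniqueDiffOn_Icc hab) le_rfl)

/-- The remainder is the error of the affine approximation of `L` at the jet of `us`. -/
lemma rem_eq {x : ℝ} (hx : x ∈ Icc a b) (h : E × E) :
    rem L a b us x h = L x (us x + h.1) (derivWithin us (Icc a b) x + h.2) -
      L x (us x) (derivWithin us (Icc a b) x) - grad L x (jet a b us x) h :=
  taylor hab hL hx _ h

variable [FiniteDimensional ℝ E]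

/-- The Hessian at points near the graph of `(us, us')` is close to the Hessian on this graph. -/
lemma exists_modulus {ε : ℝ} (hε : 0 < ε) : ∃ δ, 0 < δ ∧ δ ≤ 1 ∧ ∀ x ∈ Icc a b, ∀ x' ∈ Icc a b,
    |x - x'| ≤ δ → ∀ h : E × E, ‖h‖ ≤ δ →
      ‖hess L x (jet a b us x + h) - hess L x' (jet a b us x')‖ ≤ ε := by
  have hj := jet_continuousOn hab hL hus
  obtain ⟨ρ, hρ⟩ := isCompact_Icc.exists_bound_of_continuousOn hj
  have hK : IsCompact (Icc a b ×ˢ Metric.closedBall (0 : E × E) (ρ + 1)) :=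
    isCompact_Icc.prod (isCompact_closedBall _ _)
  have huc := hK.uniformContinuousOn_of_continuous
    ((hess_continuousOn hab hL).mono (prod_mono le_rfl (subset_univ _)))
  obtain ⟨δ₁, h1, h1'⟩ := Metric.uniformContinuousOn_iff.1 huc ε hε
  obtain ⟨δ₂, h2, h2'⟩ := Metric.uniformContinuousOn_iff.1
    (isCompact_Icc.uniformContinuousOn_of_continuous hj) (δ₁ / 4) (by positivity)
  refine ⟨min 1 (min (δ₁ / 4) (δ₂ / 2)), by positivity, min_le_left _ _,
    fun x hx x' hx' hxx h hh => ?_⟩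
  have e1 : ‖h‖ ≤ 1 := hh.trans (min_le_left _ _)
  have e2 : ‖h‖ ≤ δ₁ / 4 := hh.trans ((min_le_right _ _).trans (min_le_left _ _))
  have e3 : |x - x'| ≤ δ₂ / 2 := hxx.trans ((min_le_right _ _).trans (min_le_right _ _))
  have e4 : |x - x'| ≤ δ₁ / 4 := hxx.trans ((min_le_right _ _).trans (min_le_left _ _))
  have e5 := h2' x hx x' hx' (by rw [Real.dist_eq]; linarith)
  have := h1' (x, jet a b us x + h) ⟨hx, ?_⟩ (x', jet a b us x') ⟨hx', ?_⟩ ?_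
  · rw [dist_eq_norm] at this; exact this.le
  · rw [mem_closedBall_zero_iff]
    exact (norm_add_le _ _).trans (add_le_add (hρ x hx) e1)
  · rw [mem_closedBall_zero_iff]
    linarith [hρ x' hx']
  · rw [Prod.dist_eq, max_lt_iff]
    refine ⟨by simp only [Real.dist_eq]; linarith, ?_⟩
    simp only
    calc dist (jet a b us x + h) (jet a b us x') ≤ dist (jet a b us x + h) (jet a b us x) +
          dist (jet a b us x) (jet a b us x') := dist_triangle _ _ _
      _ < δ₁ := by rw [dist_eq_norm (jet a b us x + h), add_sub_cancel_left]; linarith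

lemma exists_hess_bound : ∃ Λ, 0 ≤ Λ ∧ ∀ x ∈ Icc a b, ‖hess L x (jet a b us x)‖ ≤ Λ := by
  have hc : ContinuousOn (fun x => hess L x (jet a b us x)) (Icc a b) :=
    (hess_continuousOn hab hL).comp (f := fun x => (x, jet a b us x))
      (continuousOn_id.prodMk (jet_continuousOn hab hL hus)) (fun x hx => ⟨hx, mem_univ _⟩)
  obtain ⟨Λ, hΛ⟩ := isCompact_Icc.exists_bound_of_continuousOn hc
  exact ⟨Λ, (norm_nonneg _).trans (hΛ a (left_mem_Icc.2 hab.le)), hΛ⟩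

/-- The remainder is uniformly close to half of the Hessian at small increments. -/
lemma rem_approx {ε : ℝ} (hε : 0 < ε) : ∃ δ, 0 < δ ∧ δ ≤ 1 ∧ ∀ x ∈ Icc a b, ∀ h : E × E, ‖h‖ ≤ δ →
      |rem L a b us x h - 1 / 2 * hess L x (jet a b us x) h h| ≤ ε * ‖h‖ ^ 2 := by
  obtain ⟨δ, h0, h1, hδ⟩ := exists_modulus hab hL hus hε
  refine ⟨δ, h0, h1, fun x hx h hh => ?_⟩
  have e0 : (∫ τ in (0 : ℝ)..1, (1 - τ)) = 1 / 2 := by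
    rw [intervalIntegral.integral_sub (by simp) (by simp)]; simp; norm_num
  have hc : Continuous (fun τ : ℝ => (1 - τ) * hess L x (jet a b us x + τ • h) h h) := by
    have := hess_slice_continuous hab hL hx
    have h5 : Continuous (fun τ : ℝ => hess L x (jet a b us x + τ • h)) := this.comp (by fun_prop)
    fun_prop
  have e1 : 1 / 2 * hess L x (jet a b us x) h h =
      ∫ τ in (0 : ℝ)..1, (1 - τ) * hess L x (jet a b us x) h h := by
    rw [intervalIntegral.integral_mul_const, e0]
  rw [rem, e1, ← intervalIntegral.integral_sub (hc.intervalIntegrable _ _)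
    (Continuous.intervalIntegrable (by fun_prop) _ _)]
  have := intervalIntegral.norm_integral_le_of_norm_le_const (a := (0 : ℝ)) (b := 1)
    (C := ε * ‖h‖ ^ 2) (f := fun τ => (1 - τ) * hess L x (jet a b us x + τ • h) h h -
      (1 - τ) * hess L x (jet a b us x) h h) ?_
  · simpa using this
  · intro τ hτ
    rw [uIoc_of_le zero_le_one] at hτ
    have e2 : ‖τ • h‖ ≤ δ := by
      rw [norm_smul, Real.norm_eq_abs, abs_of_pos hτ.1]
      nlinarith [norm_nonneg h, hτ.2]
    have e3 := hδ x hx x hx (by simp [h0.le]) _ e2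
    have e4 : (1 - τ) * hess L x (jet a b us x + τ • h) h h -
      (1 - τ) * hess L x (jet a b us x) h h =
      (1 - τ) * (hess L x (jet a b us x + τ • h) - hess L x (jet a b us x)) h h := by
      simp [mul_sub]
    rw [e4, norm_mul, Real.norm_eq_abs, abs_of_nonneg (by linarith [hτ.2])]
    have e5 := (hess L x (jet a b us x + τ • h) - hess L x (jet a b us x)).le_opNorm₂ h h
    calc (1 - τ) * ‖(hess L x (jet a b us x + τ • h) - hess L x (jet a b us x)) h h‖
        ≤ 1 * (ε * ‖h‖ ^ 2) := by
          refine mul_le_mul (by linarith [hτ.1]) (e5.trans ?_) (norm_nonneg _) zero_le_one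
          rw [mul_assoc, ← sq]
          exact mul_le_mul_of_nonneg_right e3 (sq_nonneg _)
      _ = _ := one_mul _

lemma rem_integrableOn {ξ : ℝ → E × E} (hξ : AEStronglyMeasurable ξ (volume.restrict (Icc a b)))
    {M : ℝ} (hM : ∀ x ∈ Icc a b, ‖ξ x‖ ≤ M) :
    IntegrableOn (fun x => rem L a b us x (ξ x)) (Icc a b) ∧
    IntegrableOn (fun x => L x (us x + (ξ x).1) (derivWithin us (Icc a b) x + (ξ x).2)) (Icc a b) ∧
    IntegrableOn (fun x => L x (us x) (derivWithin us (Icc a b) x)) (Icc a b) ∧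
    IntegrableOn (fun x => grad L x (jet a b us x) (ξ x)) (Icc a b) := by
  have hj := jet_continuousOn hab hL hus
  obtain ⟨ρ, hρ⟩ := isCompact_Icc.exists_bound_of_continuousOn hj
  have hjm : AEStronglyMeasurable (jet a b us) (volume.restrict (Icc a b)) :=
    hj.aestronglyMeasurable measurableSet_Icc
  have i1 := integrableOn_comp hab.le hL.continuousOn (hjm.add hξ) (M := ρ + M)
    (fun x hx => (norm_add_le _ _).trans (add_le_add (hρ x hx) (hM x hx)))
  have i2 := integrableOn_comp hab.le hL.continuousOn hjm hρ
  have hg : ContinuousOn (fun t : ℝ × ((E × E) × (E × E)) => grad L t.1 t.2.1 t.2.2)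
      (Icc a b ×ˢ univ) := by
    have : ContinuousOn (fun t : ℝ × ((E × E) × (E × E)) => grad L t.1 t.2.1) (Icc a b ×ˢ univ) :=
      (grad_contDiffOn hab hL).continuousOn.comp (f := fun t : ℝ × ((E × E) × (E × E)) =>
        (t.1, t.2.1)) (by fun_prop) (fun t ht => ⟨ht.1, mem_univ _⟩)
    exact this.clm_apply (by fun_prop)
  have i3 := integrableOn_comp hab.le hg (hjm.prodMk hξ) (M := max ρ M)
    (fun x hx => by rw [Prod.norm_def]; exact max_le_max (hρ x hx) (hM x hx))
  refine ⟨?_, i1, i2, i3⟩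
  refine ((i1.sub i2).sub i3).congr_fun (fun x hx => ?_) measurableSet_Icc
  rw [rem_eq hab hL hus hx]; rfl

omit hL in
lemma us_eq_primitive {x : ℝ} (hx : x ∈ Icc a b) :
    us x = us a + ∫ t in a..x, derivWithin us (Icc a b) t := by
  have hd := hus.continuousOn_derivWithin (uniqueDiffOn_Icc hab) le_rfl
  have hsub : Icc a x ⊆ Icc a b := Icc_subset_Icc_right hx.2
  rw [intervalIntegral.integral_eq_sub_of_hasDerivAt_of_le hx.1 (hus.continuousOn.mono hsub)]
  · abel
  · intro t ht
    have htI : t ∈ Icc a b := hsub (Ioo_subset_Icc_self ht)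
    exact ((hus.differentiableOn (by simp)) t htI).hasDerivWithinAt.hasDerivAt
      (Icc_mem_nhds ht.1 (ht.2.trans_le hx.2))
  · exact (hd.mono hsub).intervalIntegrable_of_Icc hx.1

omit hL in
lemma memA_perturb {q : ℝ} (hq : 1 < q) {D : ℝ → E}
    (hD : AEStronglyMeasurable D (volume.restrict (Icc a b))) {M : ℝ}
    (hM : ∀ x ∈ Icc a b, ‖D x‖ ≤ M) (h0 : ∫ t in a..b, D t = 0) {u : ℝ → E}
    (hu : u =ᵐ[volume.restrict (Icc a b)] fun x => us x + ∫ t in a..x, D t) :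
    MemA a b q (us a) (us b) u ∧
      weakDeriv a b u =ᵐ[volume.restrict (Icc a b)] fun x => derivWithin us (Icc a b) x + D x := by
  have hd := hus.continuousOn_derivWithin (uniqueDiffOn_Icc hab) le_rfl
  have hdi : IntegrableOn (derivWithin us (Icc a b)) (Icc a b) := hd.integrableOn_Icc
  have hDp : ∀ p, MemLp D p (volume.restrict (Icc a b)) := fun p => MemLp.of_bound hD M
    ((ae_restrict_iff' measurableSet_Icc).2 (ae_of_all _ hM))
  have hDi : IntegrableOn D (Icc a b) := (hDp 1).integrable le_rfl
  have hprim : ∀ x ∈ Icc a b, us x + ∫ t in a..x, D t =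
      us a + ∫ t in a..x, (derivWithin us (Icc a b) t + D t) := by
    intro x hx
    rw [intervalIntegral.integral_add (intervalIntegrable_of_Icc hdi (left_mem_Icc.2 hab.le) hx)
      (intervalIntegrable_of_Icc hDi (left_mem_Icc.2 hab.le) hx), ← add_assoc,
      ← us_eq_primitive hab hus hx]
  have hu' : u =ᵐ[volume.restrict (Icc a b)]
      fun x => us a + ∫ t in a..x, (derivWithin us (Icc a b) t + D t) := by
    refine hu.trans ?_
    rw [EventuallyEq, ae_restrict_iff' measurableSet_Icc]
    exact ae_of_all _ hprim
  have hbv := hasBoundaryValues_primitive hab.le (hdi.add hDi) hu'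
  refine ⟨⟨memW1_primitive hab.le (by rw [ENNReal.one_le_ofReal]; exact hq.le)
    ((memLp_of_continuousOn _ hd).add (hDp _)) hu', ?_⟩,
    ((hasWeakDeriv_primitive hab.le (us a) (hdi.add hDi)).congr_ae hu'.symm
      (ae_eq_refl _)).weakDeriv_ae_eq⟩
  have e := hprim b (right_mem_Icc.2 hab.le)
  rw [h0, add_zero] at e
  rw [e]
  exact hbv

/-- First order expansion of the action with its remainder. The perturbation is given through its
derivative `D`, which is bounded and of mean zero. -/
lemma action_perturb {D : ℝ → E}
    (hD : AEStronglyMeasurable D (volume.restrict (Icc a b))) {M : ℝ}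
    (hM : ∀ x ∈ Icc a b, ‖D x‖ ≤ M) (h0 : ∫ t in a..b, D t = 0) {u : ℝ → E}
    (hu : u =ᵐ[volume.restrict (Icc a b)] fun x => us x + ∫ t in a..x, D t) :
    action L a b u - action L a b us =
      (∫ x in Icc a b, grad L x (jet a b us x) (∫ t in a..x, D t, D x)) +
      ∫ x in Icc a b, rem L a b us x (∫ t in a..x, D t, D x) := by
  have hDi : IntegrableOn D (Icc a b) := bounded_integrable hD
    ((ae_restrict_iff' measurableSet_Icc).2 (ae_of_all _ hM))
  have hwd := (memA_perturb hab hus (q := 2) (by norm_num) hD hM h0 hu).2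
  have hwd0 : weakDeriv a b us =ᵐ[volume.restrict (Icc a b)] derivWithin us (Icc a b) := by
    have := (memA_perturb (M := 0) hab hus (q := 2) (by norm_num)
      (aestronglyMeasurable_const (b := (0 : E))) (by simp) (by simp) (u := us) (by simp)).2
    simpa using this
  have hc := continuousOn_primitive_Icc hab.le hDi
  obtain ⟨ρ, hρ⟩ := isCompact_Icc.exists_bound_of_continuousOn hc
  obtain ⟨i1, i2, i3, i4⟩ := rem_integrableOn hab hL hus
    (ξ := fun x => (∫ t in a..x, D t, D x)) ((hc.aestronglyMeasurable measurableSet_Icc).prodMk hD)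
    (M := max ρ M)
    (fun x hx => by rw [Prod.norm_def]; exact max_le_max (hρ x hx) (hM x hx))
  have e1 : action L a b u = ∫ x in Icc a b, L x (us x + ∫ t in a..x, D t)
      (derivWithin us (Icc a b) x + D x) := by
    refine integral_congr_ae ?_
    filter_upwards [hwd, hu] with x h1 h2
    rw [h1, h2]
  have e2 : action L a b us = ∫ x in Icc a b, L x (us x) (derivWithin us (Icc a b) x) := by
    refine integral_congr_ae ?_
    filter_upwards [hwd0] with x h1
    rw [h1]
  rw [e1, e2, ← integral_sub i2 i3, ← integral_add i4 i1]
  refine setIntegral_congr_fun measurableSet_Icc fun x hx => ?_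
  simp only
  rw [rem_eq hab hL hus hx]
  ring

/-- The Euler-Lagrange equation in weak form. -/
lemma euler_lagrange {q : ℝ} (hq : 1 < q) {ua ub : E} (hmin : IsMinimizer L a b q ua ub us)
    {D : ℝ → E} (hD : AEStronglyMeasurable D (volume.restrict (Icc a b))) {M : ℝ}
    (hM : ∀ x ∈ Icc a b, ‖D x‖ ≤ M) (h0 : ∫ t in a..b, D t = 0) :
    ∫ x in Icc a b, grad L x (jet a b us x) (∫ t in a..x, D t, D x) = 0 := by
  set ξ : ℝ → E × E := fun x => (∫ t in a..x, D t, D x) with hξdef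
  set I := ∫ x in Icc a b, grad L x (jet a b us x) (ξ x) with hI
  have hDi : IntegrableOn D (Icc a b) := bounded_integrable hD
    ((ae_restrict_iff' measurableSet_Icc).2 (ae_of_all _ hM))
  have hc := continuousOn_primitive_Icc hab.le hDi
  have hξm : AEStronglyMeasurable ξ (volume.restrict (Icc a b)) :=
    (hc.aestronglyMeasurable measurableSet_Icc).prodMk hD
  obtain ⟨ρ, hρ⟩ := isCompact_Icc.exists_bound_of_continuousOn hc
  set R := max 1 (max ρ M) with hR
  have hR1 : 1 ≤ R := le_max_left _ _
  have hξ : ∀ x ∈ Icc a b, ‖ξ x‖ ≤ R := fun x hx => by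
    rw [Prod.norm_def]; exact le_trans (max_le_max (hρ x hx) (hM x hx)) (le_max_right _ _)
  obtain ⟨Λ, hΛ0, hΛ⟩ := exists_hess_bound hab hL hus
  obtain ⟨δ, hδ0, hδ1, hδ⟩ := rem_approx hab hL hus (ε := 1) one_pos
  set C := (Λ + 1) * R ^ 2 * (b - a) with hC
  have hH : 0 < b - a := by linarith
  have hC0 : 0 ≤ C := by positivity
  -- the action along the variation is nonnegative and equals `t * I` up to a quadratic error
  have key : ∀ t : ℝ, |t| * R ≤ δ → 0 ≤ t * I + C * t ^ 2 := by
    intro t ht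
    have hb : us a = ua ∧ us b = ub := by
      obtain ⟨z, hz, hzu, hz0, hz1⟩ := hmin.1.2
      have := eqOn_of_ae_eq hab hus.continuousOn hz hzu
      exact ⟨(this (left_mem_Icc.2 hab.le)).trans hz0, (this (right_mem_Icc.2 hab.le)).trans hz1⟩
    have hMt : ∀ x ∈ Icc a b, ‖t • D x‖ ≤ |t| * M := fun x hx => by
      rw [norm_smul, Real.norm_eq_abs]; exact mul_le_mul_of_nonneg_left (hM x hx) (abs_nonneg _)
    have h0t : ∫ x in a..b, t • D x = 0 := by rw [intervalIntegral.integral_smul, h0, smul_zero]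
    have hA := (memA_perturb hab hus hq (hD.const_smul t) hMt h0t (ae_eq_refl _)).1
    rw [hb.1, hb.2] at hA
    have e1 := hmin.2 _ hA
    have e2 := action_perturb hab hL hus (hD.const_smul t) hMt h0t (ae_eq_refl _)
    have e3 : ∀ x, ((∫ s in a..x, (t • D) s, (t • D) x) : E × E) = t • ξ x := fun x => by
      simp [hξdef, intervalIntegral.integral_smul]
    simp_rw [e3] at e2
    have e4 : ∫ x in Icc a b, grad L x (jet a b us x) (t • ξ x) = t * I := by
      simp_rw [map_smul, smul_eq_mul]
      rw [integral_const_mul]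
    have e5 : ∫ x in Icc a b, rem L a b us x (t • ξ x) ≤ C * t ^ 2 := by
      have hn : ∀ x ∈ Icc a b, ‖t • ξ x‖ ≤ |t| * R := fun x hx => by
        rw [norm_smul, Real.norm_eq_abs]; exact mul_le_mul_of_nonneg_left (hξ x hx) (abs_nonneg _)
      have i1 := (rem_integrableOn hab hL hus (hξm.const_smul t) hn).1
      calc ∫ x in Icc a b, rem L a b us x (t • ξ x)
          ≤ ∫ x in Icc a b, (Λ + 1) * R ^ 2 * t ^ 2 := by
            refine setIntegral_mono_on i1 (integrableOn_const (by simp)) measurableSet_Icc fun x hx => ?_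
            have f1 := hδ x hx (t • ξ x) ((hn x hx).trans ht)
            have f2 := (hess L x (jet a b us x)).le_opNorm₂ (t • ξ x) (t • ξ x)
            have f3 : ‖t • ξ x‖ ^ 2 ≤ R ^ 2 * t ^ 2 := by
              rw [← mul_pow, ← sq_abs (R * t), abs_mul, abs_of_pos (by linarith : 0 < R), mul_comm R]
              exact pow_le_pow_left₀ (norm_nonneg _) (hn x hx) 2
            have f4 : hess L x (jet a b us x) (t • ξ x) (t • ξ x) ≤ Λ * ‖t • ξ x‖ ^ 2 := by
              refine (le_abs_self _).trans (f2.trans ?_)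
              rw [mul_assoc, ← sq]
              exact mul_le_mul_of_nonneg_right (hΛ x hx) (sq_nonneg _)
            have f5 := (abs_le.1 f1).2
            have f6 : 0 ≤ Λ * ‖t • ξ x‖ ^ 2 := by positivity
            calc _ ≤ (Λ + 1) * ‖t • ξ x‖ ^ 2 := by nlinarith
              _ ≤ (Λ + 1) * (R ^ 2 * t ^ 2) := mul_le_mul_of_nonneg_left f3 (by linarith)
              _ = _ := by ring
        _ = C * t ^ 2 := by
            rw [setIntegral_const, measureReal_def, Real.volume_Icc,
              ENNReal.toReal_ofReal hH.le, hC, smul_eq_mul]; ring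
    rw [e4] at e2
    have e6 : 0 ≤ action L a b (fun x => us x + ∫ s in a..x, t • D s) - action L a b us :=
      sub_nonneg.2 e1
    have e7 : action L a b (fun x => us x + ∫ s in a..x, t • D s) - action L a b us =
      t * I + ∫ x in Icc a b, rem L a b us x (t • ξ x) := e2
    linarith
  have hRp : 0 < R := by linarith
  by_contra hne
  set s := min (δ / R) (|I| / (2 * (C + 1))) with hs
  have hs0 : 0 < s := lt_min (by positivity) (by have := abs_pos.2 hne; positivity)
  have hsR : s * R ≤ δ := by
    have := min_le_left (δ / R) (|I| / (2 * (C + 1)))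
    rwa [← hs, le_div_iff₀ hRp] at this
  have hsI : s * (2 * (C + 1)) ≤ |I| := by
    have := min_le_right (δ / R) (|I| / (2 * (C + 1)))
    rwa [← hs, le_div_iff₀ (by positivity)] at this
  have k1 := key s (by rwa [abs_of_pos hs0])
  have k2 := key (-s) (by rwa [abs_neg, abs_of_pos hs0])
  rcases abs_cases I with ⟨h, _⟩ | ⟨h, _⟩
  · nlinarith
  · nlinarith

/-- The renormalized energy as the integral of the Taylor remainder. -/
lemma action_sub_eq {q : ℝ} (hq : 1 < q) {ua ub : E} (hmin : IsMinimizer L a b q ua ub us)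
    {D : ℝ → E} (hD : AEStronglyMeasurable D (volume.restrict (Icc a b))) {M : ℝ}
    (hM : ∀ x ∈ Icc a b, ‖D x‖ ≤ M) (h0 : ∫ t in a..b, D t = 0) {u : ℝ → E}
    (hu : u =ᵐ[volume.restrict (Icc a b)] fun x => us x + ∫ t in a..x, D t) :
    action L a b u - action L a b us = ∫ x in Icc a b, rem L a b us x (∫ t in a..x, D t, D x) := by
  rw [action_perturb hab hL hus hD hM h0 hu, euler_lagrange hab hL hus hq hmin hD hM h0, zero_add]

end Calculus

end Lagrangian

/-! ### Regularity of the minimizer -/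

section Regularity

variable {E : Type*} [NormedAddCommGroup E] [InnerProductSpace ℝ E] [CompleteSpace E]

/-- The lemma of du Bois-Reymond: an Euler-Lagrange equation tested with primitives of mean free
functions holds in integrated form. -/
lemma eq_primitive_of_integral_test {a b : ℝ} (hab : a < b) {α ζ : ℝ → ℝ} (hα : Continuous α)
    (hζ : Continuous ζ)
    (h : ∀ f : ℝ → ℝ, Continuous f → ∫ x in a..b, f x = 0 →
      ∫ x in a..b, ((∫ t in a..x, f t) * ζ x + f x * α x) = 0) {x : ℝ} (hx : x ∈ Icc a b) :
    α x = α a + ∫ t in a..x, ζ t := by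
  have hZd : ∀ x, HasDerivAt (fun x => ∫ t in a..x, ζ t) (ζ x) x := fun x =>
    intervalIntegral.integral_hasDerivAt_right (hζ.intervalIntegrable _ _)
      hζ.aestronglyMeasurable.stronglyMeasurableAtFilter hζ.continuousAt
  set Z : ℝ → ℝ := fun x => ∫ t in a..x, ζ t with hZ
  have hZc : Continuous Z := continuous_iff_continuousAt.2 fun x => (hZd x).continuousAt
  have hH : 0 < b - a := by linarith
  set m := (∫ x in a..b, (α x - Z x)) / (b - a) with hm
  set f : ℝ → ℝ := fun x => α x - Z x - m with hf
  have hfc : Continuous f := (hα.sub hZc).sub continuous_const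
  have hf0 : ∫ x in a..b, f x = 0 := by
    have c0 : Continuous fun x => α x - Z x := hα.sub hZc
    simp only [hf]
    rw [intervalIntegral.integral_sub (c0.intervalIntegrable _ _)
      (continuous_const.intervalIntegrable _ _)]
    simp only [intervalIntegral.integral_const, smul_eq_mul, hm]
    field_simp
    ring
  have hFd : ∀ x, HasDerivAt (fun x => ∫ t in a..x, f t) (f x) x := fun x =>
    intervalIntegral.integral_hasDerivAt_right (hfc.intervalIntegrable _ _)
      hfc.aestronglyMeasurable.stronglyMeasurableAtFilter hfc.continuousAt
  set F : ℝ → ℝ := fun x => ∫ t in a..x, f t with hF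
  have hFc : Continuous F := continuous_iff_continuousAt.2 fun x => (hFd x).continuousAt
  have h1 := h f hfc hf0
  have h2 : ∫ x in a..b, (f x * Z x + F x * ζ x) = 0 := by
    rw [intervalIntegral.integral_deriv_mul_eq_sub (fun x _ => hFd x) (fun x _ => hZd x)
      (hfc.intervalIntegrable _ _) (hζ.intervalIntegrable _ _)]
    have e1 : F b = 0 := hf0
    have e2 : F a = 0 := intervalIntegral.integral_same
    rw [e1, e2, zero_mul, zero_mul, sub_zero]
  have h3 : ∫ x in a..b, f x ^ 2 = 0 := by
    have e : ∀ x, f x ^ 2 = (F x * ζ x + f x * α x) - (f x * Z x + F x * ζ x) - m * f x :=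
      fun x => by simp only [hf]; ring
    simp_rw [e]
    have c1 : Continuous fun x => F x * ζ x + f x * α x := by fun_prop
    have c2 : Continuous fun x => f x * Z x + F x * ζ x := by fun_prop
    have c3 : Continuous fun x => F x * ζ x + f x * α x - (f x * Z x + F x * ζ x) := c1.sub c2
    have c4 : Continuous fun x => m * f x := continuous_const.mul hfc
    rw [intervalIntegral.integral_sub (c3.intervalIntegrable _ _) (c4.intervalIntegrable _ _),
      intervalIntegral.integral_sub (c1.intervalIntegrable _ _) (c2.intervalIntegrable _ _),
      intervalIntegral.integral_const_mul, hf0, h2]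
    rw [h1]; simp
  have h4 : f =ᵐ[volume.restrict (Icc a b)] 0 := by
    rw [← integral_Icc_eq_interval hab.le,
      integral_eq_zero_iff_of_nonneg (fun x => sq_nonneg _) (by
        exact (hfc.pow 2).continuousOn.integrableOn_Icc)] at h3
    filter_upwards [h3] with x hx
    simpa using hx
  have h5 := eqOn_of_ae_eq hab hfc.continuousOn continuousOn_const h4
  have e1 := h5 hx
  have e2 := h5 (left_mem_Icc.2 hab.le)
  simp only [hf, hZ, intervalIntegral.integral_same] at e1 e2
  linarith

variable [FiniteDimensional ℝ E] {a b : ℝ} {L : ℝ → E → E → ℝ} {us : ℝ → E}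
  (hab : a < b)
  (hL : ContDiffOn ℝ 2 (fun t : ℝ × E × E => L t.1 t.2.1 t.2.2) (Icc a b ×ˢ univ))
  (hus : ContDiffOn ℝ 1 us (Icc a b))

include hab hL hus

lemma grad_jet_continuousOn : ContinuousOn (fun x => grad L x (jet a b us x)) (Icc a b) :=
  (grad_contDiffOn hab hL).continuousOn.comp (f := fun x => (x, jet a b us x))
    (continuousOn_id.prodMk (jet_continuousOn hab hL hus)) (fun _ hx => ⟨hx, mem_univ _⟩)

lemma hess_jet_continuousOn : ContinuousOn (fun x => hess L x (jet a b us x)) (Icc a b) :=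
  (hess_continuousOn hab hL).comp (f := fun x => (x, jet a b us x))
    (continuousOn_id.prodMk (jet_continuousOn hab hL hus)) (fun _ hx => ⟨hx, mem_univ _⟩)

/-- The Euler-Lagrange equation in differentiated form. -/
lemma grad_hasDerivWithinAt {q : ℝ} (hq : 1 < q) {ua ub : E} (hmin : IsMinimizer L a b q ua ub us)
    {x : ℝ} (hx : x ∈ Icc a b) :
    HasDerivWithinAt (fun x => (grad L x (jet a b us x)).comp (ContinuousLinearMap.inr ℝ E E))
      ((grad L x (jet a b us x)).comp (ContinuousLinearMap.inl ℝ E E)) (Icc a b) x := by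
  have hg := grad_jet_continuousOn hab hL hus
  have c1 : Continuous fun x => grad L (projIcc a b hab.le x) (jet a b us (projIcc a b hab.le x)) :=
    hg.comp_continuous (f := fun x => (projIcc a b hab.le x : ℝ)) (by fun_prop)
      (fun x => (projIcc a b hab.le x).2)
  set γ := fun x => grad L (projIcc a b hab.le x) (jet a b us (projIcc a b hab.le x)) with hγ
  have hγe : ∀ x ∈ Icc a b, γ x = grad L x (jet a b us x) := fun x hx => by
    simp [hγ, projIcc_of_mem hab.le hx]
  have c2 : ∀ v, Continuous fun x => γ x v := fun v => c1.clm_apply continuous_const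
  have c3 : Continuous fun x => (γ x).comp (ContinuousLinearMap.inl ℝ E E) :=
    c1.clm_comp continuous_const
  have key : ∀ x ∈ Icc a b, ∀ e, γ x (0, e) = γ a (0, e) + ∫ t in a..x, γ t (e, 0) := by
    intro x hx e
    refine eq_primitive_of_integral_test hab (c2 (0, e)) (c2 (e, 0)) (fun f hf hf0 => ?_) hx
    obtain ⟨M, hM⟩ := isCompact_Icc.exists_bound_of_continuousOn
      (s := Icc a b) (f := fun x => f x • e) (by fun_prop)
    have := euler_lagrange hab hL hus hq hmin (D := fun x => f x • e)
      (Continuous.aestronglyMeasurable (by fun_prop)) hM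
      (by rw [intervalIntegral.integral_smul_const, hf0, zero_smul])
    rw [← integral_Icc_eq_interval hab.le, ← this]
    refine setIntegral_congr_fun measurableSet_Icc fun x hx => ?_
    rw [hγe x hx, intervalIntegral.integral_smul_const]
    have e1 : (((∫ t in a..x, f t) • e, f x • e) : E × E) =
      (∫ t in a..x, f t) • ((e, 0) : E × E) + f x • ((0, e) : E × E) := by simp
    rw [e1, map_add, map_smul, map_smul, smul_eq_mul, smul_eq_mul]
  have key2 : ∀ x ∈ Icc a b, (γ x).comp (ContinuousLinearMap.inr ℝ E E) =
      (γ a).comp (ContinuousLinearMap.inr ℝ E E) +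
        ∫ t in a..x, (γ t).comp (ContinuousLinearMap.inl ℝ E E) := by
    intro x hx
    ext e
    have := key x hx e
    rw [add_apply, ContinuousLinearMap.intervalIntegral_apply (c3.intervalIntegrable _ _)]
    simpa using this
  have hd : HasDerivAt (fun x => ∫ t in a..x, (γ t).comp (ContinuousLinearMap.inl ℝ E E))
      ((γ x).comp (ContinuousLinearMap.inl ℝ E E)) x :=
    intervalIntegral.integral_hasDerivAt_right (c3.intervalIntegrable _ _)
      c3.aestronglyMeasurable.stronglyMeasurableAtFilter c3.continuousAt
  have := (hd.const_add ((γ a).comp (ContinuousLinearMap.inr ℝ E E))).hasDerivWithinAt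
    (s := Icc a b)
  rw [hγe x hx] at this
  refine this.congr (fun t ht => ?_) ?_
  · rw [← key2 t ht, hγe t ht]
  · rw [← key2 x hx, hγe x hx]

/-- The `p`-block of the Hessian along `us`. -/
noncomputable def hessP (L : ℝ → E → E → ℝ) (a b : ℝ) (us : ℝ → E) (x : ℝ) : E →L[ℝ] E →L[ℝ] ℝ :=
  (hess L x (jet a b us x)).bilinearComp (ContinuousLinearMap.inr ℝ E E)
    (ContinuousLinearMap.inr ℝ E E)

omit hab hL hus in
lemma hessP_apply (x : ℝ) (v w : E) :
    hessP L a b us x v w = hess L x (jet a b us x) (0, v) (0, w) := rfl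

/-- The linear form `e ↦ ∂_z ℒ e - ∂_x ∂_p ℒ e - ∂_z ∂_p ℒ (us', e)` along `us`, which equals
`∂²_p ℒ (us'', e)`. -/
noncomputable def accelForm (L : ℝ → E → E → ℝ) (a b : ℝ) (us : ℝ → E) (x : ℝ) : E →L[ℝ] ℝ :=
  (grad L x (jet a b us x)).comp (ContinuousLinearMap.inl ℝ E E) -
    (fderivWithin ℝ (fun t : ℝ × E × E => grad L t.1 t.2) (Icc a b ×ˢ univ) (x, jet a b us x)
      (1, (derivWithin us (Icc a b) x, 0))).comp (ContinuousLinearMap.inr ℝ E E)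

omit hus in
lemma fderivWithin_grad_snd {t : ℝ × E × E} (ht : t.1 ∈ Icc a b) (h : E × E) :
    fderivWithin ℝ (fun t : ℝ × E × E => grad L t.1 t.2) (Icc a b ×ˢ univ) t (0, h) =
      hess L t.1 t.2 h := by
  have h1 := hasFDerivAt_partial (G := fun t : ℝ × E × E => grad L t.1 t.2)
    ((grad_contDiffOn hab hL).differentiableOn (by simp)) ht
  have h2 := h1.unique (hasFDerivAt_grad hab hL ht t.2)
  have := congrArg (fun T => T h) h2
  simpa using this

lemma hessP_continuousOn : ContinuousOn (hessP L a b us) (Icc a b) := by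
  have h := hess_jet_continuousOn hab hL hus
  have : ∀ x, hessP L a b us x = ((ContinuousLinearMap.compL ℝ E (E × E) ℝ).flip
    (ContinuousLinearMap.inr ℝ E E)).comp ((hess L x (jet a b us x)).comp
      (ContinuousLinearMap.inr ℝ E E)) := fun x => by ext v w; rfl
  simp_rw [funext this]
  exact continuousOn_const.clm_comp (h.clm_comp continuousOn_const)

lemma accelForm_continuousOn : ContinuousOn (accelForm L a b us) (Icc a b) := by
  have h1 := grad_jet_continuousOn hab hL hus
  have hu : UniqueDiffOn ℝ (Icc a b ×ˢ (univ : Set (E × E))) :=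
    (uniqueDiffOn_Icc hab).prod uniqueDiffOn_univ
  have hj := jet_continuousOn hab hL hus
  have h2 := ((grad_contDiffOn hab hL).continuousOn_fderivWithin hu le_rfl).comp
    (f := fun x => (x, jet a b us x)) (continuousOn_id.prodMk hj) (fun x hx => ⟨hx, mem_univ _⟩)
  have h3 : ContinuousOn (fun x => ((1 : ℝ), ((derivWithin us (Icc a b) x, (0 : E)) : E × E)))
    (Icc a b) := continuousOn_const.prodMk
      ((hus.continuousOn_derivWithin (uniqueDiffOn_Icc hab) le_rfl).prodMk continuousOn_const)
  exact (h1.clm_comp continuousOn_const).sub ((h2.clm_apply h3).clm_comp continuousOn_const)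

variable {θ : ℝ} (hθ : 0 < θ)
  (hpos : ∀ x ∈ Icc a b, ∀ w : E, 2 * θ * ‖w‖ ^ 2 ≤ hessP L a b us x w w)

include hθ hpos

omit hL hus [FiniteDimensional ℝ E] hab in
lemma hessP_norm_le {x : ℝ} (hx : x ∈ Icc a b) (w : E) :
    2 * θ * ‖w‖ ≤ ‖hessP L a b us x w‖ := by
  rcases eq_or_ne w 0 with rfl | hw
  · simp
  · have h1 := hpos x hx w
    have h2 := (hessP L a b us x w).le_opNorm w
    rw [Real.norm_eq_abs] at h2
    have h3 := (le_abs_self _).trans h2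
    have : 0 < ‖w‖ := norm_pos_iff.2 hw
    nlinarith

set_option maxHeartbeats 1000000 in
/-- The derivative `us'` is differentiable, although only `∂_p ℒ (x, us, us')` is known to be so: the
coercivity of `∂²_p ℒ` allows the chain rule to be solved for the difference quotient of `us'`. -/
lemma exists_accel {q : ℝ} (hq : 1 < q) {ua ub : E} (hmin : IsMinimizer L a b q ua ub us)
    {x : ℝ} (hx : x ∈ Icc a b) : ∃ d, hessP L a b us x d = accelForm L a b us x ∧
      HasDerivWithinAt (derivWithin us (Icc a b)) d (Icc a b) x := by
  have hco : IsCoercive (hessP L a b us x) :=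
    ⟨2 * θ, by positivity, fun w => by have := hpos x hx w; rwa [mul_assoc, ← sq]⟩
  obtain ⟨d, hd⟩ : ∃ d, hessP L a b us x d = accelForm L a b us x := by
    refine ⟨hco.continuousLinearEquivOfBilin.symm
      ((InnerProductSpace.toDual ℝ E).symm (accelForm L a b us x)), ?_⟩
    ext w
    rw [← hco.continuousLinearEquivOfBilin_apply]
    simp
  refine ⟨d, hd, ?_⟩
  set p := derivWithin us (Icc a b) with hp
  set Γ := fderivWithin ℝ (fun t : ℝ × E × E => grad L t.1 t.2) (Icc a b ×ˢ univ)
    (x, jet a b us x) with hΓ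
  have hG : HasFDerivWithinAt (fun t : ℝ × E × E => grad L t.1 t.2) Γ (Icc a b ×ˢ univ)
      (x, jet a b us x) :=
    ((grad_contDiffOn hab hL).differentiableOn (by simp) _ ⟨hx, mem_univ _⟩).hasFDerivWithinAt
  have hj := jet_continuousOn hab hL hus
  have hpc : ContinuousOn p (Icc a b) := hus.continuousOn_derivWithin (uniqueDiffOn_Icc hab) le_rfl
  have hud : HasDerivWithinAt us (p x) (Icc a b) x :=
    (hus.differentiableOn (by simp) x hx).hasDerivWithinAt
  have hA := grad_hasDerivWithinAt hab hL hus hq hmin hx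
  rw [hasDerivWithinAt_iff_isLittleO, Asymptotics.isLittleO_iff] at hud hA
  rw [hasFDerivWithinAt_iff_isLittleO, Asymptotics.isLittleO_iff] at hG
  rw [hasDerivWithinAt_iff_isLittleO, Asymptotics.isLittleO_iff]
  intro ε hε
  set K := ‖hess L x (jet a b us x)‖ with hK
  set M := 3 + K + ‖p x‖ + ‖d‖ with hM
  have hMpos : 0 < M := by positivity
  -- `c` absorbs the coercivity constant and the size of the coefficients
  set c := min (min 1 θ) (θ * ε / M) with hc
  have hc0 : 0 < c := by positivity
  have hc1 : c ≤ 1 := (min_le_left _ _).trans (min_le_left _ _)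
  have hcθ : c ≤ θ := (min_le_left _ _).trans (min_le_right _ _)
  have hcM : c * M ≤ θ * ε := by
    have := min_le_right (min 1 θ) (θ * ε / M)
    rwa [← hc, le_div_iff₀ hMpos] at this
  have htend : Tendsto (fun t => (t, jet a b us t)) (𝓝[Icc a b] x)
      (𝓝[Icc a b ×ˢ univ] (x, jet a b us x)) :=
    tendsto_nhdsWithin_iff.2 ⟨(continuousWithinAt_id.prodMk (hj x hx)).tendsto,
      eventually_nhdsWithin_of_forall fun t ht => ⟨ht, mem_univ _⟩⟩
  filter_upwards [hud hc0, hA hc0, htend.eventually (hG hc0), self_mem_nhdsWithin]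
    with t h2 h3 h1 ht
  set Δ := t - x with hΔ
  set δ := p t - p x with hδ
  set r2 := us t - us x - Δ • p x with hr2
  set r1 := grad L t (jet a b us t) - grad L x (jet a b us x) -
    Γ ((t, jet a b us t) - (x, jet a b us x)) with hr1
  set r3 := (grad L t (jet a b us t)).comp (ContinuousLinearMap.inr ℝ E E) -
    (grad L x (jet a b us x)).comp (ContinuousLinearMap.inr ℝ E E) -
    Δ • (grad L x (jet a b us x)).comp (ContinuousLinearMap.inl ℝ E E) with hr3
  have e1 : ((t, jet a b us t) - (x, jet a b us x) : ℝ × E × E) =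
      Δ • ((1, (p x, 0)) : ℝ × E × E) + ((0, (r2, δ)) : ℝ × E × E) := by
    simp only [Prod.ext_iff, Prod.fst_sub, Prod.snd_sub, Prod.fst_add, Prod.snd_add, Prod.smul_fst,
      Prod.smul_snd, jet]
    refine ⟨by simp [hΔ], by simp [hr2], by simp [hδ, hp]⟩
  have e2 : Γ ((t, jet a b us t) - (x, jet a b us x)) =
      Δ • Γ (1, (p x, 0)) + hess L x (jet a b us x) (r2, δ) := by
    rw [e1, map_add, map_smul]
    congr 1
    exact fderivWithin_grad_snd hab hL (t := (x, jet a b us x)) hx _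
  have e3 : hessP L a b us x (δ - Δ • d) = r3 - r1.comp (ContinuousLinearMap.inr ℝ E E) -
      (hess L x (jet a b us x) (r2, 0)).comp (ContinuousLinearMap.inr ℝ E E) := by
    rw [map_sub, map_smul, hd]
    ext w
    have e4 : ((r2, δ) : E × E) = (r2, 0) + (0, δ) := by simp
    have e5 : r1 (0, w) = grad L t (jet a b us t) (0, w) - grad L x (jet a b us x) (0, w) -
        (Δ * Γ (1, (p x, 0)) (0, w) + (hess L x (jet a b us x) (r2, 0) (0, w) +
          hess L x (jet a b us x) (0, δ) (0, w))) := by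
      rw [hr1, e2, e4, map_add]; simp
    have e6 : accelForm L a b us x w = grad L x (jet a b us x) (w, 0) -
        Γ (1, (p x, 0)) (0, w) := rfl
    have e7 : r3 w = grad L t (jet a b us t) (0, w) - grad L x (jet a b us x) (0, w) -
        Δ * grad L x (jet a b us x) (w, 0) := rfl
    simp only [sub_apply, smul_apply, smul_eq_mul, ContinuousLinearMap.comp_apply,
      ContinuousLinearMap.inr_apply]
    rw [e5, e6, e7, hessP_apply]
    ring
  have hinr : ‖ContinuousLinearMap.inr ℝ E E‖ ≤ 1 :=
    ContinuousLinearMap.opNorm_le_bound _ zero_le_one fun w => by simp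
  have hcomp : ∀ T : E × E →L[ℝ] ℝ, ‖T.comp (ContinuousLinearMap.inr ℝ E E)‖ ≤ ‖T‖ := fun T =>
    (T.opNorm_comp_le _).trans (by nlinarith [norm_nonneg T])
  have n1 := hessP_norm_le hθ hpos hx (δ - Δ • d)
  set ρ := δ - Δ • d with hρ
  have n2 : ‖hess L x (jet a b us x) (r2, 0)‖ ≤ K * (c * ‖Δ‖) := by
    refine ((hess L x (jet a b us x)).le_opNorm _).trans ?_
    refine mul_le_mul_of_nonneg_left ?_ (norm_nonneg _)
    simpa [Prod.norm_def] using h2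
  have n3 : ‖δ‖ ≤ ‖ρ‖ + ‖Δ‖ * ‖d‖ := by
    have : δ = ρ + Δ • d := by rw [hρ]; abel
    rw [this]; exact (norm_add_le _ _).trans (by rw [norm_smul])
  have n4 : ‖us t - us x‖ ≤ c * ‖Δ‖ + ‖Δ‖ * ‖p x‖ := by
    have : us t - us x = r2 + Δ • p x := by rw [hr2]; abel
    rw [this]; exact (norm_add_le _ _).trans (by rw [norm_smul]; gcongr)
  have hΔ0 := norm_nonneg Δ
  have hρ0 := norm_nonneg ρ
  have n5 : ‖((t, jet a b us t) - (x, jet a b us x) : ℝ × E × E)‖ ≤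
      ‖ρ‖ + ‖Δ‖ * (2 + ‖p x‖ + ‖d‖) := by
    have q1 := norm_nonneg (p x)
    have q2 := norm_nonneg d
    have q3 := mul_nonneg hΔ0 q1
    have q4 := mul_nonneg hΔ0 q2
    have q5 : c * ‖Δ‖ ≤ ‖Δ‖ := by nlinarith
    rw [Prod.norm_def, Prod.norm_def]
    refine max_le ?_ (max_le ?_ ?_)
    · change ‖Δ‖ ≤ _; nlinarith
    · change ‖us t - us x‖ ≤ _; nlinarith
    · change ‖δ‖ ≤ _; nlinarith
  have n6 : ‖r1‖ ≤ c * (‖ρ‖ + ‖Δ‖ * (2 + ‖p x‖ + ‖d‖)) :=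
    h1.trans (mul_le_mul_of_nonneg_left n5 hc0.le)
  rw [e3] at n1
  have n7 : ‖r3 - r1.comp (ContinuousLinearMap.inr ℝ E E) -
      (hess L x (jet a b us x) (r2, 0)).comp (ContinuousLinearMap.inr ℝ E E)‖ ≤
      c * ‖Δ‖ + c * (‖ρ‖ + ‖Δ‖ * (2 + ‖p x‖ + ‖d‖)) + K * (c * ‖Δ‖) :=
    (norm_sub_le _ _).trans (add_le_add ((norm_sub_le _ _).trans
      (add_le_add h3 ((hcomp _).trans n6))) ((hcomp _).trans n2))
  have n8 : c * ‖Δ‖ + c * (‖ρ‖ + ‖Δ‖ * (2 + ‖p x‖ + ‖d‖)) + K * (c * ‖Δ‖) =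
      c * ‖ρ‖ + c * M * ‖Δ‖ := by rw [hM]; ring
  have n9 : c * ‖ρ‖ ≤ θ * ‖ρ‖ := mul_le_mul_of_nonneg_right hcθ hρ0
  have n10 : c * M * ‖Δ‖ ≤ θ * ε * ‖Δ‖ := mul_le_mul_of_nonneg_right hcM hΔ0
  have n11 : θ * ‖ρ‖ ≤ θ * (ε * ‖Δ‖) := by linarith
  exact le_of_mul_le_mul_left n11 hθ

/-- The minimizer is twice differentiable, and `us''` solves the Euler-Lagrange equation. -/
lemma hasDerivWithinAt_secondDeriv {q : ℝ} (hq : 1 < q) {ua ub : E}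
    (hmin : IsMinimizer L a b q ua ub us) {x : ℝ} (hx : x ∈ Icc a b) :
    HasDerivWithinAt (derivWithin us (Icc a b)) (secondDeriv a b us x) (Icc a b) x ∧
      hessP L a b us x (secondDeriv a b us x) = accelForm L a b us x := by
  obtain ⟨d, h1, h2⟩ := exists_accel hab hL hus hθ hpos hq hmin hx
  have : secondDeriv a b us x = d := h2.derivWithin (uniqueDiffOn_Icc hab x hx)
  rw [this]
  exact ⟨h2, h1⟩

/-- Continuity of `us''`: it solves a linear equation with continuous and uniformly coercive
coefficients. -/
lemma secondDeriv_continuousOn {q : ℝ} (hq : 1 < q) {ua ub : E}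
    (hmin : IsMinimizer L a b q ua ub us) : ContinuousOn (secondDeriv a b us) (Icc a b) := by
  intro x hx
  have h1 := (hessP_continuousOn hab hL hus x hx)
  have h2 := (accelForm_continuousOn hab hL hus x hx)
  set σ := secondDeriv a b us
  have hσ := fun y (hy : y ∈ Icc a b) => (hasDerivWithinAt_secondDeriv hab hL hus hθ hpos hq hmin hy).2
  have h3 : Tendsto (fun y => (2 * θ)⁻¹ * ‖(accelForm L a b us y - accelForm L a b us x) -
      (hessP L a b us y - hessP L a b us x) (σ x)‖) (𝓝[Icc a b] x) (𝓝 0) := by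
    have h4 : ContinuousWithinAt (fun y => (2 * θ)⁻¹ * ‖(accelForm L a b us y - accelForm L a b us x) -
      (hessP L a b us y - hessP L a b us x) (σ x)‖) (Icc a b) x :=
      continuousWithinAt_const.mul (((h2.sub continuousWithinAt_const).sub
        ((h1.sub continuousWithinAt_const).clm_apply continuousWithinAt_const)).norm)
    have := h4.tendsto
    simpa using this
  rw [ContinuousWithinAt, tendsto_iff_norm_sub_tendsto_zero]
  refine squeeze_zero' (Eventually.of_forall fun _ => norm_nonneg _) ?_ h3
  filter_upwards [self_mem_nhdsWithin] with y hy
  have h5 := hessP_norm_le hθ hpos hy (σ y - σ x)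
  rw [map_sub, hσ y hy] at h5
  have e : accelForm L a b us y - hessP L a b us y (σ x) =
      (accelForm L a b us y - accelForm L a b us x) -
      (hessP L a b us y - hessP L a b us x) (σ x) := by
    rw [← hσ x hx, sub_apply]; abel
  rw [e] at h5
  rw [le_inv_mul_iff₀ (by positivity)]
  exact h5

end Regularity

/-! ### Lower bound on a cell -/

section Cell

variable {E : Type*} [NormedAddCommGroup E] [InnerProductSpace ℝ E] [CompleteSpace E]

/-- What the lower and the upper bound use about the second order expansion of the action at the
minimizer: `p` and `σ` stand for its first and second derivatives, `Q x` for the Hessian of the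
Lagrangian along it, and `R x` for the remainder in the Taylor expansion. -/
structure Expansion (a b θ : ℝ) (p σ : ℝ → E) (Q : ℝ → E × E →L[ℝ] E × E →L[ℝ] ℝ)
    (R : ℝ → E × E → ℝ) : Prop where
  θ_pos : 0 < θ
  Q_cont : ContinuousOn Q (Icc a b)
  Q_symm : ∀ x ∈ Icc a b, ∀ ζ η, Q x ζ η = Q x η ζ
  Q_pos : ∀ x ∈ Icc a b, ∀ ζ : E × E, 2 * θ * ‖ζ.2‖ ^ 2 ≤ Q x ζ ζ
  σ_cont : ContinuousOn σ (Icc a b)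
  p_deriv : ∀ x ∈ Icc a b, HasDerivWithinAt p (σ x) (Icc a b) x
  R_pos : ∀ x ∈ Icc a b, ∀ h : E × E, θ * ‖h.2‖ ^ 2 ≤ R x h
  R_approx : ∀ ε, 0 < ε → ∃ δ, 0 < δ ∧ δ ≤ 1 ∧ ∀ x ∈ Icc a b, ∀ h : E × E, ‖h‖ ≤ δ →
    |R x h - 1 / 2 * Q x h h| ≤ ε * ‖h‖ ^ 2
  R_int : ∀ ξ : ℝ → E × E, AEStronglyMeasurable ξ (volume.restrict (Icc a b)) →
    ∀ M : ℝ, (∀ x ∈ Icc a b, ‖ξ x‖ ≤ M) → IntegrableOn (fun x => R x (ξ x)) (Icc a b)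

lemma bilin_bound {V : Type*} [NormedAddCommGroup V] [NormedSpace ℝ V] {B : V →L[ℝ] V →L[ℝ] ℝ}
    {Λ : ℝ} (hB : ‖B‖ ≤ Λ) (v w : V) : |B v w| ≤ Λ * ‖v‖ * ‖w‖ := by
  have := B.le_opNorm₂ v w
  rw [Real.norm_eq_abs] at this
  refine this.trans ?_
  gcongr

/-- Pointwise lower bound for the quadratic form `B`, obtained by testing with
`ζ - λ (x - m) (0, σ)`, where `y = x - m`. -/
lemma quad_lower {B : E × E →L[ℝ] E × E →L[ℝ] ℝ} (hsymm : ∀ ζ η, B ζ η = B η ζ)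
    (hpos : ∀ ζ, 0 ≤ B ζ ζ) {Λ : ℝ} (hB : ‖B‖ ≤ Λ) {S ε n l y : ℝ} (hε : 0 ≤ ε) (hn : 0 ≤ n)
    (hl : 0 ≤ l)
    {g g₀ r w w₀ σ : E} (hσ : ‖σ‖ ≤ S) (hg : ‖g - g₀‖ ≤ ε) (hr : ‖r‖ ≤ ε * |y|)
    (hw : w = w₀ - n • (y • σ + r)) (ζ : E × E) :
    B (g, w) ζ - 1 / 2 * B ζ ζ + y * (l * (B ζ (0, σ) - B (g₀, w₀) (0, σ))) +
      y ^ 2 * (n * l * (B (0, σ) (0, σ) - Λ * ε * S) - 1 / 2 * l ^ 2 * B (0, σ) (0, σ)) -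
      l * |y| * (Λ * ε * S) ≤ 1 / 2 * B (g, w) (g, w) := by
  have hΛ : 0 ≤ Λ := (norm_nonneg _).trans hB
  set τ : E × E := (0, σ) with hτ
  set ξ : E × E := (g, w) with hξ
  have h1 := hpos (ξ - ζ + (l * y) • τ)
  have h2 : B (ξ - ζ + (l * y) • τ) (ξ - ζ + (l * y) • τ) =
      B ξ ξ + B ζ ζ + (l * y) ^ 2 * B τ τ - 2 * B ξ ζ + 2 * (l * y) * B ξ τ -
        2 * (l * y) * B ζ τ := by
    simp only [map_add, map_sub, map_smul, add_apply, sub_apply, smul_apply, smul_eq_mul]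
    rw [hsymm ζ ξ, hsymm τ ξ, hsymm τ ζ]
    ring
  have h3 : ξ = (g₀, w₀) + (g - g₀, 0) - n • (0, r) - (n * y) • τ := by
    simp only [hξ, hτ, Prod.ext_iff, Prod.fst_sub, Prod.fst_add, Prod.snd_sub, Prod.snd_add,
      Prod.smul_fst, Prod.smul_snd, hw]
    refine ⟨by simp, ?_⟩
    rw [smul_add, smul_smul]
    simp; abel
  have h4 : B ξ τ = B (g₀, w₀) τ + B (g - g₀, 0) τ - n * B (0, r) τ - n * y * B τ τ := by
    rw [h3]; simp only [map_add, map_sub, map_smul, add_apply, sub_apply, smul_apply, smul_eq_mul]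
  have hτn : ‖τ‖ ≤ S := by simpa [hτ, Prod.norm_def] using hσ
  have h5 : |B (g - g₀, 0) τ| ≤ Λ * ε * S := by
    refine (bilin_bound hB _ _).trans ?_
    have : ‖((g - g₀, 0) : E × E)‖ ≤ ε := by simpa [Prod.norm_def] using hg
    gcongr
  have h6 : |B (0, r) τ| ≤ Λ * (ε * |y|) * S := by
    refine (bilin_bound hB _ _).trans ?_
    have : ‖((0, r) : E × E)‖ ≤ ε * |y| := by simpa [Prod.norm_def] using hr
    gcongr
  have h7 : -(l * y) * B (g - g₀, 0) τ ≥ - (l * |y| * (Λ * ε * S)) := by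
    have : |(l * y) * B (g - g₀, 0) τ| ≤ l * |y| * (Λ * ε * S) := by
      rw [abs_mul, abs_mul, abs_of_nonneg hl]; gcongr
    have := (abs_le.1 this).2
    linarith
  have h8 : (l * y) * (n * B (0, r) τ) ≥ - (n * l * y ^ 2 * (Λ * ε * S)) := by
    have : |(l * y) * (n * B (0, r) τ)| ≤ n * l * y ^ 2 * (Λ * ε * S) := by
      rw [abs_mul, abs_mul, abs_mul, abs_of_nonneg hl, abs_of_nonneg hn, ← sq_abs y]
      calc l * |y| * (n * |B (0, r) τ|) ≤ l * |y| * (n * (Λ * (ε * |y|) * S)) := by gcongr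
        _ = _ := by ring
    exact (abs_le.1 this).1
  rw [h2, h4] at h1
  nlinarith

variable {a b θ : ℝ} {p σ : ℝ → E} {Q : ℝ → E × E →L[ℝ] E × E →L[ℝ] ℝ} {R : ℝ → E × E → ℝ}

lemma Expansion.p_cont (ex : Expansion a b θ p σ Q R) : ContinuousOn p (Icc a b) :=
  fun x hx => (ex.p_deriv x hx).continuousWithinAt

lemma Expansion.R_nonneg (ex : Expansion a b θ p σ Q R) {x : ℝ} (hx : x ∈ Icc a b) (h : E × E) :
    0 ≤ R x h := le_trans (by have := ex.θ_pos; positivity) (ex.R_pos x hx h)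

lemma Expansion.Q_nonneg (ex : Expansion a b θ p σ Q R) {x : ℝ} (hx : x ∈ Icc a b) (h : E × E) :
    0 ≤ Q x h h := le_trans (by have := ex.θ_pos; positivity) (ex.Q_pos x hx h)

lemma integral_center {s t : ℝ} : ∫ x in s..t, (x - (s + t) / 2) = 0 := by
  rw [intervalIntegral.integral_sub (by simp) (by simp)]; simp; ring

lemma integral_center_sq {s t : ℝ} : ∫ x in s..t, (x - (s + t) / 2) ^ 2 = (t - s) ^ 3 / 12 := by
  rw [intervalIntegral.integral_comp_sub_right (fun x => x ^ 2)]; simp; ring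

set_option maxHeartbeats 800000 in
/-- Lower bound for the energy on a mesh cell on which the gradient of the competitor is close to
that of the minimizer. The parameter `A` is the expected value of `n (t - s)`; the error of a wrong
guess is the term with `A ^ 3`, which appears once per cell and not per length. -/
lemma Expansion.good_cell (ex : Expansion a b θ p σ Q R) {ε δ : ℝ} (hε : 0 < ε)
    (hδ : ∀ x ∈ Icc a b, ∀ h : E × E, ‖h‖ ≤ δ → |R x h - 1 / 2 * Q x h h| ≤ ε * ‖h‖ ^ 2)
    {s t : ℝ} (hst : s < t) (hsub : Icc s t ⊆ Icc a b) {n : ℝ} (hn : 1 ≤ n) {G : ℝ → E} {v : E}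
    (hGc : ContinuousOn G (Icc s t)) {B : E × E →L[ℝ] E × E →L[ℝ] ℝ}
    (hsymm : ∀ ζ η, B ζ η = B η ζ) (hpos : ∀ ζ, 0 ≤ B ζ ζ) {Λ : ℝ} (hB : ‖B‖ ≤ Λ)
    (hQ : ∀ x ∈ Icc s t, ‖Q x - B‖ ≤ ε) {S : ℝ} {σ₀ : E} (hσ : ‖σ₀‖ ≤ S)
    (hp : ∀ x ∈ Icc s t, ∀ y ∈ Icc s t, ‖p x - p y - (x - y) • σ₀‖ ≤ ε * |x - y|)
    (hG : ∀ x ∈ Icc s t, ‖G x - G s‖ ≤ ε)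
    (hint : IntervalIntegrable (fun x => R x (n⁻¹ • (G x, n • (v - p x)))) volume s t)
    (hgood : ∀ x ∈ Icc s t, ‖n⁻¹ • ((G x, n • (v - p x)) : E × E)‖ ≤ δ)
    {A : ℝ} (hA : 0 ≤ A) (ζ : E × E) :
    (∫ x in s..t, B (G x, n • (v - p x)) ζ) - 1 / 2 * B ζ ζ * (t - s) +
      B (0, σ₀) (0, σ₀) * A ^ 2 / 8 * (t - s) - B (0, σ₀) (0, σ₀) * A ^ 3 / 12 / n
      - ε * (Λ * S * (A + A ^ 2)) * (t - s)
      - 2 * ε * ∫ x in s..t, ‖((G x, n • (v - p x)) : E × E)‖ ^ 2 ≤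
      n ^ 2 * ∫ x in s..t, R x (n⁻¹ • (G x, n • (v - p x))) := by
  have hn0 : 0 < n := by linarith
  have hΛ : 0 ≤ Λ := (norm_nonneg _).trans hB
  have hS : 0 ≤ S := (norm_nonneg _).trans hσ
  set ξ : ℝ → E × E := fun x => (G x, n • (v - p x)) with hξ
  set m := (s + t) / 2 with hm
  set b₀ := B (0, σ₀) (0, σ₀) with hb₀
  have hb0 : 0 ≤ b₀ := hpos _
  have hmI : m ∈ Icc s t := ⟨by rw [hm]; linarith, by rw [hm]; linarith⟩
  have hpc : ContinuousOn p (Icc s t) := ex.p_cont.mono hsub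
  have hξc : ContinuousOn ξ (Icc s t) :=
    hGc.prodMk (continuousOn_const.smul (continuousOn_const.sub hpc))
  have i1 : IntervalIntegrable (fun x => B (ξ x) ζ) volume s t :=
    ((B.continuous.comp_continuousOn hξc).clm_apply continuousOn_const).intervalIntegrable_of_Icc
      hst.le
  have i2 : IntervalIntegrable (fun x => ‖ξ x‖ ^ 2) volume s t :=
    (hξc.norm.pow 2).intervalIntegrable_of_Icc hst.le
  -- the bound for an arbitrary amplitude `l` of the oscillating part of the test function
  have main : ∀ l : ℝ, 0 ≤ l →
      (∫ x in s..t, B (ξ x) ζ) - 1 / 2 * B ζ ζ * (t - s) +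
      (t - s) ^ 3 / 12 * (n * l * (b₀ - Λ * ε * S) - 1 / 2 * l ^ 2 * b₀) -
      l * ((t - s) / 2) * (Λ * ε * S) * (t - s) - 2 * ε * ∫ x in s..t, ‖ξ x‖ ^ 2 ≤
      n ^ 2 * ∫ x in s..t, R x (n⁻¹ • ξ x) := by
    intro l hl
    set c1 := l * (B ζ (0, σ₀) - B (G s, n • (v - p m)) (0, σ₀)) with hc1
    set c2 := n * l * (b₀ - Λ * ε * S) - 1 / 2 * l ^ 2 * b₀ with hc2
    set c3 := l * ((t - s) / 2) * (Λ * ε * S) with hc3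
    have j1 : IntervalIntegrable (fun x => (x - m) * c1) volume s t :=
      Continuous.intervalIntegrable (by fun_prop) _ _
    have j2 : IntervalIntegrable (fun x => (x - m) ^ 2 * c2) volume s t :=
      Continuous.intervalIntegrable (by fun_prop) _ _
    have e1 : ∫ x in s..t, (B (ξ x) ζ - 1 / 2 * B ζ ζ + (x - m) * c1 + (x - m) ^ 2 * c2 - c3 -
        2 * ε * ‖ξ x‖ ^ 2) = (∫ x in s..t, B (ξ x) ζ) - 1 / 2 * B ζ ζ * (t - s) +
      (t - s) ^ 3 / 12 * c2 - c3 * (t - s) - 2 * ε * ∫ x in s..t, ‖ξ x‖ ^ 2 := by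
      have k1 : ∫ x in s..t, (x - m) * c1 = 0 := by
        rw [intervalIntegral.integral_mul_const, hm, integral_center, zero_mul]
      have k2 : ∫ x in s..t, (x - m) ^ 2 * c2 = (t - s) ^ 3 / 12 * c2 := by
        rw [intervalIntegral.integral_mul_const, hm, integral_center_sq]
      have k3 := intervalIntegral.integral_const_mul (a := s) (b := t) (μ := volume) (2 * ε)
        (fun x => ‖ξ x‖ ^ 2)
      rw [intervalIntegral.integral_sub ((((i1.sub (by simp)).add j1).add j2).sub (by simp))
          (i2.const_mul _),
        intervalIntegral.integral_sub (((i1.sub (by simp)).add j1).add j2) (by simp),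
        intervalIntegral.integral_add ((i1.sub (by simp)).add j1) j2,
        intervalIntegral.integral_add (i1.sub (by simp)) j1,
        intervalIntegral.integral_sub i1 (by simp), k1, k2, k3,
        intervalIntegral.integral_const, intervalIntegral.integral_const, smul_eq_mul, smul_eq_mul]
      ring
    rw [← e1, ← intervalIntegral.integral_const_mul]
    refine intervalIntegral.integral_mono_on hst.le
      (((((i1.sub (by simp)).add j1).add j2).sub (by simp)).sub (i2.const_mul _))
      (hint.const_mul _) fun x hx => ?_
    have hxm : |x - m| ≤ (t - s) / 2 := by
      rw [abs_le, hm]; constructor <;> linarith [hx.1, hx.2]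
    have h1 := quad_lower hsymm hpos hB hε.le hn0.le hl (y := x - m) hσ (hG x hx) (hp x hx m hmI)
      (w := n • (v - p x)) (w₀ := n • (v - p m)) (by
        rw [← smul_sub]; congr 1; abel) ζ
    have h2 := hδ x (hsub hx) _ (hgood x hx)
    have h3 : |(Q x - B) (ξ x) (ξ x)| ≤ ε * ‖ξ x‖ * ‖ξ x‖ := bilin_bound (hQ x hx) _ _
    have h4 : Q x (n⁻¹ • ξ x) (n⁻¹ • ξ x) = (n ^ 2)⁻¹ * Q x (ξ x) (ξ x) := by
      simp only [map_smul, smul_apply, smul_eq_mul]; field_simp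
    have h5 : ‖n⁻¹ • ξ x‖ ^ 2 = (n ^ 2)⁻¹ * ‖ξ x‖ ^ 2 := by
      rw [norm_smul, mul_pow, norm_inv, Real.norm_eq_abs, abs_of_pos hn0, inv_pow]
    rw [show ((G x, n • (v - p x)) : E × E) = ξ x from rfl] at h2 h1
    rw [h4, h5] at h2
    have h6 : 1 / 2 * Q x (ξ x) (ξ x) - ε * ‖ξ x‖ ^ 2 ≤ n ^ 2 * R x (n⁻¹ • ξ x) := by
      have := (abs_le.1 h2).1
      have h7 : n ^ 2 * (-(ε * ((n ^ 2)⁻¹ * ‖ξ x‖ ^ 2))) ≤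
        n ^ 2 * (R x (n⁻¹ • ξ x) - 1 / 2 * ((n ^ 2)⁻¹ * Q x (ξ x) (ξ x))) :=
        mul_le_mul_of_nonneg_left this (by positivity)
      have h8 : n ^ 2 * (-(ε * ((n ^ 2)⁻¹ * ‖ξ x‖ ^ 2))) = -(ε * ‖ξ x‖ ^ 2) := by field_simp
      have h9 : n ^ 2 * (R x (n⁻¹ • ξ x) - 1 / 2 * ((n ^ 2)⁻¹ * Q x (ξ x) (ξ x))) =
        n ^ 2 * R x (n⁻¹ • ξ x) - 1 / 2 * Q x (ξ x) (ξ x) := by field_simp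
      linarith
    have h7 : B (ξ x) (ξ x) - ε * ‖ξ x‖ ^ 2 ≤ Q x (ξ x) (ξ x) := by
      have := (abs_le.1 h3).1
      simp only [sub_apply] at this
      linarith
    have h8 : l * |x - m| * (Λ * ε * S) ≤ c3 := by rw [hc3]; gcongr
    rw [← hc1, ← hb₀, ← hc2] at h1
    have h9 := mul_nonneg hε.le (sq_nonneg ‖ξ x‖)
    linarith
  have hℓ : 0 < t - s := by linarith
  have hKpos : 0 ≤ Λ * ε * S := by positivity
  -- if `b₀` does not exceed the error `Λ ε S`, the oscillation is not worth resolving: take `l = 0`;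
  -- otherwise take `l = A / (t - s)`, and use `A (n (t - s) - A) ^ 2 ≥ 0` in `e3`
  by_cases hb : Λ * ε * S ≤ b₀
  · refine le_trans ?_ (main (A / (t - s)) (by positivity))
    have e1 : (t - s) ^ 3 / 12 * (n * (A / (t - s)) * (b₀ - Λ * ε * S) -
        1 / 2 * (A / (t - s)) ^ 2 * b₀) =
        n * A * (t - s) ^ 2 / 12 * (b₀ - Λ * ε * S) - A ^ 2 * (t - s) / 24 * b₀ := by
      field_simp; ring
    have e2 : A / (t - s) * ((t - s) / 2) * (Λ * ε * S) * (t - s) =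
        A / 2 * (Λ * ε * S) * (t - s) := by field_simp
    have e3 : A ^ 2 * (t - s) / 6 - A ^ 3 / (12 * n) ≤ n * A * (t - s) ^ 2 / 12 := by
      have : n * A * (t - s) ^ 2 / 12 - (A ^ 2 * (t - s) / 6 - A ^ 3 / (12 * n)) =
        A * (n * (t - s) - A) ^ 2 / (12 * n) := by field_simp; ring
      have h2 : 0 ≤ A * (n * (t - s) - A) ^ 2 / (12 * n) := by positivity
      linarith
    have e4 := mul_le_mul_of_nonneg_right e3 (sub_nonneg.2 hb)
    have e5 : b₀ * A ^ 3 / 12 / n = A ^ 3 / (12 * n) * b₀ := by field_simp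
    have e6 : 0 ≤ A ^ 3 / (12 * n) * (Λ * ε * S) := by positivity
    have e7 : 0 ≤ A * (Λ * ε * S) * (t - s) := by positivity
    have e8 : 0 ≤ A ^ 2 * (Λ * ε * S) * (t - s) := by positivity
    rw [e1, e2, e5]
    linarith
  · push Not at hb
    refine le_trans ?_ (main 0 le_rfl)
    have e5 : 0 ≤ b₀ * A ^ 3 / 12 / n := by positivity
    have e7 : 0 ≤ A * (Λ * ε * S) * (t - s) := by positivity
    have e8 : 0 ≤ A ^ 2 * (t - s) * (Λ * ε * S - b₀) := by
      have := sub_pos.2 hb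
      positivity
    have e9 : 0 ≤ A ^ 2 * (t - s) * b₀ := by positivity
    nlinarith

/-- On a mesh cell on which the gradient of the competitor is far from that of the minimizer, the
expression bounding the energy from below is absorbed by a multiple of `‖ξ‖² / n`. -/
lemma bad_cell {δ : ℝ} (hδ : 0 < δ) {s t : ℝ} (hst : s ≤ t) {n : ℝ} (hn : 1 ≤ n)
    {ξ : ℝ → E × E} (hξc : ContinuousOn ξ (Icc s t)) {B : E × E →L[ℝ] E × E →L[ℝ] ℝ}
    (hpos : ∀ ζ, 0 ≤ B ζ ζ) {Λ : ℝ} (hB : ‖B‖ ≤ Λ)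
    (hbad : ∀ x ∈ Icc s t, n * δ / 2 ≤ ‖ξ x‖) {K : ℝ} (hK : 0 ≤ K) (ζ : E × E) :
    (∫ x in s..t, B (ξ x) ζ) - 1 / 2 * B ζ ζ * (t - s) + K * (t - s) ≤
      (4 * K / δ ^ 2 + 2 * Λ * ‖ζ‖ / δ) / n * ∫ x in s..t, ‖ξ x‖ ^ 2 := by
  have hΛ : 0 ≤ Λ := (norm_nonneg _).trans hB
  have hn0 : 0 < n := by linarith
  have i1 : IntervalIntegrable (fun x => B (ξ x) ζ) volume s t :=
    ((B.continuous.comp_continuousOn hξc).clm_apply continuousOn_const).intervalIntegrable_of_Icc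
      hst
  have i2 : IntervalIntegrable (fun x => ‖ξ x‖ ^ 2) volume s t :=
    (hξc.norm.pow 2).intervalIntegrable_of_Icc hst
  have e1 : (∫ x in s..t, B (ξ x) ζ) - 1 / 2 * B ζ ζ * (t - s) + K * (t - s) =
      ∫ x in s..t, (B (ξ x) ζ - 1 / 2 * B ζ ζ + K) := by
    rw [intervalIntegral.integral_add (i1.sub (by simp)) (by simp),
      intervalIntegral.integral_sub i1 (by simp)]
    simp; ring
  rw [e1, ← intervalIntegral.integral_const_mul]
  refine intervalIntegral.integral_mono_on hst ((i1.sub (by simp)).add (by simp)) (i2.const_mul _)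
    fun x hx => ?_
  have h1 := hbad x hx
  have h2 := (le_abs_self _).trans (bilin_bound hB (ξ x) ζ)
  have h3 := hpos ζ
  have hX : 0 ≤ ‖ξ x‖ := norm_nonneg _
  have h4 : 1 ≤ 2 / (n * δ) * ‖ξ x‖ := by
    rw [div_mul_eq_mul_div, le_div_iff₀ (by positivity)]; linarith
  have h5 : K ≤ 4 * K / δ ^ 2 / n * ‖ξ x‖ ^ 2 := by
    calc K = K * 1 ^ 2 := by ring
      _ ≤ K * (2 / (n * δ) * ‖ξ x‖) ^ 2 := by gcongr
      _ = 4 * K / δ ^ 2 / n * ‖ξ x‖ ^ 2 * (1 / n) := by field_simp; ring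
      _ ≤ 4 * K / δ ^ 2 / n * ‖ξ x‖ ^ 2 * 1 := by
          refine mul_le_mul_of_nonneg_left ?_ (by positivity)
          rw [div_le_one hn0]; exact hn
      _ = _ := mul_one _
  have h6 : Λ * ‖ξ x‖ * ‖ζ‖ ≤ 2 * Λ * ‖ζ‖ / δ / n * ‖ξ x‖ ^ 2 := by
    calc Λ * ‖ξ x‖ * ‖ζ‖ = Λ * ‖ξ x‖ * ‖ζ‖ * 1 := by ring
      _ ≤ Λ * ‖ξ x‖ * ‖ζ‖ * (2 / (n * δ) * ‖ξ x‖) := by gcongr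
      _ = _ := by field_simp
  have h7 : (4 * K / δ ^ 2 + 2 * Λ * ‖ζ‖ / δ) / n * ‖ξ x‖ ^ 2 =
    4 * K / δ ^ 2 / n * ‖ξ x‖ ^ 2 + 2 * Λ * ‖ζ‖ / δ / n * ‖ξ x‖ ^ 2 := by ring
  rw [h7]
  linarith

/-- A mesh on `[a, b]` induces one on each subinterval, with degenerate cells outside of it. -/
lemma isNodes_clamp {n : ℕ} {x : ℕ → ℝ} (hx : IsNodes a b n x) {α β : ℝ} (hα : a ≤ α)
    (hαβ : α ≤ β) (hβ : β ≤ b) : IsNodes α β n (fun i => max α (min β (x i))) where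
  mono := fun i j hij => max_le_max le_rfl (min_le_min le_rfl (hx.mono hij))
  zero := by
    rw [hx.zero, max_eq_left]
    exact (min_le_right _ _).trans hα
  last := by rw [hx.last, min_eq_left hβ, max_eq_right hαβ]

/-- The scaled difference `(g, g')` of a competitor and the minimizer is bounded and measurable. -/
lemma Expansion.xi_bound (ex : Expansion a b θ p σ Q R) {n : ℕ} {x : ℕ → ℝ} {c : ℕ → E}
    {G : ℝ → E} (hGc : ContinuousOn G (Icc a b)) (r : ℝ) :
    AEStronglyMeasurable (fun t => ((G t, r • (stepFun n x c t - p t)) : E × E))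
      (volume.restrict (Icc a b)) ∧
    ∃ M, ∀ t ∈ Icc a b, ‖((G t, r • (stepFun n x c t - p t)) : E × E)‖ ≤ M := by
  constructor
  · exact (hGc.aestronglyMeasurable measurableSet_Icc).prodMk
      ((stepFun_stronglyMeasurable.aestronglyMeasurable.sub
        (ex.p_cont.aestronglyMeasurable measurableSet_Icc)).const_smul r)
  · obtain ⟨M₁, h₁⟩ := isCompact_Icc.exists_bound_of_continuousOn hGc
    obtain ⟨M₂, h₂⟩ := isCompact_Icc.exists_bound_of_continuousOn ex.p_cont
    refine ⟨max M₁ (|r| * (∑ i ∈ Finset.range n, ‖c i‖ + M₂)), fun t ht => ?_⟩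
    rw [Prod.norm_def]
    refine max_le_max (h₁ t ht) ?_
    rw [norm_smul, Real.norm_eq_abs]
    gcongr
    exact (norm_sub_le _ _).trans (add_le_add (norm_stepFun_le t) (h₂ t ht))

lemma integral_stepFun_congr {F : Type*} [NormedAddCommGroup F] [NormedSpace ℝ F] {n : ℕ}
    {x : ℕ → ℝ} (hx : Monotone x) {c : ℕ → E} {i : ℕ} (hi : i < n) {s t : ℝ} (hs : x i ≤ s)
    (ht : t ≤ x (i + 1)) (hst : s ≤ t) (f : ℝ → E → F) :
    ∫ τ in s..t, f τ (stepFun n x c τ) = ∫ τ in s..t, f τ (c i) := by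
  refine intervalIntegral.integral_congr_ae ?_
  have h : ∀ᵐ τ : ℝ, τ ≠ t := by simp [ae_iff]
  filter_upwards [h] with τ hτ hτ2
  rw [uIoc_of_le hst] at hτ2
  rw [stepFun_apply hx hi ⟨hs.trans hτ2.1.le, (lt_of_le_of_ne hτ2.2 hτ).trans_le ht⟩]

/-- Lower bound for the energy on an interval `[α, β]` on which the coefficients are almost
constant. The number of mesh cells in this interval is controlled by `Y β - Y α`. -/
lemma Expansion.macro_bound (ex : Expansion a b θ p σ Q R) (hab : a < b) {ε δ : ℝ} (hε : 0 < ε)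
    (hδ0 : 0 < δ)
    (hδ : ∀ x ∈ Icc a b, ∀ h : E × E, ‖h‖ ≤ δ → |R x h - 1 / 2 * Q x h h| ≤ ε * ‖h‖ ^ 2)
    {α β : ℝ} (hα : a ≤ α) (hαβ : α ≤ β) (hβ : β ≤ b) {n : ℕ} (hn : 1 ≤ n) {x : ℕ → ℝ}
    {c : ℕ → E} {U : ℝ → E} {Y : ℝ → ℝ} (hd : AdmData a b n x c U Y) {G : ℝ → E}
    (hGc : ContinuousOn G (Icc a b)) {Λ S : ℝ} (hB : ‖Q α‖ ≤ Λ) (hσ : ‖σ α‖ ≤ S)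
    (hQ : ∀ x ∈ Icc α β, ‖Q x - Q α‖ ≤ ε)
    (hp : ∀ x ∈ Icc α β, ∀ y ∈ Icc α β, ‖p x - p y - (x - y) • σ α‖ ≤ ε * |x - y|)
    (hG : ∀ x ∈ Icc α β, ∀ y ∈ Icc α β, ‖G x - G y‖ ≤ ε)
    (hGn : ∀ x ∈ Icc α β, ‖G x‖ ≤ n * δ)
    (hosc : ∀ x ∈ Icc α β, ∀ y ∈ Icc α β, ‖p x - p y‖ ≤ δ / 2)
    {A : ℝ} (hA : 0 ≤ A) (ζ : E × E) :
    (∫ t in α..β, Q α (G t, (n : ℝ) • (stepFun n x c t - p t)) ζ) -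
      1 / 2 * Q α ζ ζ * (β - α) + Q α (0, σ α) (0, σ α) * A ^ 2 / 8 * (β - α) -
      Q α (0, σ α) (0, σ α) * A ^ 3 / 12 * ((Y β - Y α) / (b - a) + 2 / n)
      - ε * (Λ * S * (A + A ^ 2)) * (β - α)
      - (2 * ε + (4 * (Q α (0, σ α) (0, σ α) * A ^ 2 / 8) / δ ^ 2 + 2 * Λ * ‖ζ‖ / δ) / n) *
        ∫ t in α..β, ‖((G t, (n : ℝ) • (stepFun n x c t - p t)) : E × E)‖ ^ 2 ≤
      (n : ℝ) ^ 2 *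
        ∫ t in α..β, R t ((n : ℝ)⁻¹ • (G t, (n : ℝ) • (stepFun n x c t - p t))) := by
  have hαI : α ∈ Icc a b := ⟨hα, hαβ.trans hβ⟩
  have hsub : Icc α β ⊆ Icc a b := Icc_subset_Icc hα hβ
  have hΛ : 0 ≤ Λ := (norm_nonneg _).trans hB
  have hS : 0 ≤ S := (norm_nonneg _).trans hσ
  have hnR : (1 : ℝ) ≤ n := by exact_mod_cast hn
  have hn0 : (0 : ℝ) < n := by linarith
  set B := Q α with hBdef
  set b₀ := B (0, σ α) (0, σ α) with hb₀
  have hb0 : 0 ≤ b₀ := ex.Q_nonneg hαI _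
  set C := 4 * (b₀ * A ^ 2 / 8) / δ ^ 2 + 2 * Λ * ‖ζ‖ / δ with hC
  have hC0 : 0 ≤ C := by positivity
  set ξ : ℝ → E × E := fun t => (G t, (n : ℝ) • (stepFun n x c t - p t)) with hξ
  set s : ℕ → ℝ := fun i => max α (min β (x i)) with hs
  have hsN : IsNodes α β n s := isNodes_clamp hd.nodes hα hαβ hβ
  obtain ⟨hξm, M, hM⟩ := ex.xi_bound (n := n) (x := x) (c := c) hGc (n : ℝ)
  have hMae : ∀ᵐ t ∂volume.restrict (Icc a b), ‖ξ t‖ ≤ M :=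
    (ae_restrict_iff' measurableSet_Icc).2 (ae_of_all _ hM)
  have hM0 : 0 ≤ M := (norm_nonneg _).trans (hM α hαI)
  have I1 : IntegrableOn (fun t => B (ξ t) ζ) (Icc α β) := by
    refine IntegrableOn.mono_set ?_ hsub
    refine bounded_integrable (M := ‖B‖ * M * ‖ζ‖)
      ((ContinuousLinearMap.continuous (B.flip ζ)).comp_aestronglyMeasurable hξm) ?_
    filter_upwards [hMae] with t ht
    exact (B.le_opNorm₂ _ _).trans (by gcongr)
  have I2 : IntegrableOn (fun t => ‖ξ t‖ ^ 2) (Icc α β) := by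
    refine IntegrableOn.mono_set ?_ hsub
    refine bounded_integrable (M := M ^ 2) (hξm.norm.pow 2) ?_
    filter_upwards [hMae] with t ht
    rw [norm_pow, norm_norm]; gcongr
  have I3 : IntegrableOn (fun t => R t ((n : ℝ)⁻¹ • ξ t)) (Icc α β) := by
    refine IntegrableOn.mono_set ?_ hsub
    refine ex.R_int (fun t => (n : ℝ)⁻¹ • ξ t) (hξm.const_smul (n : ℝ)⁻¹) (‖(n : ℝ)⁻¹‖ * M)
      fun t ht => ?_
    rw [norm_smul]; gcongr; exact hM t ht
  -- the estimate on a single cell; degenerate cells contribute nothing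
  have cell : ∀ i < n, (∫ t in s i..s (i + 1), B (ξ t) ζ) - 1 / 2 * B ζ ζ * (s (i + 1) - s i) +
      b₀ * A ^ 2 / 8 * (s (i + 1) - s i) - (if s i < s (i + 1) then b₀ * A ^ 3 / 12 / n else 0)
      - ε * (Λ * S * (A + A ^ 2)) * (s (i + 1) - s i)
      - (2 * ε + C / n) * (∫ t in s i..s (i + 1), ‖ξ t‖ ^ 2) ≤
      (n : ℝ) ^ 2 * ∫ t in s i..s (i + 1), R t ((n : ℝ)⁻¹ • ξ t) := by
    intro i hi
    rcases (hsN.mono (Nat.le_succ i)).eq_or_lt with heq | hlt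
    · have : s (i + 1) = s i := heq.symm
      rw [this]; simp
    change s i < s (i + 1) at hlt
    rw [if_pos hlt]
    have hi1 : s i ∈ Icc α β := hsN.mem_Icc' hi.le
    have hi2 : s (i + 1) ∈ Icc α β := hsN.mem_Icc' hi
    have hcs : Icc (s i) (s (i + 1)) ⊆ Icc α β := Icc_subset_Icc hi1.1 hi2.2
    have hx1 : x i < β ∧ α < x (i + 1) := by
      constructor
      · by_contra h
        push Not at h
        have : s i = β := by simp only [hs]; rw [min_eq_left h, max_eq_right hαβ]
        linarith [hi2.2]
      · by_contra h
        push Not at h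
        have : s (i + 1) = α := by
          simp only [hs]; rw [max_eq_left ((min_le_right _ _).trans h)]
        linarith [hi1.1]
    have hx2 : x i ≤ s i := by
      simp only [hs]; rw [min_eq_right hx1.1.le]; exact le_max_right _ _
    have hx3 : s (i + 1) ≤ x (i + 1) := by
      simp only [hs]; exact max_le hx1.2.le (min_le_right _ _)
    have e := fun (F : ℝ → E → ℝ) => integral_stepFun_congr (c := c) hd.nodes.mono hi hx2 hx3 hlt.le F
    have e1 := e fun t v => B (G t, (n : ℝ) • (v - p t)) ζ
    have e2 := e fun t v => ‖((G t, (n : ℝ) • (v - p t)) : E × E)‖ ^ 2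
    have e3 := e fun t v => R t ((n : ℝ)⁻¹ • (G t, (n : ℝ) • (v - p t)))
    have hGc' : ContinuousOn G (Icc (s i) (s (i + 1))) := hGc.mono (hcs.trans hsub)
    have hpc' : ContinuousOn p (Icc (s i) (s (i + 1))) := ex.p_cont.mono (hcs.trans hsub)
    have hξc : ContinuousOn (fun t => ((G t, (n : ℝ) • (c i - p t)) : E × E))
        (Icc (s i) (s (i + 1))) :=
      hGc'.prodMk (continuousOn_const.smul (continuousOn_const.sub hpc'))
    have hI2 : 0 ≤ ∫ t in s i..s (i + 1), ‖ξ t‖ ^ 2 :=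
      intervalIntegral.integral_nonneg hlt.le fun t _ => sq_nonneg _
    simp only [hξ] at hI2 ⊢
    rw [e2] at hI2
    rw [e1, e2, e3]
    -- if the gradient is far from `p` at one point of the cell, then it is so on the whole cell
    by_cases hg : ∀ t ∈ Icc (s i) (s (i + 1)),
        ‖(n : ℝ)⁻¹ • ((G t, (n : ℝ) • (c i - p t)) : E × E)‖ ≤ δ
    · have hint : IntervalIntegrable (fun t => R t ((n : ℝ)⁻¹ • (G t, (n : ℝ) • (c i - p t))))
          volume (s i) (s (i + 1)) := by
        rw [intervalIntegrable_iff_integrableOn_Icc_of_le hlt.le]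
        have hm := hξc.aestronglyMeasurable (μ := volume) measurableSet_Icc
        have h5 : ContinuousOn (fun t => ((G t, (n : ℝ) • (c i - p t)) : E × E)) (Icc a b) :=
          hGc.prodMk (continuousOn_const.smul (continuousOn_const.sub ex.p_cont))
        obtain ⟨M', hM'⟩ := isCompact_Icc.exists_bound_of_continuousOn h5
        refine (ex.R_int (fun t => (n : ℝ)⁻¹ • (G t, (n : ℝ) • (c i - p t)))
          ((h5.aestronglyMeasurable measurableSet_Icc).const_smul (n : ℝ)⁻¹)
          (‖(n : ℝ)⁻¹‖ * M') fun t ht => ?_).mono_set (hcs.trans hsub)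
        rw [norm_smul]; gcongr; exact hM' t ht
      have := ex.good_cell hε hδ hlt (hcs.trans hsub) hnR hGc' (ex.Q_symm α hαI)
        (ex.Q_nonneg hαI) hB (fun t ht => hQ t (hcs ht)) hσ
        (fun t ht t' ht' => hp t (hcs ht) t' (hcs ht')) (fun t ht => hG t (hcs ht) _ hi1) hint hg
        hA ζ
      have h6 : 0 ≤ C / n := by positivity
      have h7 := mul_nonneg h6 hI2
      linarith
    · push Not at hg
      obtain ⟨t₀, ht₀, hg⟩ := hg
      have hbad : ∀ t ∈ Icc (s i) (s (i + 1)), n * δ / 2 ≤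
          ‖((G t, (n : ℝ) • (c i - p t)) : E × E)‖ := by
        intro t ht
        have h1 : δ < ‖c i - p t₀‖ := by
          rw [Prod.smul_mk, Prod.norm_def, smul_smul, inv_mul_cancel₀ hn0.ne', one_smul,
            lt_max_iff] at hg
          rcases hg with hg | hg
          · exfalso
            simp only [norm_smul, norm_inv, Real.norm_eq_abs, abs_of_pos hn0] at hg
            have := hGn t₀ (hcs ht₀)
            rw [lt_inv_mul_iff₀ hn0] at hg
            linarith
          · exact hg
        have h2 := hosc t (hcs ht) t₀ (hcs ht₀)
        have h3 : ‖c i - p t₀‖ ≤ ‖c i - p t‖ + ‖p t - p t₀‖ := by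
          refine le_trans (le_of_eq ?_) (norm_add_le _ _)
          congr 1; abel
        have h4 : δ / 2 ≤ ‖c i - p t‖ := by linarith
        rw [Prod.norm_def]
        refine le_max_of_le_right ?_
        rw [norm_smul, Real.norm_eq_abs, abs_of_pos hn0, mul_div_assoc]
        gcongr
      have h1 := bad_cell hδ0 hlt.le hnR hξc (ex.Q_nonneg hαI) hB hbad
        (K := b₀ * A ^ 2 / 8) (by positivity) ζ
      have h2 : 0 ≤ ∫ t in s i..s (i + 1), R t ((n : ℝ)⁻¹ • (G t, (n : ℝ) • (c i - p t))) :=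
        intervalIntegral.integral_nonneg hlt.le fun t ht => ex.R_nonneg (hsub (hcs ht)) _
      have h3 := mul_nonneg (sq_nonneg (n : ℝ)) h2
      have h4 : 0 ≤ b₀ * A ^ 3 / 12 / n := by positivity
      have h5 : 0 ≤ ε * (Λ * S * (A + A ^ 2)) * (s (i + 1) - s i) := by
        have := sub_pos.2 hlt; positivity
      have h6 := mul_nonneg hε.le hI2
      linarith
  have hsl : ∑ i ∈ Finset.range n, s (i + 1) - ∑ i ∈ Finset.range n, s i = β - α := by
    rw [← Finset.sum_sub_distrib, Finset.sum_range_sub, hsN.last, hsN.zero]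
  have hsum := Finset.sum_le_sum fun i hi => cell i (Finset.mem_range.1 hi)
  simp only [Finset.sum_add_distrib, Finset.sum_sub_distrib, ← Finset.mul_sum] at hsum
  rw [hsN.sum_integral I1, hsN.sum_integral I2, hsN.sum_integral I3,
    hsl, ← Finset.sum_filter,
    Finset.sum_const, nsmul_eq_mul] at hsum
  have hcard := hd.card_le hab hn hα hαβ hβ
    (s := (Finset.range n).filter (fun i => s i < s (i + 1))) (by
      intro i hi
      rw [Finset.mem_filter, Finset.mem_range] at hi
      have hi1 : s i ∈ Icc α β := hsN.mem_Icc' hi.1.le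
      have hi2 : s (i + 1) ∈ Icc α β := hsN.mem_Icc' hi.1
      refine ⟨hi.1, ?_, ?_⟩
      · by_contra h
        push Not at h
        have : s i = β := by simp only [hs]; rw [min_eq_left h, max_eq_right hαβ]
        linarith [hi2.2, hi.2]
      · by_contra h
        push Not at h
        have : s (i + 1) = α := by
          simp only [hs]; rw [max_eq_left ((min_le_right _ _).trans h)]
        linarith [hi1.1, hi.2])
  have hcard2 : (((Finset.range n).filter (fun i => s i < s (i + 1))).card : ℝ) *
      (b₀ * A ^ 3 / 12 / n) ≤ b₀ * A ^ 3 / 12 * ((Y β - Y α) / (b - a) + 2 / n) := by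
    calc _ ≤ (n * (Y β - Y α) / (b - a) + 2) * (b₀ * A ^ 3 / 12 / n) :=
          mul_le_mul_of_nonneg_right hcard (by positivity)
      _ = _ := by field_simp
  linarith

end Cell

/-! ### Lower bound along a sequence, on a macroscopic interval -/

section Macro

variable {E : Type*} [NormedAddCommGroup E] [InnerProductSpace ℝ E] [CompleteSpace E]
variable {a b θ : ℝ} {p σ : ℝ → E} {Q : ℝ → E × E →L[ℝ] E × E →L[ℝ] ℝ} {R : ℝ → E × E → ℝ}

/-- The derivative `n (u' - us')` for the piecewise affine function `u` with slopes `c`. -/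
noncomputable abbrev dev (n : ℕ) (x : ℕ → ℝ) (c : ℕ → E) (p : ℝ → E) (t : ℝ) : E :=
  (n : ℝ) • (stepFun n x c t - p t)

/-- An admissible pair whose renormalized energy is at most `C`, where `G` stands for the scaled
difference `n (u - us)`. -/
structure EnergyBounded (a b : ℝ) (p : ℝ → E) (R : ℝ → E × E → ℝ) (C : ℝ) (n : ℕ) (x : ℕ → ℝ)
    (c : ℕ → E) (U : ℝ → E) (Y : ℝ → ℝ) (G : ℝ → E) : Prop where
  one_le : 1 ≤ n
  data : AdmData a b n x c U Y
  prim : ∀ t ∈ Icc a b, G t = ∫ τ in a..t, dev n x c p τ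
  energy : (n : ℝ) ^ 2 * ∫ t in a..b, R t ((n : ℝ)⁻¹ • (G t, dev n x c p t)) ≤ C

lemma Expansion.bounds (ex : Expansion a b θ p σ Q R) (hab : a < b) :
    ∃ Λ S, 0 ≤ Λ ∧ 0 ≤ S ∧ ∀ t ∈ Icc a b, ‖Q t‖ ≤ Λ ∧ ‖σ t‖ ≤ S := by
  obtain ⟨Λ, hΛ⟩ := isCompact_Icc.exists_bound_of_continuousOn ex.Q_cont
  obtain ⟨S, hS⟩ := isCompact_Icc.exists_bound_of_continuousOn ex.σ_cont
  have ha := left_mem_Icc.2 hab.le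
  exact ⟨Λ, S, (norm_nonneg _).trans (hΛ a ha), (norm_nonneg _).trans (hS a ha),
    fun t ht => ⟨hΛ t ht, hS t ht⟩⟩

lemma exists_modulus_of_continuousOn {F : Type*} [NormedAddCommGroup F] {f : ℝ → F}
    (hf : ContinuousOn f (Icc a b)) {ε : ℝ} (hε : 0 < ε) :
    ∃ h, 0 < h ∧ ∀ x ∈ Icc a b, ∀ y ∈ Icc a b, |x - y| ≤ h → ‖f x - f y‖ ≤ ε := by
  obtain ⟨h, h0, hh⟩ := Metric.uniformContinuousOn_iff.1
    (isCompact_Icc.uniformContinuousOn_of_continuous hf) ε hε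
  refine ⟨h / 2, by positivity, fun x hx y hy hxy => ?_⟩
  have := hh x hx y hy (by rw [Real.dist_eq]; linarith)
  rw [dist_eq_norm] at this
  exact this.le

/-- On short intervals the coefficients of the expansion are almost constant. -/
lemma Expansion.exists_scale (ex : Expansion a b θ p σ Q R) {ε δ : ℝ} (hε : 0 < ε) (hδ : 0 < δ) :
    ∃ h, 0 < h ∧ ∀ α β, a ≤ α → α ≤ β → β ≤ b → β - α ≤ h →
      (∀ x ∈ Icc α β, ‖Q x - Q α‖ ≤ ε) ∧
      (∀ x ∈ Icc α β, ∀ y ∈ Icc α β, ‖p x - p y - (x - y) • σ α‖ ≤ ε * |x - y|) ∧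
      (∀ x ∈ Icc α β, ∀ y ∈ Icc α β, ‖p x - p y‖ ≤ δ) := by
  obtain ⟨h₁, h1, H1⟩ := exists_modulus_of_continuousOn ex.Q_cont hε
  obtain ⟨h₂, h2, H2⟩ := exists_modulus_of_continuousOn ex.σ_cont hε
  obtain ⟨h₃, h3, H3⟩ := exists_modulus_of_continuousOn ex.p_cont hδ
  refine ⟨min h₁ (min h₂ h₃), by positivity, fun α β hα hαβ hβ hh => ?_⟩
  have k1 : β - α ≤ h₁ := hh.trans (min_le_left _ _)
  have k2 : β - α ≤ h₂ := hh.trans ((min_le_right _ _).trans (min_le_left _ _))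
  have k3 : β - α ≤ h₃ := hh.trans ((min_le_right _ _).trans (min_le_right _ _))
  have hsub : Icc α β ⊆ Icc a b := Icc_subset_Icc hα hβ
  have hd : ∀ x ∈ Icc α β, ∀ y ∈ Icc α β, |x - y| ≤ β - α := fun x hx y hy => by
    rw [abs_le]; constructor <;> linarith [hx.1, hx.2, hy.1, hy.2]
  have hαI : α ∈ Icc α β := left_mem_Icc.2 hαβ
  refine ⟨fun x hx => H1 x (hsub hx) α (hsub hαI) ((hd x hx α hαI).trans k1), fun x hx y hy => ?_,
    fun x hx y hy => H3 x (hsub hx) y (hsub hy) ((hd x hx y hy).trans k3)⟩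
  have hder : ∀ z ∈ Icc α β, HasDerivWithinAt (fun z => p z - z • σ α) (σ z - (1 : ℝ) • σ α)
      (Icc α β) z := fun z hz =>
    ((ex.p_deriv z (hsub hz)).mono hsub).sub ((hasDerivWithinAt_id z _).smul_const (σ α))
  have := (convex_Icc α β).norm_image_sub_le_of_norm_hasDerivWithin_le (C := ε) hder
    (fun z hz => by
      rw [one_smul]; exact H2 z (hsub hz) α (hsub hαI) ((hd z hz α hαI).trans k2)) hy hx
  rw [Real.norm_eq_abs] at this
  refine le_trans (le_of_eq ?_) this
  congr 1
  rw [sub_smul]; abel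

/-- Fine partitions with nodes in a given set of full measure. -/
lemma exists_nodes_mem (hab : a < b) {D : Set ℝ} (hD : ∀ᵐ t, t ∈ D) (haD : a ∈ D) (hbD : b ∈ D)
    {h : ℝ} (hh : 0 < h) : ∃ (N : ℕ) (α : ℕ → ℝ), 1 ≤ N ∧ IsNodes a b N α ∧ StrictMono α ∧
      (∀ i, α (i + 1) - α i ≤ h) ∧ ∀ i, α i ∈ D := by
  have hH : 0 < b - a := by linarith
  obtain ⟨N, hN⟩ := exists_nat_gt (2 * (b - a) / h)
  have hN0 : (0 : ℝ) < N := lt_of_le_of_lt (by positivity) hN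
  set u := (b - a) / N with hu
  have hu0 : 0 < u := by positivity
  have huh : 2 * u ≤ h := by
    rw [div_lt_iff₀ hh] at hN
    rw [hu, ← mul_div_assoc, div_le_iff₀ hN0]; linarith
  have key : ∀ i : ℕ, ∃ t ∈ D, t ∈ Ioo (a + (i - 1 / 3) * u) (a + (i + 1 / 3) * u) ∧
      (i = 0 → t = a) ∧ (i = N → t = b) := by
    intro i
    have hNpos : 0 < N := by exact_mod_cast hN0
    by_cases h0 : i = 0
    · subst h0
      refine ⟨a, haD, ⟨?_, ?_⟩, fun _ => rfl, fun h => absurd h hNpos.ne⟩ <;> push_cast <;> linarith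
    by_cases h1 : i = N
    · subst h1
      have e : (i : ℝ) * u = b - a := by rw [hu]; field_simp
      refine ⟨b, hbD, ⟨?_, ?_⟩, fun h => absurd h h0, fun _ => rfl⟩
      · linarith
      · linarith
    obtain ⟨t, ht⟩ : (D ∩ Ioo (a + (i - 1 / 3) * u) (a + (i + 1 / 3) * u)).Nonempty := by
      by_contra hne
      rw [not_nonempty_iff_eq_empty] at hne
      have hsub : Ioo (a + (i - 1 / 3) * u) (a + (i + 1 / 3) * u) ⊆ Dᶜ := fun t ht hD' => by
        have : t ∈ D ∩ Ioo (a + (i - 1 / 3) * u) (a + (i + 1 / 3) * u) := ⟨hD', ht⟩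
        rw [hne] at this; exact this
      have h2 := measure_mono_null hsub (ae_iff.1 hD)
      rw [Real.volume_Ioo, ENNReal.ofReal_eq_zero] at h2
      linarith
    exact ⟨t, ht.1, ht.2, fun h => absurd h h0, fun h => absurd h h1⟩
  choose α hα1 hα2 hα3 hα4 using key
  have hs : StrictMono α := strictMono_nat_of_lt_succ fun i => by
    have h1 := (hα2 i).2
    have h2 := (hα2 (i + 1)).1
    push_cast at h2
    linarith
  refine ⟨N, α, by exact_mod_cast hN0, ⟨hs.monotone, hα3 0 rfl, hα4 N rfl⟩, hs, fun i => ?_, hα1⟩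
  have h1 := (hα2 i).1
  have h2 := (hα2 (i + 1)).2
  push_cast at h2
  linarith

variable {C : ℝ} {n : ℕ} {x : ℕ → ℝ} {c : ℕ → E} {U : ℝ → E} {Y : ℝ → ℝ} {G : ℝ → E}

lemma Expansion.dev_integrableOn (ex : Expansion a b θ p σ Q R) (n : ℕ) (x : ℕ → ℝ) (c : ℕ → E) :
    IntegrableOn (dev n x c p) (Icc a b) := by
  have h1 : IntegrableOn (stepFun n x c) (Icc a b) := (stepFun_memLp 1).integrable le_rfl
  exact (h1.sub ex.p_cont.integrableOn_Icc).smul (n : ℝ)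

lemma Expansion.dev_memLp (ex : Expansion a b θ p σ Q R) (n : ℕ) (x : ℕ → ℝ) (c : ℕ → E) :
    MemLp (dev n x c p) 2 (volume.restrict (Icc a b)) :=
  ((stepFun_memLp 2).sub (memLp_of_continuousOn 2 ex.p_cont)).const_smul (n : ℝ)

lemma EnergyBounded.continuousOn (ex : Expansion a b θ p σ Q R) (hab : a < b)
    (h : EnergyBounded a b p R C n x c U Y G) : ContinuousOn G (Icc a b) :=
  (continuousOn_primitive_Icc hab.le (ex.dev_integrableOn n x c)).congr h.prim

/-- Coercivity: the energy controls the `L²` norm of the scaled derivative. -/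
lemma EnergyBounded.integral_sq_le (ex : Expansion a b θ p σ Q R) (hab : a < b)
    (h : EnergyBounded a b p R C n x c U Y G) : ∫ t in a..b, ‖dev n x c p t‖ ^ 2 ≤ C / θ := by
  have hn0 : (0 : ℝ) < n := by exact_mod_cast h.one_le
  have hGc := h.continuousOn ex hab
  obtain ⟨hm, M, hM⟩ := ex.xi_bound (n := n) (x := x) (c := c) hGc (n : ℝ)
  have i1 : IntegrableOn (fun t => ‖dev n x c p t‖ ^ 2) (Icc a b) :=
    (ex.dev_memLp n x c).integrable_norm_pow (by simp)
  have i2 := ex.R_int (fun t => (n : ℝ)⁻¹ • (G t, dev n x c p t)) (hm.const_smul (n : ℝ)⁻¹)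
    (‖(n : ℝ)⁻¹‖ * M) fun t ht => by rw [norm_smul]; gcongr; exact hM t ht
  rw [le_div_iff₀ ex.θ_pos]
  refine le_trans ?_ h.energy
  rw [mul_comm, ← intervalIntegral.integral_const_mul, ← intervalIntegral.integral_const_mul,
    ← integral_Icc_eq_interval hab.le, ← integral_Icc_eq_interval hab.le]
  refine setIntegral_mono_on (i1.const_mul _) (i2.const_mul _) measurableSet_Icc fun t ht => ?_
  have := ex.R_pos t ht ((n : ℝ)⁻¹ • (G t, dev n x c p t))
  rw [Prod.smul_snd, norm_smul, norm_inv, Real.norm_eq_abs, abs_of_pos hn0] at this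
  calc θ * ‖dev n x c p t‖ ^ 2 = (n : ℝ) ^ 2 * (θ * ((n : ℝ)⁻¹ * ‖dev n x c p t‖) ^ 2) := by
        field_simp
    _ ≤ _ := by gcongr

lemma norm_integral_le_young {F : Type*} [NormedAddCommGroup F] [NormedSpace ℝ F] {w : ℝ → F}
    (hw2 : IntegrableOn (fun t => ‖w t‖ ^ 2) (Icc a b)) {M s t : ℝ}
    (hM : ∫ t in a..b, ‖w t‖ ^ 2 ≤ M) (hab : a ≤ b) (hw : IntegrableOn w (Icc a b))
    (hs : s ∈ Icc a b) (ht : t ∈ Icc a b) (hst : s ≤ t) {η : ℝ} (hη : 0 < η) :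
    ‖∫ τ in s..t, w τ‖ ≤ (t - s) / η + η * M := by
  have hsub : Icc s t ⊆ Icc a b := Icc_subset_Icc hs.1 ht.2
  have i1 : IntervalIntegrable (fun τ => ‖w τ‖ ^ 2) volume s t := intervalIntegrable_of_Icc hw2 hs ht
  calc ‖∫ τ in s..t, w τ‖ ≤ ∫ τ in s..t, ‖w τ‖ := intervalIntegral.norm_integral_le_integral_norm hst
    _ ≤ ∫ τ in s..t, (1 / η + η * ‖w τ‖ ^ 2) := by
        refine intervalIntegral.integral_mono_on hst (intervalIntegrable_of_Icc hw hs ht).norm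
          ((by simp : IntervalIntegrable (fun _ => 1 / η) volume s t).add (i1.const_mul _))
          fun τ _ => ?_
        have h1 : 0 ≤ (1 - η * ‖w τ‖ ) ^ 2 / η := by positivity
        have h2 : (1 - η * ‖w τ‖ ) ^ 2 / η = 1 / η - 2 * ‖w τ‖ + η * ‖w τ‖ ^ 2 := by
          field_simp; ring
        have := norm_nonneg (w τ)
        linarith
    _ = (t - s) / η + η * ∫ τ in s..t, ‖w τ‖ ^ 2 := by
        rw [intervalIntegral.integral_add (by simp) (i1.const_mul _),
          intervalIntegral.integral_const_mul]
        simp [div_eq_mul_inv]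
    _ ≤ (t - s) / η + η * M := by
        gcongr
        refine le_trans ?_ hM
        rw [← integral_Icc_eq_interval hst, ← integral_Icc_eq_interval hab]
        exact setIntegral_mono_set hw2 (ae_of_all _ fun _ => sq_nonneg _)
          (LE.le.eventuallyLE hsub)

lemma EnergyBounded.sub_le (ex : Expansion a b θ p σ Q R) (hab : a < b)
    (h : EnergyBounded a b p R C n x c U Y G) {s t : ℝ} (hs : s ∈ Icc a b) (ht : t ∈ Icc a b)
    {η : ℝ} (hη : 0 < η) : ‖G t - G s‖ ≤ |t - s| / η + η * (C / θ) := by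
  have i1 : IntegrableOn (fun t => ‖dev n x c p t‖ ^ 2) (Icc a b) :=
    (ex.dev_memLp n x c).integrable_norm_pow (by simp)
  have hi := ex.dev_integrableOn n x c
  have ha := left_mem_Icc.2 hab.le
  wlog hst : s ≤ t generalizing s t
  · rw [norm_sub_rev, abs_sub_comm]
    exact this ht hs (le_of_not_ge hst)
  rw [h.prim t ht, h.prim s hs, intervalIntegral.integral_interval_sub_left
    (intervalIntegrable_of_Icc hi ha ht) (intervalIntegrable_of_Icc hi ha hs),
    abs_of_nonneg (sub_nonneg.2 hst)]
  exact norm_integral_le_young i1 (h.integral_sq_le ex hab) hab.le hi hs ht hst hη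

lemma EnergyBounded.C_nonneg (ex : Expansion a b θ p σ Q R) (hab : a < b)
    (h : EnergyBounded a b p R C n x c U Y G) : 0 ≤ C / θ :=
  (intervalIntegral.integral_nonneg hab.le fun _ _ => sq_nonneg _).trans (h.integral_sq_le ex hab)

lemma EnergyBounded.norm_le (ex : Expansion a b θ p σ Q R) (hab : a < b)
    (h : EnergyBounded a b p R C n x c U Y G) {t : ℝ} (ht : t ∈ Icc a b) :
    ‖G t‖ ≤ (b - a) + C / θ := by
  have ha := left_mem_Icc.2 hab.le
  have h1 := h.sub_le ex hab ha ht one_pos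
  have h2 : G a = 0 := by rw [h.prim a ha]; simp
  rw [h2, sub_zero, div_one, one_mul, abs_of_nonneg (by linarith [ht.1])] at h1
  linarith [ht.2]

lemma EnergyBounded.integral_xi_le (ex : Expansion a b θ p σ Q R) (hab : a < b)
    (h : EnergyBounded a b p R C n x c U Y G) :
    IntegrableOn (fun t => ‖((G t, dev n x c p t) : E × E)‖ ^ 2) (Icc a b) ∧
    ∫ t in a..b, ‖((G t, dev n x c p t) : E × E)‖ ^ 2 ≤
      (b - a) * ((b - a) + C / θ) ^ 2 + C / θ := by
  obtain ⟨hm, M, hM⟩ := ex.xi_bound (n := n) (x := x) (c := c) (h.continuousOn ex hab) (n : ℝ)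
  have i2 : IntegrableOn (fun t => ‖((G t, dev n x c p t) : E × E)‖ ^ 2) (Icc a b) := by
    refine bounded_integrable (M := M ^ 2) (hm.norm.pow 2) ?_
    rw [ae_restrict_iff' measurableSet_Icc]
    refine ae_of_all _ fun t ht => ?_
    rw [norm_pow, norm_norm]; gcongr; exact hM t ht
  refine ⟨i2, ?_⟩
  have i1 : IntegrableOn (fun t => ‖dev n x c p t‖ ^ 2) (Icc a b) :=
    (ex.dev_memLp n x c).integrable_norm_pow (by simp)
  have h3 := h.integral_sq_le ex hab
  have ha := left_mem_Icc.2 hab.le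
  have hb := right_mem_Icc.2 hab.le
  calc _ ≤ ∫ t in a..b, (((b - a) + C / θ) ^ 2 + ‖dev n x c p t‖ ^ 2) := by
        refine intervalIntegral.integral_mono_on hab.le (intervalIntegrable_of_Icc i2 ha hb)
          ((by simp : IntervalIntegrable (fun _ => ((b - a) + C / θ) ^ 2) volume a b).add
          (intervalIntegrable_of_Icc i1 ha hb)) fun t ht => ?_
        have h4 := h.norm_le ex hab ht
        rw [Prod.norm_def]
        rcases max_cases ‖G t‖ ‖dev n x c p t‖ with ⟨h5, _⟩ | ⟨h5, _⟩
        · simp only [h5]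
          have : ‖G t‖ ^ 2 ≤ ((b - a) + C / θ) ^ 2 := by gcongr
          nlinarith [sq_nonneg ‖dev n x c p t‖]
        · simp only [h5]
          nlinarith [sq_nonneg ((b - a) + C / θ)]
    _ = (b - a) * ((b - a) + C / θ) ^ 2 + ∫ t in a..b, ‖dev n x c p t‖ ^ 2 := by
        rw [intervalIntegral.integral_add (by simp) (intervalIntegrable_of_Icc i1 ha hb)]
        simp
    _ ≤ _ := by gcongr

end Macro

section LowerBound

variable {E : Type*} [NormedAddCommGroup E] [InnerProductSpace ℝ E] [CompleteSpace E]
variable {a b θ : ℝ} {p σ : ℝ → E} {Q : ℝ → E × E →L[ℝ] E × E →L[ℝ] ℝ} {R : ℝ → E × E → ℝ}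

lemma clm_prod_apply (T : E × E →L[ℝ] ℝ) (u v : E) : T (u, v) =
    (T.comp (ContinuousLinearMap.inl ℝ E E)) u + (T.comp (ContinuousLinearMap.inr ℝ E E)) v := by
  simp only [ContinuousLinearMap.comp_apply, ContinuousLinearMap.inl_apply,
    ContinuousLinearMap.inr_apply, ← map_add]
  simp

lemma integral_clm_prod (T : E × E →L[ℝ] ℝ) {g w : ℝ → E} {α β : ℝ}
    (hg : IntervalIntegrable g volume α β) (hw : IntervalIntegrable w volume α β) :
    ∫ t in α..β, T (g t, w t) = T (∫ t in α..β, g t, ∫ t in α..β, w t) := by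
  simp_rw [clm_prod_apply]
  rw [intervalIntegral.integral_add, ContinuousLinearMap.intervalIntegral_comp_comm _ hg,
    ContinuousLinearMap.intervalIntegral_comp_comm _ hw]
  · exact ⟨ContinuousLinearMap.integrable_comp _ hg.1, ContinuousLinearMap.integrable_comp _ hg.2⟩
  · exact ⟨ContinuousLinearMap.integrable_comp _ hw.1, ContinuousLinearMap.integrable_comp _ hw.2⟩

lemma WeakL2Tendsto.integral_tendsto {f : ℕ → ℝ → E} {F : ℝ → E} (h : WeakL2Tendsto a b f F)
    (hf : ∀ k, IntegrableOn (f k) (Icc a b)) (hF : IntegrableOn F (Icc a b)) {α β : ℝ}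
    (hα : a ≤ α) (hαβ : α ≤ β) (hβ : β ≤ b) (T : E →L[ℝ] ℝ) :
    Tendsto (fun k => T (∫ t in α..β, f k t)) atTop (𝓝 (T (∫ t in α..β, F t))) := by
  set v := (InnerProductSpace.toDual ℝ E).symm T with hv
  have hsub : Icc α β ⊆ Icc a b := Icc_subset_Icc hα hβ
  have hαI : α ∈ Icc a b := ⟨hα, hαβ.trans hβ⟩
  have hβI : β ∈ Icc a b := ⟨hα.trans hαβ, hβ⟩
  have h1 := h ((Icc α β).indicator fun _ => v)
    ((memLp_const v).indicator measurableSet_Icc)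
  have key : ∀ u : ℝ → E, IntegrableOn u (Icc a b) →
      ∫ t in Icc a b, inner ℝ (u t) ((Icc α β).indicator (fun _ => v) t) =
        T (∫ t in α..β, u t) := by
    intro u hu
    have e1 : ∀ t, inner ℝ (u t) ((Icc α β).indicator (fun _ => v) t) =
        (Icc α β).indicator (fun t => T (u t)) t := by
      intro t
      by_cases ht : t ∈ Icc α β
      · rw [indicator_of_mem ht, indicator_of_mem ht, real_inner_comm, hv]
        simp
      · rw [indicator_of_notMem ht, indicator_of_notMem ht, inner_zero_right]
    simp_rw [e1]
    rw [setIntegral_indicator measurableSet_Icc, inter_eq_right.2 hsub,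
      integral_Icc_eq_interval hαβ,
      ContinuousLinearMap.intervalIntegral_comp_comm _ (intervalIntegrable_of_Icc hu hαI hβI)]
  rw [key F hF] at h1
  exact h1.congr fun k => key _ (hf k)

variable {C : ℝ} {m : ℕ → ℕ} {x : ℕ → ℕ → ℝ} {c : ℕ → ℕ → E} {U : ℕ → ℝ → E} {Y : ℕ → ℝ → ℝ}
  {G : ℕ → ℝ → E} {g dg : ℝ → E}

/-- The lower bound on a macroscopic interval, in the limit of infinitely many mesh cells. -/
lemma Expansion.local_lower_bound (ex : Expansion a b θ p σ Q R) (hab : a < b)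
    (hE : ∀ k, EnergyBounded a b p R C (m k) (x k) (c k) (U k) (Y k) (G k))
    (hm : Tendsto m atTop atTop)
    (hG : WeakL2Tendsto a b G g)
    (hdG : WeakL2Tendsto a b (fun k => dev (m k) (x k) (c k) p) dg)
    (hg : IntegrableOn g (Icc a b)) (hdg : IntegrableOn dg (Icc a b))
    {ε δ : ℝ} (hε : 0 < ε) (hδ0 : 0 < δ)
    (hδ : ∀ x ∈ Icc a b, ∀ h : E × E, ‖h‖ ≤ δ → |R x h - 1 / 2 * Q x h h| ≤ ε * ‖h‖ ^ 2)
    {α β : ℝ} (hα : a ≤ α) (hαβ : α < β) (hβ : β ≤ b) {Λ S : ℝ} (hB : ‖Q α‖ ≤ Λ) (hσ : ‖σ α‖ ≤ S)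
    (hQ : ∀ x ∈ Icc α β, ‖Q x - Q α‖ ≤ ε)
    (hp : ∀ x ∈ Icc α β, ∀ y ∈ Icc α β, ‖p x - p y - (x - y) • σ α‖ ≤ ε * |x - y|)
    (hosc : ∀ x ∈ Icc α β, ∀ y ∈ Icc α β, ‖p x - p y‖ ≤ δ / 2)
    (hGosc : ∀ k, ∀ x ∈ Icc α β, ∀ y ∈ Icc α β, ‖G k x - G k y‖ ≤ ε)
    {yα yβ : ℝ} (hYα : Tendsto (fun k => Y k α) atTop (𝓝 yα))
    (hYβ : Tendsto (fun k => Y k β) atTop (𝓝 yβ)) {A : ℝ} (hA : 0 ≤ A) {ζ : E × E}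
    (hζ : ζ = (β - α)⁻¹ • (∫ t in α..β, g t, ∫ t in α..β, dg t)) {η : ℝ} (hη : 0 < η) :
    ∀ᶠ k in atTop, (1 / 2 * Q α ζ ζ + Q α (0, σ α) (0, σ α) * A ^ 2 / 8 -
        ε * (Λ * S * (A + A ^ 2))) * (β - α) -
      Q α (0, σ α) (0, σ α) * A ^ 3 / 12 * ((yβ - yα) / (b - a))
      - 2 * ε * (∫ t in α..β, ‖((G k t, dev (m k) (x k) (c k) p t) : E × E)‖ ^ 2) - η ≤
      (m k : ℝ) ^ 2 *
        ∫ t in α..β, R t ((m k : ℝ)⁻¹ • (G k t, dev (m k) (x k) (c k) p t)) := by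
  have hΛ : 0 ≤ Λ := (norm_nonneg _).trans hB
  have hℓ : 0 < β - α := sub_pos.2 hαβ
  have hαI : α ∈ Icc a b := ⟨hα, hαβ.le.trans hβ⟩
  have hβI : β ∈ Icc a b := ⟨hα.trans hαβ.le, hβ⟩
  have hsub : Icc α β ⊆ Icc a b := Icc_subset_Icc hα hβ
  have hmR : Tendsto (fun k => (m k : ℝ)) atTop atTop := tendsto_natCast_atTop_atTop.comp hm
  set b₀ := Q α (0, σ α) (0, σ α) with hb₀
  have hb0 : 0 ≤ b₀ := ex.Q_nonneg hαI _
  set C' := 4 * (b₀ * A ^ 2 / 8) / δ ^ 2 + 2 * Λ * ‖ζ‖ / δ with hC'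
  have hC0 : 0 ≤ C' := by positivity
  set M := (b - a) * ((b - a) + C / θ) ^ 2 + C / θ with hM
  have hGi : ∀ k, IntegrableOn (G k) (Icc a b) := fun k =>
    ((hE k).continuousOn ex hab).integrableOn_Icc
  have hdi : ∀ k, IntegrableOn (dev (m k) (x k) (c k) p) (Icc a b) := fun k =>
    ex.dev_integrableOn _ _ _
  -- the term that is linear in the competitor passes to the limit
  have t1 : Tendsto (fun k => ∫ t in α..β, Q α (G k t, dev (m k) (x k) (c k) p t) ζ) atTop
      (𝓝 (Q α ζ ζ * (β - α))) := by
    set T := (Q α).flip ζ with hT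
    have hTa : ∀ v, Q α v ζ = T v := fun v => rfl
    have e1 : Q α ζ ζ * (β - α) = T (∫ t in α..β, g t, ∫ t in α..β, dg t) := by
      have : (∫ t in α..β, g t, ∫ t in α..β, dg t) = (β - α) • ζ := by
        rw [hζ, smul_smul, mul_inv_cancel₀ hℓ.ne', one_smul]
      rw [this, map_smul, smul_eq_mul, hTa, mul_comm]
    rw [e1, clm_prod_apply]
    refine Tendsto.congr (fun k => ?_)
      ((hG.integral_tendsto hGi hg hα hαβ.le hβ (T.comp (ContinuousLinearMap.inl ℝ E E))).add
      (hdG.integral_tendsto hdi hdg hα hαβ.le hβ (T.comp (ContinuousLinearMap.inr ℝ E E))))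
    rw [← clm_prod_apply, ← integral_clm_prod T (intervalIntegrable_of_Icc (hGi k) hαI hβI)
      (intervalIntegrable_of_Icc (hdi k) hαI hβI)]
    rfl
  have t2 : Tendsto (fun k => b₀ * A ^ 3 / 12 * ((Y k β - Y k α) / (b - a) + 2 / (m k : ℝ))) atTop
      (𝓝 (b₀ * A ^ 3 / 12 * ((yβ - yα) / (b - a) + 0))) :=
    (((hYβ.sub hYα).div_const _).add (tendsto_const_nhds.div_atTop hmR)).const_mul _
  have t3 : Tendsto (fun k => C' / (m k : ℝ) * M) atTop (𝓝 (0 * M)) :=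
    (tendsto_const_nhds.div_atTop hmR).mul_const M
  have t4 := (t1.sub t2).sub t3
  have h1 := (tendsto_order.1 t4).1 (Q α ζ ζ * (β - α) - b₀ * A ^ 3 / 12 * ((yβ - yα) / (b - a) + 0)
    - 0 * M - η) (by linarith)
  have h2 := hmR.eventually_ge_atTop (((b - a) + C / θ) / δ)
  filter_upwards [h1, h2] with k h1 h2
  have hk := hE k
  have hGn : ∀ t ∈ Icc α β, ‖G k t‖ ≤ m k * δ := fun t ht => by
    rw [div_le_iff₀ hδ0] at h2
    exact (hk.norm_le ex hab (hsub ht)).trans h2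
  have h3 := ex.macro_bound hab hε hδ0 hδ hα hαβ.le hβ hk.one_le hk.data (hk.continuousOn ex hab) hB
    hσ hQ hp (hGosc k) hGn hosc hA ζ
  have h4 := hk.integral_xi_le ex hab
  have h5 : ∫ t in α..β, ‖((G k t, dev (m k) (x k) (c k) p t) : E × E)‖ ^ 2 ≤ M := by
    refine le_trans ?_ h4.2
    rw [← integral_Icc_eq_interval hαβ.le, ← integral_Icc_eq_interval hab.le]
    exact setIntegral_mono_set h4.1 (ae_of_all _ fun _ => sq_nonneg _) (LE.le.eventuallyLE hsub)
  have h6 : C' / (m k : ℝ) * (∫ t in α..β, ‖((G k t, dev (m k) (x k) (c k) p t) : E × E)‖ ^ 2) ≤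
      C' / (m k : ℝ) * M := mul_le_mul_of_nonneg_left h5 (by positivity)
  simp only [← hb₀, ← hC'] at h3
  simp only [dev] at h1 h6 ⊢
  nlinarith

/-- On fine partitions, the piecewise constant approximation of the limit functional is bounded by
the energy. The nodes are points of convergence of `Y`, so that the increments of `Y k` converge. -/
lemma Expansion.exists_partition (ex : Expansion a b θ p σ Q R) (hab : a < b)
    (hE : ∀ k, EnergyBounded a b p R C (m k) (x k) (c k) (U k) (Y k) (G k))
    (hm : Tendsto m atTop atTop)
    (hG : WeakL2Tendsto a b G g)
    (hdG : WeakL2Tendsto a b (fun k => dev (m k) (x k) (c k) p) dg)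
    (hg : IntegrableOn g (Icc a b)) (hdg : IntegrableOn dg (Icc a b))
    {Y₀ : ℝ → ℝ} (hY₀ : NMono a b Y₀) (hY : ∀ᵐ t, Tendsto (fun k => Y k t) atTop (𝓝 (Y₀ t)))
    {κ : ℝ} (hκ : 0 < κ) : ∃ (N : ℕ) (α : ℕ → ℝ), 1 ≤ N ∧ IsNodes a b N α ∧ StrictMono α ∧
      (∀ i, α (i + 1) - α i ≤ κ) ∧ ∀ ζ : ℕ → E × E,
      (∀ i, ζ i = (α (i + 1) - α i)⁻¹ •
        (∫ t in α i..α (i + 1), g t, ∫ t in α i..α (i + 1), dg t)) →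
      ∑ i ∈ Finset.range N, (1 / 2 * Q (α i) (ζ i) (ζ i) + Q (α i) (0, σ (α i)) (0, σ (α i)) *
        ((b - a) / ((Y₀ (α (i + 1)) - Y₀ (α i)) / (α (i + 1) - α i) + κ)) ^ 2 / 24) *
          (α (i + 1) - α i) ≤ C + κ := by
  have hH : 0 < b - a := sub_pos.2 hab
  obtain ⟨Λ, S, hΛ, hS, hbd⟩ := ex.bounds hab
  have hCθ : 0 ≤ C / θ := (hE 0).C_nonneg ex hab
  set M := (b - a) * ((b - a) + C / θ) ^ 2 + C / θ with hM
  have hM0 : 0 ≤ M := by positivity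
  set P := Λ * S * ((b - a) / κ + ((b - a) / κ) ^ 2) * (b - a) + 2 * M with hP
  have hP0 : 0 ≤ P := by positivity
  -- `P` collects the factors of `ε` in the error terms
  set ε := κ / (2 * (P + 1)) with hε
  have hε0 : 0 < ε := by positivity
  have hεP : ε * P ≤ κ / 2 := by
    have : ε * (P + 1) = κ / 2 := by rw [hε]; field_simp
    nlinarith
  obtain ⟨δ, hδ0, hδ1, hδ⟩ := ex.R_approx ε hε0
  obtain ⟨h, hh0, hh⟩ := ex.exists_scale hε0 (half_pos hδ0)
  -- with this parameter in Young's inequality, `G k` oscillates by at most `ε` on a cell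
  set η₁ := ε / (2 * (C / θ + 1)) with hη₁
  have hη₁0 : 0 < η₁ := by positivity
  obtain ⟨N, α, hN, hα, hαs, hαh, hαD⟩ := exists_nodes_mem hab
    (D := {t | Tendsto (fun k => Y k t) atTop (𝓝 (Y₀ t))}) hY
    (by
      have : ∀ k, Y k a = Y₀ a := fun k => by
        rw [(hE k).data.nmono.left a le_rfl, hY₀.left a le_rfl]
      change Tendsto _ _ _
      simp_rw [this]; exact tendsto_const_nhds)
    (by
      have : ∀ k, Y k b = Y₀ b := fun k => by
        rw [(hE k).data.nmono.right b le_rfl, hY₀.right b le_rfl]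
      change Tendsto _ _ _
      simp_rw [this]; exact tendsto_const_nhds)
    (h := min κ (min h (ε / 2 * η₁))) (by positivity)
  refine ⟨N, α, hN, hα, hαs, fun i => (hαh i).trans (min_le_left _ _), fun ζ hζ => ?_⟩
  -- `T i` is the expected value of `n` times the length of a mesh cell in `[α i, α (i + 1)]`; by `hTY`
  -- the cubic term of the local bound is at most `T i ^ 2 / 12`, and `1 / 8 - 1 / 12 = 1 / 24`
  set T : ℕ → ℝ := fun i => (b - a) / ((Y₀ (α (i + 1)) - Y₀ (α i)) / (α (i + 1) - α i) + κ) with hT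
  have hℓ : ∀ i, 0 < α (i + 1) - α i := fun i => sub_pos.2 (hαs (Nat.lt_succ_self i))
  have hΔ : ∀ i, 0 ≤ (Y₀ (α (i + 1)) - Y₀ (α i)) / (α (i + 1) - α i) := fun i =>
    div_nonneg (sub_nonneg.2 (hY₀.mono (hαs (Nat.lt_succ_self i)).le)) (hℓ i).le
  have hT0 : ∀ i, 0 ≤ T i := fun i => by
    have := hΔ i
    have := hκ.le
    exact div_nonneg hH.le (by linarith)
  have hTle : ∀ i, T i ≤ (b - a) / κ := fun i =>
    div_le_div_of_nonneg_left hH.le hκ (by linarith [hΔ i])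
  have hTY : ∀ i, T i * ((Y₀ (α (i + 1)) - Y₀ (α i)) / (b - a)) ≤ α (i + 1) - α i := fun i => by
    have h0 := hΔ i
    have h2 : Y₀ (α (i + 1)) - Y₀ (α i) =
      (Y₀ (α (i + 1)) - Y₀ (α i)) / (α (i + 1) - α i) * (α (i + 1) - α i) :=
      (div_mul_cancel₀ _ (hℓ i).ne').symm
    have hTi : T i = (b - a) / ((Y₀ (α (i + 1)) - Y₀ (α i)) / (α (i + 1) - α i) + κ) := rfl
    generalize (Y₀ (α (i + 1)) - Y₀ (α i)) / (α (i + 1) - α i) = q at h0 h2 hTi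
    rw [hTi, h2]
    have h3 : (b - a) / (q + κ) * (q * (α (i + 1) - α i) / (b - a)) =
        q / (q + κ) * (α (i + 1) - α i) := by
      have : q + κ ≠ 0 := by positivity
      field_simp
    rw [h3]
    refine mul_le_of_le_one_left (hℓ i).le ?_
    exact div_le_one_of_le₀ (by linarith) (by linarith)
  set bb : ℕ → ℝ := fun i => Q (α i) (0, σ (α i)) (0, σ (α i)) with hbb
  have hηN : 0 < κ / (2 * N) := by
    have : (0 : ℝ) < N := by exact_mod_cast hN
    positivity
  have hloc : ∀ i ∈ Finset.range N, ∀ᶠ k in atTop,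
      (1 / 2 * Q (α i) (ζ i) (ζ i) + bb i * T i ^ 2 / 8 -
        ε * (Λ * S * (T i + T i ^ 2))) * (α (i + 1) - α i) -
      bb i * T i ^ 3 / 12 * ((Y₀ (α (i + 1)) - Y₀ (α i)) / (b - a))
      - 2 * ε * (∫ t in α i..α (i + 1), ‖((G k t, dev (m k) (x k) (c k) p t) : E × E)‖ ^ 2)
      - κ / (2 * N) ≤
      (m k : ℝ) ^ 2 *
        ∫ t in α i..α (i + 1), R t ((m k : ℝ)⁻¹ • (G k t, dev (m k) (x k) (c k) p t)) := by
    intro i hi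
    rw [Finset.mem_range] at hi
    have i1 := hα.mem_Icc' hi.le
    have i2 := hα.mem_Icc' (Nat.succ_le_of_lt hi)
    have i3 := hαs (Nat.lt_succ_self i)
    obtain ⟨s1, s2, s3⟩ := hh (α i) (α (i + 1)) i1.1 i3.le i2.2
      ((hαh i).trans ((min_le_right _ _).trans (min_le_left _ _)))
    refine ex.local_lower_bound hab hE hm hG hdG hg hdg hε0 hδ0 hδ i1.1 i3 i2.2 (hbd _ i1).1
      (hbd _ i1).2 s1 s2 s3 (fun k t ht t' ht' => ?_) (hαD i) (hαD (i + 1)) (hT0 i) (hζ i) hηN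
    have hsub : Icc (α i) (α (i + 1)) ⊆ Icc a b := Icc_subset_Icc i1.1 i2.2
    have h1 := (hE k).sub_le ex hab (hsub ht') (hsub ht) hη₁0
    have h2 : |t - t'| ≤ ε / 2 * η₁ := by
      have h3 : α (i + 1) - α i ≤ ε / 2 * η₁ :=
        (hαh i).trans ((min_le_right _ _).trans (min_le_right _ _))
      rw [abs_le]; constructor <;> linarith [ht.1, ht.2, ht'.1, ht'.2]
    have h3 : |t - t'| / η₁ ≤ ε / 2 := by rw [div_le_iff₀ hη₁0]; exact h2
    have h4 : η₁ * (C / θ) ≤ ε / 2 := by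
      have : η₁ * (C / θ + 1) = ε / 2 := by rw [hη₁]; field_simp
      nlinarith
    linarith
  obtain ⟨k, hk⟩ := ((Finset.eventually_all _).2 hloc).exists
  have hEk := hE k
  have hX := hEk.integral_xi_le ex hab
  have hRint : IntegrableOn (fun t => R t ((m k : ℝ)⁻¹ • (G k t, dev (m k) (x k) (c k) p t)))
      (Icc a b) := by
    obtain ⟨hxm, K, hK⟩ := ex.xi_bound (n := m k) (x := x k) (c := c k)
      (hEk.continuousOn ex hab) (m k : ℝ)
    exact ex.R_int (fun t => (m k : ℝ)⁻¹ • (G k t, dev (m k) (x k) (c k) p t))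
      (hxm.const_smul (m k : ℝ)⁻¹)
      (‖(m k : ℝ)⁻¹‖ * K) fun t ht => by rw [norm_smul]; gcongr; exact hK t ht
  have hcell : ∀ i ∈ Finset.range N, (1 / 2 * Q (α i) (ζ i) (ζ i) + bb i * T i ^ 2 / 24) *
      (α (i + 1) - α i) ≤ (m k : ℝ) ^ 2 *
        (∫ t in α i..α (i + 1), R t ((m k : ℝ)⁻¹ • (G k t, dev (m k) (x k) (c k) p t))) +
      2 * ε * (∫ t in α i..α (i + 1), ‖((G k t, dev (m k) (x k) (c k) p t) : E × E)‖ ^ 2) +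
      ε * (Λ * S * ((b - a) / κ + ((b - a) / κ) ^ 2)) * (α (i + 1) - α i) + κ / (2 * N) := by
    intro i hi
    have h1 := hk i hi
    have hiN := Finset.mem_range.1 hi
    have hb0 : 0 ≤ bb i := ex.Q_nonneg (hα.mem_Icc' hiN.le) _
    have h2 : bb i * T i ^ 3 / 12 * ((Y₀ (α (i + 1)) - Y₀ (α i)) / (b - a)) ≤
        bb i * T i ^ 2 / 12 * (α (i + 1) - α i) := by
      calc _ = bb i * T i ^ 2 / 12 * (T i * ((Y₀ (α (i + 1)) - Y₀ (α i)) / (b - a))) := by ring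
        _ ≤ _ := by
          have := hT0 i
          exact mul_le_mul_of_nonneg_left (hTY i) (by positivity)
    have h3 : ε * (Λ * S * (T i + T i ^ 2)) * (α (i + 1) - α i) ≤
        ε * (Λ * S * ((b - a) / κ + ((b - a) / κ) ^ 2)) * (α (i + 1) - α i) := by
      have h4 := hTle i
      have h5 := hT0 i
      have h6 := (hℓ i).le
      gcongr
    linarith
  refine (Finset.sum_le_sum hcell).trans ?_
  simp only [Finset.sum_add_distrib, ← Finset.mul_sum, Finset.sum_const, Finset.card_range,
    nsmul_eq_mul]
  rw [hα.sum_integral hRint, hα.sum_integral hX.1, Finset.sum_range_sub, hα.last, hα.zero]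
  have e1 : (N : ℝ) * (κ / (2 * N)) = κ / 2 := by
    have : (N : ℝ) ≠ 0 := by positivity
    field_simp
  rw [e1]
  have h1 := hEk.energy
  have h2 : 2 * ε * (∫ t in a..b, ‖((G k t, dev (m k) (x k) (c k) p t) : E × E)‖ ^ 2) ≤
      2 * ε * M := mul_le_mul_of_nonneg_left hX.2 (by positivity)
  have h3 : ε * P = ε * (Λ * S * ((b - a) / κ + ((b - a) / κ) ^ 2)) * (b - a) + 2 * ε * M := by
    rw [hP]; ring
  linarith

end LowerBound

/-! ### Passage to the limit in the lower bound -/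

section Fatou

variable {E : Type*} [NormedAddCommGroup E] [InnerProductSpace ℝ E] [CompleteSpace E]
variable {a b θ : ℝ} {p σ : ℝ → E} {Q : ℝ → E × E →L[ℝ] E × E →L[ℝ] ℝ} {R : ℝ → E × E → ℝ}

/-- Difference quotients over shrinking intervals that contain a point of differentiability. -/
lemma tendsto_straddle {F : Type*} [NormedAddCommGroup F] [NormedSpace ℝ F] {f : ℝ → F} {d : F}
    {t : ℝ} (hf : HasDerivAt f d t) {α β : ℕ → ℝ} (hα : Tendsto α atTop (𝓝 t))
    (hβ : Tendsto β atTop (𝓝 t)) (h1 : ∀ j, α j ≤ t) (h2 : ∀ j, t ≤ β j) (h3 : ∀ j, α j < β j) :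
    Tendsto (fun j => (β j - α j)⁻¹ • (f (β j) - f (α j))) atTop (𝓝 d) := by
  rw [hasDerivAt_iff_isLittleO, Asymptotics.isLittleO_iff] at hf
  rw [tendsto_iff_norm_sub_tendsto_zero, Metric.tendsto_nhds]
  intro ε hε
  have h4 := hf (half_pos hε)
  filter_upwards [hα.eventually h4, hβ.eventually h4] with j h5 h6
  have hℓ : 0 < β j - α j := sub_pos.2 (h3 j)
  have e : (β j - α j)⁻¹ • (f (β j) - f (α j)) - d = (β j - α j)⁻¹ •
      ((f (β j) - f t - (β j - t) • d) - (f (α j) - f t - (α j - t) • d)) := by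
    have e1 : (f (β j) - f t - (β j - t) • d) - (f (α j) - f t - (α j - t) • d) =
      (f (β j) - f (α j)) - (β j - α j) • d := by
      simp only [sub_smul]; abel
    rw [e1, smul_sub _ (f (β j) - f (α j)), smul_smul, inv_mul_cancel₀ hℓ.ne', one_smul]
  rw [Real.dist_eq, sub_zero, abs_norm, e, norm_smul, norm_inv, Real.norm_eq_abs, abs_of_pos hℓ]
  rw [Real.norm_eq_abs, abs_of_nonneg (sub_nonneg.2 (h2 j))] at h6
  rw [Real.norm_eq_abs, abs_of_nonpos (sub_nonpos.2 (h1 j))] at h5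
  have h7 := norm_sub_le (f (β j) - f t - (β j - t) • d) (f (α j) - f t - (α j - t) • d)
  have h8 : (β j - α j)⁻¹ * ‖(f (β j) - f t - (β j - t) • d) - (f (α j) - f t - (α j - t) • d)‖ ≤
      (β j - α j)⁻¹ * (ε / 2 * (β j - α j)) := by gcongr; linarith
  have h9 : (β j - α j)⁻¹ * (ε / 2 * (β j - α j)) = ε / 2 := by field_simp
  linarith

lemma tendsto_clm_apply {V W ι : Type*} [NormedAddCommGroup V] [NormedSpace ℝ V]
    [NormedAddCommGroup W] [NormedSpace ℝ W] {l : Filter ι} {T : ι → V →L[ℝ] W} {v : ι → V}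
    {T₀ : V →L[ℝ] W} {v₀ : V} (hT : Tendsto T l (𝓝 T₀)) (hv : Tendsto v l (𝓝 v₀)) :
    Tendsto (fun j => T j (v j)) l (𝓝 (T₀ v₀)) :=
  (isBoundedBilinearMap_apply (𝕜 := ℝ) (E := V) (F := W)).continuous.continuousAt.tendsto.comp
    (hT.prodMk_nhds hv)

lemma IsNodes.exists_Ico {N : ℕ} {α : ℕ → ℝ} (hα : IsNodes a b N α) (hN : 1 ≤ N) {t : ℝ}
    (ht : t ∈ Ico a b) : ∃ i < N, t ∈ Ico (α i) (α (i + 1)) := by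
  obtain ⟨i, hi, hti⟩ := hα.exists_cell ⟨ht.1, ht.2.le⟩ hN
  rcases hti.2.eq_or_lt with heq | hlt
  · -- pass to the last node with the same value
    have hlast : t < α N := by rw [hα.last]; exact ht.2
    have hex : ∃ k, t < α (k + 1) := ⟨N, hlast.trans_le (hα.mono (Nat.le_succ N))⟩
    classical
    have h1 := Nat.find_spec hex
    have h2 : ∀ k < Nat.find hex, α (k + 1) ≤ t := fun k hk => not_lt.1 (Nat.find_min hex hk)
    refine ⟨Nat.find hex, ?_, ?_, h1⟩
    · obtain ⟨M, rfl⟩ : ∃ M, N = M + 1 := ⟨N - 1, by omega⟩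
      exact Nat.lt_succ_of_le (Nat.find_min' hex hlast)
    · rcases Nat.eq_zero_or_pos (Nat.find hex) with h0 | hpos
      · rw [h0, hα.zero]; exact ht.1
      · have := h2 (Nat.find hex - 1) (by omega)
        rwa [Nat.sub_add_cancel hpos] at this
  · exact ⟨i, hi, hti.1, hlt⟩

lemma integral_stepFun {N : ℕ} {α : ℕ → ℝ} (hα : IsNodes a b N α) (φ : ℕ → ℝ) :
    ∫ t in a..b, stepFun N α φ t = ∑ i ∈ Finset.range N, φ i * (α (i + 1) - α i) := by
  have hi : IntegrableOn (stepFun N α φ) (Icc a b) := (stepFun_memLp 1).integrable le_rfl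
  rw [← hα.sum_integral hi]
  refine Finset.sum_congr rfl fun i hi => ?_
  have h := hα.mono (Nat.le_succ i)
  rw [integral_stepFun_cell hα.mono (Finset.mem_range.1 hi) (left_mem_Icc.2 h)
    (right_mem_Icc.2 h) h, smul_eq_mul, mul_comm]

variable {C : ℝ} {m : ℕ → ℕ} {x : ℕ → ℕ → ℝ} {c : ℕ → ℕ → E} {U : ℕ → ℝ → E} {Y : ℕ → ℝ → ℝ}
  {G : ℕ → ℝ → E} {g dg : ℝ → E}

/-- The lower bound: energy bounds pass to the limit functional. -/
theorem Expansion.lower_bound (ex : Expansion a b θ p σ Q R) (hab : a < b)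
    (hE : ∀ k, EnergyBounded a b p R C (m k) (x k) (c k) (U k) (Y k) (G k))
    (hm : Tendsto m atTop atTop)
    (hG : WeakL2Tendsto a b G g)
    (hdG : WeakL2Tendsto a b (fun k => dev (m k) (x k) (c k) p) dg)
    (hg : IntegrableOn g (Icc a b)) (hdg : IntegrableOn dg (Icc a b))
    {Y₀ : ℝ → ℝ} (hY₀ : NMono a b Y₀) (hY : ∀ᵐ t, Tendsto (fun k => Y k t) atTop (𝓝 (Y₀ t)))
    {ρ : ℝ → ℝ} (hρ : ∀ᵐ t, HasDerivAt Y₀ (ρ t) t) :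
    ∫⁻ t in Icc a b, (ENNReal.ofReal (1 / 2 * Q t (g t, dg t) (g t, dg t)) +
      ENNReal.ofReal ((b - a) ^ 2 / 24) *
        (ENNReal.ofReal (Q t (0, σ t) (0, σ t)) / ENNReal.ofReal |ρ t| ^ 2)) ≤
      ENNReal.ofReal C := by
  have hH : 0 < b - a := sub_pos.2 hab
  set κ : ℕ → ℝ := fun j => 1 / ((j : ℝ) + 1) with hκ
  have hκ0 : ∀ j, 0 < κ j := fun j => by simp only [hκ]; positivity
  have hκt : Tendsto κ atTop (𝓝 0) := tendsto_one_div_add_atTop_nhds_zero_nat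
  choose N α hN hα hαs hαh hsum using fun j =>
    ex.exists_partition hab hE hm hG hdG hg hdg hY₀ hY (hκ0 j)
  set ζ : ℕ → ℕ → E × E := fun j i => (α j (i + 1) - α j i)⁻¹ •
    (∫ t in α j i..α j (i + 1), g t, ∫ t in α j i..α j (i + 1), dg t) with hζ
  set q : ℕ → ℕ → ℝ := fun j i => (Y₀ (α j (i + 1)) - Y₀ (α j i)) / (α j (i + 1) - α j i) with hq
  set φ : ℕ → ℕ → ℝ := fun j i => 1 / 2 * Q (α j i) (ζ j i) (ζ j i) +
    Q (α j i) (0, σ (α j i)) (0, σ (α j i)) * ((b - a) / (q j i + κ j)) ^ 2 / 24 with hφ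
  have hφ0 : ∀ j, ∀ i < N j, 0 ≤ φ j i := fun j i hi => by
    have h1 := ex.Q_nonneg ((hα j).mem_Icc' hi.le) (ζ j i)
    have h2 := ex.Q_nonneg ((hα j).mem_Icc' hi.le) (0, σ (α j i))
    positivity
  have hΦ0 : ∀ j t, 0 ≤ stepFun (N j) (α j) (φ j) t := fun j t =>
    Finset.sum_nonneg fun i hi => indicator_nonneg (fun _ _ => hφ0 j i (Finset.mem_range.1 hi)) _
  have hint : ∀ j, ∫⁻ t in Icc a b, ENNReal.ofReal (stepFun (N j) (α j) (φ j) t) ≤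
      ENNReal.ofReal (C + κ j) := fun j => by
    have hi : IntegrableOn (stepFun (N j) (α j) (φ j)) (Icc a b) :=
      (stepFun_memLp 1).integrable le_rfl
    rw [← ofReal_integral_eq_lintegral_ofReal hi (ae_of_all _ (hΦ0 j)),
      integral_Icc_eq_interval hab.le, integral_stepFun (hα j)]
    exact ENNReal.ofReal_le_ofReal (hsum j (ζ j) fun i => rfl)
  have hlim : Tendsto (fun j => ENNReal.ofReal (C + κ j)) atTop (𝓝 (ENNReal.ofReal C)) := by
    have := (tendsto_const_nhds (x := C)).add hκt
    rw [add_zero] at this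
    exact ENNReal.tendsto_ofReal this
  -- Fatou's lemma
  refine le_trans ?_ ((lintegral_liminf_le (μ := volume.restrict (Icc a b))
    (f := fun j t => ENNReal.ofReal (stepFun (N j) (α j) (φ j) t)) (u := atTop)
    fun j => stepFun_stronglyMeasurable.measurable.ennreal_ofReal).trans
    ((liminf_le_liminf (Eventually.of_forall hint)).trans_eq hlim.liminf_eq))
  refine lintegral_mono_ae ?_
  have haI := left_mem_Icc.2 hab.le
  have hbI := right_mem_Icc.2 hab.le
  have hne : ∀ᵐ t : ℝ, t ≠ b := by simp [ae_iff]
  rw [ae_restrict_iff' measurableSet_Icc]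
  filter_upwards [(intervalIntegrable_of_Icc hg haI hbI).ae_hasDerivAt_integral,
    (intervalIntegrable_of_Icc hdg haI hbI).ae_hasDerivAt_integral, hρ, hne]
    with t d1 d2 d3 htb htI
  rw [uIcc_of_le hab.le] at d1 d2
  have d1 := d1 htI a haI
  have d2 := d2 htI a haI
  choose i hiN hi using fun j => (hα j).exists_Ico (hN j) ⟨htI.1, lt_of_le_of_ne htI.2 htb⟩
  set A : ℕ → ℝ := fun j => α j (i j) with hA
  set B : ℕ → ℝ := fun j => α j (i j + 1) with hB
  have hAB : ∀ j, A j < B j := fun j => hαs j (Nat.lt_succ_self _)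
  have hAI : ∀ j, A j ∈ Icc a b := fun j => (hα j).mem_Icc' (hiN j).le
  have hBI : ∀ j, B j ∈ Icc a b := fun j => (hα j).mem_Icc' (hiN j)
  have hAt : Tendsto A atTop (𝓝 t) := by
    have : Tendsto (fun j => t - κ j) atTop (𝓝 (t - 0)) := tendsto_const_nhds.sub hκt
    rw [sub_zero] at this
    refine tendsto_of_tendsto_of_tendsto_of_le_of_le this tendsto_const_nhds (fun j => ?_)
      fun j => (hi j).1
    have h1 := hαh j (i j)
    have h2 := (hi j).2
    simp only [hA]; linarith
  have hBt : Tendsto B atTop (𝓝 t) := by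
    have : Tendsto (fun j => t + κ j) atTop (𝓝 (t + 0)) := tendsto_const_nhds.add hκt
    rw [add_zero] at this
    refine tendsto_of_tendsto_of_tendsto_of_le_of_le tendsto_const_nhds this
      (fun j => (hi j).2.le) fun j => ?_
    have h1 := hαh j (i j)
    have h2 := (hi j).1
    simp only [hB]; linarith
  have hAt' : Tendsto A atTop (𝓝[Icc a b] t) :=
    tendsto_nhdsWithin_iff.2 ⟨hAt, Eventually.of_forall hAI⟩
  have hst : ∀ {F : Type _} [NormedAddCommGroup F] [NormedSpace ℝ F] {f : ℝ → F} {d : F},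
      HasDerivAt f d t → Tendsto (fun j => (B j - A j)⁻¹ • (f (B j) - f (A j))) atTop (𝓝 d) :=
    fun hf => tendsto_straddle hf hAt hBt (fun j => (hi j).1) (fun j => (hi j).2.le) hAB
  have hζt : Tendsto (fun j => ζ j (i j)) atTop (𝓝 (g t, dg t)) := by
    refine Tendsto.congr (fun j => ?_) ((hst d1).prodMk_nhds (hst d2))
    rw [intervalIntegral.integral_interval_sub_left (intervalIntegrable_of_Icc hg haI (hBI j))
      (intervalIntegrable_of_Icc hg haI (hAI j)),
      intervalIntegral.integral_interval_sub_left (intervalIntegrable_of_Icc hdg haI (hBI j))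
      (intervalIntegrable_of_Icc hdg haI (hAI j))]
    rfl
  have hqt : Tendsto (fun j => q j (i j)) atTop (𝓝 (ρ t)) := by
    refine Tendsto.congr (fun j => ?_) (tendsto_straddle d3 hAt hBt (fun j => (hi j).1)
      (fun j => (hi j).2.le) hAB)
    rw [smul_eq_mul, inv_mul_eq_div]
  have hq0 : ∀ j, 0 ≤ q j (i j) := fun j =>
    div_nonneg (sub_nonneg.2 (hY₀.mono (hAB j).le)) (sub_nonneg.2 (hAB j).le)
  have hρ0 : 0 ≤ ρ t := ge_of_tendsto' hqt hq0
  have hQt : Tendsto (fun j => Q (A j)) atTop (𝓝 (Q t)) := (ex.Q_cont t htI).tendsto.comp hAt'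
  have hσt : Tendsto (fun j => σ (A j)) atTop (𝓝 (σ t)) := (ex.σ_cont t htI).tendsto.comp hAt'
  have T1 : Tendsto (fun j => ENNReal.ofReal (1 / 2 * Q (A j) (ζ j (i j)) (ζ j (i j)))) atTop
      (𝓝 (ENNReal.ofReal (1 / 2 * Q t (g t, dg t) (g t, dg t)))) :=
    ENNReal.tendsto_ofReal ((tendsto_clm_apply (tendsto_clm_apply hQt hζt) hζt).const_mul _)
  have h0σ : Tendsto (fun j => ((0, σ (A j)) : E × E)) atTop (𝓝 (0, σ t)) :=
    tendsto_const_nhds.prodMk_nhds hσt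
  have T2 : Tendsto (fun j => Q (A j) (0, σ (A j)) (0, σ (A j))) atTop
      (𝓝 (Q t (0, σ t) (0, σ t))) := tendsto_clm_apply (tendsto_clm_apply hQt h0σ) h0σ
  have hval : ∀ j, stepFun (N j) (α j) (φ j) t = φ j (i j) := fun j =>
    stepFun_apply (hα j).mono (hiN j) (hi j)
  have hsplit : ∀ j, ENNReal.ofReal (stepFun (N j) (α j) (φ j) t) =
      ENNReal.ofReal (1 / 2 * Q (A j) (ζ j (i j)) (ζ j (i j))) +
      ENNReal.ofReal ((b - a) ^ 2 / 24) * (ENNReal.ofReal (Q (A j) (0, σ (A j)) (0, σ (A j))) /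
        ENNReal.ofReal (q j (i j) + κ j) ^ 2) := fun j => by
    have h1 := ex.Q_nonneg (hAI j) (ζ j (i j))
    have h2 := ex.Q_nonneg (hAI j) (0, σ (A j))
    have h3 : 0 < q j (i j) + κ j := by linarith [hq0 j, hκ0 j]
    rw [hval, hφ, ENNReal.ofReal_add (by positivity) (by positivity), ← ENNReal.ofReal_pow h3.le,
      ← ENNReal.ofReal_div_of_pos (by positivity), ← ENNReal.ofReal_mul (by positivity)]
    congr 2
    simp only [hA, div_pow]
    field_simp
  simp_rw [hsplit]
  by_cases hb : Q t (0, σ t) (0, σ t) = 0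
  · rw [hb, ENNReal.ofReal_zero, ENNReal.zero_div, mul_zero, add_zero, ← T1.liminf_eq]
    exact liminf_le_liminf (Eventually.of_forall fun j => le_self_add)
  · have hbpos : 0 < Q t (0, σ t) (0, σ t) := lt_of_le_of_ne (ex.Q_nonneg htI _) (Ne.symm hb)
    have T3 : Tendsto (fun j => ENNReal.ofReal (q j (i j) + κ j) ^ 2) atTop
        (𝓝 (ENNReal.ofReal |ρ t| ^ 2)) := by
      have := hqt.add hκt
      rw [add_zero] at this
      rw [abs_of_nonneg hρ0]
      exact (ENNReal.continuous_pow 2).continuousAt.tendsto.comp (ENNReal.tendsto_ofReal this)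
    have T4 := ENNReal.Tendsto.div (ENNReal.tendsto_ofReal T2)
      (Or.inl (by simpa using hbpos)) T3 (Or.inl (by simp))
    exact (T1.add (ENNReal.Tendsto.const_mul T4 (Or.inr ENNReal.ofReal_ne_top))).liminf_eq.ge

end Fatou

/-! ### Meshes with a prescribed asymptotic density -/

section MeshConstruction

variable {a b : ℝ} {Y : ℝ → ℝ}

/-- The convex combination of `Y` and the identity, whose inverse is Lipschitz continuous. -/
noncomputable def mixId (l : ℝ) (Y : ℝ → ℝ) (t : ℝ) : ℝ := (1 - l) * Y t + l * t

lemma mixId_sub_ge {l : ℝ} (hl1 : l ≤ 1) (hY : NMono a b Y) {s t : ℝ} (hst : s ≤ t) :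
    l * (t - s) ≤ mixId l Y t - mixId l Y s := by
  have h1 := hY.mono hst
  have h2 : 0 ≤ (1 - l) * (Y t - Y s) := mul_nonneg (by linarith) (by linarith)
  simp only [mixId]
  linarith

lemma node_succ_sub (a b : ℝ) (n i : ℕ) : node a b n (i + 1) - node a b n i = (b - a) / n := by
  simp only [node, Nat.cast_add, Nat.cast_one]; ring

/-- The mesh obtained by inverting `(1 - l) Y + l id` on the uniform grid. -/
lemma NMono.exists_mesh (hab : a < b) (hY : NMono a b Y) {l : ℝ} (hl : 0 < l) (hl1 : l ≤ 1) {n : ℕ}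
    (hn : 1 ≤ n) : ∃ x : ℕ → ℝ, IsNodes a b n x ∧
      (∀ i, x (i + 1) - x i ≤ (b - a) / (n * l)) ∧
      (∀ i, ∫ t in x i..x (i + 1), ((1 - l) * deriv Y t + l) ≤ (b - a) / n) ∧
      (∀ i, ∀ t ∈ Icc a b, t < x i → mixId l Y t ≤ node a b n i) ∧
      (∀ i, ∀ t ∈ Icc a b, x i < t → node a b n i ≤ mixId l Y t) := by
  have hH : 0 < b - a := sub_pos.2 hab
  have hn0 : (0 : ℝ) < n := by exact_mod_cast hn
  have hX := isNodes_node hab hn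
  have haI := left_mem_Icc.2 hab.le
  have hZa : mixId l Y a = a := by simp only [mixId, hY.left a le_rfl]; ring
  have hZb : mixId l Y b = b := by simp only [mixId, hY.right b le_rfl]; ring
  have hZm : Monotone (mixId l Y) := fun s t hst => by
    have := mixId_sub_ge hl1 hY hst
    have h2 : 0 ≤ l * (t - s) := mul_nonneg hl.le (by linarith)
    linarith
  set S : ℕ → Set ℝ := fun i => {t ∈ Icc a b | mixId l Y t ≤ node a b n i} with hS
  have haS : ∀ i, a ∈ S i := fun i => ⟨haI, by
    rw [hZa]; exact hX.zero.symm.trans_le (hX.mono (Nat.zero_le i))⟩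
  have hbdd : ∀ i, BddAbove (S i) := fun i => ⟨b, fun t ht => ht.1.2⟩
  set x : ℕ → ℝ := fun i => sSup (S i) with hx
  have hxI : ∀ i, x i ∈ Icc a b := fun i =>
    ⟨le_csSup (hbdd i) (haS i), csSup_le ⟨a, haS i⟩ fun t ht => ht.1.2⟩
  have hxm : Monotone x := fun i j hij => csSup_le_csSup (hbdd j) ⟨a, haS i⟩ fun t ht =>
    ⟨ht.1, ht.2.trans (hX.mono hij)⟩
  have hlow : ∀ i, ∀ t ∈ Icc a b, t < x i → mixId l Y t ≤ node a b n i := fun i t ht hti => by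
    obtain ⟨s, hs, hts⟩ := exists_lt_of_lt_csSup ⟨a, haS i⟩ hti
    exact (hZm hts.le).trans hs.2
  have hup : ∀ i, ∀ t ∈ Icc a b, x i < t → node a b n i ≤ mixId l Y t := fun i t ht hti => by
    by_contra hcon
    push Not at hcon
    exact absurd (le_csSup (hbdd i) ⟨ht, hcon.le⟩) (not_le.2 hti)
  have hsub : ∀ i, ∀ t ∈ Icc (x i) (x (i + 1)), t ∈ Icc a b := fun i t ht =>
    ⟨(hxI i).1.trans ht.1, ht.2.trans (hxI (i + 1)).2⟩
  refine ⟨x, ⟨hxm, ?_, ?_⟩, fun i => ?_, fun i => ?_, hlow, hup⟩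
  · refine le_antisymm (csSup_le ⟨a, haS 0⟩ fun t ht => ?_) (hxI 0).1
    have h1 := mixId_sub_ge hl1 hY ht.1.1
    have h2 := ht.2
    rw [hX.zero] at h2
    rw [hZa] at h1
    by_contra h3
    push Not at h3
    have : 0 < l * (t - a) := mul_pos hl (by linarith)
    linarith
  · refine le_antisymm (hxI n).2 (le_csSup (hbdd n) ⟨right_mem_Icc.2 hab.le, ?_⟩)
    rw [hZb, hX.last]
  · by_contra hcon
    push Not at hcon
    set e := (x (i + 1) - x i - (b - a) / (n * l)) / 4 with he
    have he0 : 0 < e := by rw [he]; linarith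
    have hpos : 0 < (b - a) / (n * l) := by positivity
    have hs : x i + e < x (i + 1) - e := by linarith
    have k1 := hup i (x i + e) (hsub i _ ⟨by linarith, by linarith⟩) (by linarith)
    have k2 := hlow (i + 1) (x (i + 1) - e) (hsub i _ ⟨by linarith, by linarith⟩) (by linarith)
    have k3 := mixId_sub_ge hl1 hY hs.le
    have k4 := node_succ_sub a b n i
    have k5 : x (i + 1) - e - (x i + e) = (b - a) / (n * l) + 2 * e := by rw [he]; ring
    rw [k5, mul_add] at k3
    have k6 : l * ((b - a) / (n * l)) = (b - a) / n := by field_simp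
    have k7 : 0 < l * (2 * e) := by positivity
    linarith
  · -- truncation to `[X_i, X_{i+1}]` does not change the derivative inside the cell
    set f : ℝ → ℝ := fun t => max (node a b n i) (min (node a b n (i + 1)) (mixId l Y t)) with hf
    have hfm : Monotone f := fun s t hst => max_le_max le_rfl (min_le_min le_rfl (hZm hst))
    have hXi : node a b n i ≤ node a b n (i + 1) := hX.mono (Nat.le_succ i)
    have hxi : x i ≤ x (i + 1) := hxm (Nat.le_succ i)
    have h1 := (hfm.monotoneOn (uIcc (x i) (x (i + 1)))).intervalIntegral_deriv_mem_uIcc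
    have h2 : f (x (i + 1)) - f (x i) ≤ (b - a) / n := by
      rw [← node_succ_sub a b n i]
      have e1 : f (x (i + 1)) ≤ node a b n (i + 1) := max_le hXi (min_le_left _ _)
      have e2 : node a b n i ≤ f (x i) := le_max_left _ _
      linarith
    have h3 : ∫ t in x i..x (i + 1), ((1 - l) * deriv Y t + l) =
        ∫ t in x i..x (i + 1), deriv f t := by
      refine intervalIntegral.integral_congr_ae ?_
      have hne : ∀ᵐ t : ℝ, t ≠ x (i + 1) := by simp [ae_iff]
      filter_upwards [hY.mono.ae_differentiableAt, hne] with t ht htne htI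
      rw [uIoc_of_le hxi] at htI
      have htI' : t ∈ Ioo (x i) (x (i + 1)) := ⟨htI.1, lt_of_le_of_ne htI.2 htne⟩
      have heq : f =ᶠ[𝓝 t] mixId l Y := by
        filter_upwards [Ioo_mem_nhds htI'.1 htI'.2] with s hs
        have hsI := hsub i s ⟨hs.1.le, hs.2.le⟩
        simp only [hf]
        rw [min_eq_right (hlow (i + 1) s hsI hs.2), max_eq_right (hup i s hsI hs.1)]
      rw [heq.deriv_eq]
      have hd : HasDerivAt (mixId l Y) ((1 - l) * deriv Y t + l * 1) t :=
        (ht.hasDerivAt.const_mul (1 - l)).add ((hasDerivAt_id t).const_mul l)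
      rw [hd.deriv, mul_one]
    rw [h3]
    have h4 : 0 ≤ f (x (i + 1)) - f (x i) := sub_nonneg.2 (hfm hxi)
    rw [uIcc_of_le h4] at h1
    exact h1.2.trans h2

/-- A function that takes the values of the uniform mesh between the nodes built from
`(1 - l) Y + l id` is uniformly close to `Y`. -/
lemma mesh_close (hY : NMono a b Y) {l : ℝ} (hl : 0 ≤ l) {n : ℕ}
    (hn : 1 ≤ n) {x : ℕ → ℝ} (hx : IsNodes a b n x)
    (hlow : ∀ i, ∀ t ∈ Icc a b, t < x i → mixId l Y t ≤ node a b n i)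
    (hup : ∀ i, ∀ t ∈ Icc a b, x i < t → node a b n i ≤ mixId l Y t) {y : ℝ → ℝ}
    (hy : ∀ i ≤ n, ∀ t ∈ Icc a b, x i < t ↔ node a b n i < y t) :
    ∀ᵐ t ∂volume.restrict (Icc a b), |y t - Y t| ≤ (b - a) / n + l * (b - a) := by
  have hne : ∀ᵐ t : ℝ, ∀ i, t ≠ x i := ae_all_iff.2 fun i => by simp [ae_iff]
  have hneb : ∀ᵐ t : ℝ, t ≠ b := by simp [ae_iff]
  rw [ae_restrict_iff' measurableSet_Icc]
  filter_upwards [hne, hneb] with t ht htb htI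
  obtain ⟨i, hi, hti⟩ := hx.exists_Ico hn ⟨htI.1, lt_of_le_of_ne htI.2 htb⟩
  have h1 : x i < t := lt_of_le_of_ne hti.1 (Ne.symm (ht i))
  have k1 := (hy i hi.le t htI).1 h1
  have k2 : y t ≤ node a b n (i + 1) := by
    by_contra hcon
    push Not at hcon
    exact absurd ((hy (i + 1) hi t htI).2 hcon) (not_lt.2 hti.2.le)
  have k3 := hup i t htI h1
  have k4 := hlow (i + 1) t htI hti.2
  have k5 := node_succ_sub a b n i
  have k6 : |mixId l Y t - Y t| ≤ l * (b - a) := by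
    have e : mixId l Y t - Y t = l * (t - Y t) := by simp only [mixId]; ring
    have hr := hY.range_mem t
    rw [e, abs_mul, abs_of_nonneg hl]
    refine mul_le_mul_of_nonneg_left ?_ hl
    rw [abs_le]; constructor <;> linarith [hr.1, hr.2, htI.1, htI.2]
  have k7 : |y t - mixId l Y t| ≤ (b - a) / n := by
    rw [abs_le]; constructor <;> linarith
  calc |y t - Y t| ≤ |y t - mixId l Y t| + |mixId l Y t - Y t| := abs_sub_le _ _ _
    _ ≤ _ := add_le_add k7 k6

/-- Jensen's inequality for `r ↦ r⁻²`, in the form used on a mesh cell. -/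
lemma cell_cube_le {s t H n : ℝ} (hst : s ≤ t) (hn : 0 < n) (hH : 0 < H) {r : ℝ → ℝ} {l : ℝ}
    (hl : 0 < l) (hr : ∀ᵐ τ, l ≤ r τ) (hri : IntervalIntegrable r volume s t)
    (hri2 : IntervalIntegrable (fun τ => (r τ ^ 2)⁻¹) volume s t)
    (h : ∫ τ in s..t, r τ ≤ H / n) :
    n ^ 2 * (t - s) ^ 3 ≤ H ^ 2 * ∫ τ in s..t, (r τ ^ 2)⁻¹ := by
  rcases hst.eq_or_lt with rfl | hlt
  · simp
  have hℓ : 0 < t - s := sub_pos.2 hlt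
  set d := H / (n * (t - s)) with hd
  have hd0 : 0 < d := by positivity
  -- the tangent line at `d`
  have h1 : ∫ τ in s..t, (3 / d ^ 2 - 2 / d ^ 3 * r τ) ≤ ∫ τ in s..t, (r τ ^ 2)⁻¹ := by
    refine intervalIntegral.integral_mono_ae_restrict hst
      (intervalIntegrable_const.sub (hri.const_mul _)) hri2 ?_
    refine ae_restrict_of_ae ?_
    filter_upwards [hr] with τ hτ
    have hr0 : 0 < r τ := hl.trans_le hτ
    have : (r τ ^ 2)⁻¹ - (3 / d ^ 2 - 2 / d ^ 3 * r τ) =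
        (r τ - d) ^ 2 * (2 * r τ + d) / (d ^ 3 * r τ ^ 2) := by field_simp; ring
    have h2 : 0 ≤ (r τ - d) ^ 2 * (2 * r τ + d) / (d ^ 3 * r τ ^ 2) := by positivity
    linarith
  rw [intervalIntegral.integral_sub (by simp) (hri.const_mul _),
    intervalIntegral.integral_const_mul, intervalIntegral.integral_const, smul_eq_mul] at h1
  have h2 : 2 / d ^ 3 * ∫ τ in s..t, r τ ≤ 2 / d ^ 3 * (H / n) := by gcongr
  have h3 : (t - s) * (3 / d ^ 2) - 2 / d ^ 3 * (H / n) = n ^ 2 * (t - s) ^ 3 / H ^ 2 := by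
    rw [hd]; field_simp; ring
  have h4 : n ^ 2 * (t - s) ^ 3 / H ^ 2 ≤ ∫ τ in s..t, (r τ ^ 2)⁻¹ := by linarith
  rw [div_le_iff₀ (by positivity)] at h4
  linarith

end MeshConstruction

/-! ### Upper bound for the energy of interpolants -/

section UpperCell

variable {E : Type*} [NormedAddCommGroup E] [InnerProductSpace ℝ E] [CompleteSpace E]
variable {a b θ : ℝ} {p σ : ℝ → E} {Q : ℝ → E × E →L[ℝ] E × E →L[ℝ] ℝ} {R : ℝ → E × E → ℝ}

/-- Convexity of `B`, in a form that becomes Jensen's inequality when `w₀` and `p₀` are the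
averages of `w` and `p`: the last two terms then have integral zero. -/
lemma quad_upper {B : E × E →L[ℝ] E × E →L[ℝ] ℝ} (hsymm : ∀ ζ η, B ζ η = B η ζ)
    (hpos : ∀ ζ, 0 ≤ B ζ ζ) (n : ℝ) (g w w₀ p p₀ e : E) :
    B (g, w₀ + n • (p₀ - p)) (g, w₀ + n • (p₀ - p)) ≤ B (g, w) (g, w) +
      n ^ 2 * B (0, p - e) (0, p - e) - 2 * B (0, w - w₀) (g, w₀) -
      (2 * n * B (0, p - p₀) (g, w₀) + 2 * n ^ 2 * B (0, p - p₀) (0, p₀ - e)) := by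
  set v : E × E := (g, w₀) with hv
  set ϖ : E × E := (0, w - w₀) with hϖ
  set π : E × E := (0, p - p₀) with hπ
  set τ : E × E := (0, p₀ - e) with hτ
  have e1 : ((g, w₀ + n • (p₀ - p)) : E × E) = v - n • π := by
    simp only [hv, hπ, Prod.ext_iff, Prod.fst_sub, Prod.snd_sub, Prod.smul_fst, Prod.smul_snd]
    refine ⟨by simp, ?_⟩
    rw [← neg_sub p p₀, smul_neg]; abel
  have e2 : ((g, w) : E × E) = v + ϖ := by simp [hv, hϖ]
  have e3 : ((0, p - e) : E × E) = π + τ := by simp [hπ, hτ]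
  rw [e1, e2, e3]
  simp only [map_add, map_sub, map_smul, add_apply, sub_apply, smul_apply, smul_eq_mul]
  rw [hsymm v π, hsymm v ϖ, hsymm τ π]
  have h1 := hpos ϖ
  have h2 := mul_nonneg (sq_nonneg n) (hpos τ)
  nlinarith

/-- Continuity of `B v v` in `B` and `v`, with constants. -/
lemma quad_close {B B' : E × E →L[ℝ] E × E →L[ℝ] ℝ} {ε Λ K : ℝ} (hB : ‖B' - B‖ ≤ ε)
    (hΛ : ‖B‖ ≤ Λ) {v v' : E × E} (hv : ‖v‖ ≤ K) (hv' : ‖v'‖ ≤ K) (hvv : ‖v' - v‖ ≤ ε) :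
    |B' v' v' - B v v| ≤ ε * (K ^ 2 + 2 * Λ * K) := by
  have hΛ0 : 0 ≤ Λ := (norm_nonneg _).trans hΛ
  have hK : 0 ≤ K := (norm_nonneg _).trans hv
  have hε : 0 ≤ ε := (norm_nonneg _).trans hB
  have e : B' v' v' - B v v = (B' - B) v' v' + B (v' - v) v' + B v (v' - v) := by
    simp only [sub_apply, map_sub]; ring
  rw [e]
  have h1 : |(B' - B) v' v'| ≤ ε * K * K := (bilin_bound hB v' v').trans (by gcongr)
  have h2 : |B (v' - v) v'| ≤ Λ * ε * K := (bilin_bound hΛ _ _).trans (by gcongr)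
  have h3 : |B v (v' - v)| ≤ Λ * K * ε := (bilin_bound hΛ _ _).trans (by gcongr)
  calc _ ≤ |(B' - B) v' v'| + |B (v' - v) v'| + |B v (v' - v)| := abs_add_three _ _ _
    _ ≤ ε * K * K + Λ * ε * K + Λ * K * ε := by gcongr
    _ = _ := by ring

/-- The error constant in the upper bound on a cell. -/
noncomputable def upperConst (H K Λ S l : ℝ) : ℝ :=
  2 * K ^ 2 + 2 * Λ * K + H ^ 2 / (24 * l ^ 2) * (1 + 2 * Λ * S + Λ)

/-- Upper bound for the energy of an interpolant on a mesh cell `[s, t]`. -/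
lemma Expansion.upper_cell (ex : Expansion a b θ p σ Q R) {ε δ : ℝ} (hε : 0 < ε) (hε1 : ε ≤ 1)
    (hδ : ∀ x ∈ Icc a b, ∀ h : E × E, ‖h‖ ≤ δ → |R x h - 1 / 2 * Q x h h| ≤ ε * ‖h‖ ^ 2)
    {s t : ℝ} (hst : s < t) (hsub : Icc s t ⊆ Icc a b) {n : ℝ} (hn : 1 ≤ n) {G γ w : ℝ → E}
    {K Λ S H l : ℝ} {p₀ w₀ : E}
    (hp₀ : p₀ = (t - s)⁻¹ • ∫ τ in s..t, p τ) (hw₀ : w₀ = (t - s)⁻¹ • ∫ τ in s..t, w τ)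
    (hξK : ∀ x ∈ Icc s t, ‖((G x, w₀ + n • (p₀ - p x)) : E × E)‖ ≤ K)
    (hwK : ∀ x ∈ Icc s t, ‖((γ x, w x) : E × E)‖ ≤ K) (hKn : K ≤ n * δ)
    (hGs : G s = γ s) (hG : ∀ x ∈ Icc s t, ‖G x - G s‖ ≤ ε) (hγ : ∀ x ∈ Icc s t, ‖γ x - γ s‖ ≤ ε)
    (hQ : ∀ x ∈ Icc s t, ‖Q x - Q s‖ ≤ ε)
    (hp : ∀ x ∈ Icc s t, ∀ y ∈ Icc s t, ‖p x - p y - (x - y) • σ s‖ ≤ ε * |x - y|)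
    (hb : ∀ x ∈ Icc s t, Q s (0, σ s) (0, σ s) ≤ Q x (0, σ x) (0, σ x) + ε)
    (hΛ : ‖Q s‖ ≤ Λ) (hS : ‖σ s‖ ≤ S)
    (hwi : IntervalIntegrable w volume s t)
    (hRi : IntervalIntegrable (fun x => R x (n⁻¹ • (G x, w₀ + n • (p₀ - p x)))) volume s t)
    (hQi : IntervalIntegrable (fun x => Q x (γ x, w x) (γ x, w x)) volume s t)
    {r : ℝ → ℝ} (hl : 0 < l) (hr : ∀ᵐ τ, l ≤ r τ)
    (hri : IntervalIntegrable (fun τ => (r τ ^ 2)⁻¹) volume s t)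
    (hcube : n ^ 2 * (t - s) ^ 3 ≤ H ^ 2 * ∫ τ in s..t, (r τ ^ 2)⁻¹) :
    n ^ 2 * ∫ x in s..t, R x (n⁻¹ • (G x, w₀ + n • (p₀ - p x))) ≤
      1 / 2 * (∫ x in s..t, Q x (γ x, w x) (γ x, w x)) +
      H ^ 2 / 24 * (∫ x in s..t, Q x (0, σ x) (0, σ x) * (r x ^ 2)⁻¹) +
      ε * upperConst H K Λ S l * (t - s) := by
  have hn0 : 0 < n := by linarith
  have hℓ : 0 < t - s := sub_pos.2 hst
  have hsI : s ∈ Icc s t := left_mem_Icc.2 hst.le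
  have hsab : s ∈ Icc a b := hsub hsI
  have hΛ0 : 0 ≤ Λ := (norm_nonneg _).trans hΛ
  have hS0 : 0 ≤ S := (norm_nonneg _).trans hS
  have hK0 : 0 ≤ K := (norm_nonneg _).trans (hwK s hsI)
  set m := (s + t) / 2 with hm
  have hmI : m ∈ Icc s t := ⟨by rw [hm]; linarith, by rw [hm]; linarith⟩
  set B := Q s with hB
  set b₀ := B (0, σ s) (0, σ s) with hb₀
  set P := b₀ + ε * (2 * Λ * S + Λ) with hP
  set T₁ : E → ℝ := fun v => 2 * B (0, v) (γ s, w₀) with hT₁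
  set T₂ : E → ℝ := fun v => 2 * n * B (0, v) (γ s, w₀) + 2 * n ^ 2 * B (0, v) (0, p₀ - p m) with hT₂
  have hsymm := ex.Q_symm s hsab
  have hpos := fun ζ => ex.Q_nonneg hsab ζ
  have hpi : IntervalIntegrable p volume s t :=
    (ex.p_cont.mono hsub).intervalIntegrable_of_Icc hst.le
  -- the pointwise estimate
  have hpt : ∀ x ∈ Icc s t, n ^ 2 * R x (n⁻¹ • (G x, w₀ + n • (p₀ - p x))) ≤
      1 / 2 * Q x (γ x, w x) (γ x, w x) + (x - m) ^ 2 * (1 / 2 * n ^ 2 * P)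
      - 1 / 2 * T₁ (w x - w₀) - 1 / 2 * T₂ (p x - p₀) + ε * (2 * K ^ 2 + 2 * Λ * K) := by
    intro x hx
    set ξ : E × E := (G x, w₀ + n • (p₀ - p x)) with hξ
    set ξ₀ : E × E := (γ s, w₀ + n • (p₀ - p x)) with hξ₀
    have k0 := hξK x hx
    have k1 : ‖n⁻¹ • ξ‖ ≤ δ := by
      rw [norm_smul, norm_inv, Real.norm_eq_abs, abs_of_pos hn0, inv_mul_le_iff₀ hn0]
      exact k0.trans hKn
    have k2 := (abs_le.1 (hδ x (hsub hx) _ k1)).2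
    have h4 : Q x (n⁻¹ • ξ) (n⁻¹ • ξ) = (n ^ 2)⁻¹ * Q x ξ ξ := by
      simp only [map_smul, smul_apply, smul_eq_mul]; field_simp
    have h5 : ‖n⁻¹ • ξ‖ ^ 2 = (n ^ 2)⁻¹ * ‖ξ‖ ^ 2 := by
      rw [norm_smul, mul_pow, norm_inv, Real.norm_eq_abs, abs_of_pos hn0, inv_pow]
    rw [h4, h5] at k2
    have k3 : n ^ 2 * R x (n⁻¹ • ξ) ≤ 1 / 2 * Q x ξ ξ + ε * ‖ξ‖ ^ 2 := by
      have h6 := mul_le_mul_of_nonneg_left k2 (sq_nonneg n)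
      have h7 : n ^ 2 * (R x (n⁻¹ • ξ) - 1 / 2 * ((n ^ 2)⁻¹ * Q x ξ ξ)) =
        n ^ 2 * R x (n⁻¹ • ξ) - 1 / 2 * Q x ξ ξ := by field_simp
      have h8 : n ^ 2 * (ε * ((n ^ 2)⁻¹ * ‖ξ‖ ^ 2)) = ε * ‖ξ‖ ^ 2 := by field_simp
      linarith
    have k4 : ε * ‖ξ‖ ^ 2 ≤ ε * K ^ 2 := by gcongr
    have k5 : ‖ξ₀‖ ≤ K := by
      have h6 := hξK s hsI
      have h7 := (norm_fst_le _).trans h6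
      have h8 := (norm_snd_le ξ).trans k0
      rw [Prod.norm_def]
      refine max_le ?_ h8
      rw [hξ₀, ← hGs]; exact h7
    have k6 : ‖ξ - ξ₀‖ ≤ ε := by
      have : ξ - ξ₀ = (G x - G s, 0) := by simp [hξ, hξ₀, hGs]
      rw [this]; simpa [Prod.norm_def] using hG x hx
    have k7 := (abs_le.1 (quad_close (hQ x hx) hΛ k5 k0 k6)).2
    have k8 := quad_upper hsymm hpos n (γ s) (w x) w₀ (p x) p₀ (p m)
    have hwx := hwK x hx
    have k9 : ‖((γ s, w x) : E × E)‖ ≤ K := by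
      rw [Prod.norm_def]
      exact max_le ((norm_fst_le ((γ s, w s) : E × E)).trans (hwK s hsI))
        ((norm_snd_le ((γ x, w x) : E × E)).trans hwx)
    have k10 : ‖((γ x, w x) : E × E) - (γ s, w x)‖ ≤ ε := by
      have : ((γ x, w x) : E × E) - (γ s, w x) = (γ x - γ s, 0) := by simp
      rw [this]; simpa [Prod.norm_def] using hγ x hx
    have k11 := (abs_le.1 (quad_close (hQ x hx) hΛ k9 hwx k10)).1
    have k12 : B (0, p x - p m) (0, p x - p m) ≤ (x - m) ^ 2 * P := by
      set y := x - m with hy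
      set e := p x - p m - y • σ s with he
      have hen : ‖e‖ ≤ ε * |y| := hp x hx m hmI
      have e1 : ((0, p x - p m) : E × E) = y • (0, σ s) + (0, e) := by simp [he]
      have e2 : B (0, p x - p m) (0, p x - p m) = y ^ 2 * b₀ + 2 * (y * B (0, e) (0, σ s)) +
          B (0, e) (0, e) := by
        rw [e1]
        simp only [map_add, map_smul, add_apply, smul_apply, smul_eq_mul]
        rw [hsymm (0, σ s) (0, e)]; ring
      have e3 : ‖((0, σ s) : E × E)‖ ≤ S := by simpa [Prod.norm_def] using hS
      have e4 : ‖((0, e) : E × E)‖ ≤ ε * |y| := by simpa [Prod.norm_def] using hen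
      have e5 : |y * B (0, e) (0, σ s)| ≤ y ^ 2 * (ε * (Λ * S)) := by
        rw [abs_mul]
        calc |y| * |B (0, e) (0, σ s)| ≤ |y| * (Λ * (ε * |y|) * S) := by
              gcongr
              exact (bilin_bound hΛ _ _).trans (by gcongr)
          _ = |y| ^ 2 * (ε * (Λ * S)) := by ring
          _ = _ := by rw [sq_abs]
      have e6 : |B (0, e) (0, e)| ≤ y ^ 2 * (ε * Λ) := by
        calc |B (0, e) (0, e)| ≤ Λ * (ε * |y|) * (ε * |y|) :=
              (bilin_bound hΛ _ _).trans (by gcongr)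
          _ = |y| ^ 2 * (ε * Λ) * ε := by ring
          _ ≤ |y| ^ 2 * (ε * Λ) * 1 := by gcongr
          _ = _ := by rw [sq_abs, mul_one]
      have e7 := (abs_le.1 e5).2
      have e8 := (abs_le.1 e6).2
      rw [e2, hP]
      linarith
    have k13 : n ^ 2 * B (0, p x - p m) (0, p x - p m) ≤ n ^ 2 * ((x - m) ^ 2 * P) := by gcongr
    simp only [hT₁, hT₂]
    linarith
  have j1 : IntervalIntegrable (fun x => (x - m) ^ 2 * (1 / 2 * n ^ 2 * P)) volume s t :=
    Continuous.intervalIntegrable (by fun_prop) _ _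
  have hT₁c : ∀ v, T₁ v = ((2 : ℝ) • (B.flip (γ s, w₀)).comp (ContinuousLinearMap.inr ℝ E E)) v :=
    fun v => rfl
  have hT₂c : ∀ v, T₂ v = ((2 * n) • (B.flip (γ s, w₀)).comp (ContinuousLinearMap.inr ℝ E E) +
      (2 * n ^ 2) • (B.flip (0, p₀ - p m)).comp (ContinuousLinearMap.inr ℝ E E)) v := fun v => rfl
  have z1 : IntervalIntegrable (fun x => w x - w₀) volume s t := hwi.sub intervalIntegrable_const
  have z2 : IntervalIntegrable (fun x => p x - p₀) volume s t := hpi.sub intervalIntegrable_const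
  have hcl : ∀ (T : E →L[ℝ] ℝ) {f : ℝ → E}, IntervalIntegrable f volume s t →
      IntervalIntegrable (fun x => T (f x)) volume s t :=
    fun T f hf => ⟨T.integrable_comp hf.1, T.integrable_comp hf.2⟩
  have j2 : IntervalIntegrable (fun x => 1 / 2 * T₁ (w x - w₀)) volume s t := by
    simp_rw [hT₁c]
    exact (hcl _ z1).const_mul _
  have j3 : IntervalIntegrable (fun x => 1 / 2 * T₂ (p x - p₀)) volume s t := by
    simp_rw [hT₂c]
    exact (hcl _ z2).const_mul _
  have hmean : ∀ {f : ℝ → E} {f₀ : E}, IntervalIntegrable f volume s t →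
      f₀ = (t - s)⁻¹ • ∫ τ in s..t, f τ → ∫ τ in s..t, (f τ - f₀) = 0 := by
    intro f f₀ hf hf₀
    rw [intervalIntegral.integral_sub hf intervalIntegrable_const, intervalIntegral.integral_const,
      hf₀, smul_smul, mul_inv_cancel₀ hℓ.ne', one_smul, sub_self]
  have i2 : ∫ x in s..t, 1 / 2 * T₁ (w x - w₀) = 0 := by
    simp_rw [hT₁c]
    rw [intervalIntegral.integral_const_mul, ContinuousLinearMap.intervalIntegral_comp_comm _ z1,
      hmean hwi hw₀, map_zero, mul_zero]
  have i3 : ∫ x in s..t, 1 / 2 * T₂ (p x - p₀) = 0 := by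
    simp_rw [hT₂c]
    rw [intervalIntegral.integral_const_mul, ContinuousLinearMap.intervalIntegral_comp_comm _ z2,
      hmean hpi hp₀, map_zero, mul_zero]
  have i1 : ∫ x in s..t, (x - m) ^ 2 * (1 / 2 * n ^ 2 * P) =
      (t - s) ^ 3 / 12 * (1 / 2 * n ^ 2 * P) := by
    rw [intervalIntegral.integral_mul_const, hm, integral_center_sq]
  have j0 := hQi.const_mul (1 / 2)
  have hint := intervalIntegral.integral_mono_on hst.le (hRi.const_mul (n ^ 2))
    ((((j0.add j1).sub j2).sub j3).add intervalIntegrable_const) hpt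
  rw [intervalIntegral.integral_add (((j0.add j1).sub j2).sub j3) intervalIntegrable_const,
    intervalIntegral.integral_sub ((j0.add j1).sub j2) j3,
    intervalIntegral.integral_sub (j0.add j1) j2, intervalIntegral.integral_add j0 j1, i1, i2, i3,
    intervalIntegral.integral_const, intervalIntegral.integral_const_mul,
    intervalIntegral.integral_const_mul, smul_eq_mul] at hint
  -- the mesh term
  have hP0 : 0 ≤ P := by
    have := hpos (0, σ s)
    positivity
  have hbc : ContinuousOn (fun x => Q x (0, σ x) (0, σ x)) (Icc s t) := by
    have h1 : ContinuousOn (fun x => ((0, σ x) : E × E)) (Icc s t) :=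
      continuousOn_const.prodMk (ex.σ_cont.mono hsub)
    exact ((ex.Q_cont.mono hsub).clm_apply h1).clm_apply h1
  have hbi : IntervalIntegrable (fun x => Q x (0, σ x) (0, σ x) * (r x ^ 2)⁻¹) volume s t :=
    hri.continuousOn_mul (by rwa [uIcc_of_le hst.le])
  have hmesh : P * ∫ τ in s..t, (r τ ^ 2)⁻¹ ≤
      (∫ x in s..t, Q x (0, σ x) (0, σ x) * (r x ^ 2)⁻¹) +
        ε * (1 + 2 * Λ * S + Λ) / l ^ 2 * (t - s) := by
    have h1 : ∫ x in s..t, P * (r x ^ 2)⁻¹ ≤ ∫ x in s..t, (Q x (0, σ x) (0, σ x) * (r x ^ 2)⁻¹ +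
        ε * (1 + 2 * Λ * S + Λ) / l ^ 2) := by
      refine intervalIntegral.integral_mono_ae_restrict hst.le (hri.const_mul _)
        (hbi.add intervalIntegrable_const) ?_
      rw [EventuallyLE, ae_restrict_iff' measurableSet_Icc]
      filter_upwards [hr] with x hx hxI
      have h2 := hb x hxI
      have h3 : (r x ^ 2)⁻¹ ≤ (l ^ 2)⁻¹ := by gcongr
      have hr0 : 0 < r x := hl.trans_le hx
      have h4 : 0 ≤ (r x ^ 2)⁻¹ := by positivity
      have h5 : 0 ≤ ε * (1 + 2 * Λ * S + Λ) := by positivity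
      calc P * (r x ^ 2)⁻¹ ≤ (Q x (0, σ x) (0, σ x) + ε * (1 + 2 * Λ * S + Λ)) * (r x ^ 2)⁻¹ := by
            refine mul_le_mul_of_nonneg_right ?_ h4
            rw [hP]; linarith
        _ = Q x (0, σ x) (0, σ x) * (r x ^ 2)⁻¹ + ε * (1 + 2 * Λ * S + Λ) * (r x ^ 2)⁻¹ := by ring
        _ ≤ Q x (0, σ x) (0, σ x) * (r x ^ 2)⁻¹ + ε * (1 + 2 * Λ * S + Λ) * (l ^ 2)⁻¹ := by gcongr
        _ = _ := by rw [div_eq_mul_inv]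
    rw [intervalIntegral.integral_const_mul, intervalIntegral.integral_add hbi
      intervalIntegrable_const, intervalIntegral.integral_const, smul_eq_mul] at h1
    linarith
  have hmesh2 : (t - s) ^ 3 / 12 * (1 / 2 * n ^ 2 * P) ≤ H ^ 2 / 24 *
      ((∫ x in s..t, Q x (0, σ x) (0, σ x) * (r x ^ 2)⁻¹) +
        ε * (1 + 2 * Λ * S + Λ) / l ^ 2 * (t - s)) := by
    calc (t - s) ^ 3 / 12 * (1 / 2 * n ^ 2 * P) = (n ^ 2 * (t - s) ^ 3) * (P / 24) := by ring
      _ ≤ (H ^ 2 * ∫ τ in s..t, (r τ ^ 2)⁻¹) * (P / 24) := by gcongr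
      _ = H ^ 2 / 24 * (P * ∫ τ in s..t, (r τ ^ 2)⁻¹) := by ring
      _ ≤ _ := by gcongr
  have hfin : ε * upperConst H K Λ S l * (t - s) = H ^ 2 / 24 *
      (ε * (1 + 2 * Λ * S + Λ) / l ^ 2 * (t - s)) + (t - s) * (ε * (2 * K ^ 2 + 2 * Λ * K)) := by
    rw [upperConst]; field_simp; ring
  rw [hfin]
  linarith

end UpperCell

/-! ### Recovery sequences -/

section Recovery

variable {E : Type*} [NormedAddCommGroup E] [InnerProductSpace ℝ E] [CompleteSpace E]
variable {a b θ : ℝ} {p σ : ℝ → E} {Q : ℝ → E × E →L[ℝ] E × E →L[ℝ] ℝ} {R : ℝ → E × E → ℝ}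

lemma integrable_quad (hQ : ContinuousOn Q (Icc a b)) {ξ : ℝ → E × E}
    (hξ : MemLp ξ 2 (volume.restrict (Icc a b))) :
    IntegrableOn (fun t => Q t (ξ t) (ξ t)) (Icc a b) := by
  obtain ⟨Λ, hΛ⟩ := isCompact_Icc.exists_bound_of_continuousOn hQ
  have hQm : AEStronglyMeasurable Q (volume.restrict (Icc a b)) :=
    hQ.aestronglyMeasurable measurableSet_Icc
  refine Integrable.mono' ((hξ.integrable_norm_pow (by simp)).const_mul Λ)
    ((by fun_prop : Continuous fun q : (E × E →L[ℝ] E × E →L[ℝ] ℝ) × (E × E) =>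
      q.1 q.2 q.2).comp_aestronglyMeasurable (hQm.prodMk hξ.1)) ?_
  rw [ae_restrict_iff' measurableSet_Icc]
  refine ae_of_all _ fun t ht => ?_
  have := bilin_bound (hΛ t ht) (ξ t) (ξ t)
  rw [Real.norm_eq_abs]
  calc _ ≤ _ := this
    _ = _ := by ring

/-- On a nondegenerate mesh cell the slope of the interpolant of `us + γ / n` is given by cell
averages. -/
lemma slope_eq {us γ w : ℝ → E} (hpi : IntegrableOn p (Icc a b)) (hwi : IntegrableOn w (Icc a b))
    (hus : ∀ t ∈ Icc a b, us t = us a + ∫ τ in a..t, p τ)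
    (hγ : ∀ t ∈ Icc a b, γ t = ∫ τ in a..t, w τ) {n : ℝ} (hn : n ≠ 0) {s t : ℝ}
    (hs : s ∈ Icc a b) (ht : t ∈ Icc a b) (e : E) :
    n • ((t - s)⁻¹ • ((us t + n⁻¹ • γ t) - (us s + n⁻¹ • γ s)) - e) =
      (t - s)⁻¹ • (∫ τ in s..t, w τ) + n • ((t - s)⁻¹ • (∫ τ in s..t, p τ) - e) := by
  have haI : a ∈ Icc a b := ⟨le_rfl, hs.1.trans hs.2⟩
  have h1 := intervalIntegral.integral_interval_sub_left (intervalIntegrable_of_Icc hpi haI ht)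
    (intervalIntegrable_of_Icc hpi haI hs)
  have h2 := intervalIntegral.integral_interval_sub_left (intervalIntegrable_of_Icc hwi haI ht)
    (intervalIntegrable_of_Icc hwi haI hs)
  rw [hus t ht, hus s hs, hγ t ht, hγ s hs, ← h1, ← h2]
  simp only [smul_sub, smul_add, smul_comm n (t - s)⁻¹, smul_smul n n⁻¹, mul_inv_cancel₀ hn,
    one_smul]
  abel

/-- Upper bound for the energy of the interpolants of `us + γ / n`, for bounded `γ'`, on meshes
whose asymptotic density `r` is bounded from below. The bound `∫ r ≤ (b - a) / n` on each cell says
that the mesh is at least as fine as prescribed by `r`. -/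
lemma Expansion.upper_bound_mesh (ex : Expansion a b θ p σ Q R) (hab : a < b) {us γ w : ℝ → E}
    (hus : ∀ t ∈ Icc a b, us t = us a + ∫ τ in a..t, p τ) (hw : ContinuousOn w (Icc a b))
    (hγ : ∀ t ∈ Icc a b, γ t = ∫ τ in a..t, w τ) {r : ℝ → ℝ} {l : ℝ} (hl : 0 < l)
    (hr : ∀ᵐ τ, l ≤ r τ) (hri : IntegrableOn r (Icc a b))
    (hri2 : IntegrableOn (fun τ => (r τ ^ 2)⁻¹) (Icc a b)) {ε : ℝ} (hε : 0 < ε) :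
    ∃ n₀ : ℕ, 1 ≤ n₀ ∧ ∀ n : ℕ, n₀ ≤ n → ∀ x : ℕ → ℝ, IsNodes a b n x →
      (∀ i, x (i + 1) - x i ≤ (b - a) / (n * l)) →
      (∀ i, ∫ t in x i..x (i + 1), r t ≤ (b - a) / n) →
      ∀ (c : ℕ → E) (G : ℝ → E),
      (∀ i, c i = (x (i + 1) - x i)⁻¹ • ((us (x (i + 1)) + (n : ℝ)⁻¹ • γ (x (i + 1))) -
        (us (x i) + (n : ℝ)⁻¹ • γ (x i)))) →
      (∀ t ∈ Icc a b, G t = ∫ τ in a..t, dev n x c p τ) →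
      (∀ i ≤ n, G (x i) = γ (x i)) →
      (∀ t ∈ Icc a b, ‖G t - γ t‖ ≤ ε) ∧
      (n : ℝ) ^ 2 * ∫ t in a..b, R t ((n : ℝ)⁻¹ • (G t, dev n x c p t)) ≤
        1 / 2 * (∫ t in a..b, Q t (γ t, w t) (γ t, w t)) +
        (b - a) ^ 2 / 24 * (∫ t in a..b, Q t (0, σ t) (0, σ t) * (r t ^ 2)⁻¹) + ε := by
  have hH : 0 < b - a := sub_pos.2 hab
  have haI := left_mem_Icc.2 hab.le
  obtain ⟨Λ, S, hΛ0, hS0, hΛS⟩ := ex.bounds hab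
  obtain ⟨M, hM⟩ := isCompact_Icc.exists_bound_of_continuousOn hw
  have hM0 : 0 ≤ M := (norm_nonneg _).trans (hM a haI)
  have hwi : IntegrableOn w (Icc a b) := hw.integrableOn_Icc
  have hpi : IntegrableOn p (Icc a b) := ex.p_cont.integrableOn_Icc
  have hγc : ContinuousOn γ (Icc a b) := (continuousOn_primitive_Icc hab.le hwi).congr hγ
  -- `D` bounds the scaled deviation of the gradients, `K` that of the pair `ξ`
  set D := M + (1 + S) * ((b - a) / l) with hD
  have hD0 : 0 ≤ D := by positivity
  set K := (M * (b - a) + D * ((b - a) / l)) + D with hK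
  have hKp : 0 ≤ K := by positivity
  set U := upperConst (b - a) K Λ S l with hU
  have hU0 : 0 ≤ U := by rw [hU, upperConst]; positivity
  -- chosen so that the errors `ε' U ℓ` of the cells add up to at most `ε`
  set ε' := min 1 (ε / (U * (b - a) + 1)) with hε'
  have hε'0 : 0 < ε' := by positivity
  have hε'1 : ε' ≤ 1 := min_le_left _ _
  have hε'U : ε' * U * (b - a) ≤ ε := by
    have h1 : ε' ≤ ε / (U * (b - a) + 1) := min_le_right _ _
    rw [le_div_iff₀ (by positivity)] at h1
    nlinarith
  obtain ⟨δ, hδ0, -, hδ⟩ := ex.R_approx ε' hε'0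
  obtain ⟨h₁, hh1, H1⟩ := ex.exists_scale hε'0 one_pos
  have hbc : ContinuousOn (fun x => Q x (0, σ x) (0, σ x)) (Icc a b) := by
    have h1 : ContinuousOn (fun x => ((0, σ x) : E × E)) (Icc a b) :=
      continuousOn_const.prodMk ex.σ_cont
    exact (ex.Q_cont.clm_apply h1).clm_apply h1
  obtain ⟨h₂, hh2, H2⟩ := exists_modulus_of_continuousOn hbc hε'0
  obtain ⟨n₀, hn₀⟩ := exists_nat_gt (max 1 (max ((b - a) / (l * min h₁ h₂))
    (max ((D + M) * (b - a) / (l * min ε' ε)) (K / δ))))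
  refine ⟨n₀, by exact_mod_cast ((le_max_left _ _).trans_lt hn₀).le, ?_⟩
  intro n hnn x hx hwid hrc c G hc hG hGγ
  have hnR : max 1 (max ((b - a) / (l * min h₁ h₂))
    (max ((D + M) * (b - a) / (l * min ε' ε)) (K / δ))) ≤ (n : ℝ) :=
    hn₀.le.trans (by exact_mod_cast hnn)
  have hn1 : (1 : ℝ) ≤ n := (le_max_left _ _).trans hnR
  have hn1' : 1 ≤ n := by exact_mod_cast hn1
  have hn0 : (0 : ℝ) < n := by linarith
  have q1 : (b - a) / (n * l) ≤ min h₁ h₂ := by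
    have h1 := ((le_max_left _ _).trans (le_max_right _ _)).trans hnR
    rw [div_le_iff₀ (by positivity)] at h1 ⊢
    linarith
  have q2 : (D + M) * ((b - a) / (n * l)) ≤ min ε' ε := by
    have h1 := (((le_max_left _ _).trans (le_max_right _ _)).trans (le_max_right _ _)).trans hnR
    rw [div_le_iff₀ (by positivity)] at h1
    rw [← mul_div_assoc, div_le_iff₀ (by positivity)]
    linarith
  have q3 : K ≤ n * δ := by
    have h1 := (((le_max_right _ _).trans (le_max_right _ _)).trans (le_max_right _ _)).trans hnR
    rwa [div_le_iff₀ hδ0] at h1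
  have q4 : (b - a) / (n * l) ≤ (b - a) / l := by
    apply div_le_div_of_nonneg_left hH.le hl
    nlinarith
  have q5 : (n : ℝ) * ((b - a) / (n * l)) = (b - a) / l := by field_simp
  have hGc : ContinuousOn G (Icc a b) :=
    (continuousOn_primitive_Icc hab.le (ex.dev_integrableOn n x c)).congr hG
  -- what happens on a nondegenerate cell
  have hcell : ∀ i < n, x i < x (i + 1) → ∃ p₀ w₀ : E,
      p₀ = (x (i + 1) - x i)⁻¹ • (∫ τ in x i..x (i + 1), p τ) ∧
      w₀ = (x (i + 1) - x i)⁻¹ • (∫ τ in x i..x (i + 1), w τ) ∧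
      (∀ e, (n : ℝ) • (c i - e) = w₀ + (n : ℝ) • (p₀ - e)) ∧
      (∀ t ∈ Icc (x i) (x (i + 1)), ‖w₀ + (n : ℝ) • (p₀ - p t)‖ ≤ D) ∧
      (∀ t ∈ Icc (x i) (x (i + 1)), ‖G t - G (x i)‖ ≤ D * (t - x i)) ∧
      (∀ t ∈ Icc (x i) (x (i + 1)), ‖γ t - γ (x i)‖ ≤ M * (t - x i)) := by
    intro i hi hlt
    set s := x i
    set t := x (i + 1)
    have hsI : s ∈ Icc a b := hx.mem_Icc' hi.le
    have htI : t ∈ Icc a b := hx.mem_Icc' hi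
    have hsub : Icc s t ⊆ Icc a b := Icc_subset_Icc hsI.1 htI.2
    have hℓ : 0 < t - s := sub_pos.2 hlt
    have hwid' := hwid i
    have avg : ∀ {f : ℝ → E} {B : ℝ} (e : E), IntegrableOn f (Icc a b) →
        (∀ τ ∈ Icc s t, ‖f τ - e‖ ≤ B) → ‖(t - s)⁻¹ • (∫ τ in s..t, f τ) - e‖ ≤ B := by
      intro f B e hf hB
      have h1 : (t - s)⁻¹ • (∫ τ in s..t, f τ) - e = (t - s)⁻¹ • ∫ τ in s..t, (f τ - e) := by
        rw [intervalIntegral.integral_sub (intervalIntegrable_of_Icc hf hsI htI)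
          intervalIntegrable_const, intervalIntegral.integral_const, smul_sub, smul_smul,
          inv_mul_cancel₀ hℓ.ne', one_smul]
      have h2 : ‖∫ τ in s..t, (f τ - e)‖ ≤ B * |t - s| :=
        intervalIntegral.norm_integral_le_of_norm_le_const fun τ hτ => hB τ (by
          rw [uIoc_of_le hlt.le] at hτ; exact Ioc_subset_Icc_self hτ)
      rw [h1, norm_smul, norm_inv, Real.norm_eq_abs, inv_mul_le_iff₀ (abs_pos.2 hℓ.ne')]
      linarith
    have hmul : ∀ e, (n : ℝ) • (c i - e) = (t - s)⁻¹ • (∫ τ in s..t, w τ) +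
        (n : ℝ) • ((t - s)⁻¹ • (∫ τ in s..t, p τ) - e) := fun e => by
      rw [hc i]; exact slope_eq hpi hwi hus hγ hn0.ne' hsI htI e
    have hdev : ∀ τ ∈ Icc s t, ‖(t - s)⁻¹ • (∫ τ in s..t, w τ) +
        (n : ℝ) • ((t - s)⁻¹ • (∫ τ in s..t, p τ) - p τ)‖ ≤ D := by
      intro τ hτ
      have h1 : ‖(t - s)⁻¹ • (∫ τ in s..t, w τ)‖ ≤ M := by
        have := avg (B := M) 0 hwi fun τ hτ => by rw [sub_zero]; exact hM τ (hsub hτ)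
        rwa [sub_zero] at this
      have h2 : ‖(t - s)⁻¹ • (∫ τ in s..t, p τ) - p τ‖ ≤ (1 + S) * (t - s) := by
        refine avg _ hpi fun τ' hτ' => ?_
        have h3 := (H1 s t hsI.1 hlt.le htI.2 (hwid'.trans (q1.trans (min_le_left _ _)))).2.1
          τ' hτ' τ hτ
        have h4 : ‖(τ' - τ) • σ s‖ ≤ |τ' - τ| * S := by
          rw [norm_smul, Real.norm_eq_abs]; gcongr; exact (hΛS s hsI).2
        have h5 : |τ' - τ| ≤ t - s := by
          rw [abs_le]; constructor <;> linarith [hτ.1, hτ.2, hτ'.1, hτ'.2]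
        calc ‖p τ' - p τ‖ = ‖(p τ' - p τ - (τ' - τ) • σ s) + (τ' - τ) • σ s‖ := by
              rw [sub_add_cancel]
          _ ≤ ε' * |τ' - τ| + |τ' - τ| * S := (norm_add_le _ _).trans (by gcongr)
          _ ≤ 1 * |τ' - τ| + |τ' - τ| * S := by gcongr
          _ = (1 + S) * |τ' - τ| := by ring
          _ ≤ _ := by gcongr
      calc _ ≤ M + n * ((1 + S) * (t - s)) := by
            refine (norm_add_le _ _).trans (add_le_add h1 ?_)
            rw [norm_smul, Real.norm_eq_abs, abs_of_pos hn0]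
            gcongr
        _ ≤ M + n * ((1 + S) * ((b - a) / (n * l))) := by gcongr
        _ = M + (1 + S) * (n * ((b - a) / (n * l))) := by ring
        _ = D := by rw [q5]
    refine ⟨_, _, rfl, rfl, hmul, hdev, fun τ hτ => ?_, fun τ hτ => ?_⟩
    · have hτI := hsub hτ
      rw [hG τ hτI, hG s hsI, intervalIntegral.integral_interval_sub_left
        (intervalIntegrable_of_Icc (ex.dev_integrableOn n x c) haI hτI)
        (intervalIntegrable_of_Icc (ex.dev_integrableOn n x c) haI hsI)]
      have h1 := integral_stepFun_congr (c := c) hx.mono hi le_rfl hτ.2 hτ.1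
        fun τ v => (n : ℝ) • (v - p τ)
      simp only [dev] at h1 ⊢
      rw [h1]
      have := intervalIntegral.norm_integral_le_of_norm_le_const (a := s) (b := τ) (C := D)
        (f := fun τ => (n : ℝ) • (c i - p τ)) fun y hy => by
          rw [uIoc_of_le hτ.1] at hy
          rw [hmul]; exact hdev y ⟨hy.1.le, hy.2.trans hτ.2⟩
      rwa [abs_of_nonneg (sub_nonneg.2 hτ.1)] at this
    · have hτI := hsub hτ
      rw [hγ τ hτI, hγ s hsI, intervalIntegral.integral_interval_sub_left
        (intervalIntegrable_of_Icc hwi haI hτI) (intervalIntegrable_of_Icc hwi haI hsI)]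
      have := intervalIntegral.norm_integral_le_of_norm_le_const (a := s) (b := τ) (C := M)
        (f := w) fun y hy => by
          rw [uIoc_of_le hτ.1] at hy
          exact hM y (hsub ⟨hy.1.le, hy.2.trans hτ.2⟩)
      rwa [abs_of_nonneg (sub_nonneg.2 hτ.1)] at this
  have hclose : ∀ t ∈ Icc a b, ‖G t - γ t‖ ≤ (D + M) * ((b - a) / (n * l)) := by
    intro t ht
    obtain ⟨i, hi, hti⟩ := hx.exists_cell ht hn1'
    rcases (hx.mono (Nat.le_succ i)).eq_or_lt with heq | hlt
    · have : t = x i := le_antisymm (heq ▸ hti.2) hti.1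
      rw [this, hGγ i hi.le, sub_self, norm_zero]; positivity
    · obtain ⟨p₀, w₀, -, -, -, -, h1, h2⟩ := hcell i hi hlt
      have h1 := h1 t hti
      have h2 := h2 t hti
      rw [hGγ i hi.le] at h1
      have h3 : t - x i ≤ (b - a) / (n * l) := by linarith [hti.2, hwid i]
      calc ‖G t - γ t‖ = ‖(G t - γ (x i)) - (γ t - γ (x i))‖ := by congr 1; abel
        _ ≤ D * (t - x i) + M * (t - x i) := (norm_sub_le _ _).trans (add_le_add h1 h2)
        _ = (D + M) * (t - x i) := by ring
        _ ≤ _ := by gcongr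
  have hγn : ∀ t ∈ Icc a b, ‖γ t‖ ≤ M * (b - a) := by
    intro t ht
    rw [hγ t ht]
    have := intervalIntegral.norm_integral_le_of_norm_le_const (a := a) (b := t) (C := M)
        (f := w) fun y hy => by
          rw [uIoc_of_le ht.1] at hy
          exact hM y ⟨hy.1.le, hy.2.trans ht.2⟩
    rw [abs_of_nonneg (sub_nonneg.2 ht.1)] at this
    exact this.trans (by gcongr; exact ht.2)
  refine ⟨fun t ht => (hclose t ht).trans (q2.trans (min_le_right _ _)), ?_⟩
  obtain ⟨hξm, B, hB⟩ := ex.xi_bound (n := n) (x := x) (c := c) hGc (n : ℝ)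
  have iR : IntegrableOn (fun t => R t ((n : ℝ)⁻¹ • (G t, dev n x c p t))) (Icc a b) :=
    ex.R_int (fun t => (n : ℝ)⁻¹ • (G t, dev n x c p t)) (hξm.const_smul (n : ℝ)⁻¹)
      (‖(n : ℝ)⁻¹‖ * B) fun t ht => by rw [norm_smul]; gcongr; exact hB t ht
  have iQ : IntegrableOn (fun t => Q t (γ t, w t) (γ t, w t)) (Icc a b) :=
    ((ex.Q_cont.clm_apply (hγc.prodMk hw)).clm_apply (hγc.prodMk hw)).integrableOn_Icc
  have iB : IntegrableOn (fun t => Q t (0, σ t) (0, σ t) * (r t ^ 2)⁻¹) (Icc a b) := by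
    have h1 := (intervalIntegrable_of_Icc hri2 haI (right_mem_Icc.2 hab.le)).continuousOn_mul
      (by rwa [uIcc_of_le hab.le] : ContinuousOn (fun x => Q x (0, σ x) (0, σ x)) (uIcc a b))
    rwa [intervalIntegrable_iff_integrableOn_Icc_of_le hab.le] at h1
  have key : ∀ i ∈ Finset.range n, (n : ℝ) ^ 2 * ∫ t in x i..x (i + 1),
      R t ((n : ℝ)⁻¹ • (G t, dev n x c p t)) ≤
      1 / 2 * (∫ t in x i..x (i + 1), Q t (γ t, w t) (γ t, w t)) +
      (b - a) ^ 2 / 24 * (∫ t in x i..x (i + 1), Q t (0, σ t) (0, σ t) * (r t ^ 2)⁻¹) +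
      ε' * U * (x (i + 1) - x i) := by
    intro i hi
    have hi := Finset.mem_range.1 hi
    rcases (hx.mono (Nat.le_succ i)).eq_or_lt with heq | hlt
    · rw [← heq]; simp
    have hsI : x i ∈ Icc a b := hx.mem_Icc' hi.le
    have htI : x (i + 1) ∈ Icc a b := hx.mem_Icc' hi
    have hsub : Icc (x i) (x (i + 1)) ⊆ Icc a b := Icc_subset_Icc hsI.1 htI.2
    have hlen := (hwid i).trans q1
    obtain ⟨p₀, w₀, hp₀, hw₀, hcp, hdev, hGd, hγd⟩ := hcell i hi hlt
    have e1 : ∀ f : ℝ → E → ℝ, ∫ t in x i..x (i + 1), f t (stepFun n x c t) =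
        ∫ t in x i..x (i + 1), f t (c i) :=
      integral_stepFun_congr hx.mono hi le_rfl le_rfl hlt.le
    have e2 := e1 fun t v => R t ((n : ℝ)⁻¹ • (G t, (n : ℝ) • (v - p t)))
    simp only [dev]
    rw [e2]
    simp only [hcp]
    have hsc := H1 (x i) (x (i + 1)) hsI.1 hlt.le htI.2 (hlen.trans (min_le_left _ _))
    have hq2 : ∀ {A : ℝ}, 0 ≤ A → A ≤ D + M → ∀ t ∈ Icc (x i) (x (i + 1)), A * (t - x i) ≤ ε' := by
      intro A hA hAD t ht
      have h3 : t - x i ≤ (b - a) / (n * l) := by linarith [ht.2, hwid i]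
      have h4 : 0 ≤ t - x i := sub_nonneg.2 ht.1
      calc A * (t - x i) ≤ (D + M) * ((b - a) / (n * l)) := by gcongr
        _ ≤ ε' := q2.trans (min_le_left _ _)
    have hG2 : ∀ t ∈ Icc (x i) (x (i + 1)), ‖G t‖ ≤ M * (b - a) + D * ((b - a) / l) := by
      intro t ht
      have h3 : t - x i ≤ (b - a) / l := by linarith [ht.2, hwid i]
      have h1 := hGd t ht
      rw [hGγ i hi.le] at h1
      calc ‖G t‖ = ‖γ (x i) + (G t - γ (x i))‖ := by rw [add_sub_cancel]
        _ ≤ M * (b - a) + D * (t - x i) := (norm_add_le _ _).trans (add_le_add (hγn _ hsI) h1)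
        _ ≤ _ := by gcongr
    have iRc : IntervalIntegrable (fun t => R t ((n : ℝ)⁻¹ • (G t, w₀ + (n : ℝ) • (p₀ - p t))))
        volume (x i) (x (i + 1)) := by
      have h1 := intervalIntegrable_of_Icc iR hsI htI
      refine h1.congr_ae ?_
      have h : ∀ᵐ τ : ℝ, τ ≠ x (i + 1) := by simp [ae_iff]
      rw [uIoc_of_le hlt.le, EventuallyEq, ae_restrict_iff' measurableSet_Ioc]
      filter_upwards [h] with τ hτ hτ2
      have e3 : stepFun n x c τ = c i :=
        stepFun_apply hx.mono hi ⟨hτ2.1.le, lt_of_le_of_ne hτ2.2 hτ⟩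
      simp only [dev, e3, hcp]
    have hcube := cell_cube_le hlt.le hn0 hH hl hr (intervalIntegrable_of_Icc hri hsI htI)
      (intervalIntegrable_of_Icc hri2 hsI htI) (hrc i)
    refine ex.upper_cell hε'0 hε'1 hδ hlt hsub hn1 hp₀ hw₀ (fun t ht => ?_) (fun t ht => ?_) q3
      (hGγ i hi.le) (fun t ht => (hGd t ht).trans (hq2 hD0 (by linarith) t ht))
      (fun t ht => (hγd t ht).trans (hq2 hM0 (by linarith) t ht)) hsc.1 hsc.2.1
      (fun t ht => ?_) (hΛS _ hsI).1 (hΛS _ hsI).2 (intervalIntegrable_of_Icc hwi hsI htI) iRc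
      (intervalIntegrable_of_Icc iQ hsI htI) hl hr (intervalIntegrable_of_Icc hri2 hsI htI) hcube
    · rw [Prod.norm_def]
      have h1 : 0 ≤ M * (b - a) + D * ((b - a) / l) := by positivity
      exact max_le ((hG2 t ht).trans (by rw [hK]; linarith))
        ((hdev t ht).trans (by rw [hK]; linarith))
    · rw [Prod.norm_def]
      have h1 : 0 ≤ D * ((b - a) / l) := by positivity
      have h2 : M ≤ D := by rw [hD]; have : 0 ≤ (1 + S) * ((b - a) / l) := by positivity
                            linarith
      have h3 : 0 ≤ M * (b - a) := by positivity
      exact max_le ((hγn t (hsub ht)).trans (by rw [hK]; linarith))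
        ((hM t (hsub ht)).trans (by rw [hK]; linarith))
    · have h1 := H2 (x i) hsI t (hsub ht) (by
        rw [abs_sub_comm, abs_of_nonneg (sub_nonneg.2 ht.1)]
        have := hlen.trans (min_le_right _ _)
        linarith [ht.2])
      rw [Real.norm_eq_abs] at h1
      have := (abs_le.1 h1).2
      linarith
  have hsum := Finset.sum_le_sum key
  rw [← Finset.mul_sum, hx.sum_integral iR] at hsum
  simp only [Finset.sum_add_distrib, ← Finset.mul_sum] at hsum
  rw [hx.sum_integral iQ, hx.sum_integral iB, Finset.sum_range_sub, hx.zero, hx.last] at hsum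
  linarith

end Recovery

section Approximation

variable {E : Type*} [NormedAddCommGroup E] [InnerProductSpace ℝ E] [CompleteSpace E]
variable {a b θ : ℝ} {p σ : ℝ → E} {Q : ℝ → E × E →L[ℝ] E × E →L[ℝ] ℝ} {R : ℝ → E × E → ℝ}

/-- Continuous functions with mean zero are dense among the `L²` functions with mean zero. -/
lemma exists_continuous_approx (hab : a < b) {w : ℝ → E}
    (hw : MemLp w 2 (volume.restrict (Icc a b))) (h0 : ∫ t in a..b, w t = 0) {ε : ℝ}
    (hε : 0 < ε) : ∃ v : ℝ → E, Continuous v ∧ ∫ t in a..b, v t = 0 ∧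
      ∫ t in a..b, ‖v t - w t‖ ^ 2 ≤ ε := by
  have hH : 0 < b - a := sub_pos.2 hab
  have hw' : MemLp w (ENNReal.ofReal 2) (volume.restrict (Icc a b)) := by
    rwa [show ENNReal.ofReal 2 = 2 by norm_num]
  obtain ⟨v, -, hv1, hvc, hv2⟩ := hw'.exists_hasCompactSupport_integral_rpow_sub_le two_pos hε
  rw [show ENNReal.ofReal 2 = 2 by norm_num] at hv2
  have hf : MemLp (fun t => v t - w t) 2 (volume.restrict (Icc a b)) := hv2.sub hw
  have hf2 := hf.integrable_norm_pow (by simp)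
  have hf1 : IntegrableOn (fun t => v t - w t) (Icc a b) := hf.integrable (by norm_num)
  have hwi : IntegrableOn w (Icc a b) := hw.integrable (by norm_num)
  have haI := left_mem_Icc.2 hab.le
  have hbI := right_mem_Icc.2 hab.le
  have ii := intervalIntegrable_of_Icc hf1 haI hbI
  have hfv : ∫ t in a..b, (v t - w t) = ∫ t in a..b, v t := by
    rw [intervalIntegral.integral_sub (hvc.intervalIntegrable _ _)
      (intervalIntegrable_of_Icc hwi haI hbI), h0, sub_zero]
  set m : E := (b - a)⁻¹ • ∫ t in a..b, v t with hm
  have hm' : ∫ t in a..b, v t = (b - a) • m := by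
    rw [hm, smul_smul, mul_inv_cancel₀ hH.ne', one_smul]
  refine ⟨fun t => v t - m, hvc.sub continuous_const, ?_, ?_⟩
  · rw [intervalIntegral.integral_sub (hvc.intervalIntegrable _ _) intervalIntegrable_const,
      intervalIntegral.integral_const, hm', sub_self]
  have hinner : IntervalIntegrable (fun t => (innerSL ℝ m) (v t - w t)) volume a b :=
    ⟨(innerSL ℝ m).integrable_comp ii.1, (innerSL ℝ m).integrable_comp ii.2⟩
  -- subtracting the mean does not increase the `L²` norm
  have e1 : ∀ t, ‖v t - m - w t‖ ^ 2 =
      ‖v t - w t‖ ^ 2 - 2 * (innerSL ℝ m) (v t - w t) + ‖m‖ ^ 2 := fun t => by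
    rw [show v t - m - w t = (v t - w t) - m by abel, norm_sub_sq_real, innerSL_apply_apply,
      real_inner_comm]
  have hii : IntervalIntegrable (fun t => ‖v t - w t‖ ^ 2) volume a b :=
    intervalIntegrable_of_Icc hf2 haI hbI
  simp only [e1]
  rw [intervalIntegral.integral_add (hii.sub (hinner.const_mul 2)) intervalIntegrable_const,
    intervalIntegral.integral_sub hii (hinner.const_mul 2), intervalIntegral.integral_const_mul,
    ContinuousLinearMap.intervalIntegral_comp_comm _ ii, hfv, hm', map_smul,
    innerSL_apply_apply, real_inner_self_eq_norm_sq, intervalIntegral.integral_const,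
    smul_eq_mul]
  have e2 : ∫ t in a..b, ‖v t - w t‖ ^ 2 ≤ ε := by
    rw [← integral_Icc_eq_interval hab.le]
    refine le_trans (le_of_eq ?_) hv1
    refine integral_congr_ae (ae_of_all _ fun t => ?_)
    simp only [Real.rpow_two]
    rw [norm_sub_rev]
  nlinarith [mul_nonneg hH.le (sq_nonneg ‖m‖)]

lemma memLp_prodMk {u v : ℝ → E} {q : ℝ≥0∞} {μ : Measure ℝ} (hu : MemLp u q μ)
    (hv : MemLp v q μ) : MemLp (fun t => ((u t, v t) : E × E)) q μ := by
  refine MemLp.mono' (hu.norm.add hv.norm) (hu.1.prodMk hv.1) (ae_of_all _ fun t => ?_)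
  rw [Prod.norm_def]
  exact max_le (le_add_of_nonneg_right (norm_nonneg _)) (le_add_of_nonneg_left (norm_nonneg _))

/-- Continuity of the quadratic functional in `L²`, by Young's inequality. -/
lemma integral_quad_le (hab : a ≤ b) (hQ : ContinuousOn Q (Icc a b)) {Λ : ℝ}
    (hΛ : ∀ t ∈ Icc a b, ‖Q t‖ ≤ Λ) {ξ ζ : ℝ → E × E}
    (hξ : MemLp ξ 2 (volume.restrict (Icc a b))) (hζ : MemLp ζ 2 (volume.restrict (Icc a b)))
    {η : ℝ} (hη : 0 < η) :
    ∫ t in a..b, Q t (ξ t) (ξ t) ≤ (∫ t in a..b, Q t (ζ t) (ζ t)) +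
      Λ * ((1 + 1 / η) * (∫ t in a..b, ‖ξ t - ζ t‖ ^ 2) + η * ∫ t in a..b, ‖ζ t‖ ^ 2) := by
  have i1 := integrable_quad hQ hξ
  have i2 := integrable_quad hQ hζ
  have i3 : IntegrableOn (fun t => ‖ξ t - ζ t‖ ^ 2) (Icc a b) :=
    (hξ.sub hζ).integrable_norm_pow (by simp)
  have i4 : IntegrableOn (fun t => ‖ζ t‖ ^ 2) (Icc a b) := hζ.integrable_norm_pow (by simp)
  simp only [← integral_Icc_eq_interval hab]
  have i5 : IntegrableOn (fun t => Λ * ((1 + 1 / η) * ‖ξ t - ζ t‖ ^ 2 + η * ‖ζ t‖ ^ 2))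
      (Icc a b) := ((i3.const_mul (1 + 1 / η)).add (i4.const_mul η)).const_mul Λ
  rw [← integral_const_mul, ← integral_const_mul, ← integral_add (i3.const_mul _) (i4.const_mul _),
    ← integral_const_mul, ← integral_add i2 i5]
  refine setIntegral_mono_on i1 (i2.add i5) measurableSet_Icc fun t ht => ?_
  have hΛ0 : 0 ≤ Λ := (norm_nonneg _).trans (hΛ t ht)
  set d := ξ t - ζ t with hd
  have e1 : ξ t = ζ t + d := by rw [hd]; abel
  have e2 : Q t (ξ t) (ξ t) = Q t (ζ t) (ζ t) + (Q t (ζ t) d + Q t d (ζ t) + Q t d d) := by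
    rw [e1]; simp only [map_add, add_apply]; ring
  have h1 := (abs_le.1 (bilin_bound (hΛ t ht) (ζ t) d)).2
  have h2 := (abs_le.1 (bilin_bound (hΛ t ht) d (ζ t))).2
  have h3 := (abs_le.1 (bilin_bound (hΛ t ht) d d)).2
  have h4 : 2 * ‖d‖ * ‖ζ t‖ ≤ 1 / η * ‖d‖ ^ 2 + η * ‖ζ t‖ ^ 2 := by
    have h5 : 0 ≤ (‖d‖ - η * ‖ζ t‖) ^ 2 / η := by positivity
    have h6 : (‖d‖ - η * ‖ζ t‖) ^ 2 / η =
      1 / η * ‖d‖ ^ 2 - 2 * ‖d‖ * ‖ζ t‖ + η * ‖ζ t‖ ^ 2 := by field_simp; ring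
    linarith
  have h7 := mul_le_mul_of_nonneg_left h4 hΛ0
  rw [e2]
  nlinarith

/-- Approximation of the first argument of the limit functional. -/
lemma Expansion.exists_approx (ex : Expansion a b θ p σ Q R) (hab : a < b) {g dg : ℝ → E}
    (hdg : MemLp dg 2 (volume.restrict (Icc a b))) (h0 : ∫ t in a..b, dg t = 0)
    (hg : ∀ t ∈ Icc a b, g t = ∫ τ in a..t, dg τ) {ε : ℝ} (hε : 0 < ε) :
    ∃ w : ℝ → E, Continuous w ∧ ∫ t in a..b, w t = 0 ∧
      (∀ t ∈ Icc a b, ‖(∫ τ in a..t, w τ) - g t‖ ≤ ε) ∧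
      ∫ t in a..b, Q t (∫ τ in a..t, w τ, w t) (∫ τ in a..t, w τ, w t) ≤
        (∫ t in a..b, Q t (g t, dg t) (g t, dg t)) + ε := by
  have hH : 0 < b - a := sub_pos.2 hab
  have haI := left_mem_Icc.2 hab.le
  obtain ⟨Λ, S, hΛ0, -, hΛ⟩ := ex.bounds hab
  have hdgi : IntegrableOn dg (Icc a b) := hdg.integrable (by norm_num)
  have hgc : ContinuousOn g (Icc a b) := (continuousOn_primitive_Icc hab.le hdgi).congr hg
  have hζ := memLp_prodMk (memLp_of_continuousOn 2 hgc) hdg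
  set Z := ∫ t in a..b, ‖((g t, dg t) : E × E)‖ ^ 2 with hZ
  have hZ0 : 0 ≤ Z := intervalIntegral.integral_nonneg hab.le fun _ _ => sq_nonneg _
  set η := ε / (2 * (Λ * Z + 1)) with hη
  have hη0 : 0 < η := by positivity
  have hηZ : Λ * (η * Z) ≤ ε / 2 := by
    have : η * (2 * (Λ * Z + 1)) = ε := by rw [hη]; field_simp
    nlinarith
  obtain ⟨τ, ⟨hτ1, hτ2⟩, hτ0⟩ : ∃ τ : ℝ, (((b - a) + 1) * τ < ε ∧
      Λ * ((1 + 1 / η) * ((((b - a) + 1) * τ) ^ 2 * (b - a) + τ ^ 2)) < ε / 2) ∧ 0 < τ := by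
    have c1 : Tendsto (fun τ : ℝ => ((b - a) + 1) * τ) (𝓝 0) (𝓝 (((b - a) + 1) * 0)) :=
      Continuous.tendsto (by fun_prop) 0
    have c2 : Tendsto (fun τ : ℝ => Λ * ((1 + 1 / η) * ((((b - a) + 1) * τ) ^ 2 * (b - a) + τ ^ 2)))
        (𝓝 0) (𝓝 (Λ * ((1 + 1 / η) * ((((b - a) + 1) * 0) ^ 2 * (b - a) + 0 ^ 2)))) :=
      Continuous.tendsto (by fun_prop) 0
    have k1 := c1.eventually_lt_const (by simpa using hε : _ < ε)
    have k2 := c2.eventually_lt_const (by simpa using hε : _ < ε / 2)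
    exact (((k1.and k2).filter_mono nhdsWithin_le_nhds).and
      (self_mem_nhdsWithin : Ioi (0 : ℝ) ∈ 𝓝[>] 0)).exists
  obtain ⟨w, hwc, hw0, hw⟩ := exists_continuous_approx hab hdg h0 (by positivity : 0 < τ ^ 2)
  have hwi : IntegrableOn w (Icc a b) := hwc.integrableOn_Icc
  have hwL := memLp_of_continuousOn (a := a) (b := b) 2 hwc.continuousOn
  have hdL : MemLp (fun t => w t - dg t) 2 (volume.restrict (Icc a b)) := hwL.sub hdg
  have hd2 : IntegrableOn (fun t => ‖w t - dg t‖ ^ 2) (Icc a b) :=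
    hdL.integrable_norm_pow (by simp)
  have hd1 : IntegrableOn (fun t => w t - dg t) (Icc a b) := hwi.sub hdgi
  have hclose : ∀ t ∈ Icc a b, ‖(∫ τ in a..t, w τ) - g t‖ ≤ ((b - a) + 1) * τ := by
    intro t ht
    rw [hg t ht, ← intervalIntegral.integral_sub (intervalIntegrable_of_Icc hwi haI ht)
      (intervalIntegrable_of_Icc hdgi haI ht)]
    have h1 := norm_integral_le_young hd2 hw hab.le hd1 haI ht ht.1 (inv_pos.2 hτ0)
    have h2 : τ⁻¹ * τ ^ 2 = τ := by field_simp
    rw [h2, div_inv_eq_mul] at h1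
    refine h1.trans ?_
    have := mul_le_mul_of_nonneg_right (sub_le_sub_right ht.2 a) hτ0.le
    linarith
  refine ⟨w, hwc, hw0, fun t ht => (hclose t ht).trans hτ1.le, ?_⟩
  have hγc : ContinuousOn (fun t => ∫ τ in a..t, w τ) (Icc a b) :=
    continuousOn_primitive_Icc hab.le hwi
  have hξ := memLp_prodMk (memLp_of_continuousOn 2 hγc) hwL
  have h1 := integral_quad_le hab.le ex.Q_cont (fun t ht => (hΛ t ht).1) hξ hζ hη0
  have h2 : ∫ t in a..b, ‖((∫ τ in a..t, w τ, w t) : E × E) - (g t, dg t)‖ ^ 2 ≤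
      (((b - a) + 1) * τ) ^ 2 * (b - a) + τ ^ 2 := by
    calc _ ≤ ∫ t in a..b, ((((b - a) + 1) * τ) ^ 2 + ‖w t - dg t‖ ^ 2) := by
          rw [← integral_Icc_eq_interval hab.le, ← integral_Icc_eq_interval hab.le]
          have hcst : IntegrableOn (fun _ : ℝ => (((b - a) + 1) * τ) ^ 2) (Icc a b) :=
            continuousOn_const.integrableOn_Icc
          refine setIntegral_mono_on ((hξ.sub hζ).integrable_norm_pow (by simp))
            (hcst.add hd2) measurableSet_Icc fun t ht => ?_
          have k1 := hclose t ht
          have k2 : 0 ≤ ((b - a) + 1) * τ := by positivity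
          rw [Prod.mk_sub_mk, Prod.norm_mk]
          rcases max_cases ‖(∫ τ in a..t, w τ) - g t‖ ‖w t - dg t‖ with ⟨h, -⟩ | ⟨h, -⟩ <;> rw [h]
          · have := pow_le_pow_left₀ (norm_nonneg _) k1 2
            have := sq_nonneg ‖w t - dg t‖
            linarith
          · have := sq_nonneg (((b - a) + 1) * τ)
            linarith
      _ = (((b - a) + 1) * τ) ^ 2 * (b - a) + ∫ t in a..b, ‖w t - dg t‖ ^ 2 := by
          rw [intervalIntegral.integral_add intervalIntegrable_const
            (intervalIntegrable_of_Icc hd2 haI (right_mem_Icc.2 hab.le)),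
            intervalIntegral.integral_const, smul_eq_mul, mul_comm (b - a)]
      _ ≤ _ := by gcongr
  refine h1.trans ?_
  rw [mul_add]
  have h3 : Λ * ((1 + 1 / η) * ∫ t in a..b, ‖((∫ τ in a..t, w τ, w t) : E × E) - (g t, dg t)‖ ^ 2) ≤
      ε / 2 := le_trans (by gcongr) hτ2.le
  linarith

end Approximation

section RecoveryPairs

variable {E : Type*} [NormedAddCommGroup E] [InnerProductSpace ℝ E] [CompleteSpace E]
variable {a b θ : ℝ} {p σ : ℝ → E} {Q : ℝ → E × E →L[ℝ] E × E →L[ℝ] ℝ} {R : ℝ → E × E → ℝ}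

/-- Mixing the mesh density with the uniform one increases the mesh energy by at most the factor
`(1 - l)⁻²`. -/
lemma integral_mix_le (hab : a ≤ b) {β ρ r : ℝ → ℝ} (hβ : ∀ t ∈ Icc a b, 0 ≤ β t) {l : ℝ}
    (hl : 0 < l) (hl1 : l < 1) (hρ : ∀ᵐ t, 0 ≤ ρ t) (hr : ∀ᵐ t, r t = (1 - l) * ρ t + l)
    (hi : IntegrableOn (fun t => β t * (r t ^ 2)⁻¹) (Icc a b))
    (hfin : ∫⁻ t in Icc a b, ENNReal.ofReal (β t) / ENNReal.ofReal |ρ t| ^ 2 ≠ ⊤) :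
    ∫ t in a..b, β t * (r t ^ 2)⁻¹ ≤ ((1 - l) ^ 2)⁻¹ *
      (∫⁻ t in Icc a b, ENNReal.ofReal (β t) / ENNReal.ofReal |ρ t| ^ 2).toReal := by
  have hl2 : 0 < 1 - l := by linarith
  rw [← integral_Icc_eq_interval hab, integral_eq_lintegral_of_nonneg_ae ?_ hi.1]
  · rw [← ENNReal.toReal_ofReal (by positivity : 0 ≤ ((1 - l) ^ 2)⁻¹), ← ENNReal.toReal_mul]
    refine ENNReal.toReal_mono (ENNReal.mul_ne_top ENNReal.ofReal_ne_top hfin) ?_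
    rw [← lintegral_const_mul' _ _ ENNReal.ofReal_ne_top]
    refine lintegral_mono_ae ?_
    rw [ae_restrict_iff' measurableSet_Icc]
    filter_upwards [hρ, hr] with t h1 h2 ht
    have h3 := hβ t ht
    rw [h2]
    rcases h1.eq_or_lt with h0 | h0
    · rw [← h0, abs_zero, ENNReal.ofReal_zero]
      rcases h3.eq_or_lt with h4 | h4
      · rw [← h4]; simp
      · -- here the integrand on the right is infinite
        rw [zero_pow two_ne_zero, ENNReal.div_zero (by simpa using h4), ENNReal.mul_top]
        · exact le_top
        · rw [Ne, ENNReal.ofReal_eq_zero, not_le]; positivity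
    · rw [abs_of_pos h0, ← ENNReal.ofReal_pow h0.le, ← ENNReal.ofReal_div_of_pos (by positivity),
        ← ENNReal.ofReal_mul (by positivity)]
      refine ENNReal.ofReal_le_ofReal ?_
      have e : ((1 - l) ^ 2)⁻¹ * (β t / ρ t ^ 2) = β t * (((1 - l) * ρ t) ^ 2)⁻¹ := by
        rw [mul_pow, mul_inv]; ring
      rw [e]
      have h5 : 0 < (1 - l) * ρ t := mul_pos hl2 h0
      gcongr
      linarith
  · rw [EventuallyLE, ae_restrict_iff' measurableSet_Icc]
    exact ae_of_all _ fun t ht => mul_nonneg (hβ t ht) (by positivity)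

/-- Admissible pairs that are close to a given pair of finite limit energy, with energy not much
larger than the limit energy. -/
theorem Expansion.exists_recovery (ex : Expansion a b θ p σ Q R) (hab : a < b) {us : ℝ → E}
    (hus : ∀ t ∈ Icc a b, us t = us a + ∫ τ in a..t, p τ) {g dg : ℝ → E}
    (hdg : MemLp dg 2 (volume.restrict (Icc a b))) (h0 : ∫ t in a..b, dg t = 0)
    (hg : ∀ t ∈ Icc a b, g t = ∫ τ in a..t, dg τ) {Y₀ : ℝ → ℝ} (hY₀ : NMono a b Y₀) {ρ : ℝ → ℝ}
    (hρ : ∀ᵐ t, HasDerivAt Y₀ (ρ t) t)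
    (hfin : ∫⁻ t in Icc a b, ENNReal.ofReal (Q t (0, σ t) (0, σ t)) / ENNReal.ofReal |ρ t| ^ 2 ≠ ⊤)
    {ε : ℝ} (hε : 0 < ε) :
    ∃ n₀ : ℕ, 1 ≤ n₀ ∧ ∀ n : ℕ, n₀ ≤ n → ∃ (x : ℕ → ℝ) (c : ℕ → E) (U : ℝ → E) (y : ℝ → ℝ),
      IsNodes a b n x ∧ IsPL n x c U ∧ U a = us a ∧ U b = us b ∧ IsMono a b y ∧
      (∀ q : ℝ, 1 < q → Admissible a b q (us a) (us b) n U y) ∧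
      (∀ t ∈ Icc a b, ‖(n : ℝ) • (U t - us t) - g t‖ ≤ ε) ∧
      (∫ t in Icc a b, |y t - Y₀ t| ≤ ε) ∧
      (n : ℝ) ^ 2 * ∫ t in a..b, R t ((n : ℝ)⁻¹ • ((n : ℝ) • (U t - us t), dev n x c p t)) ≤
        1 / 2 * (∫ t in a..b, Q t (g t, dg t) (g t, dg t)) + (b - a) ^ 2 / 24 *
          (∫⁻ t in Icc a b, ENNReal.ofReal (Q t (0, σ t) (0, σ t)) /
            ENNReal.ofReal |ρ t| ^ 2).toReal + ε := by
  have hH : 0 < b - a := sub_pos.2 hab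
  have haI := left_mem_Icc.2 hab.le
  have hbI := right_mem_Icc.2 hab.le
  have hpi : IntegrableOn p (Icc a b) := ex.p_cont.integrableOn_Icc
  set J := (∫⁻ t in Icc a b, ENNReal.ofReal (Q t (0, σ t) (0, σ t)) /
            ENNReal.ofReal |ρ t| ^ 2).toReal with hJ
  -- `l` is the share of the uniform mesh
  obtain ⟨l, ⟨⟨hl2, hl3⟩, hl1⟩, hl⟩ : ∃ l : ℝ, (((b - a) ^ 2 / 24 * (((1 - l) ^ 2)⁻¹ * J) <
      (b - a) ^ 2 / 24 * J + ε / 4 ∧ l * (b - a) * (b - a) < ε / 2) ∧ l < 1) ∧ 0 < l := by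
    have c1 : Tendsto (fun l : ℝ => (b - a) ^ 2 / 24 * (((1 - l) ^ 2)⁻¹ * J)) (𝓝 0)
        (𝓝 ((b - a) ^ 2 / 24 * (((1 - 0) ^ 2)⁻¹ * J))) := by
      refine ContinuousAt.tendsto (f := fun l : ℝ => (b - a) ^ 2 / 24 * (((1 - l) ^ 2)⁻¹ * J)) ?_
      have : ContinuousAt (fun l : ℝ => ((1 - l) ^ 2)⁻¹) 0 :=
        ContinuousAt.inv₀ (by fun_prop) (by norm_num)
      exact continuousAt_const.mul (this.mul continuousAt_const)
    have c2 : Tendsto (fun l : ℝ => l * (b - a) * (b - a)) (𝓝 0) (𝓝 (0 * (b - a) * (b - a))) :=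
      Continuous.tendsto (by fun_prop) 0
    have k1 := c1.eventually_lt_const
      (by simpa using hε : _ < (b - a) ^ 2 / 24 * J + ε / 4)
    have k2 := c2.eventually_lt_const (by simpa using hε : _ < ε / 2)
    exact ((((k1.and k2).and (eventually_lt_nhds one_pos)).filter_mono nhdsWithin_le_nhds).and
      (self_mem_nhdsWithin : Ioi (0 : ℝ) ∈ 𝓝[>] 0)).exists
  obtain ⟨w, hwc, hw0, hwg, hwQ⟩ := ex.exists_approx hab hdg h0 hg (by positivity : 0 < ε / 4)
  set γ : ℝ → E := fun t => ∫ τ in a..t, w τ with hγ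
  set r : ℝ → ℝ := fun t => (1 - l) * deriv Y₀ t + l with hr
  have hd0 : ∀ t, 0 ≤ deriv Y₀ t := fun t => hY₀.mono.deriv_nonneg
  have hrl : ∀ t, l ≤ r t := fun t => by
    have := mul_nonneg (by linarith : 0 ≤ 1 - l) (hd0 t)
    simp only [hr]; linarith
  have hrm : Measurable r := ((measurable_deriv Y₀).const_mul (1 - l)).add_const l
  have hri : IntegrableOn r (Icc a b) := by
    have h1 : IntervalIntegrable (deriv Y₀) volume a b :=
      (hY₀.mono.monotoneOn _).intervalIntegrable_deriv
    rw [intervalIntegrable_iff_integrableOn_Icc_of_le hab.le] at h1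
    exact (h1.const_mul (1 - l)).add continuousOn_const.integrableOn_Icc
  have hri2 : IntegrableOn (fun t => (r t ^ 2)⁻¹) (Icc a b) := by
    refine bounded_integrable (M := (l ^ 2)⁻¹) (hrm.pow_const 2).inv.aestronglyMeasurable
      (ae_of_all _ fun t => ?_)
    have := hrl t
    rw [Real.norm_eq_abs, abs_of_nonneg (by positivity)]
    gcongr
  obtain ⟨n₀, hn₀, hmesh⟩ := ex.upper_bound_mesh hab hus hwc.continuousOn (γ := γ)
    (fun t _ => rfl) hl (ae_of_all _ hrl) hri hri2 (by positivity : 0 < ε / 4)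
  obtain ⟨n₁, hn₁⟩ := exists_nat_gt ((b - a) * (b - a) / (ε / 2))
  refine ⟨max n₀ n₁, hn₀.trans (le_max_left _ _), fun n hn => ?_⟩
  have hn1 : 1 ≤ n := hn₀.trans ((le_max_left _ _).trans hn)
  have hn0 : (0 : ℝ) < n := by exact_mod_cast hn1
  obtain ⟨x, hx, hx1, hx2, hx3, hx4⟩ := hY₀.exists_mesh hab hl hl1.le hn1
  obtain ⟨y, hy1, hy2, hy3⟩ := exists_admissible_of_nodes (E := E) hab hn1 hx
  set f : ℝ → E := fun t => us t + (n : ℝ)⁻¹ • γ t with hf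
  have hγa : γ a = 0 := by simp [hγ]
  have hfa : f a = us a := by simp [hf, hγa]
  have hfb : f b = us b := by
    have : γ b = 0 := hw0
    simp [hf, this]
  set c : ℕ → E := fun i => (x (i + 1) - x i)⁻¹ • (f (x (i + 1)) - f (x i)) with hc
  have hPL : IsPL n x c (interp a n x f) := interp_isPL hx f
  have hUa : interp a n x f a = us a := by
    have := interp_node hx f (Nat.zero_le n)
    rwa [hx.zero, hfa] at this
  have hUb : interp a n x f b = us b := by
    have := interp_node hx f le_rfl
    rwa [hx.last, hfb] at this
  have hprim : ∀ t ∈ Icc a b, (n : ℝ) • (interp a n x f t - us t) =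
      ∫ τ in a..t, dev n x c p τ := fun t ht => by
    simp only [dev]
    rw [intervalIntegral.integral_smul, intervalIntegral.integral_sub
      (stepFun_intervalIntegrable a t) (intervalIntegrable_of_Icc hpi haI ht), hus t ht, interp, hfa]
    congr 1
    abel
  obtain ⟨m1, m2⟩ := hmesh n ((le_max_left _ _).trans hn) x hx hx1 hx2 c
    (fun t => (n : ℝ) • (interp a n x f t - us t)) (fun i => rfl) hprim fun i hi => by
      rw [interp_node hx f hi, hf]
      simp only [add_sub_cancel_left, smul_smul]
      rw [mul_inv_cancel₀ hn0.ne', one_smul]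
  refine ⟨x, c, interp a n x f, y, hx, hPL, hUa, hUb, hy1, fun q hq => ?_, fun t ht => ?_, ?_, ?_⟩
  · have := hy3 q f hq
    rwa [hfa, hfb] at this
  · calc _ = ‖((n : ℝ) • (interp a n x f t - us t) - γ t) + (γ t - g t)‖ := by congr 1; abel
      _ ≤ ε / 4 + ε / 4 := (norm_add_le _ _).trans (add_le_add (m1 t ht) (hwg t ht))
      _ ≤ ε := by linarith
  · have h1 := mesh_close hY₀ hl.le hn1 hx hx3 hx4 hy2
    have h2 : ∫ t in Icc a b, |y t - Y₀ t| ≤ ∫ t in Icc a b, ((b - a) / n + l * (b - a)) := by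
      refine integral_mono_of_nonneg (ae_of_all _ fun t => abs_nonneg _) ?_ h1
      exact continuousOn_const.integrableOn_Icc
    refine h2.trans ?_
    rw [integral_Icc_eq_interval hab.le, intervalIntegral.integral_const, smul_eq_mul]
    have h3 : (b - a) * (b - a) / n ≤ ε / 2 := by
      have h4 : (b - a) * (b - a) / (ε / 2) ≤ n :=
        hn₁.le.trans (by exact_mod_cast (le_max_right _ _).trans hn)
      rw [div_le_iff₀ (by positivity)] at h4 ⊢
      linarith
    have h5 : (b - a) * ((b - a) / n + l * (b - a)) =
      (b - a) * (b - a) / n + l * (b - a) * (b - a) := by ring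
    linarith
  · have hbc : ContinuousOn (fun x => Q x (0, σ x) (0, σ x)) (Icc a b) := by
      have h1 : ContinuousOn (fun x => ((0, σ x) : E × E)) (Icc a b) :=
        continuousOn_const.prodMk ex.σ_cont
      exact (ex.Q_cont.clm_apply h1).clm_apply h1
    have iB : IntegrableOn (fun t => Q t (0, σ t) (0, σ t) * (r t ^ 2)⁻¹) (Icc a b) := by
      have h1 := (intervalIntegrable_of_Icc hri2 haI hbI).continuousOn_mul
        (by rwa [uIcc_of_le hab.le] : ContinuousOn (fun x => Q x (0, σ x) (0, σ x)) (uIcc a b))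
      rwa [intervalIntegrable_iff_integrableOn_Icc_of_le hab.le] at h1
    have hρ' : ∀ᵐ t, deriv Y₀ t = ρ t := hρ.mono fun t ht => ht.deriv
    have h1 := integral_mix_le hab.le (fun t ht => ex.Q_nonneg ht (0, σ t)) hl hl1
      (hρ'.mono fun t ht => ht ▸ hd0 t) (hρ'.mono fun t ht => by simp only [hr, ht]) iB hfin
    have h2 := mul_le_mul_of_nonneg_left h1 (by positivity : 0 ≤ (b - a) ^ 2 / 24)
    refine m2.trans ?_
    linarith

end RecoveryPairs

/-! ### The renormalized energy as an expansion at the minimizer -/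

section Link

variable {E : Type*} [NormedAddCommGroup E] [InnerProductSpace ℝ E] [CompleteSpace E]
variable [FiniteDimensional ℝ E] {a b q : ℝ} {L : ℝ → E → E → ℝ} {us : ℝ → E} {ua ub : E}

lemma IsMinimizer.boundary (hab : a < b) (hus : ContDiffOn ℝ 1 us (Icc a b))
    (hmin : IsMinimizer L a b q ua ub us) : us a = ua ∧ us b = ub := by
  obtain ⟨v, hv, huv, hva, hvb⟩ := hmin.1.2
  have h := eqOn_of_ae_eq hab hus.continuousOn hv huv
  exact ⟨(h (left_mem_Icc.2 hab.le)).trans hva, (h (right_mem_Icc.2 hab.le)).trans hvb⟩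

/-- The derivatives of a stable minimizer, the Hessian along it and the Taylor remainder have the
properties collected in `Expansion`. -/
lemma Stable.exists_expansion (hab : a < b) (hq : 1 < q) (hus : ContDiffOn ℝ 1 us (Icc a b))
    (hmin : IsMinimizer L a b q ua ub us) (hst : Stable L a b us) :
    ∃ θ, Expansion a b θ (derivWithin us (Icc a b)) (secondDeriv a b us)
      (fun x => hess L x (jet a b us x)) (rem L a b us) := by
  obtain ⟨hL, θ, hθ, hθ2⟩ := hst
  have hQpos : ∀ x ∈ Icc a b, ∀ ζ : E × E, 2 * θ * ‖ζ.2‖ ^ 2 ≤ hess L x (jet a b us x) ζ ζ := by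
    intro x hx ζ
    have h1 := hθ2 x hx 0 0 ζ
    have e0 : (∫ τ in (0 : ℝ)..1, (1 - τ)) = 1 / 2 := by
      rw [intervalIntegral.integral_sub (by simp) (by simp)]; simp; norm_num
    simp only [smul_zero, add_zero, intervalIntegral.integral_mul_const, e0] at h1
    rw [hessQ_eq] at h1
    change θ * ‖ζ.2‖ ^ 2 ≤ 1 / 2 * hess L x (jet a b us x) ζ ζ at h1
    linarith
  have hpos : ∀ x ∈ Icc a b, ∀ w, 2 * θ * ‖w‖ ^ 2 ≤ hessP L a b us x w w := fun x hx w =>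
    hQpos x hx (0, w)
  refine ⟨θ, hθ, hess_jet_continuousOn hab hL hus, fun x hx => hess_symm hab hL hx _, hQpos,
    secondDeriv_continuousOn hab hL hus hθ hpos hq hmin,
    fun x hx => (hasDerivWithinAt_secondDeriv hab hL hus hθ hpos hq hmin hx).1,
    fun x hx h => hθ2 x hx h.1 h.2 h, fun ε hε => rem_approx hab hL hus hε,
    fun ξ hξ M hM => (rem_integrableOn hab hL hus hξ hM).1⟩

variable {n : ℕ} {x : ℕ → ℝ} {c : ℕ → E} {U u : ℝ → E} {y : ℝ → ℝ}

/-- The scaled deviation of a piecewise affine competitor is a primitive of the scaled deviation of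
its gradient. -/
lemma IsPL.scaled_eq_primitive (hab : a < b) (hus : ContDiffOn ℝ 1 us (Icc a b)) (hn : 1 ≤ n)
    (hx : IsNodes a b n x) (hU : IsPL n x c U) (h0 : U a = us a) :
    ∀ t ∈ Icc a b, (n : ℝ) • (U t - us t) =
      ∫ τ in a..t, dev n x c (derivWithin us (Icc a b)) τ := by
  intro t ht
  have hd : IntegrableOn (derivWithin us (Icc a b)) (Icc a b) :=
    (hus.continuousOn_derivWithin (uniqueDiffOn_Icc hab) le_rfl).integrableOn_Icc
  simp only [dev]
  rw [intervalIntegral.integral_smul, intervalIntegral.integral_sub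
    (stepFun_intervalIntegrable a t) (intervalIntegrable_of_Icc hd (left_mem_Icc.2 hab.le) ht),
    hU.eq_primitive hx hn t ht, us_eq_primitive hab hus ht, h0]
  congr 1
  abel

/-- The scaled deviation of a piecewise affine competitor from the minimizer, and its energy. -/
lemma IsPL.energy_eq (hab : a < b) (hq : 1 < q) (hus : ContDiffOn ℝ 1 us (Icc a b))
    (hmin : IsMinimizer L a b q ua ub us) (hst : Stable L a b us) (hn : 1 ≤ n)
    (hx : IsNodes a b n x) (hU : IsPL n x c U) (h0 : U a = us a) (h1 : U b = us b)
    (hu : u =ᵐ[volume.restrict (Icc a b)] U) :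
    MemW120 a b (fun t => (n : ℝ) • (u t - us t)) ∧
    weakDeriv a b (fun t => (n : ℝ) • (u t - us t)) =ᵐ[volume.restrict (Icc a b)]
      dev n x c (derivWithin us (Icc a b)) ∧
    (n : ℝ) ^ 2 * (action L a b u - action L a b us) = (n : ℝ) ^ 2 * ∫ t in a..b,
      rem L a b us t ((n : ℝ)⁻¹ • ((n : ℝ) • (U t - us t),
        dev n x c (derivWithin us (Icc a b)) t)) := by
  obtain ⟨θ, ex⟩ := hst.exists_expansion hab hq hus hmin
  have hn0 : (n : ℝ) ≠ 0 := by positivity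
  have hprim := hU.scaled_eq_primitive hab hus hn hx h0
  have hbI := right_mem_Icc.2 hab.le
  have hzero : ∫ τ in a..b, dev n x c (derivWithin us (Icc a b)) τ = 0 := by
    rw [← hprim b hbI, h1, sub_self, smul_zero]
  have hae : (fun t => (n : ℝ) • (u t - us t)) =ᵐ[volume.restrict (Icc a b)]
      fun t => ∫ τ in a..t, dev n x c (derivWithin us (Icc a b)) τ := by
    rw [EventuallyEq, ae_restrict_iff' measurableSet_Icc] at hu ⊢
    filter_upwards [hu] with t ht htI
    rw [ht htI, hprim t htI]
  obtain ⟨k1, k2⟩ := memW120_of_primitive hab (ex.dev_memLp n x c) hae hzero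
  refine ⟨k1, k2, ?_⟩
  congr 1
  have hGc : ContinuousOn (fun t => (n : ℝ) • (U t - us t)) (Icc a b) :=
    (continuousOn_primitive_Icc hab.le (ex.dev_integrableOn n x c)).congr hprim
  obtain ⟨m1, M, hM⟩ := ex.xi_bound (n := n) (x := x) (c := c) hGc 1
  simp only [one_smul] at m1 hM
  set D : ℝ → E := fun t => stepFun n x c t - derivWithin us (Icc a b) t with hD
  have hDG : ∀ t ∈ Icc a b, ∫ τ in a..t, D τ = U t - us t := fun t ht => by
    have := hprim t ht
    simp only [dev] at this
    rw [intervalIntegral.integral_smul] at this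
    exact ((smul_right_injective E hn0) this).symm
  have hDm : AEStronglyMeasurable D (volume.restrict (Icc a b)) :=
    continuous_snd.comp_aestronglyMeasurable m1
  have hu' : u =ᵐ[volume.restrict (Icc a b)] fun t => us t + ∫ τ in a..t, D τ := by
    rw [EventuallyEq, ae_restrict_iff' measurableSet_Icc] at hu ⊢
    filter_upwards [hu] with t ht htI
    rw [ht htI, hDG t htI, add_sub_cancel]
  rw [action_sub_eq hab hst.1 hus hq hmin hDm
    (fun t ht => (norm_snd_le _).trans (hM t ht)) (by rw [hDG b hbI, h1, sub_self]) hu',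
    ← integral_Icc_eq_interval hab.le]
  refine setIntegral_congr_fun measurableSet_Icc fun t ht => ?_
  have : ((n : ℝ)⁻¹ • ((n : ℝ) • (U t - us t), dev n x c (derivWithin us (Icc a b)) t) : E × E) =
      (∫ τ in a..t, D τ, D t) := by
    simp only [dev, hD, Prod.smul_mk, smul_smul, inv_mul_cancel₀ hn0, one_smul]
    rw [← hDG t ht]
  rw [this]

/-- A pair of finite energy, in terms of its mesh. -/
lemma exists_energyBounded (hab : a < b) (hq : 1 < q) (hus : ContDiffOn ℝ 1 us (Icc a b))
    (hmin : IsMinimizer L a b q ua ub us) (hst : Stable L a b us) (hn : 1 ≤ n) {C : ℝ}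
    (h : energy L a b q ua ub us n u y ≤ C) :
    ∃ x c U Y G, EnergyBounded a b (derivWithin us (Icc a b)) (rem L a b us) C n x c U Y G ∧
      G b = 0 ∧ MemW120 a b (fun t => (n : ℝ) • (u t - us t)) ∧ (fun t => (n : ℝ) • (u t - us t)) =ᵐ[volume.restrict (Icc a b)] G ∧
      weakDeriv a b (fun t => (n : ℝ) • (u t - us t)) =ᵐ[volume.restrict (Icc a b)]
        dev n x c (derivWithin us (Icc a b)) ∧ y =ᵐ[volume.restrict (Icc a b)] Y := by
  have hadm : Admissible a b q ua ub n u y := by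
    by_contra hcon
    rw [energy, if_neg hcon] at h
    exact absurd h (not_le.2 (EReal.coe_lt_top C))
  rw [energy, if_pos hadm, EReal.coe_le_coe_iff] at h
  obtain ⟨x, c, U, Y, hd, h0, h1, hu, hy⟩ := hadm.exists_data hab hn
  obtain ⟨b0, b1⟩ := hmin.boundary hab hus
  rw [← b0] at h0
  rw [← b1] at h1
  obtain ⟨k1, k2, k3⟩ := hd.pl.energy_eq hab hq hus hmin hst hn hd.nodes h0 h1 hu
  refine ⟨x, c, U, Y, fun t => (n : ℝ) • (U t - us t), ⟨hn, hd,
    hd.pl.scaled_eq_primitive hab hus hn hd.nodes h0, k3 ▸ h⟩, by simp [h1], k1, ?_, k2, hy⟩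
  exact hu.mono fun t ht => by simp only [ht]

lemma Admissible.memW120 (hab : a < b) (hq : 1 < q) (hus : ContDiffOn ℝ 1 us (Icc a b))
    (hmin : IsMinimizer L a b q ua ub us) (hst : Stable L a b us) (hn : 1 ≤ n)
    (h : Admissible a b q ua ub n u y) : MemW120 a b (fun t => (n : ℝ) • (u t - us t)) := by
  obtain ⟨x, c, U, Y, hd, h0, h1, hu, hy⟩ := h.exists_data hab hn
  obtain ⟨b0, b1⟩ := hmin.boundary hab hus
  exact (hd.pl.energy_eq hab hq hus hmin hst hn hd.nodes (h0.trans b0.symm) (h1.trans b1.symm)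
    hu).1

end Link

/-! ### Weak compactness -/

section Compactness

variable {E : Type*} [NormedAddCommGroup E] [InnerProductSpace ℝ E] [CompleteSpace E]
variable [FiniteDimensional ℝ E]
variable {a b θ : ℝ} {p σ : ℝ → E} {Q : ℝ → E × E →L[ℝ] E × E →L[ℝ] ℝ} {R : ℝ → E × E → ℝ}

/-- Bounded sequences in `L²` have weakly convergent subsequences (Banach-Alaoglu). -/
lemma exists_weakL2_subseq {f : ℕ → ℝ → E} (hf : ∀ k, MemLp (f k) 2 (volume.restrict (Icc a b)))
    {M : ℝ} (hM : ∀ k, ∫ t in Icc a b, ‖f k t‖ ^ 2 ≤ M) :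
    ∃ (φ : ℕ → ℕ) (F : ℝ → E), StrictMono φ ∧ MemLp F 2 (volume.restrict (Icc a b)) ∧
      WeakL2Tendsto a b (fun k => f (φ k)) F := by
  set μ := volume.restrict (Icc a b) with hμ
  have hinner : ∀ {u v : ℝ → E} (hu : MemLp u 2 μ) (hv : MemLp v 2 μ),
      inner ℝ hu.toLp hv.toLp = ∫ t in Icc a b, inner ℝ (u t) (v t) := by
    intro u v hu hv
    rw [L2.inner_def]
    refine integral_congr_ae ?_
    filter_upwards [hu.coeFn_toLp, hv.coeFn_toLp] with t h1 h2
    rw [h1, h2]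
  set T : ℕ → Lp E 2 μ := fun k => (hf k).toLp with hT
  have hTn : ∀ k, ‖T k‖ ≤ √M := fun k => by
    refine Real.le_sqrt_of_sq_le ?_
    rw [← real_inner_self_eq_norm_sq, hinner]
    simpa only [real_inner_self_eq_norm_sq] using hM k
  have : Fact ((2 : ℝ≥0∞) ≠ ⊤) := ⟨by norm_num⟩
  have hcpt := WeakDual.isSeqCompact_closedBall ℝ (Lp E 2 μ) 0 (√M)
  obtain ⟨l, -, φ, hφ, hl⟩ := hcpt (x := fun k =>
    StrongDual.toWeakDual (InnerProductSpace.toDual ℝ (Lp E 2 μ) (T k))) (fun k => by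
      simpa using hTn k)
  set F : Lp E 2 μ := (InnerProductSpace.toDual ℝ (Lp E 2 μ)).symm (WeakDual.toStrongDual l) with hF
  refine ⟨φ, F, hφ, Lp.memLp F, fun h hh => ?_⟩
  have h1 := ((WeakDual.eval_continuous (𝕜 := ℝ) hh.toLp).tendsto l).comp hl
  have e1 : ∀ k, ∫ t in Icc a b, inner ℝ (f (φ k) t) (h t) = inner ℝ (T (φ k)) hh.toLp :=
    fun k => (hinner _ _).symm
  have e2 : ∫ t in Icc a b, inner ℝ (F t) (h t) = l hh.toLp := by
    have h2 : inner ℝ F hh.toLp = l hh.toLp := by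
      rw [hF, InnerProductSpace.toDual_symm_apply]; rfl
    rw [← h2, ← hinner (Lp.memLp F) hh, Lp.toLp_coeFn]
  rw [e2]
  refine h1.congr fun k => ?_
  rw [e1]
  exact InnerProductSpace.toDual_apply_apply

/-- Bounded almost everywhere convergence implies weak convergence in `L²`. -/
lemma WeakL2Tendsto.of_dominated {f : ℕ → ℝ → E} {F : ℝ → E} {B : ℝ}
    (hf : ∀ k, AEStronglyMeasurable (f k) (volume.restrict (Icc a b)))
    (hB : ∀ k, ∀ᵐ t ∂volume.restrict (Icc a b), ‖f k t‖ ≤ B)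
    (hlim : ∀ᵐ t ∂volume.restrict (Icc a b), Tendsto (fun k => f k t) atTop (𝓝 (F t))) :
    WeakL2Tendsto a b f F := by
  intro h hh
  have hi : Integrable h (volume.restrict (Icc a b)) := hh.integrable (by norm_num)
  refine tendsto_integral_of_dominated_convergence (fun t => B * ‖h t‖)
    (fun k => (hf k).inner hh.1) (hi.norm.const_mul B) (fun k => ?_) ?_
  · filter_upwards [hB k] with t ht
    exact (norm_inner_le_norm _ _).trans (by gcongr)
  · filter_upwards [hlim] with t ht
    exact ht.inner tendsto_const_nhds

variable {C : ℝ} {m : ℕ → ℕ} {x : ℕ → ℕ → ℝ} {c : ℕ → ℕ → E} {U : ℕ → ℝ → E} {Y : ℕ → ℝ → ℝ}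
  {G : ℕ → ℝ → E}

/-- Compactness of the scaled deviations of bounded energy. -/
lemma Expansion.exists_weak_subseq (ex : Expansion a b θ p σ Q R) (hab : a < b)
    (hE : ∀ k, EnergyBounded a b p R C (m k) (x k) (c k) (U k) (Y k) (G k)) :
    ∃ (φ : ℕ → ℕ) (dg : ℝ → E), StrictMono φ ∧ MemLp dg 2 (volume.restrict (Icc a b)) ∧
      WeakL2Tendsto a b (fun k => dev (m (φ k)) (x (φ k)) (c (φ k)) p) dg ∧
      (∀ t ∈ Icc a b, Tendsto (fun k => G (φ k) t) atTop (𝓝 (∫ τ in a..t, dg τ))) := by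
  obtain ⟨φ, dg, hφ, hdg, hw⟩ := exists_weakL2_subseq
    (fun k => ex.dev_memLp (m k) (x k) (c k)) (M := C / θ) fun k => by
      rw [integral_Icc_eq_interval hab.le]; exact (hE k).integral_sq_le ex hab
  refine ⟨φ, dg, hφ, hdg, hw, fun t ht => ?_⟩
  have haI := left_mem_Icc.2 hab.le
  have hdgi : IntegrableOn dg (Icc a b) := hdg.integrable (by norm_num)
  have h1 : ∀ T : E →L[ℝ] ℝ, Tendsto (fun k => T (G (φ k) t)) atTop
      (𝓝 (T (∫ τ in a..t, dg τ))) := fun T => by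
    refine (hw.integral_tendsto (fun k => ex.dev_integrableOn _ _ _) hdgi le_rfl ht.1 ht.2 T).congr
      fun k => ?_
    rw [(hE (φ k)).prim t ht]
  -- in finite dimension, weak convergence is strong convergence
  set B := stdOrthonormalBasis ℝ E
  have h2 : ∀ v : E, v = ∑ i, (innerSL ℝ (B i)) v • B i := fun v => by
    simp only [innerSL_apply_apply]; exact (B.sum_repr' v).symm
  rw [h2 (∫ τ in a..t, dg τ)]
  exact (tendsto_finsetSum _ fun i _ => (h1 _).smul_const _).congr fun k => (h2 _).symm

/-- If the deviations converge almost everywhere to a primitive of `dg`, then their derivatives,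
being bounded in `L²`, converge weakly to `dg`: every weak limit has the same primitive. -/
lemma Expansion.weak_tendsto_of_ae_tendsto (ex : Expansion a b θ p σ Q R) (hab : a < b)
    (hE : ∀ k, EnergyBounded a b p R C (m k) (x k) (c k) (U k) (Y k) (G k)) {dg : ℝ → E}
    (hdg : IntegrableOn dg (Icc a b))
    (hG : ∀ᵐ t ∂volume.restrict (Icc a b), Tendsto (fun k => G k t) atTop (𝓝 (∫ τ in a..t, dg τ))) :
    WeakL2Tendsto a b (fun k => dev (m k) (x k) (c k) p) dg := by
  intro h hh
  refine tendsto_of_subseq_tendsto fun ns hns => ?_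
  obtain ⟨φ, dg', hφ, hdg', hw, hlim⟩ := ex.exists_weak_subseq hab fun k => hE (ns k)
  refine ⟨φ, ?_⟩
  have hdgi' : IntegrableOn dg' (Icc a b) := hdg'.integrable (by norm_num)
  have he : (fun t => 0 + ∫ τ in a..t, dg' τ) =ᵐ[volume.restrict (Icc a b)]
      fun t => 0 + ∫ τ in a..t, dg τ := by
    rw [ae_restrict_iff' measurableSet_Icc] at hG
    rw [EventuallyEq, ae_restrict_iff' measurableSet_Icc]
    filter_upwards [hG] with t ht htI
    rw [tendsto_nhds_unique (hlim t htI) ((ht htI).comp (hns.comp hφ.tendsto_atTop))]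
  have h1 := (hasWeakDeriv_primitive hab.le 0 hdgi').congr_ae he (ae_eq_refl _)
  have h2 := h1.ae_unique (hasWeakDeriv_primitive hab.le 0 hdg)
  have h3 := hw h hh
  have h4 : ∫ t in Icc a b, inner ℝ (dg' t) (h t) = ∫ t in Icc a b, inner ℝ (dg t) (h t) :=
    integral_congr_ae (h2.mono fun t ht => by simp only [ht])
  rw [h4] at h3
  exact h3

end Compactness

/-! ### The Γ-limit -/

section Gamma

variable {E : Type*} [NormedAddCommGroup E] [InnerProductSpace ℝ E] [CompleteSpace E]

lemma WeakL2Tendsto.comp_congr {a b : ℝ} {f f' : ℕ → ℝ → E} {F F' : ℝ → E}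
    (hf : WeakL2Tendsto a b f F) {φ : ℕ → ℕ} (hφ : Tendsto φ atTop atTop)
    (h : ∀ k, f (φ k) =ᵐ[volume.restrict (Icc a b)] f' k)
    (hF : F =ᵐ[volume.restrict (Icc a b)] F') : WeakL2Tendsto a b f' F' := by
  intro v hv
  have e : ∫ t in Icc a b, inner ℝ (F' t) (v t) = ∫ t in Icc a b, inner ℝ (F t) (v t) :=
    integral_congr_ae (hF.mono fun t ht => by simp only [ht])
  rw [e]
  exact ((hf v hv).comp hφ).congr fun k =>
    integral_congr_ae ((h k).mono fun t ht => by simp only [ht])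

lemma WeakL2Tendsto.of_tail {a b : ℝ} {f : ℕ → ℝ → E} {F : ℝ → E} (n₁ : ℕ)
    (hf : WeakL2Tendsto a b (fun k => f (k + n₁)) F) : WeakL2Tendsto a b f F :=
  fun v hv => (tendsto_add_atTop_iff_nat n₁).1 (hf v hv)

/-- Diagonal sequences. -/
lemma exists_diagonal {P : ℕ → ℕ → Prop} (h : ∀ j, ∀ᶠ n in atTop, P j n) :
    ∃ J : ℕ → ℕ, Tendsto J atTop atTop ∧ ∀ᶠ n in atTop, P (J n) n := by
  choose N hN using fun j => eventually_atTop.1 (h j)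
  refine ⟨fun n => Nat.findGreatest (fun j => N j ≤ n) n, ?_, ?_⟩
  · refine tendsto_atTop.2 fun j => ?_
    filter_upwards [eventually_ge_atTop (max j (N j))] with n hn
    exact Nat.le_findGreatest ((le_max_left _ _).trans hn) ((le_max_right _ _).trans hn)
  · filter_upwards [eventually_ge_atTop (N 0)] with n hn
    exact hN _ n (Nat.findGreatest_spec (P := fun j => N j ≤ n) (Nat.zero_le n) hn)

variable [FiniteDimensional ℝ E] {a b q : ℝ} {L : ℝ → E → E → ℝ} {us : ℝ → E} {ua ub : E}

lemma MemW120.memLp_pair (hab : a < b) {g : ℝ → E} (hg : MemW120 a b g) :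
    MemLp (fun t => ((g t, weakDeriv a b g t) : E × E)) 2 (volume.restrict (Icc a b)) :=
  memLp_prodMk hg.1.1 (hg.primitive hab).1

lemma secondVariation_nonneg (hab : a < b) (hq : 1 < q) (hus : ContDiffOn ℝ 1 us (Icc a b))
    (hmin : IsMinimizer L a b q ua ub us) (hst : Stable L a b us) (g : ℝ → E) :
    0 ≤ 1 / 2 * secondVariation L a b us g := by
  obtain ⟨θ, ex⟩ := hst.exists_expansion hab hq hus hmin
  have : 0 ≤ secondVariation L a b us g :=
    setIntegral_nonneg measurableSet_Icc fun t ht => ex.Q_nonneg ht _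
  positivity

/-- On its domain, the limit energy is a sum in `[0, ∞]`, since the second variation at a minimizer is
nonnegative. -/
lemma limitEnergy_eq (hab : a < b) (hq : 1 < q) (hus : ContDiffOn ℝ 1 us (Icc a b))
    (hmin : IsMinimizer L a b q ua ub us) (hst : Stable L a b us) {g : ℝ → E} {y : ℝ → ℝ}
    (hg : MemW120 a b g) (hy : MemMBV a b y) :
    limitEnergy L a b us g y = ((ENNReal.ofReal (1 / 2 * secondVariation L a b us g) +
      ENNReal.ofReal ((b - a) ^ 2 / 24) * meshIntegral L a b us y : ℝ≥0∞) : EReal) := by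
  rw [limitEnergy, if_pos ⟨hy, hg⟩, EReal.coe_ennreal_add, EReal.coe_ennreal_ofReal,
    max_eq_left (secondVariation_nonneg hab hq hus hmin hst g)]

/-- The lower bound. -/
theorem limitEnergy_le_liminf (hab : a < b) (hq : 1 < q) (hus : ContDiffOn ℝ 1 us (Icc a b))
    (hmin : IsMinimizer L a b q ua ub us) (hst : Stable L a b us) {s : ℕ → ℕ} (hs : StrictMono s)
    {u : ℕ → ℝ → E} {y : ℕ → ℝ → ℝ} {g : ℝ → E} {y₀ : ℝ → ℝ}
    (hw : WeakW120Tendsto a b (fun k x => (s k : ℝ) • (u k x - us x)) g)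
    (hy : BVTendsto a b y y₀) :
    limitEnergy L a b us g y₀ ≤
      liminf (fun k => energy L a b q ua ub us (s k) (u k) (y k)) atTop := by
  by_contra hcon
  obtain ⟨C, h1, h2⟩ := EReal.lt_iff_exists_real_btwn.1 (not_le.1 hcon)
  obtain ⟨θ, ex⟩ := hst.exists_expansion hab hq hus hmin
  obtain ⟨φ, hφ, hφ2⟩ := extraction_of_frequently_atTop
    ((frequently_lt_of_liminf_lt (by isBoundedDefault) h1).and_eventually
      (hs.tendsto_atTop.eventually_ge_atTop 1))
  choose x c U Y G hE _ _ hGae hdev hYae using fun k =>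
    exists_energyBounded hab hq hus hmin hst (hφ2 k).2 (hφ2 k).1.le
  have hL1 : Tendsto (fun k => ∫ t in Icc a b, |Y k t - y₀ t|) atTop (𝓝 0) := by
    refine (hy.2.2.1.comp hφ.tendsto_atTop).congr fun k => integral_congr_ae ?_
    filter_upwards [hYae k] with t ht
    simp only [ht]
  obtain ⟨ψ, Y₀, hψ, hY₀, hyY, hYt⟩ := exists_nmono_of_L1_limit hab
    (fun k => (hE k).data.nmono) hy.2.1.1 hL1
  have hφψ := (hφ.comp hψ).tendsto_atTop
  have hg := hw.2.1
  have hgL := hg.primitive hab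
  have hlow := ex.lower_bound hab (fun k => hE (ψ k)) (hs.tendsto_atTop.comp hφψ)
    (hw.2.2.1.comp_congr hφψ (fun k => hGae (ψ k)) (ae_eq_refl _))
    (hw.2.2.2.comp_congr hφψ (fun k => hdev (ψ k)) (ae_eq_refl _))
    (hg.1.1.integrable (by norm_num)) (hgL.1.integrable (by norm_num)) hY₀ hYt
    (hY₀.ae_hasDerivAt hyY)
  have hQi := (integrable_quad ex.Q_cont (hg.memLp_pair hab)).const_mul (1 / 2)
  have hC : 0 ≤ C := by
    have := mul_nonneg ((hE 0).C_nonneg ex hab) ex.θ_pos.le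
    rwa [div_mul_cancel₀ _ ex.θ_pos.ne'] at this
  have e1 : ∫⁻ t in Icc a b, ENNReal.ofReal (1 / 2 * hess L t (jet a b us t)
      (g t, weakDeriv a b g t) (g t, weakDeriv a b g t)) =
      ENNReal.ofReal (1 / 2 * secondVariation L a b us g) := by
    rw [← ofReal_integral_eq_lintegral_ofReal hQi, integral_const_mul]
    · rfl
    · rw [EventuallyLE, ae_restrict_iff' measurableSet_Icc]
      exact ae_of_all _ fun t ht => mul_nonneg (by norm_num) (ex.Q_nonneg ht _)
  rw [lintegral_add_left' hQi.1.aemeasurable.ennreal_ofReal, e1,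
    lintegral_const_mul' _ _ ENNReal.ofReal_ne_top] at hlow
  rw [limitEnergy_eq hab hq hus hmin hst hg (hY₀.memMBV hyY)] at h2
  have h3 := EReal.coe_ennreal_le_coe_ennreal_iff.2 hlow
  rw [EReal.coe_ennreal_ofReal, max_eq_left hC] at h3
  exact absurd h2 (not_lt.2 h3)

/-- Compactness of sequences of bounded energy. -/
theorem exists_subseq_of_energy_le (hab : a < b) (hq : 1 < q) (hus : ContDiffOn ℝ 1 us (Icc a b))
    (hmin : IsMinimizer L a b q ua ub us) (hst : Stable L a b us) {u : ℕ → ℝ → E} {y : ℕ → ℝ → ℝ}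
    {C : ℝ} (hC : ∀ n, 1 ≤ n → energy L a b q ua ub us n (u n) (y n) ≤ (C : EReal)) :
    ∃ s : ℕ → ℕ, StrictMono s ∧ ∃ (g : ℝ → E) (y₀ : ℝ → ℝ), MemW120 a b g ∧ MemMBV a b y₀ ∧
      WeakW120Tendsto a b (fun k x => (s k : ℝ) • (u (s k) x - us x)) g ∧
      BVTendsto a b (fun k => y (s k)) y₀ := by
  obtain ⟨θ, ex⟩ := hst.exists_expansion hab hq hus hmin
  choose x c U Y G hE hGb hmem hGae hdev hYae using fun k : ℕ =>
    exists_energyBounded hab hq hus hmin hst (Nat.succ_le_succ (Nat.zero_le k))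
      (hC (k + 1) (Nat.succ_le_succ (Nat.zero_le k)))
  obtain ⟨φ, dg, hφ, hdg, hdw, hGt⟩ := ex.exists_weak_subseq hab hE
  obtain ⟨ψ, Y₀, hψ, hY₀, hYt⟩ := exists_subseq_tendsto_of_nmono hab
    fun k => (hE (φ k)).data.nmono
  have hdgi : IntegrableOn dg (Icc a b) := hdg.integrable (by norm_num)
  have h0 : ∫ t in a..b, dg t = 0 := by
    refine tendsto_nhds_unique (hGt b (right_mem_Icc.2 hab.le)) ?_
    simp only [hGb]
    exact tendsto_const_nhds
  obtain ⟨hg, hgd⟩ := memW120_of_primitive hab hdg (ae_eq_refl fun t => ∫ τ in a..t, dg τ) h0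
  refine ⟨fun k => φ (ψ k) + 1, fun i j hij => Nat.succ_lt_succ (hφ (hψ hij)), _, Y₀, hg,
    hY₀.memMBV (ae_eq_refl _), ⟨fun k => hmem (φ (ψ k)), hg, ?_, ?_⟩, ?_⟩
  · have h1 : WeakL2Tendsto a b (fun k => G (φ k)) (fun t => ∫ τ in a..t, dg τ) := by
      refine WeakL2Tendsto.of_dominated (B := (b - a) + C / θ)
        (fun k => ((hE (φ k)).continuousOn ex hab).aestronglyMeasurable measurableSet_Icc)
        (fun k => ?_) ?_
      · rw [ae_restrict_iff' measurableSet_Icc]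
        exact ae_of_all _ fun t ht => (hE (φ k)).norm_le ex hab ht
      · rw [ae_restrict_iff' measurableSet_Icc]
        exact ae_of_all _ hGt
    exact h1.comp_congr hψ.tendsto_atTop (fun k => (hGae (φ (ψ k))).symm) (ae_eq_refl _)
  · exact hdw.comp_congr hψ.tendsto_atTop (fun k => (hdev (φ (ψ k))).symm) hgd.symm
  · exact bvTendsto_of_L1 hab.le (fun k => (hE (φ (ψ k))).data.nmono) (fun k => hYae (φ (ψ k))) hY₀
      (ae_eq_refl _) (NMono.tendsto_L1 (fun k => (hE (φ (ψ k))).data.nmono) hY₀ hYt)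

/-- Recovery sequences for pairs of infinite limit energy: the sequence that realizes `g` and `y₀`
exactly has infinite limiting energy by the lower bound. -/
lemma exists_recovery_of_eq_top (hab : a < b) (hq : 1 < q) (hus : ContDiffOn ℝ 1 us (Icc a b))
    (hmin : IsMinimizer L a b q ua ub us) (hst : Stable L a b us) {g : ℝ → E} {y₀ : ℝ → ℝ}
    (hg : MemW120 a b g) (hy₀ : MemMBV a b y₀) (htop : limitEnergy L a b us g y₀ = ⊤) :
    ∃ (u : ℕ → ℝ → E) (y : ℕ → ℝ → ℝ),
      WeakW120Tendsto a b (fun n x => (n : ℝ) • (u n x - us x)) g ∧ BVTendsto a b y y₀ ∧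
      limsup (fun n => energy L a b q ua ub us n (u n) (y n)) atTop = ⊤ := by
  obtain ⟨Y₀, hY₀, hyY⟩ := hy₀.exists_nmono hab
  have h0 : ∀ n : ℕ, n ≠ 0 → (fun x => (n : ℝ) • ((us x + (n : ℝ)⁻¹ • g x) - us x)) = g := by
    intro n hn
    funext x
    rw [add_sub_cancel_left, smul_smul, mul_inv_cancel₀ (by exact_mod_cast hn), one_smul]
  have hw : WeakW120Tendsto a b (fun n x => (n : ℝ) • ((us x + (n : ℝ)⁻¹ • g x) - us x)) g := by
    refine ⟨fun n => ?_, hg, fun v hv => ?_, fun v hv => ?_⟩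
    · rcases eq_or_ne n 0 with rfl | hn
      · refine (memW120_of_primitive (w := 0) hab MemLp.zero' (ae_of_all _ fun t => ?_) ?_).1 <;>
          simp
      · have := h0 n hn
        simp only [this]; exact hg
    all_goals
      refine tendsto_const_nhds.congr' ?_
      filter_upwards [eventually_ne_atTop 0] with n hn
    · exact integral_congr_ae (ae_of_all _ fun t =>
        congrArg (fun e => inner ℝ e (v t)) (congrFun (h0 n hn) t).symm)
    · simp only [h0 n hn]
  have hbv : BVTendsto a b (fun _ => y₀) y₀ :=
    bvTendsto_of_L1 hab.le (fun _ => hY₀) (fun _ => hyY) hY₀ hyY (by simp)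
  refine ⟨fun n x => us x + (n : ℝ)⁻¹ • g x, fun _ => y₀, hw, hbv, top_le_iff.1 ?_⟩
  have h1 := limitEnergy_le_liminf hab hq hus hmin hst strictMono_id hw hbv
  rw [htop] at h1
  exact h1.trans (liminf_le_limsup (by isBoundedDefault) (by isBoundedDefault))

/-- Recovery sequences for pairs of finite limit energy. -/
lemma exists_recovery_of_lt_top (hab : a < b) (hq : 1 < q) (hus : ContDiffOn ℝ 1 us (Icc a b))
    (hmin : IsMinimizer L a b q ua ub us) (hst : Stable L a b us) {g : ℝ → E} {y₀ : ℝ → ℝ}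
    (hg : MemW120 a b g) (hy₀ : MemMBV a b y₀) (hfin : limitEnergy L a b us g y₀ < ⊤) :
    ∃ (u : ℕ → ℝ → E) (y : ℕ → ℝ → ℝ),
      (∀ n, 1 ≤ n → Admissible a b q ua ub n (u n) (y n)) ∧
      WeakW120Tendsto a b (fun n x => (n : ℝ) • (u n x - us x)) g ∧ BVTendsto a b y y₀ ∧
      limsup (fun n => energy L a b q ua ub us n (u n) (y n)) atTop =
        limitEnergy L a b us g y₀ := by
  obtain ⟨θ, ex⟩ := hst.exists_expansion hab hq hus hmin
  obtain ⟨b0, b1⟩ := hmin.boundary hab hus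
  obtain ⟨Y₀, hY₀, hyY⟩ := hy₀.exists_nmono hab
  obtain ⟨hdg, hgp, hg0⟩ := hg.primitive hab
  have hdgi : IntegrableOn (weakDeriv a b g) (Icc a b) := hdg.integrable (by norm_num)
  have hH : 0 < b - a := sub_pos.2 hab
  set g₀ : ℝ → E := fun t => ∫ τ in a..t, weakDeriv a b g τ with hg₀
  have hA := secondVariation_nonneg hab hq hus hmin hst g
  set A := 1 / 2 * secondVariation L a b us g with hAdef
  have hJ : meshIntegral L a b us y₀ ≠ ⊤ := by
    intro hJ
    rw [limitEnergy_eq hab hq hus hmin hst hg hy₀, hJ, ENNReal.mul_top (by simp; positivity),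
      add_top, EReal.coe_ennreal_top] at hfin
    exact lt_irrefl _ hfin
  set J := (meshIntegral L a b us y₀).toReal with hJdef
  set F := A + (b - a) ^ 2 / 24 * J with hF
  have hFe : limitEnergy L a b us g y₀ = (F : EReal) := by
    rw [limitEnergy_eq hab hq hus hmin hst hg hy₀, ← ENNReal.ofReal_toReal hJ,
      ← ENNReal.ofReal_mul (by positivity), ← ENNReal.ofReal_add hA (by positivity),
      EReal.coe_ennreal_ofReal, max_eq_left (by positivity)]
  have hAe : 1 / 2 * (∫ t in a..b, hess L t (jet a b us t) (g₀ t, weakDeriv a b g t)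
      (g₀ t, weakDeriv a b g t)) = A := by
    rw [hAdef, secondVariation, ← integral_Icc_eq_interval hab.le]
    congr 1
    exact integral_congr_ae (hgp.mono fun t ht => by simp only [ht]; rfl)
  -- pairs that are `ε`-close to the given one
  let P : ℝ → ℕ → (ℝ → E) → (ℝ → ℝ) → Prop := fun ε n u y =>
    (∀ t ∈ Icc a b, ‖(n : ℝ) • (u t - us t) - g₀ t‖ ≤ ε) ∧ (∫ t in Icc a b, |y t - Y₀ t| ≤ ε) ∧
      (n : ℝ) ^ 2 * (action L a b u - action L a b us) ≤ F + ε
  have hP : ∀ ε, 0 < ε → ∀ᶠ n : ℕ in atTop, 1 ≤ n ∧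
      ∃ u y, Admissible a b q ua ub n u y ∧ IsMono a b y ∧ P ε n u y := by
    intro ε hε
    obtain ⟨n₀, hn₀, h⟩ := ex.exists_recovery hab (us := us)
      (fun t ht => us_eq_primitive hab hus ht) hdg hg0 (g := g₀) (fun t _ => rfl) hY₀
      (hY₀.ae_hasDerivAt hyY) hJ hε
    filter_upwards [eventually_ge_atTop n₀] with n hn
    have hn1 := hn₀.trans hn
    obtain ⟨x, c, U, y, k1, k2, k3, k4, k5, k6, k7, k8, k9⟩ := h n hn
    refine ⟨hn1, U, y, b0 ▸ b1 ▸ k6 q hq, k5, k7, k8, ?_⟩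
    rw [(k2.energy_eq hab hq hus hmin hst hn1 k1 k3 k4 (ae_eq_refl U)).2.2]
    rw [hAe] at k9
    exact k9
  have hκ0 : ∀ j : ℕ, 0 < 1 / ((j : ℝ) + 1) := fun j => by positivity
  obtain ⟨I, hI, hIP⟩ := exists_diagonal fun j : ℕ => hP _ (hκ0 j)
  have hκ : Tendsto (fun n => 1 / ((I n : ℝ) + 1)) atTop (𝓝 0) :=
    tendsto_one_div_add_atTop_nhds_zero_nat.comp hI
  -- for the finitely many `n` without a close pair, any admissible pair will do: here `us` is
  -- interpolated on the uniform mesh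
  have hpair : ∀ n : ℕ, ∃ u y, (1 ≤ n → Admissible a b q ua ub n u y) ∧ IsMono a b y ∧
      ((∃ u y, Admissible a b q ua ub n u y ∧ IsMono a b y ∧ P (1 / ((I n : ℝ) + 1)) n u y) →
        P (1 / ((I n : ℝ) + 1)) n u y) := by
    intro n
    by_cases h : ∃ u y, Admissible a b q ua ub n u y ∧ IsMono a b y ∧ P (1 / ((I n : ℝ) + 1)) n u y
    · obtain ⟨u, y, h1, h2, h3⟩ := h
      exact ⟨u, y, fun _ => h1, h2, fun _ => h3⟩
    rcases Nat.eq_zero_or_pos n with rfl | hn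
    · exact ⟨us, Y₀, fun h => absurd h (by norm_num), hY₀.isMono, fun h' => absurd h' h⟩
    · obtain ⟨y, hy1, -, hy2⟩ := exists_admissible_of_nodes (E := E) hab hn (isNodes_node hab hn)
      have := hy2 q us hq
      rw [b0, b1] at this
      exact ⟨_, y, fun _ => this, hy1, fun h' => absurd h' h⟩
  choose u y hadm hmono hgood using hpair
  have hev : ∀ᶠ n in atTop, 1 ≤ n ∧ P (1 / ((I n : ℝ) + 1)) n (u n) (y n) :=
    hIP.mono fun n hn => ⟨hn.1, hgood n hn.2⟩
  obtain ⟨n₁, hn₁⟩ := eventually_atTop.1 hev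
  have hen : ∀ n, n₁ ≤ n → energy L a b q ua ub us n (u n) (y n) ≤
      ((F + 1 / ((I n : ℝ) + 1) : ℝ) : EReal) := fun n hn => by
    obtain ⟨h1, -, -, h2⟩ := hn₁ n hn
    rw [energy, if_pos (hadm n h1)]
    exact EReal.coe_le_coe_iff.2 h2
  have hle1 : ∀ j : ℕ, 1 / ((j : ℝ) + 1) ≤ 1 := fun j => by
    rw [div_le_one (by positivity)]; linarith [(Nat.cast_nonneg j : (0 : ℝ) ≤ j)]
  choose x c U Y G hE _ _ hGae hdev hYae using fun k : ℕ =>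
    exists_energyBounded (C := F + 1) hab hq hus hmin hst (hn₁ (k + n₁) (Nat.le_add_left _ _)).1
      ((hen (k + n₁) (Nat.le_add_left _ _)).trans (EReal.coe_le_coe_iff.2 (by
        have := hle1 (I (k + n₁)); linarith)))
  have hGt : ∀ᵐ t ∂volume.restrict (Icc a b), Tendsto (fun k => G k t) atTop (𝓝 (g₀ t)) := by
    have hall := ae_all_iff.2 hGae
    rw [ae_restrict_iff' measurableSet_Icc] at hall ⊢
    filter_upwards [hall] with t ht htI
    rw [tendsto_iff_norm_sub_tendsto_zero]
    refine squeeze_zero (fun _ => norm_nonneg _) (fun k => ?_)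
      (hκ.comp (tendsto_add_atTop_nat n₁))
    rw [← ht htI k]
    exact (hn₁ (k + n₁) (Nat.le_add_left _ _)).2.1 t htI
  have hw : WeakW120Tendsto a b (fun n x => (n : ℝ) • (u n x - us x)) g := by
    refine ⟨fun n => ?_, hg, WeakL2Tendsto.of_tail n₁ ?_, WeakL2Tendsto.of_tail n₁ ?_⟩
    · rcases Nat.eq_zero_or_pos n with rfl | hn
      · refine (memW120_of_primitive (w := 0) hab MemLp.zero' (ae_of_all _ fun t => ?_) ?_).1 <;>
          simp
      · exact (hadm n hn).memW120 hab hq hus hmin hst hn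
    · have h1 : WeakL2Tendsto a b G g₀ :=
        WeakL2Tendsto.of_dominated (B := (b - a) + (F + 1) / θ)
          (fun k => ((hE k).continuousOn ex hab).aestronglyMeasurable measurableSet_Icc)
          (fun k => by
            rw [ae_restrict_iff' measurableSet_Icc]
            exact ae_of_all _ fun t ht => (hE k).norm_le ex hab ht) hGt
      exact h1.comp_congr tendsto_id (fun k => (hGae k).symm) hgp.symm
    · exact (ex.weak_tendsto_of_ae_tendsto hab hE hdgi hGt).comp_congr tendsto_id
        (fun k => (hdev k).symm) (ae_eq_refl _)
  have hbv : BVTendsto a b y y₀ := by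
    choose Z hZ hZy using fun n => (hmono n).exists_nmono hab
    have hae : ∀ n, y n =ᵐ[volume.restrict (Icc a b)] Z n := fun n =>
      ae_Icc_of_Ioo fun t ht => (hZy n t ht).symm
    refine bvTendsto_of_L1 hab.le hZ hae hY₀ hyY ?_
    refine squeeze_zero' (Eventually.of_forall fun n => integral_nonneg fun t => abs_nonneg _)
      (hev.mono fun n hn => ?_) hκ
    refine le_trans (le_of_eq (integral_congr_ae ?_)) hn.2.2.1
    filter_upwards [hae n] with t ht
    simp only [ht]
  refine ⟨u, y, hadm, hw, hbv, le_antisymm ?_ ?_⟩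
  · have hlim : Tendsto (fun n => ((F + 1 / ((I n : ℝ) + 1) : ℝ) : EReal)) atTop
        (𝓝 ((F + 0 : ℝ) : EReal)) :=
      (continuous_coe_real_ereal.tendsto _).comp (tendsto_const_nhds.add hκ)
    rw [hFe, ← add_zero F, ← hlim.limsup_eq]
    exact limsup_le_limsup (eventually_atTop.2 ⟨n₁, hen⟩)
      (by isBoundedDefault) (by isBoundedDefault)
  · exact (limitEnergy_le_liminf hab hq hus hmin hst strictMono_id hw hbv).trans
      (liminf_le_limsup (by isBoundedDefault) (by isBoundedDefault))

end Gamma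

end RAdapt

theorem theorem2p2 (N : ℕ) (a b q r : ℝ) (hab : a < b) (hq : 1 < q) (hr : 1 < r)
    (L : ℝ → EuclideanSpace ℝ (Fin N) → EuclideanSpace ℝ (Fin N) → ℝ)
    (ua ub : EuclideanSpace ℝ (Fin N)) (us : ℝ → EuclideanSpace ℝ (Fin N))
    (hgrowth : RAdapt.HasGrowth L a b q r)
    (hreg : ContDiffOn ℝ 1 us (Icc a b))
    (hmin : RAdapt.IsMinimizer L a b q ua ub us)
    (hstable : RAdapt.Stable L a b us) :
    -- (o) compactness
    (∀ (u : ℕ → ℝ → EuclideanSpace ℝ (Fin N)) (y : ℕ → ℝ → ℝ),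
      (∃ C : ℝ, ∀ n, 1 ≤ n → RAdapt.energy L a b q ua ub us n (u n) (y n) ≤ (C : EReal)) →
      ∃ σ : ℕ → ℕ, StrictMono σ ∧
        ∃ (g : ℝ → EuclideanSpace ℝ (Fin N)) (y₀ : ℝ → ℝ),
          RAdapt.MemW120 a b g ∧ RAdapt.MemMBV a b y₀ ∧
          RAdapt.WeakW120Tendsto a b (fun k x => (σ k : ℝ) • (u (σ k) x - us x)) g ∧
          RAdapt.BVTendsto a b (fun k => y (σ k)) y₀) ∧
    -- (i) lower bound, also along subsequences
    (∀ (σ : ℕ → ℕ), StrictMono σ →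
      ∀ (u : ℕ → ℝ → EuclideanSpace ℝ (Fin N)) (y : ℕ → ℝ → ℝ)
        (g : ℝ → EuclideanSpace ℝ (Fin N)) (y₀ : ℝ → ℝ),
      RAdapt.WeakW120Tendsto a b (fun k x => (σ k : ℝ) • (u k x - us x)) g →
      RAdapt.BVTendsto a b y y₀ →
      RAdapt.limitEnergy L a b us g y₀ ≤
        liminf (fun k => RAdapt.energy L a b q ua ub us (σ k) (u k) (y k)) atTop) ∧
    -- (ii) recovery sequences
    (∀ (g : ℝ → EuclideanSpace ℝ (Fin N)) (y₀ : ℝ → ℝ),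
      RAdapt.MemW120 a b g → RAdapt.MemMBV a b y₀ →
      ∃ (u : ℕ → ℝ → EuclideanSpace ℝ (Fin N)) (y : ℕ → ℝ → ℝ),
        (RAdapt.limitEnergy L a b us g y₀ < ⊤ →
          ∀ n, 1 ≤ n → RAdapt.Admissible a b q ua ub n (u n) (y n)) ∧
        RAdapt.WeakW120Tendsto a b (fun n x => (n : ℝ) • (u n x - us x)) g ∧
        RAdapt.BVTendsto a b y y₀ ∧
        limsup (fun n => RAdapt.energy L a b q ua ub us n (u n) (y n)) atTop =
          RAdapt.limitEnergy L a b us g y₀) := by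
  refine ⟨fun u y h => ?_, fun s hs u y g y₀ hw hy => ?_, fun g y₀ hg hy => ?_⟩
  · obtain ⟨C, hC⟩ := h
    exact RAdapt.exists_subseq_of_energy_le hab hq hreg hmin hstable hC
  · exact RAdapt.limitEnergy_le_liminf hab hq hreg hmin hstable hs hw hy
  · rcases eq_top_or_lt_top (RAdapt.limitEnergy L a b us g y₀) with h | h
    · obtain ⟨u, y, h1, h2, h3⟩ :=
        RAdapt.exists_recovery_of_eq_top hab hq hreg hmin hstable hg hy h
      exact ⟨u, y, fun h' => absurd h' (h ▸ lt_irrefl _), h1, h2, h3.trans h.symm⟩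
    · obtain ⟨u, y, h1, h2, h3, h4⟩ :=
        RAdapt.exists_recovery_of_lt_top hab hq hreg hmin hstable hg hy h
      exact ⟨u, y, fun _ => h1, h2, h3, h4⟩
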